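/- Setting. Let $N$ be an asymptotically flat spacetime whose metric in Bondi–Sachs coordinates $(w,r,x^2,x^3)$, for $w$ near $c$ and $r$ large, is $$-UV\,dw^2-2U\,dw\,dr+\sigma_{ab}(dx^a+W^a dw)(dx^b+W^b dw),\qquad \det\sigma_{ab}=r^4\sin^2\theta,$$ smooth on the spheres (poles included), $U>0$, $\sigma$ positive definite, and on $w=c$, as $r\to\infty$, $$U=1+O(r^{-2}),\quad V=1-\frac{2m}{r}+o(r^{-1}),\quad W^a=\frac{W_0^a}{r^2}+o(r^{-2}),\quad \sigma_{ab}=r^2\tilde\sigma_{ab}+O(r),$$ where $m$ is a smooth function and $W_0$ a smooth vector field on $S^2$, $\tilde\sigma$ is the round metric, and these expansions may be differentiated. Let $\Sigma_r$ be the surface $w=c$ with $r$ fixed, and $\tilde X_1,\tilde X_2,\tilde X_3$ the coordinate functions on $S^2\subset\mathbb R^3$. For an isometric embedding $X$ of $\Sigma_r$ into Minkowski space $\mathbb R^{3,1}$ and a constant future timelike vector $T_0$ put $\tau=-\langle T_0,X\rangle$ and $$\mathcal E(\Sigma_r,X,T_0)=\frac1{8\pi}\int_{\Sigma_r}\Big[-\Big\langle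 T_0,\frac{J_0}{|H_0|}\Big\rangle(|H_0|-|H|)-\Big\langle\nabla^{\mathbb R^{3,1}}_{\nabla\tau}\frac{J_0}{|H_0|},\frac{H_0}{|H_0|}\Big\rangle+\Big\langle\nabla^{N}_{\nabla\tau}\frac{J}{|H|},\frac{H}{|H|}\Big\rangle\Big]d\Sigma_r,$$ where $H$ and $H_0$ are the mean curvature vectors of $\Sigma_r$ in $N$ and of its image in $\mathbb R^{3,1}$, and $J$, $J_0$ are the dual future timelike normal vectors (orthogonal to $H$, $H_0$, with $\langle J,J\rangle=-\langle H,H\rangle$, $\langle J_0,J_0\rangle=-\langle H_0,H_0\rangle$). The limit of $\mathcal E$ as $r\to\infty$ is the limit of the quasilocal energy. A vector $p\in\mathbb R^{3,1}$ is the *energy-momentum 4-vector* of a family $X_r$ if for every constant future timelike $T_0$ the integrand of $\mathcal E(\Sigma_r,X_r,T_0)$ is integrable for $r$ large and $$\lim_{r\to\infty}\mathcal E(\Sigma_r,X_r,T_0)=-\langle T_0,p\rangle .$$ Corollary. Let $X_r=(\tau_0,X_1,X_2,X_3)$, for $r$ large, be a family of isometric embeddings of $\Sigma_r$ into $\mathbb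 R^{3,1}$ with $\tau_0=\tilde\tau_0+O(r^{-1})$ for some smooth function $\tilde\tau_0$ on $S^2$ and $X_i=r\tilde X_i+O(1)$ (together with all derivatives along $S^2$). Let $X_r'=\tilde L_rX_r$, where $\tilde L_rx=L_rx+b_r$ with $b_r\in\mathbb R^{3,1}$ arbitrary and $L_r\in SO(3,1)$ preserving the time orientation, and suppose $L_r\to L_\infty$ as $r\to\infty$. Then the energy-momentum 4-vector $p$ of the family $X_r$ exists, and the energy-momentum 4-vector of the family $X_r'$ exists and equals $L_\infty p$. -/

import Mathlib

open Filter Topology Asymptotics MeasureTheory Matrix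
open scoped ContDiff

noncomputable section

namespace BondiSachs

/-- Euclidean 3-space; the sphere `S²` is the set of its unit vectors. -/
abbrev E3 := EuclideanSpace ℝ (Fin 3)

/-- Four real coordinates, numbered from `0`. For the Minkowski space `ℝ^{3,1}` they are
`(t, x₁, x₂, x₃)`; for the curved spacetime they are `(w, y₁, y₂, y₃)`, where `w` is the retarded
time and `y = r • n` has the Bondi--Sachs radius `r` as its norm and the angular variable
`n ∈ S²` as its direction. (These are the Bondi--Sachs coordinates `(w, r, θ, φ)` with `(r, θ, φ)`
read as polar coordinates of `y`; in this way the poles play no special role.) -/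
abbrev R4 := Fin 4 → ℝ

/-- The point (or vector) with coordinates `(w, y)`. -/
def pt (w : ℝ) (y : E3) : R4 := Fin.cons w (fun i => y i)

/-- The last three coordinates. -/
def spatial (x : R4) : E3 := WithLp.toLp 2 (fun i : Fin 3 => x i.succ)

/-! ### Functions on the sphere and decay conditions

A function on `S²` is given as a function on `E3`, of which only the values at unit vectors are
used. -/

/-- The extension of a function on `S²` that is constant along rays from the origin. -/
def radialExt (f : E3 → ℝ) : E3 → ℝ := fun y => f (‖y‖⁻¹ • y)

/-- Smoothness of a function on `S²`. -/
def SmoothOnSphere (f : E3 → ℝ) : Prop := ContDiffOn ℝ ∞ (radialExt f) {0}ᶜ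

/-- `f_r = O(r^q)` as `r → ∞` for a family of functions on `S²`, together with all derivatives
along `S²`. -/
def SphereBigO (q : ℤ) (f : ℝ → E3 → ℝ) : Prop :=
  ∀ k : ℕ, ∃ C : ℝ, ∀ᶠ r : ℝ in atTop, ∀ n : E3, ‖n‖ = 1 →
    ‖iteratedFDeriv ℝ k (radialExt (f r)) n‖ ≤ C * r ^ q

/-- `f = O(r^q)` as `r = ‖y‖ → ∞`, an estimate that may be differentiated: each derivative in the
Cartesian coordinates `y` gains a factor `1 / r`, i.e. each application of `∂_θ`, `∂_φ`,
`r ∂_r` preserves the order. -/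
def DecayBigO (q : ℤ) (f : E3 → ℝ) : Prop :=
  ∀ k : ℕ, (fun y => iteratedFDeriv ℝ k f y) =O[Bornology.cobounded E3]
    fun y => ‖y‖ ^ (q - (k : ℤ))

/-- `f = o(r^q)` as `r = ‖y‖ → ∞`, an estimate that may be differentiated. -/
def DecayLittleO (q : ℤ) (f : E3 → ℝ) : Prop :=
  ∀ k : ℕ, (fun y => iteratedFDeriv ℝ k f y) =o[Bornology.cobounded E3]
    fun y => ‖y‖ ^ (q - (k : ℤ))

/-! ### Spacelike surfaces in a Lorentzian spacetime

`g` is a metric on an open set of `R4`, given by its matrix in the coordinates; `K` is a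
nowhere vanishing future causal vector field (it fixes the time orientation); `F` is a
parametrized surface, with parameters `u = (θ, φ)`. -/

/-- The scalar product `⟨v, v'⟩` of the metric `g` at the point `x`. -/
def ip (g : R4 → Matrix (Fin 4) (Fin 4) ℝ) (x v v' : R4) : ℝ := v ⬝ᵥ (g x *ᵥ v')

/-- Christoffel symbols `Γ^l_{μν}` of the Levi-Civita connection of `g`. -/
def christoffel (g : R4 → Matrix (Fin 4) (Fin 4) ℝ) (x : R4) (l μ ν : Fin 4) : ℝ :=
  (1 / 2) * ∑ κ, (g x)⁻¹ l κ *
    (fderiv ℝ (fun z => g z κ ν) x (Pi.single μ 1)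
      + fderiv ℝ (fun z => g z κ μ) x (Pi.single ν 1)
      - fderiv ℝ (fun z => g z μ ν) x (Pi.single κ 1))

/-- The two coordinate directions of the parameter domain. -/
def dir (a : Fin 2) : ℝ × ℝ := ![((1 : ℝ), (0 : ℝ)), ((0 : ℝ), (1 : ℝ))] a

/-- The coordinate tangent vector `∂_a F`. -/
def tangent (F : ℝ × ℝ → R4) (a : Fin 2) (u : ℝ × ℝ) : R4 := fderiv ℝ F u (dir a)

/-- The covariant derivative `∇_{∂_a F} Z` of a vector field `Z` along the surface. -/
def covDeriv (g : R4 → Matrix (Fin 4) (Fin 4) ℝ) (F Z : ℝ × ℝ → R4) (a : Fin 2)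
    (u : ℝ × ℝ) : R4 :=
  fun l => fderiv ℝ (fun z => Z z l) u (dir a)
    + ∑ μ, ∑ ν, christoffel g (F u) l μ ν * tangent F a u μ * Z u ν

/-- The induced metric `σ_{ab} = ⟨∂_a F, ∂_b F⟩`. -/
def inducedMetric (g : R4 → Matrix (Fin 4) (Fin 4) ℝ) (F : ℝ × ℝ → R4) (u : ℝ × ℝ) :
    Matrix (Fin 2) (Fin 2) ℝ :=
  Matrix.of fun a b => ip g (F u) (tangent F a u) (tangent F b u)

/-- The component of `Z` normal to the surface. -/
def normalPart (g : R4 → Matrix (Fin 4) (Fin 4) ℝ) (F : ℝ × ℝ → R4) (u : ℝ × ℝ) (Z : R4) : R4 :=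
  Z - ∑ a, ∑ b, ((inducedMetric g F u)⁻¹ a b * ip g (F u) Z (tangent F a u)) • tangent F b u

/-- The mean curvature vector `H`, the trace of the second fundamental form. -/
def meanCurv (g : R4 → Matrix (Fin 4) (Fin 4) ℝ) (F : ℝ × ℝ → R4) (u : ℝ × ℝ) : R4 :=
  ∑ a, ∑ b, (inducedMetric g F u)⁻¹ a b • normalPart g F u (covDeriv g F (tangent F b) a u)

/-- The norm `|H|` (for a spacelike mean curvature vector). -/
def normH (g : R4 → Matrix (Fin 4) (Fin 4) ℝ) (F : ℝ × ℝ → R4) (u : ℝ × ℝ) : ℝ :=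
  Real.sqrt (ip g (F u) (meanCurv g F u) (meanCurv g F u))

/-- `J` is the future timelike normal vector dual to `H`: it is normal to the surface, orthogonal
to `H`, of opposite square, and future directed. If `H` is spacelike there is exactly one. -/
def IsFutureDual (g : R4 → Matrix (Fin 4) (Fin 4) ℝ) (K : R4 → R4) (F : ℝ × ℝ → R4)
    (u : ℝ × ℝ) (J : R4) : Prop :=
  (∀ a, ip g (F u) J (tangent F a u) = 0) ∧
  ip g (F u) J (meanCurv g F u) = 0 ∧
  ip g (F u) J J = - ip g (F u) (meanCurv g F u) (meanCurv g F u) ∧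
  ip g (F u) J (K (F u)) < 0

open Classical in
/-- The vector field `J` along the surface. -/
def dualJ (g : R4 → Matrix (Fin 4) (Fin 4) ℝ) (K : R4 → R4) (F : ℝ × ℝ → R4)
    (u : ℝ × ℝ) : R4 :=
  if hJ : ∃ J, IsFutureDual g K F u J then hJ.choose else 0

/-- The connection one-form `⟨∇_{∂_a F} (J / |H|), H / |H|⟩` of the normal bundle in the mean
curvature gauge. -/
def connForm (g : R4 → Matrix (Fin 4) (Fin 4) ℝ) (K : R4 → R4) (F : ℝ × ℝ → R4) (a : Fin 2)
    (u : ℝ × ℝ) : ℝ :=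
  ip g (F u) (covDeriv g F (fun z => (normH g F z)⁻¹ • dualJ g K F z) a u)
    ((normH g F u)⁻¹ • meanCurv g F u)

/-! ### Minkowski space -/

/-- The Minkowski form, of signature `(-, +, +, +)`. -/
def eta : Matrix (Fin 4) (Fin 4) ℝ := Matrix.diagonal ![-1, 1, 1, 1]

/-- The Minkowski metric. -/
def minkowski : R4 → Matrix (Fin 4) (Fin 4) ℝ := fun _ => eta

/-- The future time direction of Minkowski space. -/
def timeDir : R4 → R4 := fun _ => Pi.single 0 1

/-- The Minkowski scalar product. -/
def mink (v v' : R4) : ℝ := v ⬝ᵥ (eta *ᵥ v')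

/-- Future timelike vectors of Minkowski space. -/
def IsFutureTimelike (T : R4) : Prop := mink T T < 0 ∧ 0 < T 0

/-- The (time orientation preserving) group `SO(3,1)`. -/
def IsLorentz (L : Matrix (Fin 4) (Fin 4) ℝ) : Prop :=
  Lᵀ * eta * L = eta ∧ L.det = 1 ∧ 0 < L 0 0

/-! ### Spacetimes in Bondi--Sachs coordinates -/

/-- The coefficients of the one-form `dr` in the coordinates `(w, y)`, `r = ‖y‖`. -/
def drForm (x : R4) : R4 := Fin.cons 0 (fun i : Fin 3 => x i.succ / ‖spatial x‖)

/-- The coefficients of the one-forms `dyⁱ + Wⁱ dw`. -/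
def shiftForm (W : Fin 3 → ℝ) (i : Fin 3) : R4 :=
  Fin.cons (W i) (fun j : Fin 3 => if i = j then (1 : ℝ) else 0)

/-- The metric
`-U V dw² - 2 U dw dr + h_{ij} (dyⁱ + Wⁱ dw) (dyʲ + Wʲ dw)`. When `h` annihilates the radial
direction and `W` is tangent to the spheres of constant `r`, the last term is
`σ_{ab} (dx^a + W^a dw) (dx^b + W^b dw)` in angular coordinates `x^a`, where `σ` is the
restriction of `h` to these spheres. -/
def bondiMetric (U V : R4 → ℝ) (W : R4 → Fin 3 → ℝ) (h : R4 → Matrix (Fin 3) (Fin 3) ℝ)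
    (x : R4) : Matrix (Fin 4) (Fin 4) ℝ :=
  -(U x * V x) • vecMulVec (Pi.single 0 1) (Pi.single 0 1)
    - U x • (vecMulVec (Pi.single 0 1) (drForm x) + vecMulVec (drForm x) (Pi.single 0 1))
    + ∑ i, ∑ j, h x i j • vecMulVec (shiftForm (W x) i) (shiftForm (W x) j)

/-- The exterior region `|w - c| < ε`, `r > R₀`. -/
def exteriorRegion (c ε R₀ : ℝ) : Set R4 := {x | |x 0 - c| < ε ∧ R₀ < ‖spatial x‖}

/-- The exterior region of an asymptotically flat spacetime in Bondi--Sachs coordinates near the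
null cone `w = c`. In angular coordinates `x^a` on `S²` the asymptotic conditions on `w = c` read
`U = 1 + O(r⁻²)`, `V = 1 - 2m/r + o(r⁻¹)`, `W^a = W₀^a r⁻² + o(r⁻²)`, `σ = r² σ̃ + O(r)` with
`σ̃` the round metric of `S²`; `det σ_{ab} = r⁴ sin² θ` throughout. -/
structure Exterior where
  /-- the retarded time of the null cone -/
  c : ℝ
  ε : ℝ
  R₀ : ℝ
  ε_pos : 0 < ε
  R₀_pos : 0 < R₀
  U : R4 → ℝ
  V : R4 → ℝ
  /-- the shift vector, in Cartesian components (so `Wⁱ ∂_i = W^a ∂_a`, `∂_a = r ∂_a n`) -/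
  W : R4 → Fin 3 → ℝ
  /-- the metric of the spheres, in Cartesian components (so `σ_{ab} = r² h(∂_a n, ∂_b n)`) -/
  h : R4 → Matrix (Fin 3) (Fin 3) ℝ
  /-- the mass aspect function on `S²` -/
  m : E3 → ℝ
  /-- the leading coefficient of the shift vector -/
  W₀ : Fin 3 → E3 → ℝ
  smooth_U : ContDiffOn ℝ ∞ U (exteriorRegion c ε R₀)
  smooth_V : ContDiffOn ℝ ∞ V (exteriorRegion c ε R₀)
  smooth_W : ∀ i, ContDiffOn ℝ ∞ (fun x => W x i) (exteriorRegion c ε R₀)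
  smooth_h : ∀ i j, ContDiffOn ℝ ∞ (fun x => h x i j) (exteriorRegion c ε R₀)
  smooth_m : SmoothOnSphere m
  smooth_W₀ : ∀ i, SmoothOnSphere (W₀ i)
  U_pos : ∀ x ∈ exteriorRegion c ε R₀, 0 < U x
  W_tangent : ∀ x ∈ exteriorRegion c ε R₀, W x ⬝ᵥ (fun i : Fin 3 => x i.succ) = 0
  h_symm : ∀ x ∈ exteriorRegion c ε R₀, (h x).IsSymm
  h_radial : ∀ x ∈ exteriorRegion c ε R₀, h x *ᵥ (fun i : Fin 3 => x i.succ) = 0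
  h_pos : ∀ x ∈ exteriorRegion c ε R₀, ∀ v : Fin 3 → ℝ,
    v ⬝ᵥ (fun i : Fin 3 => x i.succ) = 0 → v ≠ 0 → 0 < v ⬝ᵥ (h x *ᵥ v)
  /-- `h` has determinant `1` on the planes tangent to the spheres, i.e.
  `det σ_{ab} = r⁴ sin² θ` -/
  h_det : ∀ x ∈ exteriorRegion c ε R₀,
    (h x + Matrix.of fun i j : Fin 3 => x i.succ * x j.succ / ‖spatial x‖ ^ 2).det = 1
  asymp_U : DecayBigO (-2) fun y => U (pt c y) - 1
  asymp_V : DecayLittleO (-1) fun y => V (pt c y) - (1 - 2 * radialExt m y / ‖y‖)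
  asymp_W : ∀ i, DecayLittleO (-1) fun y => W (pt c y) i - radialExt (W₀ i) y / ‖y‖
  asymp_h : ∀ i j, DecayBigO (-1) fun y =>
    h (pt c y) i j - ((if i = j then (1 : ℝ) else 0) - y i * y j / ‖y‖ ^ 2)

/-- The spacetime metric. -/
def Exterior.metric (N : Exterior) : R4 → Matrix (Fin 4) (Fin 4) ℝ :=
  bondiMetric N.U N.V N.W N.h

/-- The outgoing null vector field `∂/∂r`, which is future directed because `w` is a retarded
time. -/
def radialDir (x : R4) : R4 := pt 0 (‖spatial x‖⁻¹ • spatial x)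

/-- Polar coordinates `u = (θ, φ)` on `S²`: the vector `(X̃₁, X̃₂, X̃₃)`. -/
def polar (u : ℝ × ℝ) : E3 :=
  !₂[Real.sin u.1 * Real.sin u.2, Real.sin u.1 * Real.cos u.2, Real.cos u.1]

/-- The domain of the polar coordinates; it covers `S²` up to a set of measure zero. -/
def polarDomain : Set (ℝ × ℝ) := Set.Ioo 0 Real.pi ×ˢ Set.Ioo 0 (2 * Real.pi)

/-- The surface `Σ_r`, given by `w = c` and the fixed radius `r`, in polar coordinates. -/
def Exterior.surface (N : Exterior) (r : ℝ) : ℝ × ℝ → R4 := fun u => pt N.c (r • polar u)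

/-- `Y : S² → ℝ^{3,1}` is an isometric embedding of `Σ_r` into Minkowski space. -/
structure IsIsometricEmbedding (N : Exterior) (r : ℝ) (Y : E3 → R4) : Prop where
  smooth : ∀ α, SmoothOnSphere fun n => Y n α
  injective : Set.InjOn Y (Metric.sphere 0 1)
  isometric : ∀ u ∈ polarDomain,
    inducedMetric minkowski (fun z => Y (polar z)) u = inducedMetric N.metric (N.surface r) u

/-- `X_r = (τ₀, X₁, X₂, X₃)` is a family of isometric embeddings of the surfaces `Σ_r`
(for `r` large) that is an `O(1)` perturbation of an embedding into the totally geodesic `ℝ³`: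
`τ₀ = τ̃₀ + O(r⁻¹)` for a function `τ̃₀` on `S²`, and `X_i = r X̃_i + O(1)`. -/
structure IsAsymptoticFamily (N : Exterior) (X : ℝ → E3 → R4) : Prop where
  embedding : ∀ᶠ r : ℝ in atTop, IsIsometricEmbedding N r (X r)
  time : ∃ τ : E3 → ℝ, SmoothOnSphere τ ∧ SphereBigO (-1) fun r n => X r n 0 - τ n
  space : ∀ i : Fin 3, SphereBigO 0 fun r n => X r n i.succ - r * n i

/-! ### The energy-momentum at infinity -/

/-- The density
`-⟨T₀, J₀/|H₀|⟩ (|H₀| - |H|) - ⟨∇_{∇τ} J₀/|H₀|, H₀/|H₀|⟩ + ⟨∇_{∇τ} J/|H|, H/|H|⟩`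
on `Σ_r`, where `τ = -⟨T₀, Y⟩`, multiplied by the area density of `Σ_r`. Here `H`, `J` belong to
`Σ_r` in the spacetime, `H₀`, `J₀` to the image of the isometric embedding `Y` in Minkowski
space. -/
def energyDensity (N : Exterior) (r : ℝ) (Y : E3 → R4) (T₀ : R4) (u : ℝ × ℝ) : ℝ :=
  let F : ℝ × ℝ → R4 := N.surface r
  let F₀ : ℝ × ℝ → R4 := fun z => Y (polar z)
  let σ : Matrix (Fin 2) (Fin 2) ℝ := inducedMetric N.metric F u
  let τ : ℝ × ℝ → ℝ := fun z => - mink T₀ (F₀ z)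
  let gradτ : Fin 2 → ℝ := fun a => ∑ b, σ⁻¹ a b * fderiv ℝ τ u (dir b)
  (- mink T₀ ((normH minkowski F₀ u)⁻¹ • dualJ minkowski timeDir F₀ u)
        * (normH minkowski F₀ u - normH N.metric F u)
      - ∑ a, gradτ a * connForm minkowski timeDir F₀ a u
      + ∑ a, gradτ a * connForm N.metric radialDir F a u)
    * Real.sqrt σ.det

/-- The integral over `Σ_r` whose limit for `r → ∞` is the limit of the quasilocal energy with
respect to the embedding `Y` and the observer `T₀`. -/
def energy (N : Exterior) (r : ℝ) (Y : E3 → R4) (T₀ : R4) : ℝ :=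
  1 / (8 * Real.pi) * ∫ u in polarDomain, energyDensity N r Y T₀ u

/-- `p` is the energy-momentum 4-vector at infinity with respect to the family `X_r` of isometric
embeddings: for every constant future timelike vector `T₀`, the energy converges to
`-⟨T₀, p⟩`. (Such a `p` is unique.) -/
def IsEnergyMomentum (N : Exterior) (X : ℝ → E3 → R4) (p : R4) : Prop :=
  ∀ T₀ : R4, IsFutureTimelike T₀ →
    (∀ᶠ r : ℝ in atTop, IntegrableOn (energyDensity N r (X r) T₀) polarDomain) ∧
    Tendsto (fun r : ℝ => energy N r (X r) T₀) atTop (𝓝 (- mink T₀ p))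

end BondiSachs

end

open BondiSachs

noncomputable section

namespace BondiSachs

/-! ### Partial derivatives in Cartesian coordinates -/

/-- The partial derivative in the `j`-th Cartesian coordinate. -/
def pd (j : Fin 3) (f : E3 → ℝ) (y : E3) : ℝ := fderiv ℝ f y (EuclideanSpace.single j 1)

/-- The Cartesian components of the outward unit normal of the spheres around the origin. -/
def nrm (i : Fin 3) (y : E3) : ℝ := y i / ‖y‖

/-- The orthogonal projection onto the planes tangent to the spheres. -/
def tproj (i j : Fin 3) (y : E3) : ℝ := (if i = j then (1 : ℝ) else 0) - nrm i y * nrm j y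

lemma e3_eq_sum (v : E3) : v = ∑ j, v j • EuclideanSpace.single j (1 : ℝ) := by
  ext i
  simp [Finset.sum_apply, Pi.single_apply]

lemma fderiv_eq_sum_pd (f : E3 → ℝ) (y v : E3) : fderiv ℝ f y v = ∑ j, v j * pd j f y := by
  conv_lhs => rw [e3_eq_sum v]
  simp [map_sum, pd]

lemma pd_congr {f g : E3 → ℝ} {y : E3} (h : f =ᶠ[𝓝 y] g) (j : Fin 3) : pd j f y = pd j g y := by
  simp only [pd, h.fderiv_eq]

lemma pd_eventuallyEq {f g : E3 → ℝ} {y : E3} (h : f =ᶠ[𝓝 y] g) (j : Fin 3) :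
    pd j f =ᶠ[𝓝 y] pd j g := by
  filter_upwards [h.eventually_nhds] with z hz using pd_congr hz j

lemma pd_const (j : Fin 3) (c : ℝ) (y : E3) : pd j (fun _ => c) y = 0 := by
  simp [pd]

lemma pd_add {f g : E3 → ℝ} {y : E3} (hf : DifferentiableAt ℝ f y) (hg : DifferentiableAt ℝ g y)
    (j : Fin 3) : pd j (fun z => f z + g z) y = pd j f y + pd j g y := by
  simp only [pd]; rw [fderiv_fun_add hf hg]; rfl

lemma pd_sub {f g : E3 → ℝ} {y : E3} (hf : DifferentiableAt ℝ f y) (hg : DifferentiableAt ℝ g y)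
    (j : Fin 3) : pd j (fun z => f z - g z) y = pd j f y - pd j g y := by
  simp only [pd]; rw [fderiv_fun_sub hf hg]; rfl

lemma pd_mul {f g : E3 → ℝ} {y : E3} (hf : DifferentiableAt ℝ f y) (hg : DifferentiableAt ℝ g y)
    (j : Fin 3) : pd j (fun z => f z * g z) y = pd j f y * g y + f y * pd j g y := by
  simp only [pd]; rw [fderiv_fun_mul hf hg]; simp; ring

lemma pd_const_mul {f : E3 → ℝ} {y : E3} (c : ℝ) (hf : DifferentiableAt ℝ f y)
    (j : Fin 3) : pd j (fun z => c * f z) y = c * pd j f y := by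
  rw [pd_mul (by fun_prop) hf, pd_const]; ring

lemma pd_sum {ι : Type*} {s : Finset ι} {f : ι → E3 → ℝ} {y : E3}
    (hf : ∀ i ∈ s, DifferentiableAt ℝ (f i) y) (j : Fin 3) :
    pd j (fun z => ∑ i ∈ s, f i z) y = ∑ i ∈ s, pd j (f i) y := by
  simp only [pd]; rw [fderiv_fun_sum hf]; simp

lemma pd_coord (i j : Fin 3) (y : E3) : pd j (fun z => z i) y = if i = j then 1 else 0 := by
  have : HasFDerivAt (fun z : E3 => z i) (EuclideanSpace.proj i : E3 →L[ℝ] ℝ) y :=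
    (EuclideanSpace.proj i : E3 →L[ℝ] ℝ).hasFDerivAt
  simp [pd, this.fderiv, PiLp.single_apply]

lemma contDiff_coord (i : Fin 3) : ContDiff ℝ ∞ (fun z : E3 => z i) :=
  (EuclideanSpace.proj i : E3 →L[ℝ] ℝ).contDiff

lemma norm_sq_eq_sum (y : E3) : ‖y‖ ^ 2 = ∑ i, y i * y i := by
  rw [EuclideanSpace.real_norm_sq_eq]; simp [sq]

lemma sum_nrm_sq {y : E3} (hy : y ≠ 0) : ∑ i, nrm i y * nrm i y = 1 := by
  have h0 : ‖y‖ ≠ 0 := norm_ne_zero_iff.2 hy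
  have := norm_sq_eq_sum y
  simp only [nrm, Fin.sum_univ_three] at *
  field_simp
  linarith

lemma pd_norm {y : E3} (hy : y ≠ 0) (j : Fin 3) : pd j (fun z => ‖z‖) y = nrm j y := by
  have h0 : ‖y‖ ≠ 0 := norm_ne_zero_iff.2 hy
  have hd : DifferentiableAt ℝ (fun z : E3 => ‖z‖) y :=
    ((contDiffAt_norm ℝ hy : ContDiffAt ℝ 1 _ y)).differentiableAt (by simp)
  have h1 : pd j (fun z => ‖z‖ * ‖z‖) y = pd j (fun z => ∑ i, z i * z i) y := by
    congr 1; ext z; rw [← norm_sq_eq_sum, sq]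
  have hc : ∀ i : Fin 3, DifferentiableAt ℝ (fun z : E3 => z i) y := fun i =>
    (contDiff_coord i).contDiffAt.differentiableAt (by simp)
  rw [pd_mul hd hd, pd_sum (fun i _ => (hc i).fun_mul (hc i))] at h1
  simp only [pd_mul (hc _) (hc _), pd_coord] at h1
  simp [Finset.sum_add_distrib] at h1
  rw [nrm]; field_simp; linarith

lemma contDiffAt_nrm {y : E3} (hy : y ≠ 0) (i : Fin 3) : ContDiffAt ℝ ∞ (nrm i) y :=
  (contDiff_coord i).contDiffAt.div (contDiffAt_norm ℝ hy) (norm_ne_zero_iff.2 hy)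

lemma differentiableAt_norm' {y : E3} (hy : y ≠ 0) : DifferentiableAt ℝ (fun z : E3 => ‖z‖) y :=
  (contDiffAt_norm ℝ hy : ContDiffAt ℝ 1 _ y).differentiableAt (by simp)

lemma differentiableAt_nrm {y : E3} (hy : y ≠ 0) (i : Fin 3) : DifferentiableAt ℝ (nrm i) y :=
  (contDiffAt_nrm hy i).differentiableAt (by simp)

lemma norm_mul_nrm {y : E3} (hy : y ≠ 0) (i : Fin 3) : ‖y‖ * nrm i y = y i := by
  have h0 : ‖y‖ ≠ 0 := norm_ne_zero_iff.2 hy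
  rw [nrm]; field_simp

lemma eventually_ne_zero {y : E3} (hy : y ≠ 0) : ∀ᶠ z in 𝓝 y, z ≠ 0 := isOpen_ne.mem_nhds hy

lemma pd_nrm {y : E3} (hy : y ≠ 0) (i j : Fin 3) : pd j (nrm i) y = tproj i j y / ‖y‖ := by
  have h0 : ‖y‖ ≠ 0 := norm_ne_zero_iff.2 hy
  have h1 : (fun z => ‖z‖ * nrm i z) =ᶠ[𝓝 y] fun z => z i := by
    filter_upwards [eventually_ne_zero hy] with z hz using norm_mul_nrm hz i
  have h2 := pd_congr h1 j
  rw [pd_mul (differentiableAt_norm' hy) (differentiableAt_nrm hy i), pd_norm hy, pd_coord] at h2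
  rw [tproj, ← h2]; field_simp; ring

lemma contDiffAt_tproj {y : E3} (hy : y ≠ 0) (i j : Fin 3) : ContDiffAt ℝ ∞ (tproj i j) y :=
  contDiffAt_const.sub ((contDiffAt_nrm hy i).mul (contDiffAt_nrm hy j))

lemma pd_tproj {y : E3} (hy : y ≠ 0) (i j k : Fin 3) : pd k (tproj i j) y =
    - (tproj i k y * nrm j y + nrm i y * tproj j k y) / ‖y‖ := by
  have h := differentiableAt_nrm hy
  have : tproj i j = fun z => (if i = j then (1 : ℝ) else 0) - nrm i z * nrm j z := rfl
  rw [this, pd_sub (by fun_prop) ((h i).fun_mul (h j)), pd_const, pd_mul (h i) (h j), pd_nrm hy,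
    pd_nrm hy]
  ring

lemma sum_tproj_nrm {y : E3} (hy : y ≠ 0) (i : Fin 3) : ∑ j, tproj i j y * nrm j y = 0 := by
  simp only [tproj, sub_mul, Finset.sum_sub_distrib, mul_assoc]
  rw [← Finset.mul_sum, sum_nrm_sq hy]; simp

lemma tproj_symm (i j : Fin 3) (y : E3) : tproj i j y = tproj j i y := by
  simp only [tproj, eq_comm (a := i), mul_comm]

lemma sum_tproj_self {y : E3} (hy : y ≠ 0) : ∑ j, tproj j j y = 2 := by
  simp only [tproj, if_true, Finset.sum_sub_distrib]
  rw [sum_nrm_sq hy]; norm_num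

lemma contDiffAt_pd {f : E3 → ℝ} {y : E3} (hf : ContDiffAt ℝ ∞ f y) (j : Fin 3) :
    ContDiffAt ℝ ∞ (pd j f) y :=
  (hf.fderiv_right (m := ∞) (by simp)).clm_apply contDiffAt_const

lemma pd_comm {f : E3 → ℝ} {y : E3} (hf : ContDiffAt ℝ ∞ f y) (i j : Fin 3) :
    pd i (pd j f) y = pd j (pd i f) y := by
  have h1 : DifferentiableAt ℝ (fderiv ℝ f) y :=
    (hf.fderiv_right (m := ∞) (by simp)).differentiableAt (by simp)
  have h2 : ∀ a b : Fin 3, pd a (pd b f) y =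
      fderiv ℝ (fderiv ℝ f) y (EuclideanSpace.single a 1) (EuclideanSpace.single b 1) := by
    intro a b
    have : pd b f = fun z => fderiv ℝ f z (EuclideanSpace.single b 1) := rfl
    rw [this, pd, fderiv_clm_apply h1 (by fun_prop)]
    simp
  rw [h2, h2]
  exact (hf.isSymmSndFDerivAt (by simpa using (mod_cast le_top : ((2 : ℕ∞) : WithTop ℕ∞) ≤ ∞))).eq _ _

/-! ### Homogeneous functions -/

lemma radialExt_smul (f : E3 → ℝ) {c : ℝ} (hc : 0 < c) (y : E3) :
    radialExt f (c • y) = radialExt f y := by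
  simp only [radialExt, norm_smul, smul_smul, Real.norm_of_nonneg hc.le]
  congr 2
  rw [mul_inv]; field_simp

lemma radialExt_of_norm_one (f : E3 → ℝ) {n : E3} (hn : ‖n‖ = 1) : radialExt f n = f n := by
  simp [radialExt, hn]

lemma radialExt_smul_of_norm_one (f : E3 → ℝ) {c : ℝ} (hc : 0 < c) {n : E3} (hn : ‖n‖ = 1) :
    radialExt f (c • n) = f n := by
  rw [radialExt_smul f hc, radialExt_of_norm_one f hn]

lemma SmoothOnSphere.contDiffAt_radialExt {f : E3 → ℝ} (hf : SmoothOnSphere f) {y : E3}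
    (hy : y ≠ 0) : ContDiffAt ℝ ∞ (radialExt f) y :=
  ContDiffOn.contDiffAt hf (isOpen_ne.mem_nhds hy)

/-- Positive homogeneity of degree `d`. -/
def Homog (d : ℤ) (f : E3 → ℝ) : Prop := ∀ c : ℝ, 0 < c → ∀ y, y ≠ 0 → f (c • y) = c ^ d * f y

lemma homog_radialExt (f : E3 → ℝ) : Homog 0 (radialExt f) := fun c hc y _ => by
  rw [radialExt_smul f hc]; simp

lemma homog_nrm (i : Fin 3) : Homog 0 (nrm i) := fun c hc y _ => by
  simp only [nrm, norm_smul, Real.norm_of_nonneg hc.le, PiLp.smul_apply, smul_eq_mul]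
  rw [mul_div_mul_left _ _ hc.ne']; simp

lemma homog_norm : Homog 1 (fun y => ‖y‖) := fun c hc y _ => by
  simp [norm_smul, Real.norm_of_nonneg hc.le]

lemma Homog.mul {d e : ℤ} {f g : E3 → ℝ} (hf : Homog d f) (hg : Homog e g) :
    Homog (d + e) (fun y => f y * g y) := fun c hc y hy => by
  simp only [hf c hc y hy, hg c hc y hy, zpow_add₀ hc.ne']; ring

lemma Homog.add {d : ℤ} {f g : E3 → ℝ} (hf : Homog d f) (hg : Homog d g) :
    Homog d (fun y => f y + g y) := fun c hc y hy => by
  simp only [hf c hc y hy, hg c hc y hy]; ring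

lemma Homog.sum {ι : Type*} {s : Finset ι} {d : ℤ} {f : ι → E3 → ℝ}
    (hf : ∀ i ∈ s, Homog d (f i)) : Homog d (fun y => ∑ i ∈ s, f i y) := fun c hc y hy => by
  simp only [Finset.mul_sum]
  exact Finset.sum_congr rfl fun i hi => hf i hi c hc y hy

lemma Homog.pd {d : ℤ} {f : E3 → ℝ} (hf : Homog d f) (hs : ∀ y, y ≠ 0 → DifferentiableAt ℝ f y)
    (j : Fin 3) : Homog (d - 1) (pd j f) := fun c hc y hy => by
  have hcy : c • y ≠ 0 := smul_ne_zero hc.ne' hy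
  have h1 : (fun z => f (c • z)) =ᶠ[𝓝 y] fun z => c ^ d * f z := by
    filter_upwards [eventually_ne_zero hy] with z hz using hf c hc z hz
  have h2 := pd_congr h1 j
  rw [pd_const_mul _ (hs y hy)] at h2
  have h3 : BondiSachs.pd j (fun z => f (c • z)) y = c * BondiSachs.pd j f (c • y) := by
    have hd : HasFDerivAt (fun z : E3 => c • z) (c • ContinuousLinearMap.id ℝ E3) y :=
      (hasFDerivAt_id y).const_smul c
    have := (hs _ hcy).hasFDerivAt.comp y hd
    simp only [BondiSachs.pd]
    rw [show (fun z => f (c • z)) = f ∘ (fun z => c • z) from rfl, this.fderiv]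
    simp
  rw [h3] at h2
  rw [zpow_sub_one₀ hc.ne']
  field_simp
  linarith

/-- Euler's identity. -/
lemma Homog.euler {d : ℤ} {f : E3 → ℝ} (hf : Homog d f) {y : E3} (hy : y ≠ 0)
    (hs : DifferentiableAt ℝ f y) : ∑ j, y j * BondiSachs.pd j f y = d * f y := by
  rw [← fderiv_eq_sum_pd]
  have h1 : HasDerivAt (fun c : ℝ => f (c • y)) (fderiv ℝ f y y) 1 := by
    have hd : HasDerivAt (fun c : ℝ => c • y) y 1 := by
      simpa using (hasDerivAt_id (1:ℝ)).smul_const y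
    have h2 : HasFDerivAt f (fderiv ℝ f y) ((1:ℝ) • y) := by simpa using hs.hasFDerivAt
    exact h2.comp_hasDerivAt 1 hd
  have h2 : (fun c : ℝ => f (c • y)) =ᶠ[𝓝 1] fun c => c ^ d * f y := by
    filter_upwards [lt_mem_nhds (zero_lt_one)] with c hc using hf c hc y hy
  have h3 : HasDerivAt (fun c : ℝ => c ^ d * f y) (d * f y) 1 := by
    simpa using (hasDerivAt_zpow d (1:ℝ) (by simp)).mul_const (f y)
  exact (h1.congr_of_eventuallyEq h2.symm).unique h3

lemma Homog.sum_nrm_mul_pd {d : ℤ} {f : E3 → ℝ} (hf : Homog d f) {y : E3} (hy : y ≠ 0)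
    (hs : DifferentiableAt ℝ f y) : ∑ j, nrm j y * BondiSachs.pd j f y = d * f y / ‖y‖ := by
  rw [← hf.euler hy hs, Finset.sum_div]
  exact Finset.sum_congr rfl fun j _ => by rw [nrm]; ring


/-! ### Partial derivatives in polar coordinates -/

/-- The partial derivative in the coordinate `θ` (`a = 0`) or `φ` (`a = 1`). -/
def ud (a : Fin 2) (f : ℝ × ℝ → ℝ) (u : ℝ × ℝ) : ℝ := fderiv ℝ f u (dir a)

lemma ud_congr {f g : ℝ × ℝ → ℝ} {u : ℝ × ℝ} (h : f =ᶠ[𝓝 u] g) (a : Fin 2) :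
    ud a f u = ud a g u := by
  simp only [ud, h.fderiv_eq]

lemma ud_const (a : Fin 2) (c : ℝ) (u : ℝ × ℝ) : ud a (fun _ => c) u = 0 := by
  simp [ud]

lemma ud_neg {f : ℝ × ℝ → ℝ} {u : ℝ × ℝ} (a : Fin 2) :
    ud a (fun z => - f z) u = - ud a f u := by
  simp only [ud]; rw [fderiv_fun_neg]; rfl

lemma ud_mul {f g : ℝ × ℝ → ℝ} {u : ℝ × ℝ} (hf : DifferentiableAt ℝ f u)
    (hg : DifferentiableAt ℝ g u) (a : Fin 2) :
    ud a (fun z => f z * g z) u = ud a f u * g u + f u * ud a g u := by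
  simp only [ud]; rw [fderiv_fun_mul hf hg]; simp; ring

lemma ud_const_mul {f : ℝ × ℝ → ℝ} {u : ℝ × ℝ} (c : ℝ) (hf : DifferentiableAt ℝ f u)
    (a : Fin 2) : ud a (fun z => c * f z) u = c * ud a f u := by
  rw [ud_mul (by fun_prop) hf, ud_const]; ring

lemma ud_sum {ι : Type*} {s : Finset ι} {f : ι → ℝ × ℝ → ℝ} {u : ℝ × ℝ}
    (hf : ∀ i ∈ s, DifferentiableAt ℝ (f i) u) (a : Fin 2) :
    ud a (fun z => ∑ i ∈ s, f i z) u = ∑ i ∈ s, ud a (f i) u := by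
  simp only [ud]; rw [fderiv_fun_sum hf]; simp

lemma ud_zero_comp_fst {f : ℝ → ℝ} {f' : ℝ} {u : ℝ × ℝ} (h : HasDerivAt f f' u.1) :
    ud 0 (fun z => f z.1) u = f' := by
  have := h.hasFDerivAt.comp u hasFDerivAt_fst
  simp only [ud]
  rw [show (fun z : ℝ × ℝ => f z.1) = f ∘ Prod.fst from rfl, this.fderiv]
  simp [dir]

lemma ud_one_comp_fst {f : ℝ → ℝ} {f' : ℝ} {u : ℝ × ℝ} (h : HasDerivAt f f' u.1) :
    ud 1 (fun z => f z.1) u = 0 := by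
  have := h.hasFDerivAt.comp u hasFDerivAt_fst
  simp only [ud]
  rw [show (fun z : ℝ × ℝ => f z.1) = f ∘ Prod.fst from rfl, this.fderiv]
  simp [dir]

lemma ud_zero_comp_snd {f : ℝ → ℝ} {f' : ℝ} {u : ℝ × ℝ} (h : HasDerivAt f f' u.2) :
    ud 0 (fun z => f z.2) u = 0 := by
  have := h.hasFDerivAt.comp u hasFDerivAt_snd
  simp only [ud]
  rw [show (fun z : ℝ × ℝ => f z.2) = f ∘ Prod.snd from rfl, this.fderiv]
  simp [dir]

lemma ud_one_comp_snd {f : ℝ → ℝ} {f' : ℝ} {u : ℝ × ℝ} (h : HasDerivAt f f' u.2) :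
    ud 1 (fun z => f z.2) u = f' := by
  have := h.hasFDerivAt.comp u hasFDerivAt_snd
  simp only [ud]
  rw [show (fun z : ℝ × ℝ => f z.2) = f ∘ Prod.snd from rfl, this.fderiv]
  simp [dir]

/-! ### Polar coordinates -/

/-- The unit vector in the direction of `∂_θ`. -/
def unitTheta (u : ℝ × ℝ) : E3 :=
  !₂[Real.cos u.1 * Real.sin u.2, Real.cos u.1 * Real.cos u.2, - Real.sin u.1]

/-- The unit vector in the direction of `∂_φ`. -/
def unitPhi (u : ℝ × ℝ) : E3 := !₂[Real.cos u.2, - Real.sin u.2, 0]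

/-- The coordinate tangent vectors `∂_θ`, `∂_φ` of the unit sphere. -/
def sphTan (a : Fin 2) (u : ℝ × ℝ) : E3 := ![unitTheta u, Real.sin u.1 • unitPhi u] a

lemma norm_polar (u : ℝ × ℝ) : ‖polar u‖ = 1 := by
  have : ‖polar u‖ ^ 2 = 1 := by
    rw [norm_sq_eq_sum]
    simp [Fin.sum_univ_three, polar]
    nlinarith [Real.sin_sq_add_cos_sq u.1, Real.sin_sq_add_cos_sq u.2]
  nlinarith [norm_nonneg (polar u)]

lemma norm_smul_polar {r : ℝ} (hr : 0 < r) (u : ℝ × ℝ) : ‖r • polar u‖ = r := by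
  rw [norm_smul, norm_polar, Real.norm_of_nonneg hr.le, mul_one]

lemma smul_polar_ne_zero {r : ℝ} (hr : 0 < r) (u : ℝ × ℝ) : r • polar u ≠ 0 := by
  rw [← norm_ne_zero_iff, norm_smul_polar hr]; exact hr.ne'

lemma nrm_smul_polar {r : ℝ} (hr : 0 < r) (u : ℝ × ℝ) (i : Fin 3) :
    nrm i (r • polar u) = polar u i := by
  rw [nrm, norm_smul_polar hr]; simp; field_simp

lemma contDiff_polar : ContDiff ℝ ∞ polar := by
  rw [contDiff_euclidean]
  intro i
  fin_cases i <;> simp [polar] <;> fun_prop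

lemma contDiff_unitTheta : ContDiff ℝ ∞ unitTheta := by
  rw [contDiff_euclidean]
  intro i
  fin_cases i <;> simp [unitTheta] <;> fun_prop

lemma contDiff_unitPhi : ContDiff ℝ ∞ unitPhi := by
  rw [contDiff_euclidean]
  intro i
  fin_cases i <;> simp [unitPhi] <;> fun_prop

lemma contDiff_sphTan (a : Fin 2) : ContDiff ℝ ∞ (sphTan a) := by
  fin_cases a
  · exact contDiff_unitTheta
  · exact (Real.contDiff_sin.comp contDiff_fst).smul contDiff_unitPhi

lemma differentiable_coord {f : ℝ × ℝ → E3} (hf : ContDiff ℝ ∞ f) (i : Fin 3) :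
    Differentiable ℝ fun u => f u i :=
  ((contDiff_coord i).comp hf).differentiable (by simp)

lemma ud_polar (a : Fin 2) (u : ℝ × ℝ) (i : Fin 3) : ud a (fun z => polar z i) u = sphTan a u i := by
  have s1 := Real.hasDerivAt_sin u.1
  have s2 := Real.hasDerivAt_sin u.2
  have c1 := Real.hasDerivAt_cos u.1
  have c2 := Real.hasDerivAt_cos u.2
  fin_cases a <;> fin_cases i <;> simp [polar, sphTan, unitTheta, unitPhi] <;>
    first
    | (rw [ud_mul (by fun_prop) (by fun_prop)]
       first
       | (rw [ud_zero_comp_fst s1, ud_zero_comp_snd s2]; ring)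
       | (rw [ud_zero_comp_fst s1, ud_zero_comp_snd c2]; ring)
       | (rw [ud_one_comp_fst s1, ud_one_comp_snd s2]; ring)
       | (rw [ud_one_comp_fst s1, ud_one_comp_snd c2]; ring))
    | exact ud_zero_comp_fst c1
    | exact ud_one_comp_fst c1

lemma hasFDerivAt_polar (u : ℝ × ℝ) (a : Fin 2) : fderiv ℝ polar u (dir a) = sphTan a u := by
  have h := contDiff_polar.differentiable (by simp) u
  ext i
  rw [← ud_polar, ud]
  have := ((EuclideanSpace.proj i : E3 →L[ℝ] ℝ).hasFDerivAt (x := polar u)).comp u h.hasFDerivAt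
  rw [show (fun z => polar z i) = (EuclideanSpace.proj i : E3 →L[ℝ] ℝ) ∘ polar from rfl,
    this.fderiv]
  simp

/-- The chain rule on the sphere of radius `r`. -/
lemma ud_comp_smul_polar {f : E3 → ℝ} {r : ℝ} {u : ℝ × ℝ}
    (hf : DifferentiableAt ℝ f (r • polar u)) (a : Fin 2) :
    ud a (fun z => f (r • polar z)) u = r * ∑ j, sphTan a u j * pd j f (r • polar u) := by
  have h : DifferentiableAt ℝ polar u := contDiff_polar.differentiable (by simp) u
  have h1 := hf.hasFDerivAt.comp u (h.hasFDerivAt.const_smul r)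
  rw [ud, show (fun z => f (r • polar z)) = f ∘ (r • polar) from rfl, h1.fderiv,
    ← fderiv_eq_sum_pd]
  simp [hasFDerivAt_polar]

lemma contDiffAt_comp_smul_polar {f : E3 → ℝ} {r : ℝ} {u : ℝ × ℝ}
    (hf : ContDiffAt ℝ ∞ f (r • polar u)) : ContDiffAt ℝ ∞ (fun z => f (r • polar z)) u :=
  hf.comp u (contDiff_polar.contDiffAt.const_smul r)

lemma sum_sphTan_polar (a : Fin 2) (u : ℝ × ℝ) : ∑ i, sphTan a u i * polar u i = 0 := by
  have := Real.sin_sq_add_cos_sq u.2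
  fin_cases a <;> simp [Fin.sum_univ_three, sphTan, unitTheta, unitPhi, polar]
  · linear_combination Real.cos u.1 * Real.sin u.1 * this
  · ring

/-- The frame `∂_θ`, `(sin θ)⁻¹ ∂_φ`, `n` is orthonormal. -/
lemma frame_complete (u : ℝ × ℝ) (i j : Fin 3) :
    unitTheta u i * unitTheta u j + unitPhi u i * unitPhi u j =
      (if i = j then 1 else 0) - polar u i * polar u j := by
  have h1 := Real.sin_sq_add_cos_sq u.1
  have h2 := Real.sin_sq_add_cos_sq u.2
  have e1 := Real.sin_sq u.1
  have e2 := Real.sin_sq u.2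
  fin_cases i <;> fin_cases j <;> simp [unitTheta, unitPhi, polar] <;> ring_nf <;>
    simp only [e1, e2] <;> ring

/-! ### The divergence theorem on the sphere -/

lemma ud_unitTheta_zero (u : ℝ × ℝ) (i : Fin 3) :
    ud 0 (fun z => unitTheta z i) u = - polar u i := by
  have s1 := Real.hasDerivAt_sin u.1
  have s2 := Real.hasDerivAt_sin u.2
  have c1 := Real.hasDerivAt_cos u.1
  have c2 := Real.hasDerivAt_cos u.2
  fin_cases i <;> simp [polar, unitTheta]
  · rw [ud_mul (by fun_prop) (by fun_prop), ud_zero_comp_fst c1, ud_zero_comp_snd s2]; ring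
  · rw [ud_mul (by fun_prop) (by fun_prop), ud_zero_comp_fst c1, ud_zero_comp_snd c2]; ring
  · rw [ud_neg, ud_zero_comp_fst s1]

lemma ud_unitPhi_one (u : ℝ × ℝ) (i : Fin 3) : ud 1 (fun z => unitPhi z i) u =
    - (Real.sin u.1 * polar u i + Real.cos u.1 * unitTheta u i) := by
  have s2 := Real.hasDerivAt_sin u.2
  have c2 := Real.hasDerivAt_cos u.2
  have h1 := Real.sin_sq_add_cos_sq u.1
  fin_cases i <;> simp [polar, unitTheta, unitPhi]
  · rw [ud_one_comp_snd c2]; linear_combination Real.sin u.2 * h1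
  · rw [ud_neg, ud_one_comp_snd s2]; linear_combination Real.cos u.2 * h1
  · rw [ud_const]; ring

lemma sin_mul_div_eq {Z : Fin 3 → E3 → ℝ} {r : ℝ} (hr : 0 < r) {u : ℝ × ℝ}
    (hZ : ∀ i, DifferentiableAt ℝ (Z i) (r • polar u))
    (ht : ∀ᶠ y in 𝓝 (r • polar u), ∑ i, nrm i y * Z i y = 0) :
    ud 0 (fun z => Real.sin z.1 * ∑ i, Z i (r • polar z) * unitTheta z i) u +
      ud 1 (fun z => ∑ i, Z i (r • polar z) * unitPhi z i) u =
    r * (Real.sin u.1 * ∑ i, pd i (Z i) (r • polar u)) := by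
  have hy := smul_polar_ne_zero hr u
  have dth : ∀ i, DifferentiableAt ℝ (fun z => unitTheta z i) u := fun i =>
    differentiable_coord contDiff_unitTheta i u
  have dph : ∀ i, DifferentiableAt ℝ (fun z => unitPhi z i) u := fun i =>
    differentiable_coord contDiff_unitPhi i u
  have dZ : ∀ i, DifferentiableAt ℝ (fun z => Z i (r • polar z)) u := fun i =>
    (hZ i).comp u ((contDiff_polar.differentiable (by simp) u).const_smul r)
  rw [ud_mul (by fun_prop) (DifferentiableAt.fun_sum fun i _ => (dZ i).fun_mul (dth i)),
    ud_sum (fun i _ => (dZ i).fun_mul (dth i)), ud_sum (fun i _ => (dZ i).fun_mul (dph i)),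
    ud_zero_comp_fst (Real.hasDerivAt_sin u.1)]
  simp only [ud_mul (dZ _) (dth _), ud_mul (dZ _) (dph _), ud_unitTheta_zero, ud_unitPhi_one,
    ud_comp_smul_polar (hZ _)]
  have hrad : ∑ i, ∑ j, polar u i * polar u j * pd j (Z i) (r • polar u) = 0 := by
    have h0 : ∀ j, pd j (fun y => ∑ i, nrm i y * Z i y) (r • polar u) = 0 := fun j => by
      rw [pd_congr (g := fun _ => 0) ht, pd_const]
    have h1 : ∑ j, nrm j (r • polar u) * pd j (fun y => ∑ i, nrm i y * Z i y) (r • polar u) = 0 := by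
      simp [h0]
    have dn := fun i => differentiableAt_nrm hy i
    simp only [pd_sum (fun i _ => (dn i).fun_mul (hZ i)), pd_mul (dn _) (hZ _), pd_nrm hy] at h1
    have h2 : ∀ i, ∑ j, nrm j (r • polar u) * tproj i j (r • polar u) = 0 := fun i => by
      simp only [mul_comm (nrm _ _)]; exact sum_tproj_nrm hy i
    have h3 : ∑ j, nrm j (r • polar u) * ∑ i, (tproj i j (r • polar u) / ‖r • polar u‖ *
        Z i (r • polar u) + nrm i (r • polar u) * pd j (Z i) (r • polar u)) =
      ∑ i, ((∑ j, nrm j (r • polar u) * tproj i j (r • polar u)) * (Z i (r • polar u) / ‖r • polar u‖) +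
        ∑ j, nrm i (r • polar u) * nrm j (r • polar u) * pd j (Z i) (r • polar u)) := by
      simp only [Fin.sum_univ_three]; ring
    rw [h3] at h1
    simp only [h2, zero_mul, zero_add] at h1
    simpa only [nrm_smul_polar hr] using h1
  have ht0 : ∑ i, polar u i * Z i (r • polar u) = 0 := by
    simpa [nrm_smul_polar hr] using ht.self_of_nhds
  have hc := frame_complete u
  have key : ∑ i, ∑ j, (unitTheta u i * unitTheta u j + unitPhi u i * unitPhi u j) *
      pd j (Z i) (r • polar u) = ∑ i, pd i (Z i) (r • polar u) := by
    simp only [hc, sub_mul, Finset.sum_sub_distrib, hrad]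
    simp
  have e0 : ∀ j, sphTan 0 u j = unitTheta u j := fun j => rfl
  have e1 : ∀ j, sphTan 1 u j = Real.sin u.1 * unitPhi u j := fun j => rfl
  rw [← key]
  simp only [e0, e1]
  simp only [Fin.sum_univ_three] at *
  linear_combination (-2 * Real.sin u.1) * ht0

lemma periodic_polar (θ : ℝ) : polar (θ, 2 * Real.pi) = polar (θ, 0) := by
  simp [polar]

lemma polarDomain_ae_eq : (polarDomain : Set (ℝ × ℝ)) =ᵐ[volume]
    Set.Icc ((0 : ℝ), (0 : ℝ)) (Real.pi, 2 * Real.pi) := by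
  rw [← Set.Icc_prod_Icc]
  exact Measure.set_prod_ae_eq Ioo_ae_eq_Icc Ioo_ae_eq_Icc

lemma isOpen_polarDomain : IsOpen polarDomain := isOpen_Ioo.prod isOpen_Ioo

lemma integrableOn_polarDomain {f : ℝ × ℝ → ℝ} (hf : Continuous f) :
    IntegrableOn f polarDomain := by
  rw [integrableOn_congr_set_ae polarDomain_ae_eq]
  exact hf.continuousOn.integrableOn_compact isCompact_Icc

/-- The divergence theorem for tangent vector fields on the sphere of radius `r`. -/
theorem integral_div_sphere {Z : Fin 3 → E3 → ℝ} {r : ℝ} (hr : 0 < r)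
    (hZ : ∀ i y, ‖y‖ = r → ContDiffAt ℝ ∞ (Z i) y)
    (ht : ∀ y, ‖y‖ = r → ∀ᶠ z in 𝓝 y, ∑ i, nrm i z * Z i z = 0) :
    ∫ u in polarDomain, Real.sin u.1 * ∑ i, pd i (Z i) (r • polar u) = 0 := by
  have hn := fun u => norm_smul_polar hr u
  set f : ℝ × ℝ → ℝ := fun z => Real.sin z.1 * ∑ i, Z i (r • polar z) * unitTheta z i with hf
  set g : ℝ × ℝ → ℝ := fun z => ∑ i, Z i (r • polar z) * unitPhi z i with hg
  have cth : ∀ i, ContDiff ℝ ∞ fun z => unitTheta z i := fun i =>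
    (contDiff_coord i).comp contDiff_unitTheta
  have cph : ∀ i, ContDiff ℝ ∞ fun z => unitPhi z i := fun i =>
    (contDiff_coord i).comp contDiff_unitPhi
  have cZ : ∀ i, ContDiff ℝ ∞ fun z => Z i (r • polar z) := fun i =>
    contDiff_iff_contDiffAt.2 fun u => contDiffAt_comp_smul_polar (hZ i _ (hn u))
  have cf : ContDiff ℝ ∞ f :=
    (Real.contDiff_sin.comp contDiff_fst).mul (ContDiff.sum fun i _ => (cZ i).mul (cth i))
  have cg : ContDiff ℝ ∞ g := ContDiff.sum fun i _ => (cZ i).mul (cph i)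
  have df := cf.differentiable (by simp)
  have dg := cg.differentiable (by simp)
  have cint : Continuous fun x => fderiv ℝ f x (1, 0) + fderiv ℝ g x (0, 1) :=
    ((cf.continuous_fderiv (by simp)).clm_apply continuous_const).add
      ((cg.continuous_fderiv (by simp)).clm_apply continuous_const)
  have key := integral_divergence_prod_Icc_of_hasFDerivAt_of_le f g (fderiv ℝ f) (fderiv ℝ g)
    (0, 0) (Real.pi, 2 * Real.pi) ⟨Real.pi_pos.le, by positivity⟩ cf.continuous.continuousOn
    cg.continuous.continuousOn (fun x _ => (df x).hasFDerivAt) (fun x _ => (dg x).hasFDerivAt)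
    (cint.continuousOn.integrableOn_compact isCompact_Icc)
  have hper : ∀ θ, g (θ, 2 * Real.pi) = g (θ, 0) := fun θ => by
    simp [hg, periodic_polar, unitPhi]
  have hf0 : ∀ φ, f (0, φ) = 0 := fun φ => by simp [hf]
  have hf1 : ∀ φ, f (Real.pi, φ) = 0 := fun φ => by simp [hf]
  simp only [hper, hf0, hf1] at key
  have hpt : ∀ x, fderiv ℝ f x (1, 0) + fderiv ℝ g x (0, 1) =
      r * (Real.sin x.1 * ∑ i, pd i (Z i) (r • polar x)) := fun x =>
    sin_mul_div_eq hr (fun i => (hZ i _ (hn x)).differentiableAt (by simp)) (ht _ (hn x))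
  simp only [hpt] at key
  rw [setIntegral_congr_set polarDomain_ae_eq]
  rw [integral_const_mul] at key
  have : r * ∫ x in Set.Icc ((0 : ℝ), (0 : ℝ)) (Real.pi, 2 * Real.pi),
      Real.sin x.1 * ∑ i, pd i (Z i) (r • polar x) = 0 := by
    rw [key]; simp
  exact (mul_eq_zero.1 this).resolve_left hr.ne'


/-! ### Linear algebra of a degenerate form `h` whose kernel is spanned by `n` -/

section LinearAlgebra

variable {h : Matrix (Fin 3) (Fin 3) ℝ} {n : Fin 3 → ℝ}

/-- The pseudo-inverse of a form `h` with kernel `ℝ n` and determinant one on the complement. -/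
def pinv (h : Matrix (Fin 3) (Fin 3) ℝ) (n : Fin 3 → ℝ) : Matrix (Fin 3) (Fin 3) ℝ :=
  (h + vecMulVec n n).adjugate - vecMulVec n n

lemma add_vecMulVec_mulVec (hn : h *ᵥ n = 0) (hu : n ⬝ᵥ n = 1) :
    (h + vecMulVec n n) *ᵥ n = n := by
  rw [add_mulVec, hn, zero_add, vecMulVec_mulVec, hu]; simp

lemma adjugate_mulVec_self (hn : h *ᵥ n = 0) (hu : n ⬝ᵥ n = 1)
    (hd : (h + vecMulVec n n).det = 1) : (h + vecMulVec n n).adjugate *ᵥ n = n := by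
  have := congrArg ((h + vecMulVec n n).adjugate *ᵥ ·) (add_vecMulVec_mulVec hn hu)
  simpa [mulVec_mulVec, adjugate_mul, hd] using this.symm

lemma pinv_mulVec (hn : h *ᵥ n = 0) (hu : n ⬝ᵥ n = 1) (hd : (h + vecMulVec n n).det = 1) :
    pinv h n *ᵥ n = 0 := by
  rw [pinv, sub_mulVec, adjugate_mulVec_self hn hu hd, vecMulVec_mulVec, hu]; simp

lemma pinv_isSymm (hs : h.IsSymm) : (pinv h n).IsSymm := by
  rw [IsSymm, pinv, transpose_sub, adjugate_transpose, transpose_add, hs.eq, transpose_vecMulVec]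

lemma pinv_mul (hn : h *ᵥ n = 0) (hu : n ⬝ᵥ n = 1) (hs : h.IsSymm)
    (hd : (h + vecMulVec n n).det = 1) : pinv h n * h = 1 - vecMulVec n n := by
  have h1 : (h + vecMulVec n n).adjugate * (h + vecMulVec n n) = 1 := by
    rw [adjugate_mul, hd, one_smul]
  have h2 : (h + vecMulVec n n).adjugate * vecMulVec n n = vecMulVec n n := by
    rw [mul_vecMulVec, adjugate_mulVec_self hn hu hd]
  have h3 : vecMulVec n n * h = 0 := by
    rw [vecMulVec_mul, ← mulVec_transpose, hs.eq, hn]; simp [vecMulVec_zero]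
  rw [mul_add, h2] at h1
  rw [pinv, sub_mul, h3, sub_zero, ← h1]; abel

variable {F : Fin 2 → Fin 3 → ℝ}

/-- The restriction of `h` to the span of the `F a`. -/
def gram (h : Matrix (Fin 3) (Fin 3) ℝ) (F : Fin 2 → Fin 3 → ℝ) : Matrix (Fin 2) (Fin 2) ℝ :=
  Matrix.of fun a b => F a ⬝ᵥ (h *ᵥ F b)

/-- The matrix with rows `F 0`, `F 1`, `n`. -/
def frameMatrix (F : Fin 2 → Fin 3 → ℝ) (n : Fin 3 → ℝ) : Matrix (Fin 3) (Fin 3) ℝ :=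
  Matrix.of ![F 0, F 1, n]

lemma det_gram (hn : h *ᵥ n = 0) (hu : n ⬝ᵥ n = 1) (hs : h.IsSymm)
    (hd : (h + vecMulVec n n).det = 1) (hF : ∀ a, F a ⬝ᵥ n = 0) :
    (gram h F).det = (frameMatrix F n).det ^ 2 := by
  have hM : ∀ v w : Fin 3 → ℝ, v ⬝ᵥ ((h + vecMulVec n n) *ᵥ w) =
      v ⬝ᵥ (h *ᵥ w) + (v ⬝ᵥ n) * (n ⬝ᵥ w) := fun v w => by
    rw [add_mulVec, dotProduct_add, vecMulVec_mulVec, dotProduct_smul]; simp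
  have hn' : ∀ w, n ⬝ᵥ (h *ᵥ w) = 0 := fun w => by
    rw [dotProduct_mulVec, ← mulVec_transpose, hs.eq, hn, zero_dotProduct]
  have hF' : ∀ a, n ⬝ᵥ F a = 0 := fun a => by rw [dotProduct_comm, hF]
  have key : frameMatrix F n * (h + vecMulVec n n) * (frameMatrix F n)ᵀ =
      !![gram h F 0 0, gram h F 0 1, 0; gram h F 1 0, gram h F 1 1, 0; 0, 0, 1] := by
    have e : ∀ i j, (frameMatrix F n * (h + vecMulVec n n) * (frameMatrix F n)ᵀ) i j =
        (frameMatrix F n i) ⬝ᵥ ((h + vecMulVec n n) *ᵥ frameMatrix F n j) := fun i j => by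
      rw [Matrix.mul_assoc, Matrix.mul_apply]; rfl
    ext i j
    rw [e, hM]
    have r0 : frameMatrix F n 0 = F 0 := rfl
    have r1 : frameMatrix F n 1 = F 1 := rfl
    have r2 : frameMatrix F n 2 = n := rfl
    fin_cases i <;> fin_cases j <;> simp [r0, r1, r2, gram, hn, hu, hn', hF, hF']
  have := congrArg Matrix.det key
  rw [det_mul, det_mul, hd, det_transpose] at this
  rw [mul_one] at this
  rw [sq, this]
  simp [det_fin_three, det_fin_two]

lemma sum_gram_inv (hn : h *ᵥ n = 0) (hu : n ⬝ᵥ n = 1) (hs : h.IsSymm)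
    (hd : (h + vecMulVec n n).det = 1) (hF : ∀ a, F a ⬝ᵥ n = 0)
    (hE : (frameMatrix F n).det ≠ 0) (i j : Fin 3) :
    ∑ a, ∑ b, (gram h F)⁻¹ a b * (F a i * F b j) = pinv h n i j := by
  set M := h + vecMulVec n n with hMdef
  have hF' : ∀ a, n ⬝ᵥ F a = 0 := fun a => by rw [dotProduct_comm, hF]
  have hS : (gram h F)⁻¹ * gram h F = 1 := by
    apply nonsing_inv_mul
    rw [det_gram hn hu hs hd hF]
    exact (isUnit_iff_ne_zero.2 hE).pow 2
  set K : Matrix (Fin 3) (Fin 3) ℝ :=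
    ∑ a, ∑ b, (gram h F)⁻¹ a b • vecMulVec (F a) (F b) + vecMulVec n n with hK
  have hMF : ∀ c, M *ᵥ F c = h *ᵥ F c := fun c => by
    rw [hMdef, add_mulVec, vecMulVec_mulVec, hF']; simp
  have hn' : ∀ w, n ⬝ᵥ (h *ᵥ w) = 0 := fun w => by
    rw [dotProduct_mulVec, ← mulVec_transpose, hs.eq, hn, zero_dotProduct]
  have hKv : ∀ v, K *ᵥ v = ∑ a, ∑ b, ((gram h F)⁻¹ a b * (F b ⬝ᵥ v)) • F a + (n ⬝ᵥ v) • n := by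
    intro v
    simp only [hK, add_mulVec, sum_mulVec, smul_mulVec, vecMulVec_mulVec, smul_smul, op_smul_eq_smul]
  have h1 : ∀ c, K *ᵥ (M *ᵥ F c) = F c := fun c => by
    rw [hMF, hKv, hn']
    have : ∀ a, ∑ b, (gram h F)⁻¹ a b * (F b ⬝ᵥ (h *ᵥ F c)) = (1 : Matrix (Fin 2) (Fin 2) ℝ) a c :=
      fun a => by rw [← hS, Matrix.mul_apply]; rfl
    simp only [← Finset.sum_smul, this]
    fin_cases c <;> simp [Matrix.one_apply]
  have h2 : K *ᵥ (M *ᵥ n) = n := by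
    rw [hMdef, add_vecMulVec_mulVec hn hu, hKv, hu]
    simp [hF]
  have h3 : K * M * (frameMatrix F n)ᵀ = (frameMatrix F n)ᵀ := by
    ext i j
    have : (K * M * (frameMatrix F n)ᵀ) i j = ((K * M) *ᵥ (frameMatrix F n j)) i := rfl
    rw [this, ← mulVec_mulVec]
    fin_cases j
    · exact congrFun (h1 0) i
    · exact congrFun (h1 1) i
    · exact congrFun h2 i
  have h4 : K * M = 1 := by
    have hu : IsUnit (frameMatrix F n)ᵀ.det := by
      rw [det_transpose]; exact isUnit_iff_ne_zero.2 hE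
    calc K * M = K * M * (frameMatrix F n)ᵀ * ((frameMatrix F n)ᵀ)⁻¹ := by
          rw [Matrix.mul_assoc _ (frameMatrix F n)ᵀ, mul_nonsing_inv _ hu, Matrix.mul_one]
      _ = 1 := by rw [h3, mul_nonsing_inv _ hu]
  have h5 : K = M.adjugate := by
    calc K = K * (M * M.adjugate) := by rw [mul_adjugate, hd]; simp
      _ = M.adjugate := by rw [← Matrix.mul_assoc, h4, Matrix.one_mul]
  rw [pinv, ← hMdef, ← h5, hK]
  simp [vecMulVec_apply, Fin.sum_univ_two]

end LinearAlgebra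

/-- Jacobi's formula in dimension three. -/
lemma fderiv_det_three {E : Type*} [NormedAddCommGroup E] [NormedSpace ℝ E]
    {A : E → Matrix (Fin 3) (Fin 3) ℝ} {x : E}
    (hA : ∀ i j, DifferentiableAt ℝ (fun z => A z i j) x) (v : E) :
    fderiv ℝ (fun z => (A z).det) x v =
      ∑ i, ∑ j, (A x).adjugate j i * fderiv ℝ (fun z => A z i j) x v := by
  have hm : ∀ i j k l p q, HasFDerivAt (fun z => A z i j * A z k l * A z p q) _ x :=
    fun i j k l p q => ((hA i j).hasFDerivAt.fun_mul (hA k l).hasFDerivAt).fun_mul (hA p q).hasFDerivAt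
  have : (fun z => (A z).det) = fun z => A z 0 0 * A z 1 1 * A z 2 2 - A z 0 0 * A z 1 2 * A z 2 1
      - A z 0 1 * A z 1 0 * A z 2 2 + A z 0 1 * A z 1 2 * A z 2 0 + A z 0 2 * A z 1 0 * A z 2 1
      - A z 0 2 * A z 1 1 * A z 2 0 := by
    ext z; rw [det_fin_three]
  rw [this, ((((((hm 0 0 1 1 2 2).fun_sub (hm 0 0 1 2 2 1)).fun_sub (hm 0 1 1 0 2 2)).fun_add
    (hm 0 1 1 2 2 0)).fun_add (hm 0 2 1 0 2 1)).fun_sub (hm 0 2 1 1 2 0)).fderiv, adjugate_fin_three]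
  simp [Fin.sum_univ_three]
  ring

/-! ### Coordinates and the exterior region -/

@[simp] lemma pt_zero (w : ℝ) (y : E3) : pt w y 0 = w := rfl

@[simp] lemma pt_succ (w : ℝ) (y : E3) (i : Fin 3) : pt w y i.succ = y i := rfl

@[simp] lemma spatial_apply (x : R4) (i : Fin 3) : spatial x i = x i.succ := rfl

@[simp] lemma spatial_pt (w : ℝ) (y : E3) : spatial (pt w y) = y := rfl

/-- `spatial` as a continuous linear map. -/
def spatialL : R4 →L[ℝ] E3 :=
  LinearMap.toContinuousLinearMap
    { toFun := spatial, map_add' := fun _ _ => rfl, map_smul' := fun _ _ => rfl }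

/-- `pt 0` as a continuous linear map. -/
def ptL : E3 →L[ℝ] R4 :=
  LinearMap.toContinuousLinearMap
    { toFun := pt 0
      map_add' := fun _ _ => by ext i; refine Fin.cases (by simp) (fun _ => by simp) i
      map_smul' := fun _ _ => by ext i; refine Fin.cases (by simp) (fun _ => by simp) i }

lemma pt_eq (w : ℝ) (y : E3) : pt w y = ptL y + Pi.single 0 w := by
  ext i; refine Fin.cases ?_ (fun j => ?_) i
  · change w = pt 0 y 0 + _; simp
  · change y j = pt 0 y j.succ + _; simp [pt_succ]

lemma contDiff_spatial : ContDiff ℝ ∞ spatial := spatialL.contDiff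

lemma contDiff_pt (w : ℝ) : ContDiff ℝ ∞ (pt w) := by
  have : pt w = fun y => ptL y + Pi.single 0 w := funext (pt_eq w)
  rw [this]; exact ptL.contDiff.add contDiff_const

lemma hasFDerivAt_pt (w : ℝ) (y : E3) : HasFDerivAt (pt w) ptL y := by
  have : pt w = fun y => ptL y + Pi.single 0 w := funext (pt_eq w)
  rw [this]; exact ptL.hasFDerivAt.add_const _

lemma fderiv_comp_spatial {f : E3 → ℝ} {x : R4} (hf : DifferentiableAt ℝ f (spatial x)) (z : R4) :
    fderiv ℝ (fun x => f (spatial x)) x z = ∑ j, z j.succ * pd j f (spatial x) := by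
  have := HasFDerivAt.comp x (f := spatialL) hf.hasFDerivAt (spatialL.hasFDerivAt (x := x))
  rw [show (fun x => f (spatial x)) = f ∘ spatialL from rfl, this.fderiv]
  exact fderiv_eq_sum_pd f (spatial x) (spatial z)

/-- Derivatives along a slice of constant `w`. -/
lemma pd_comp_pt {f : R4 → ℝ} {w : ℝ} {y : E3} (hf : DifferentiableAt ℝ f (pt w y)) (j : Fin 3) :
    pd j (fun y => f (pt w y)) y = fderiv ℝ f (pt w y) (Pi.single j.succ 1) := by
  have := hf.hasFDerivAt.comp y (hasFDerivAt_pt w y)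
  rw [pd, show (fun y => f (pt w y)) = f ∘ pt w from rfl, this.fderiv]
  have e : ptL (EuclideanSpace.single j 1) = Pi.single j.succ 1 := by
    ext i; refine Fin.cases ?_ (fun k => ?_) i
    · change (0:ℝ) = _; simp [Fin.succ_ne_zero]
    · change (EuclideanSpace.single j (1:ℝ)) k = _; simp [Pi.single_apply]
  simp [e]

lemma fderiv_pt_tangent {f : R4 → ℝ} {w : ℝ} {y : E3} (hf : DifferentiableAt ℝ f (pt w y))
    (v : E3) : fderiv ℝ f (pt w y) (pt 0 v) = ∑ j, v j * pd j (fun y => f (pt w y)) y := by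
  have := hf.hasFDerivAt.comp y (hasFDerivAt_pt w y)
  rw [← fderiv_eq_sum_pd, show (fun y => f (pt w y)) = f ∘ pt w from rfl, this.fderiv]
  rfl

lemma isOpen_exteriorRegion (c ε R₀ : ℝ) : IsOpen (exteriorRegion c ε R₀) := by
  have h2 : Continuous fun x : R4 => ‖spatial x‖ := contDiff_spatial.continuous.norm
  have h1 : Continuous fun x : R4 => |x 0 - c| := by fun_prop
  exact (isOpen_lt h1 continuous_const).inter (isOpen_lt continuous_const h2)

namespace Exterior

variable (N : Exterior)

/-- The coordinate region on which the metric is defined. -/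
def region : Set R4 := exteriorRegion N.c N.ε N.R₀

variable {N}

lemma region_mem_nhds {x : R4} (hx : x ∈ N.region) : N.region ∈ 𝓝 x :=
  (isOpen_exteriorRegion _ _ _).mem_nhds hx

lemma pt_mem_region {y : E3} (hy : N.R₀ < ‖y‖) : pt N.c y ∈ N.region := by
  refine ⟨?_, ?_⟩
  · simpa using N.ε_pos
  · simpa using hy

lemma spatial_ne_zero {x : R4} (hx : x ∈ N.region) : spatial x ≠ 0 := by
  rw [← norm_pos_iff]; exact N.R₀_pos.trans hx.2

lemma contDiffAt_U {x : R4} (hx : x ∈ N.region) : ContDiffAt ℝ ∞ N.U x :=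
  N.smooth_U.contDiffAt (region_mem_nhds hx)

lemma contDiffAt_V {x : R4} (hx : x ∈ N.region) : ContDiffAt ℝ ∞ N.V x :=
  N.smooth_V.contDiffAt (region_mem_nhds hx)

lemma contDiffAt_W {x : R4} (hx : x ∈ N.region) (i : Fin 3) :
    ContDiffAt ℝ ∞ (fun x => N.W x i) x :=
  (N.smooth_W i).contDiffAt (region_mem_nhds hx)

lemma contDiffAt_h {x : R4} (hx : x ∈ N.region) (i j : Fin 3) :
    ContDiffAt ℝ ∞ (fun x => N.h x i j) x :=
  (N.smooth_h i j).contDiffAt (region_mem_nhds hx)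

/-- The unit normal of the spheres as a function of the spacetime point. -/
def normal (x : R4) : Fin 3 → ℝ := fun i => nrm i (spatial x)

lemma contDiffAt_normal {x : R4} (hx : x ∈ N.region) (i : Fin 3) :
    ContDiffAt ℝ ∞ (fun x => normal x i) x :=
  (contDiffAt_nrm (spatial_ne_zero hx) i).comp x contDiff_spatial.contDiffAt

lemma normal_eq (x : R4) (i : Fin 3) : normal x i = x i.succ / ‖spatial x‖ := rfl

lemma norm_smul_normal {x : R4} (hx : x ∈ N.region) (i : Fin 3) :
    x i.succ = ‖spatial x‖ * normal x i := (norm_mul_nrm (spatial_ne_zero hx) i).symm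

lemma norm_smul_normal' {x : R4} (hx : x ∈ N.region) :
    (fun i : Fin 3 => x i.succ) = ‖spatial x‖ • normal x :=
  funext fun i => norm_smul_normal hx i

lemma norm_spatial_ne {x : R4} (hx : x ∈ N.region) : ‖spatial x‖ ≠ 0 :=
  norm_ne_zero_iff.2 (spatial_ne_zero hx)

lemma normal_dot_self {x : R4} (hx : x ∈ N.region) : normal x ⬝ᵥ normal x = 1 :=
  sum_nrm_sq (spatial_ne_zero hx)

lemma h_mulVec_normal {x : R4} (hx : x ∈ N.region) : N.h x *ᵥ normal x = 0 := by
  have := N.h_radial x hx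
  rw [norm_smul_normal' hx, mulVec_smul] at this
  exact (smul_eq_zero.1 this).resolve_left (norm_spatial_ne hx)

lemma W_dot_normal {x : R4} (hx : x ∈ N.region) : N.W x ⬝ᵥ normal x = 0 := by
  have := N.W_tangent x hx
  rw [norm_smul_normal' hx, dotProduct_smul] at this
  exact (smul_eq_zero.1 this).resolve_left (norm_spatial_ne hx)

lemma det_h_add {x : R4} (hx : x ∈ N.region) :
    (N.h x + vecMulVec (normal x) (normal x)).det = 1 := by
  rw [← N.h_det x hx]
  congr 2
  ext i j
  simp [vecMulVec_apply, normal_eq]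
  ring

lemma h_isSymm {x : R4} (hx : x ∈ N.region) : (N.h x).IsSymm := N.h_symm x hx

variable (N) in
/-- The inverse metric of the spheres of radius `r` in Cartesian components. -/
def Q (x : R4) : Matrix (Fin 3) (Fin 3) ℝ := pinv (N.h x) (normal x)

lemma Q_mulVec_normal {x : R4} (hx : x ∈ N.region) : N.Q x *ᵥ normal x = 0 :=
  pinv_mulVec (h_mulVec_normal hx) (normal_dot_self hx) (det_h_add hx)

lemma Q_isSymm {x : R4} (hx : x ∈ N.region) : (N.Q x).IsSymm := pinv_isSymm (h_isSymm hx)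

lemma Q_mul_h {x : R4} (hx : x ∈ N.region) :
    N.Q x * N.h x = 1 - vecMulVec (normal x) (normal x) :=
  pinv_mul (h_mulVec_normal hx) (normal_dot_self hx) (h_isSymm hx) (det_h_add hx)

lemma fderiv_normal_dot {x : R4} (hx : x ∈ N.region) (z : R4) :
    ∑ i, normal x i * fderiv ℝ (fun x => normal x i) x z = 0 := by
  have d := fun i => (contDiffAt_normal hx i).differentiableAt (by simp)
  have h1 : (fun x => ∑ i, normal x i * normal x i) =ᶠ[𝓝 x] fun _ => 1 := by
    filter_upwards [region_mem_nhds hx] with x' hx' using normal_dot_self hx'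
  have h2 := congrArg (fun L : R4 →L[ℝ] ℝ => L z) h1.fderiv_eq
  rw [fderiv_fun_sum (fun i _ => (d i).fun_mul (d i))] at h2
  simp only [fderiv_fun_mul (d _) (d _)] at h2
  simp [Finset.sum_add_distrib] at h2
  linarith

lemma fderiv_h_normal {x : R4} (hx : x ∈ N.region) (z : R4) (i : Fin 3) :
    ∑ j, fderiv ℝ (fun x => N.h x i j) x z * normal x j =
      - ∑ j, N.h x i j * fderiv ℝ (fun x => normal x j) x z := by
  have d := fun i => (contDiffAt_normal hx i).differentiableAt (by simp)
  have d' := fun j => (contDiffAt_h hx i j).differentiableAt (by simp)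
  have h1 : (fun x => ∑ j, N.h x i j * normal x j) =ᶠ[𝓝 x] fun _ => 0 := by
    filter_upwards [region_mem_nhds hx] with x' hx'
    exact congrFun (h_mulVec_normal hx') i
  have h2 := congrArg (fun L : R4 →L[ℝ] ℝ => L z) h1.fderiv_eq
  rw [fderiv_fun_sum (fun j _ => (d' j).fun_mul (d j))] at h2
  simp only [fderiv_fun_mul (d' _) (d _)] at h2
  simp [Finset.sum_add_distrib] at h2
  simp only [mul_comm _ (normal x _)]
  linarith

/-- The area density of the spheres is preserved in all directions. -/
lemma sum_Q_fderiv_h {x : R4} (hx : x ∈ N.region) (z : R4) :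
    ∑ i, ∑ j, N.Q x i j * fderiv ℝ (fun x => N.h x i j) x z = 0 := by
  have d := fun i => (contDiffAt_normal hx i).differentiableAt (by simp)
  have d' := fun i j => (contDiffAt_h hx i j).differentiableAt (by simp)
  have h1 : (fun x => (N.h x + vecMulVec (normal x) (normal x)).det) =ᶠ[𝓝 x] fun _ => 1 := by
    filter_upwards [region_mem_nhds hx] with x' hx' using det_h_add hx'
  have h2 := congrArg (fun L : R4 →L[ℝ] ℝ => L z) h1.fderiv_eq
  have dA : ∀ i j, DifferentiableAt ℝ
      (fun x => (N.h x + vecMulVec (normal x) (normal x)) i j) x := fun i j =>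
    (d' i j).fun_add ((d i).fun_mul (d j))
  rw [fderiv_det_three dA] at h2
  have e : ∀ i j, fderiv ℝ (fun x => (N.h x + vecMulVec (normal x) (normal x)) i j) x z =
      fderiv ℝ (fun x => N.h x i j) x z + (normal x i * fderiv ℝ (fun x => normal x j) x z +
        normal x j * fderiv ℝ (fun x => normal x i) x z) := fun i j => by
    have : (fun x => (N.h x + vecMulVec (normal x) (normal x)) i j) =
        fun x => N.h x i j + normal x i * normal x j := rfl
    rw [this, fderiv_fun_add (d' i j) ((d i).fun_mul (d j)), fderiv_fun_mul (d i) (d j)]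
    simp
  have ha := fun i => congrFun
    (adjugate_mulVec_self (h_mulVec_normal hx) (normal_dot_self hx) (det_h_add hx)) i
  have hsym : ((N.h x + vecMulVec (normal x) (normal x)).adjugate).IsSymm := by
    rw [IsSymm, adjugate_transpose, transpose_add, (h_isSymm hx).eq, transpose_vecMulVec]
  have hn := fderiv_normal_dot hx z
  have hh := fun i => fderiv_h_normal hx z i
  have hk := fun i => congrFun (h_mulVec_normal hx) i
  have hs := fun i j => (h_isSymm hx).apply i j
  simp only [e] at h2
  set A := (N.h x + vecMulVec (normal x) (normal x)).adjugate with hA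
  have hAs := fun i j => hsym.apply i j
  simp only [mulVec, dotProduct] at ha hk
  have hq : ∀ i j, N.Q x i j = A i j - normal x i * normal x j := fun i j => rfl
  simp only [hq, sub_mul, Finset.sum_sub_distrib]
  have t1 : ∑ i, ∑ j, A j i * (normal x i * fderiv ℝ (fun x => normal x j) x z) = 0 := by
    rw [Finset.sum_comm, ← hn]
    refine Finset.sum_congr rfl fun j _ => ?_
    rw [← ha j, Finset.sum_mul]; exact Finset.sum_congr rfl fun i _ => by ring
  have t2 : ∑ i, ∑ j, A j i * (normal x j * fderiv ℝ (fun x => normal x i) x z) = 0 := by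
    rw [← hn]
    refine Finset.sum_congr rfl fun j _ => ?_
    rw [← ha j, Finset.sum_mul]; exact Finset.sum_congr rfl fun i _ => by rw [hAs]; ring
  have t3 : ∑ i, ∑ j, normal x i * normal x j * fderiv ℝ (fun x => N.h x i j) x z = 0 := by
    have : ∀ i, ∑ j, normal x i * normal x j * fderiv ℝ (fun x => N.h x i j) x z =
        normal x i * ∑ j, fderiv ℝ (fun x => N.h x i j) x z * normal x j := fun i => by
      rw [Finset.mul_sum]; exact Finset.sum_congr rfl fun j _ => by ring
    simp only [this, hh, mul_neg, Finset.sum_neg_distrib, Finset.mul_sum]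
    rw [Finset.sum_comm, neg_eq_zero]
    refine Finset.sum_eq_zero fun j _ => ?_
    have : ∑ i, normal x i * (N.h x i j * fderiv ℝ (fun x => normal x j) x z) =
        (∑ i, N.h x j i * normal x i) * fderiv ℝ (fun x => normal x j) x z := by
      rw [Finset.sum_mul]; exact Finset.sum_congr rfl fun i _ => by rw [hs j i]; ring
    rw [this, hk]; simp
  rw [t3, sub_zero]
  have t4 : ∑ i, ∑ j, A j i * (fderiv ℝ (fun x => N.h x i j) x z +
      (normal x i * fderiv ℝ (fun x => normal x j) x z +
        normal x j * fderiv ℝ (fun x => normal x i) x z)) =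
      ∑ i, ∑ j, A j i * fderiv ℝ (fun x => N.h x i j) x z +
      (∑ i, ∑ j, A j i * (normal x i * fderiv ℝ (fun x => normal x j) x z) +
      ∑ i, ∑ j, A j i * (normal x j * fderiv ℝ (fun x => normal x i) x z)) := by
    simp only [mul_add, Finset.sum_add_distrib]
  rw [t4, t1, t2] at h2
  rw [add_zero, add_zero] at h2
  refine Eq.trans ?_ (h2.trans (by simp))
  exact Finset.sum_congr rfl fun i _ => Finset.sum_congr rfl fun j _ => by rw [hAs]

end Exterior


/-! ### Surfaces in a Lorentzian spacetime -/

section General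

variable {g : R4 → Matrix (Fin 4) (Fin 4) ℝ} {x : R4}

lemma ip_eq_sum (v w : R4) : ip g x v w = ∑ κ, ∑ ν, v κ * w ν * g x κ ν := by
  simp only [ip, dotProduct, mulVec, Finset.mul_sum]
  exact Finset.sum_congr rfl fun _ _ => Finset.sum_congr rfl fun _ _ => by ring

lemma ip_add_left (v v' w : R4) : ip g x (v + v') w = ip g x v w + ip g x v' w := by
  simp [ip, add_dotProduct]

lemma ip_add_right (v w w' : R4) : ip g x v (w + w') = ip g x v w + ip g x v w' := by
  simp [ip, mulVec_add]

lemma ip_sub_left (v v' w : R4) : ip g x (v - v') w = ip g x v w - ip g x v' w := by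
  simp [ip, sub_dotProduct]

lemma ip_smul_left (c : ℝ) (v w : R4) : ip g x (c • v) w = c * ip g x v w := by
  simp [ip, smul_dotProduct]

lemma ip_smul_right (c : ℝ) (v w : R4) : ip g x v (c • w) = c * ip g x v w := by
  simp [ip, mulVec_smul, dotProduct_smul]

lemma ip_sum_left {ι : Type*} (s : Finset ι) (v : ι → R4) (w : R4) :
    ip g x (∑ i ∈ s, v i) w = ∑ i ∈ s, ip g x (v i) w := by
  simp [ip, sum_dotProduct]

@[simp] lemma ip_zero_left (w : R4) : ip g x 0 w = 0 := by simp [ip]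

@[simp] lemma ip_zero_right (w : R4) : ip g x w 0 = 0 := by simp [ip]

lemma ip_comm (hs : (g x).IsSymm) (v w : R4) : ip g x v w = ip g x w v := by
  rw [ip, dotProduct_mulVec, ← mulVec_transpose, hs.eq, dotProduct_comm]; rfl

/-- The derivative `(D_z g)(v, w)` of the metric coefficients. -/
def ipDeriv (g : R4 → Matrix (Fin 4) (Fin 4) ℝ) (x z v w : R4) : ℝ :=
  ∑ κ, ∑ ν, v κ * w ν * fderiv ℝ (fun x => g x κ ν) x z

/-- The componentwise derivative of a vector field. -/
def vecDeriv (A : R4 → R4) (x z : R4) : R4 := fun l => fderiv ℝ (fun x => A x l) x z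

lemma fderiv_ip (hg : ∀ κ ν, DifferentiableAt ℝ (fun x => g x κ ν) x) {A B : R4 → R4}
    (hA : ∀ κ, DifferentiableAt ℝ (fun x => A x κ) x)
    (hB : ∀ κ, DifferentiableAt ℝ (fun x => B x κ) x) (z : R4) :
    fderiv ℝ (fun x => ip g x (A x) (B x)) x z = ipDeriv g x z (A x) (B x) +
      ip g x (vecDeriv A x z) (B x) + ip g x (A x) (vecDeriv B x z) := by
  have h1 : ∀ κ ν, DifferentiableAt ℝ (fun x => A x κ * B x ν * g x κ ν) x := fun κ ν =>
    ((hA κ).fun_mul (hB ν)).fun_mul (hg κ ν)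
  simp only [ip_eq_sum]
  rw [fderiv_fun_sum fun κ _ => DifferentiableAt.fun_sum fun ν _ => h1 κ ν]
  simp only [fderiv_fun_sum fun ν _ => h1 _ ν,
    fderiv_fun_mul ((hA _).fun_mul (hB _)) (hg _ _), fderiv_fun_mul (hA _) (hB _)]
  simp only [ipDeriv, vecDeriv, _root_.sum_apply, _root_.add_apply,
    _root_.smul_apply, smul_eq_mul, ← Finset.sum_add_distrib]
  exact Finset.sum_congr rfl fun _ _ => Finset.sum_congr rfl fun _ _ => by ring

lemma ipDeriv_comm (hs : ∀ᶠ x' in 𝓝 x, (g x').IsSymm) (z v w : R4) :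
    ipDeriv g x z v w = ipDeriv g x z w v := by
  have : ∀ κ ν, fderiv ℝ (fun x => g x κ ν) x = fderiv ℝ (fun x => g x ν κ) x := fun κ ν => by
    apply Filter.EventuallyEq.fderiv_eq
    filter_upwards [hs] with x' hx' using hx'.apply ν κ
  rw [ipDeriv, Finset.sum_comm]
  exact Finset.sum_congr rfl fun κ _ => Finset.sum_congr rfl fun ν _ => by rw [this ν κ]; ring

lemma fderiv_eq_sum_single (f : R4 → ℝ) (x z : R4) :
    fderiv ℝ f x z = ∑ μ, z μ * fderiv ℝ f x (Pi.single μ 1) := by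
  have : z = ∑ μ, z μ • (Pi.single μ (1 : ℝ) : R4) := by
    ext l; simp [Finset.sum_apply, Pi.single_apply]
  conv_lhs => rw [this]
  simp [map_sum]

/-- Lowering the upper index of the Christoffel symbols. -/
lemma ip_christoffel (hdet : (g x).det ≠ 0) (y v w : R4) :
    ip g x y (fun l => ∑ μ, ∑ ν, christoffel g x l μ ν * v μ * w ν) =
      (1 / 2) * (ipDeriv g x v y w + ipDeriv g x w y v - ipDeriv g x y v w) := by
  set c : R4 := fun κ => ∑ μ, ∑ ν, (fderiv ℝ (fun z => g z κ ν) x (Pi.single μ 1)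
      + fderiv ℝ (fun z => g z κ μ) x (Pi.single ν 1)
      - fderiv ℝ (fun z => g z μ ν) x (Pi.single κ 1)) * v μ * w ν with hc
  have h1 : (fun l => ∑ μ, ∑ ν, christoffel g x l μ ν * v μ * w ν) =
      (1 / 2 : ℝ) • ((g x)⁻¹ *ᵥ c) := by
    ext l
    simp only [christoffel, hc, Pi.smul_apply, mulVec, dotProduct, smul_eq_mul, Finset.mul_sum,
      Finset.sum_mul]
    rw [Finset.sum_comm' (t' := Finset.univ) (s' := fun _ => Finset.univ) (by simp)]
    conv_rhs => rw [Finset.sum_comm]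
    conv_lhs => rw [Finset.sum_comm]
    refine Finset.sum_congr rfl fun μ _ => ?_
    conv_rhs => rw [Finset.sum_comm]
    refine Finset.sum_congr rfl fun ν _ => ?_
    refine Finset.sum_congr rfl fun κ _ => ?_
    ring
  have h2 : ip g x y ((g x)⁻¹ *ᵥ c) = y ⬝ᵥ c := by
    rw [ip, mulVec_mulVec, mul_nonsing_inv _ (isUnit_iff_ne_zero.2 hdet), one_mulVec]
  rw [h1, ip_smul_right, h2]
  congr 1
  simp only [ipDeriv, fderiv_eq_sum_single _ x v, fderiv_eq_sum_single _ x w,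
    fderiv_eq_sum_single _ x y, dotProduct, hc, Finset.mul_sum]
  have e1 : ∑ κ, ∑ ν, ∑ μ, y κ * w ν * (v μ * fderiv ℝ (fun x => g x κ ν) x (Pi.single μ 1)) =
      ∑ κ, ∑ μ, ∑ ν, y κ * (fderiv ℝ (fun x => g x κ ν) x (Pi.single μ 1) * v μ * w ν) := by
    refine Finset.sum_congr rfl fun κ _ => ?_
    rw [Finset.sum_comm]
    exact Finset.sum_congr rfl fun _ _ => Finset.sum_congr rfl fun _ _ => by ring
  have e2 : ∑ κ, ∑ ν, ∑ μ, y κ * v ν * (w μ * fderiv ℝ (fun x => g x κ ν) x (Pi.single μ 1)) =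
      ∑ κ, ∑ μ, ∑ ν, y κ * (fderiv ℝ (fun x => g x κ μ) x (Pi.single ν 1) * v μ * w ν) :=
    Finset.sum_congr rfl fun _ _ => Finset.sum_congr rfl fun _ _ =>
      Finset.sum_congr rfl fun _ _ => by ring
  have e3 : ∑ μ, ∑ ν, ∑ κ, v μ * w ν * (y κ * fderiv ℝ (fun x => g x μ ν) x (Pi.single κ 1)) =
      ∑ κ, ∑ μ, ∑ ν, y κ * (fderiv ℝ (fun x => g x μ ν) x (Pi.single κ 1) * v μ * w ν) := by
    conv_rhs => rw [Finset.sum_comm]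
    refine Finset.sum_congr rfl fun μ _ => ?_
    rw [Finset.sum_comm]
    exact Finset.sum_congr rfl fun _ _ => Finset.sum_congr rfl fun _ _ => by ring
  rw [e1, e2, e3]
  simp only [← Finset.sum_add_distrib, ← Finset.sum_sub_distrib]
  exact Finset.sum_congr rfl fun _ _ => Finset.sum_congr rfl fun _ _ =>
      Finset.sum_congr rfl fun _ _ => by ring

variable {F Z : ℝ × ℝ → R4} {u : ℝ × ℝ} {a b : Fin 2}

lemma ip_covDeriv (hdet : (g (F u)).det ≠ 0) (y : R4) :
    ip g (F u) y (covDeriv g F Z a u) = ip g (F u) y (fun l => ud a (fun z => Z z l) u) +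
      (1 / 2) * (ipDeriv g (F u) (tangent F a u) y (Z u) + ipDeriv g (F u) (Z u) y (tangent F a u)
        - ipDeriv g (F u) y (tangent F a u) (Z u)) := by
  rw [← ip_christoffel hdet, ← ip_add_right]; rfl

/-- `⟨y, ∇_v K⟩` for a vector field `K` on the spacetime. -/
def ipNabla (g : R4 → Matrix (Fin 4) (Fin 4) ℝ) (x y v : R4) (K : R4 → R4) : ℝ :=
  ip g x y (vecDeriv K x v) +
    (1 / 2) * (ipDeriv g x v y (K x) + ipDeriv g x (K x) y v - ipDeriv g x y v (K x))

lemma ud_comp_surface {f : R4 → ℝ} (hf : DifferentiableAt ℝ f (F u))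
    (hF : DifferentiableAt ℝ F u) : ud a (fun z => f (F z)) u = fderiv ℝ f (F u) (tangent F a u) := by
  have := hf.hasFDerivAt.comp u hF.hasFDerivAt
  rw [ud, show (fun z => f (F z)) = f ∘ F from rfl, this.fderiv]; rfl

lemma ip_covDeriv_comp (hdet : (g (F u)).det ≠ 0) {K : R4 → R4}
    (hK : ∀ κ, DifferentiableAt ℝ (fun x => K x κ) (F u)) (hF : DifferentiableAt ℝ F u) (y : R4) :
    ip g (F u) y (covDeriv g F (fun z => K (F z)) a u) =
      ipNabla g (F u) y (tangent F a u) K := by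
  rw [ip_covDeriv hdet, ipNabla]
  congr 2
  ext l
  exact ud_comp_surface (hK l) hF

/-- Metric compatibility. -/
lemma fderiv_ip_eq_ipNabla (hs : ∀ᶠ x' in 𝓝 x, (g x').IsSymm)
    (hg : ∀ κ ν, DifferentiableAt ℝ (fun x => g x κ ν) x) {A B : R4 → R4}
    (hA : ∀ κ, DifferentiableAt ℝ (fun x => A x κ) x)
    (hB : ∀ κ, DifferentiableAt ℝ (fun x => B x κ) x) (z : R4) :
    fderiv ℝ (fun x => ip g x (A x) (B x)) x z =
      ipNabla g x (A x) z B + ipNabla g x (B x) z A := by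
  rw [fderiv_ip hg hA hB, ipNabla, ipNabla, ip_comm hs.self_of_nhds (B x),
    ipDeriv_comm hs z (B x), ipDeriv_comm hs (A x) (B x), ipDeriv_comm hs (B x) (A x)]
  ring

lemma covDeriv_smul {A : ℝ × ℝ → ℝ} (hA : DifferentiableAt ℝ A u)
    (hZ : ∀ l, DifferentiableAt ℝ (fun z => Z z l) u) :
    covDeriv g F (fun z => A z • Z z) a u = ud a A u • Z u + A u • covDeriv g F Z a u := by
  ext l
  simp only [covDeriv, Pi.smul_apply, Pi.add_apply, smul_eq_mul]
  have := ud_mul hA (hZ l) a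
  rw [ud] at this
  rw [this, mul_add, Finset.mul_sum, ← add_assoc]
  congr 1
  refine Finset.sum_congr rfl fun μ _ => ?_
  rw [Finset.mul_sum]
  exact Finset.sum_congr rfl fun ν _ => by ring

lemma covDeriv_congr {Z' : ℝ × ℝ → R4} (h : Z =ᶠ[𝓝 u] Z') :
    covDeriv g F Z a u = covDeriv g F Z' a u := by
  ext l
  have : (fun z => Z z l) =ᶠ[𝓝 u] fun z => Z' z l := by
    filter_upwards [h] with z hz; rw [hz]
  simp only [covDeriv, h.self_of_nhds, this.fderiv_eq]

lemma inducedMetric_isSymm (hs : (g (F u)).IsSymm) : (inducedMetric g F u).IsSymm := by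
  ext a b; simp [inducedMetric, ip_comm hs]

lemma normalPart_add (Y Y' : R4) :
    normalPart g F u (Y + Y') = normalPart g F u Y + normalPart g F u Y' := by
  simp only [normalPart, ip_add_left, mul_add, add_smul, Finset.sum_add_distrib]
  abel

lemma normalPart_smul (c : ℝ) (Y : R4) : normalPart g F u (c • Y) = c • normalPart g F u Y := by
  simp only [normalPart, ip_smul_left, smul_sub, Finset.smul_sum, smul_smul]
  congr 1
  exact Finset.sum_congr rfl fun _ _ => Finset.sum_congr rfl fun _ _ => by congr 1; ring

lemma normalPart_zero : normalPart g F u 0 = 0 := by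
  simp [normalPart]

lemma normalPart_sum {ι : Type*} (s : Finset ι) (Y : ι → R4) :
    normalPart g F u (∑ i ∈ s, Y i) = ∑ i ∈ s, normalPart g F u (Y i) := by
  classical
  induction s using Finset.induction_on with
  | empty => simp [normalPart_zero]
  | insert i s hi ih => rw [Finset.sum_insert hi, Finset.sum_insert hi, normalPart_add, ih]

lemma normalPart_of_orthogonal {Y : R4} (h : ∀ a, ip g (F u) Y (tangent F a u) = 0) :
    normalPart g F u Y = Y := by
  simp [normalPart, h]

lemma normalPart_tangent (hs : (g (F u)).IsSymm) (hσ : (inducedMetric g F u).det ≠ 0) (c : Fin 2) :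
    normalPart g F u (tangent F c u) = 0 := by
  have h1 := nonsing_inv_mul _ (isUnit_iff_ne_zero.2 hσ)
  have h2 : ∀ b, ∑ a, (inducedMetric g F u)⁻¹ a b * ip g (F u) (tangent F c u) (tangent F a u) =
      (1 : Matrix (Fin 2) (Fin 2) ℝ) b c := fun b => by
    rw [← h1, Matrix.mul_apply]
    refine Finset.sum_congr rfl fun a _ => ?_
    rw [ip_comm hs]
    have := (inducedMetric_isSymm (F := F) hs).inv.apply b a
    rw [this]; rfl
  rw [normalPart, Finset.sum_comm]
  simp only [← Finset.sum_smul, h2]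
  fin_cases c <;> simp [Matrix.one_apply]

lemma ip_normalPart_tangent (hσ : (inducedMetric g F u).det ≠ 0)
    (Y : R4) (c : Fin 2) : ip g (F u) (normalPart g F u Y) (tangent F c u) = 0 := by
  have h1 := nonsing_inv_mul _ (isUnit_iff_ne_zero.2 hσ)
  have h2 : ∀ a, ∑ b, (inducedMetric g F u)⁻¹ a b * ip g (F u) (tangent F b u) (tangent F c u) =
      (1 : Matrix (Fin 2) (Fin 2) ℝ) a c := fun b => by
    rw [← h1, Matrix.mul_apply]; rfl
  have h3 : ip g (F u) (∑ a, ∑ b, ((inducedMetric g F u)⁻¹ a b * ip g (F u) Y (tangent F a u)) •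
      tangent F b u) (tangent F c u) = ∑ a, ip g (F u) Y (tangent F a u) *
      ∑ b, (inducedMetric g F u)⁻¹ a b * ip g (F u) (tangent F b u) (tangent F c u) := by
    simp only [ip_sum_left, ip_smul_left, Finset.mul_sum]
    exact Finset.sum_congr rfl fun _ _ => Finset.sum_congr rfl fun _ _ => by ring
  rw [normalPart, ip_sub_left, h3]
  simp only [h2]
  fin_cases c <;> simp [Matrix.one_apply]

lemma ip_normalPart_of_orthogonal {K : R4} (hK : ∀ a, ip g (F u) (tangent F a u) K = 0) (Y : R4) :
    ip g (F u) (normalPart g F u Y) K = ip g (F u) Y K := by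
  simp [normalPart, ip_sub_left, ip_add_left, ip_smul_left, hK]

lemma ip_meanCurv_tangent (hσ : (inducedMetric g F u).det ≠ 0)
    (c : Fin 2) : ip g (F u) (meanCurv g F u) (tangent F c u) = 0 := by
  simp [meanCurv, ip_add_left, ip_smul_left, ip_normalPart_tangent hσ]

lemma ip_meanCurv_of_orthogonal {K : R4} (hK : ∀ a, ip g (F u) (tangent F a u) K = 0) :
    ip g (F u) (meanCurv g F u) K =
      ∑ a, ∑ b, (inducedMetric g F u)⁻¹ a b * ip g (F u) (covDeriv g F (tangent F b) a u) K := by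
  simp [meanCurv, ip_add_left, ip_smul_left, ip_normalPart_of_orthogonal hK]

/-- The future dual of a spacelike mean curvature vector is unique. -/
lemma IsFutureDual.unique {K : R4 → R4} {J J' : R4} (hs : (g (F u)).IsSymm)
    (hσ : (inducedMetric g F u).det ≠ 0)
    (hH : 0 < ip g (F u) (meanCurv g F u) (meanCurv g F u))
    (hJ : IsFutureDual g K F u J) (hJ' : IsFutureDual g K F u J') : J' = J := by
  obtain ⟨h1, h2, h3, h4⟩ := hJ
  obtain ⟨h1', h2', h3', h4'⟩ := hJ'
  set q := ip g (F u) (meanCurv g F u) (meanCurv g F u) with hq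
  set B : Matrix (Fin 4) (Fin 4) ℝ := Matrix.of ![tangent F 0 u, tangent F 1 u, meanCurv g F u, J]
    with hB
  have r0 : B 0 = tangent F 0 u := rfl
  have r1 : B 1 = tangent F 1 u := rfl
  have r2 : B 2 = meanCurv g F u := rfl
  have r3 : B 3 = J := rfl
  have hHt := ip_meanCurv_tangent (g := g) (F := F) hσ
  have hHt' : ∀ c, ip g (F u) (tangent F c u) (meanCurv g F u) = 0 := fun c => by
    rw [ip_comm hs, hHt]
  have h1c : ∀ c, ip g (F u) (tangent F c u) J = 0 := fun c => by rw [ip_comm hs, h1]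
  have h2c : ip g (F u) (meanCurv g F u) J = 0 := by rw [ip_comm hs, h2]
  set σ := inducedMetric g F u with hσd
  have s : ∀ a b, ip g (F u) (tangent F a u) (tangent F b u) = σ a b := fun a b => rfl
  have key : B * g (F u) * Bᵀ = !![σ 0 0, σ 0 1, 0, 0; σ 1 0, σ 1 1, 0, 0; 0, 0, q, 0;
      0, 0, 0, -q] := by
    have e : ∀ i j, (B * g (F u) * Bᵀ) i j = ip g (F u) (B i) (B j) := fun i j => by
      rw [Matrix.mul_assoc, Matrix.mul_apply]; rfl
    ext i j
    rw [e]
    fin_cases i <;> fin_cases j <;>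
      simp [r0, r1, r2, r3, s, hHt, hHt', h1, h1c, h2, h2c, h3, ← hq]
  have hdet : (B * g (F u)).det ≠ 0 := by
    intro h0
    have := congrArg Matrix.det key
    rw [det_mul, h0, zero_mul] at this
    have e : (!![σ 0 0, σ 0 1, 0, 0; σ 1 0, σ 1 1, 0, 0; 0, 0, q, 0;
      0, 0, 0, -q] : Matrix (Fin 4) (Fin 4) ℝ).det = - q ^ 2 * σ.det := by
      rw [det_fin_two]
      simp [det_succ_row_zero, Fin.sum_univ_succ, Fin.succAbove]
      ring
    rw [e] at this
    have h5 := mul_ne_zero (neg_ne_zero.2 (pow_ne_zero 2 hH.ne')) hσ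
    exact h5 this.symm
  set D := J' + (ip g (F u) J' J / q) • J with hD
  have hD0 : (B * g (F u)) *ᵥ D = 0 := by
    ext i
    have : ((B * g (F u)) *ᵥ D) i = ip g (F u) (B i) D := by rw [← mulVec_mulVec]; rfl
    rw [this, ip_comm hs, hD, ip_add_left, ip_smul_left]
    fin_cases i
    · simp [r0, h1, h1']
    · simp [r1, h1, h1']
    · simp [r2, h2, h2']
    · simp [r3, h3]; field_simp; ring
  have hDz : D = 0 := eq_zero_of_mulVec_eq_zero hdet hD0
  set c := - (ip g (F u) J' J / q) with hc
  have hJ' : J' = c • J := by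
    rw [hc, neg_smul]; exact eq_neg_of_add_eq_zero_left (hD ▸ hDz)
  rw [hJ', ip_smul_left, ip_smul_right, h3] at h3'
  rw [hJ', ip_smul_left] at h4'
  have hc2 : c ^ 2 = 1 := by
    have : q * (c ^ 2 - 1) = 0 := by linarith
    linarith [(mul_eq_zero.1 this).resolve_left hH.ne']
  have hc0 : 0 < c := by
    by_contra hneg
    nlinarith [mul_nonneg_of_nonpos_of_nonpos (not_lt.1 hneg) h4.le]
  have : c = 1 := by nlinarith
  rw [hJ', this, one_smul]

lemma dualJ_eq {K : R4 → R4} {J : R4} (hs : (g (F u)).IsSymm)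
    (hσ : (inducedMetric g F u).det ≠ 0)
    (hH : 0 < ip g (F u) (meanCurv g F u) (meanCurv g F u))
    (hJ : IsFutureDual g K F u J) : dualJ g K F u = J := by
  have h : ∃ J, IsFutureDual g K F u J := ⟨J, hJ⟩
  rw [dualJ, dif_pos h]
  exact hJ.unique hs hσ hH h.choose_spec

end General


namespace Exterior

variable {N : Exterior} {x : R4}

/-! ### The null frame -/

/-- The value of the one-form `dr`. -/
def rad (x v : R4) : ℝ := ∑ i, normal x i * v i.succ

variable (N) in
/-- The value of the form `h` on the spatial parts of two vectors. -/
def hform (x v w : R4) : ℝ := ∑ i, ∑ j, N.h x i j * (v i.succ * w j.succ)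

variable (N) in
/-- The ingoing null vector field orthogonal to the spheres, normalized by `dw = 1`. -/
def nullIn (x : R4) : R4 := Fin.cons 1 fun i => - N.W x i - N.V x / 2 * normal x i

@[simp] lemma nullIn_zero : N.nullIn x 0 = 1 := rfl

@[simp] lemma nullIn_succ (i : Fin 3) :
    N.nullIn x i.succ = - N.W x i - N.V x / 2 * normal x i := rfl

@[simp] lemma radialDir_zero (x : R4) : radialDir x 0 = 0 := rfl

@[simp] lemma radialDir_succ (x : R4) (i : Fin 3) : radialDir x i.succ = normal x i := by
  simp only [radialDir, pt_succ, normal, nrm, PiLp.smul_apply, smul_eq_mul]; ring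

lemma dotProduct_drForm (x v : R4) : v ⬝ᵥ drForm x = rad x v := by
  rw [dotProduct, Fin.sum_univ_succ, rad]
  simp only [drForm, Fin.cons_zero, Fin.cons_succ, mul_zero, zero_add]
  exact Finset.sum_congr rfl fun i _ => by rw [normal_eq]; ring

lemma dotProduct_shiftForm (W : Fin 3 → ℝ) (i : Fin 3) (v : R4) :
    v ⬝ᵥ shiftForm W i = v i.succ + v 0 * W i := by
  rw [dotProduct, Fin.sum_univ_succ]
  simp only [shiftForm, Fin.cons_zero, Fin.cons_succ]
  simp [add_comm]

lemma ip_metric (v w : R4) : ip N.metric x v w =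
    - (N.U x * N.V x) * (v 0 * w 0) - N.U x * (v 0 * rad x w + rad x v * w 0) +
      ∑ i, ∑ j, N.h x i j * ((v i.succ + v 0 * N.W x i) * (w j.succ + w 0 * N.W x j)) := by
  have e : ∀ a b : R4, v ⬝ᵥ (vecMulVec a b *ᵥ w) = (v ⬝ᵥ a) * (w ⬝ᵥ b) := fun a b => by
    rw [vecMulVec_mulVec, dotProduct_comm b w]; simp [mul_comm]
  have hs : v ⬝ᵥ ((∑ i, ∑ j, N.h x i j • vecMulVec (shiftForm (N.W x) i) (shiftForm (N.W x) j)) *ᵥ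
      w) = ∑ i, ∑ j, N.h x i j * ((v i.succ + v 0 * N.W x i) * (w j.succ + w 0 * N.W x j)) := by
    simp only [sum_mulVec, dotProduct_sum, smul_mulVec, dotProduct_smul, e, dotProduct_shiftForm,
      smul_eq_mul]
  simp only [ip, metric, bondiMetric, add_mulVec, sub_mulVec, dotProduct_add, dotProduct_sub, hs,
    smul_mulVec, dotProduct_smul, e, dotProduct_drForm, dotProduct_single_one, smul_eq_mul]

lemma metric_isSymm (hx : x ∈ N.region) : (N.metric x).IsSymm := by
  have hs := (h_isSymm hx).eq
  simp only [metric, bondiMetric, IsSymm, transpose_add, transpose_sub, transpose_smul,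
    transpose_vecMulVec, transpose_sum]
  congr 1
  · congr 2; rw [add_comm]
  · rw [Finset.sum_comm]
    refine Finset.sum_congr rfl fun i _ => Finset.sum_congr rfl fun j _ => ?_
    rw [← (h_isSymm hx).apply i j]

lemma metric_eventually_isSymm (hx : x ∈ N.region) : ∀ᶠ x' in 𝓝 x, (N.metric x').IsSymm := by
  filter_upwards [region_mem_nhds hx] with x' hx' using metric_isSymm hx'

lemma differentiableAt_metric (hx : x ∈ N.region) (κ ν : Fin 4) :
    DifferentiableAt ℝ (fun x => N.metric x κ ν) x := by
  have hU := (contDiffAt_U hx).differentiableAt (by simp)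
  have hV := (contDiffAt_V hx).differentiableAt (by simp)
  have hW := fun i => (contDiffAt_W hx i).differentiableAt (by simp)
  have hh := fun i j => (contDiffAt_h hx i j).differentiableAt (by simp)
  have hn := fun i => (contDiffAt_normal hx i).differentiableAt (by simp)
  have hd : ∀ ν, DifferentiableAt ℝ (fun x => drForm x ν) x := fun ν => by
    refine Fin.cases (differentiableAt_const _) (fun i => hn i) ν
  have hsh : ∀ i ν, DifferentiableAt ℝ (fun x => shiftForm (N.W x) i ν) x := fun i ν => by
    refine Fin.cases (hW i) (fun i => differentiableAt_const _) ν
  have : (fun x => N.metric x κ ν) = fun x =>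
      -(N.U x * N.V x) * ((Pi.single 0 1 : R4) κ * (Pi.single 0 1 : R4) ν) -
      N.U x * ((Pi.single 0 1 : R4) κ * drForm x ν + drForm x κ * (Pi.single 0 1 : R4) ν) +
      ∑ i, ∑ j, N.h x i j * (shiftForm (N.W x) i κ * shiftForm (N.W x) j ν) := by
    ext x
    simp only [metric, bondiMetric, Matrix.add_apply, Matrix.sub_apply, Matrix.smul_apply,
      vecMulVec_apply, smul_eq_mul, Matrix.sum_apply]
  rw [this]
  exact (((hU.fun_mul hV).fun_neg.mul_const _).fun_sub (hU.fun_mul (((hd ν).const_mul _).fun_add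
    ((hd κ).mul_const _)))).fun_add (DifferentiableAt.fun_sum fun i _ =>
      DifferentiableAt.fun_sum fun j _ => (hh i j).fun_mul ((hsh i κ).fun_mul (hsh j ν)))

lemma sum_h_normal (hx : x ∈ N.region) (i : Fin 3) : ∑ j, N.h x i j * normal x j = 0 :=
  congrFun (h_mulVec_normal hx) i

lemma h_comm (hx : x ∈ N.region) (i j : Fin 3) : N.h x i j = N.h x j i :=
  ((h_isSymm hx).apply i j).symm

/-- The product with a vector tangent to the slices of constant `w`. -/
lemma ip_metric_of_zero {w : R4} (hw : w 0 = 0) (v : R4) : ip N.metric x v w =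
    - N.U x * (v 0 * rad x w) + ∑ i, ∑ j, N.h x i j * ((v i.succ + v 0 * N.W x i) * w j.succ) := by
  rw [ip_metric, hw]; simp

lemma ip_metric_of_zero_zero {v w : R4} (hv : v 0 = 0) (hw : w 0 = 0) :
    ip N.metric x v w = N.hform x v w := by
  rw [ip_metric_of_zero hw, hv]; simp [hform]

lemma hform_normal_left (hx : x ∈ N.region) {v w : R4} {c : ℝ}
    (hv : ∀ i : Fin 3, v i.succ = c * normal x i) : N.hform x v w = 0 := by
  simp only [hform, hv]
  rw [Finset.sum_comm]
  refine Finset.sum_eq_zero fun j _ => ?_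
  have := sum_h_normal hx j
  calc ∑ i, N.h x i j * (c * normal x i * w j.succ)
      = (∑ i, N.h x j i * normal x i) * (c * w j.succ) := by
        rw [Finset.sum_mul]; exact Finset.sum_congr rfl fun i _ => by rw [h_comm hx i j]; ring
    _ = 0 := by rw [this]; simp

lemma hform_add_left (v v' w : R4) : N.hform x (v + v') w = N.hform x v w + N.hform x v' w := by
  simp only [hform, Pi.add_apply, ← Finset.sum_add_distrib]
  exact Finset.sum_congr rfl fun i _ => Finset.sum_congr rfl fun j _ => by ring

lemma hform_smul_left (c : ℝ) (v w : R4) : N.hform x (c • v) w = c * N.hform x v w := by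
  simp only [hform, Pi.smul_apply, smul_eq_mul, Finset.mul_sum]
  exact Finset.sum_congr rfl fun i _ => Finset.sum_congr rfl fun j _ => by ring

lemma ip_radialDir (hx : x ∈ N.region) (w : R4) :
    ip N.metric x (radialDir x) w = - N.U x * w 0 := by
  have h0 : ∑ i, ∑ j, N.h x i j * (normal x i * (w j.succ + w 0 * N.W x j)) = 0 := by
    rw [Finset.sum_comm]
    refine Finset.sum_eq_zero fun j _ => ?_
    calc ∑ i, N.h x i j * (normal x i * (w j.succ + w 0 * N.W x j))
        = (∑ i, N.h x j i * normal x i) * (w j.succ + w 0 * N.W x j) := by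
          rw [Finset.sum_mul]; exact Finset.sum_congr rfl fun i _ => by rw [h_comm hx i j]; ring
      _ = 0 := by rw [sum_h_normal hx]; simp
  have h1 : rad x (radialDir x) = 1 := by
    simpa only [rad, radialDir_succ, dotProduct] using normal_dot_self hx
  rw [ip_metric]
  simp [h0, h1]

lemma rad_nullIn (hx : x ∈ N.region) : rad x (N.nullIn x) = - N.V x / 2 := by
  have a := normal_dot_self hx
  have b := W_dot_normal hx
  simp only [dotProduct] at a b
  simp only [rad, nullIn_succ]
  calc _ = - ∑ i, N.W x i * normal x i - N.V x / 2 * ∑ i, normal x i * normal x i := by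
        rw [Finset.mul_sum, ← Finset.sum_neg_distrib, ← Finset.sum_sub_distrib]
        exact Finset.sum_congr rfl fun i _ => by ring
    _ = _ := by rw [a, b]; ring

lemma ip_nullIn (hx : x ∈ N.region) (w : R4) :
    ip N.metric x (N.nullIn x) w = - N.U x * rad x w - N.U x * N.V x / 2 * w 0 := by
  have h0 : ∑ i, ∑ j, N.h x i j * ((-N.W x i - N.V x / 2 * normal x i + 1 * N.W x i) *
      (w j.succ + w 0 * N.W x j)) = 0 := by
    rw [Finset.sum_comm]
    refine Finset.sum_eq_zero fun j _ => ?_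
    calc ∑ i, N.h x i j * ((-N.W x i - N.V x / 2 * normal x i + 1 * N.W x i) *
        (w j.succ + w 0 * N.W x j))
        = (∑ i, N.h x j i * normal x i) * (- N.V x / 2 * (w j.succ + w 0 * N.W x j)) := by
          rw [Finset.sum_mul]; exact Finset.sum_congr rfl fun i _ => by rw [h_comm hx i j]; ring
      _ = 0 := by rw [sum_h_normal hx]; simp
  have h1 := rad_nullIn hx
  rw [ip_metric]
  simp only [nullIn_zero, nullIn_succ]
  rw [h0, h1]
  ring

lemma eq_zero_of_spatial {v : R4} (h0 : v 0 = 0) (h : ∀ i : Fin 3, v i.succ = 0) : v = 0 := by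
  ext i; exact Fin.cases h0 h i

lemma metric_det_ne_zero (hx : x ∈ N.region) : (N.metric x).det ≠ 0 := by
  intro hdet
  obtain ⟨v, hv0, hv⟩ := exists_mulVec_eq_zero_iff.2 hdet
  have hU := N.U_pos x hx
  have hip : ∀ w, ip N.metric x w v = 0 := fun w => by rw [ip, hv, dotProduct_zero]
  have h0 : v 0 = 0 := by
    have := hip (radialDir x)
    rw [ip_radialDir hx] at this
    exact (mul_eq_zero.1 this).resolve_left (neg_ne_zero.2 hU.ne')
  have h1 : rad x v = 0 := by
    have := hip (N.nullIn x)
    rw [ip_nullIn hx, h0, mul_zero, sub_zero] at this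
    exact (mul_eq_zero.1 this).resolve_left (neg_ne_zero.2 hU.ne')
  refine hv0 (eq_zero_of_spatial h0 ?_)
  by_contra hne
  have hne' : (fun i : Fin 3 => v i.succ) ≠ 0 := fun h => hne (fun i => congrFun h i)
  have hpos := N.h_pos x hx (fun i => v i.succ) (by
    rw [norm_smul_normal' hx, dotProduct_smul, dotProduct_comm]
    simp only [dotProduct]
    rw [show ∑ i, normal x i * v i.succ = 0 from h1, smul_zero]) hne'
  have h2 := hip v
  rw [ip_metric_of_zero_zero h0 h0] at h2
  rw [← h2] at hpos
  refine lt_irrefl _ (hpos.trans_eq ?_)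
  simp only [dotProduct, mulVec, hform, Finset.mul_sum]
  exact Finset.sum_congr rfl fun i _ => Finset.sum_congr rfl fun j _ => by ring

/-! ### Derivatives of the null frame and of the metric -/

lemma fderiv_normal (hx : x ∈ N.region) (z : R4) (i : Fin 3) :
    fderiv ℝ (fun x => normal x i) x z =
      (z i.succ - rad x z * normal x i) / ‖spatial x‖ := by
  have hy := spatial_ne_zero hx
  have h1 := fderiv_comp_spatial (f := nrm i) (differentiableAt_nrm hy i) z
  rw [show (fun x => normal x i) = fun x => nrm i (spatial x) from rfl, h1]
  simp only [pd_nrm hy, tproj, rad, normal, Fin.sum_univ_three]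
  fin_cases i <;> simp <;> ring

lemma differentiableAt_radialDir (hx : x ∈ N.region) (κ : Fin 4) :
    DifferentiableAt ℝ (fun x => radialDir x κ) x := by
  refine Fin.cases ?_ (fun i => ?_) κ
  · exact differentiableAt_const _
  · simp only [radialDir_succ]; exact (contDiffAt_normal hx i).differentiableAt (by simp)

lemma differentiableAt_nullIn (hx : x ∈ N.region) (κ : Fin 4) :
    DifferentiableAt ℝ (fun x => N.nullIn x κ) x := by
  refine Fin.cases ?_ (fun i => ?_) κ
  · exact differentiableAt_const _
  · have hV := (contDiffAt_V hx).differentiableAt (by simp)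
    have hV2 : DifferentiableAt ℝ (fun x => N.V x / 2) x := by
      simp only [div_eq_mul_inv]; exact hV.mul_const _
    have hW := (contDiffAt_W hx i).differentiableAt (by simp)
    have hn := (contDiffAt_normal hx i).differentiableAt (by simp)
    simp only [nullIn_succ]
    exact hW.fun_neg.fun_sub (hV2.fun_mul hn)

lemma vecDeriv_radialDir (hx : x ∈ N.region) (z : R4) : vecDeriv radialDir x z =
    pt 0 (WithLp.toLp 2 fun i => (z i.succ - rad x z * normal x i) / ‖spatial x‖) := by
  ext κ
  refine Fin.cases ?_ (fun i => ?_) κ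
  · simp [vecDeriv]
  · simp only [vecDeriv, radialDir_succ, pt_succ]
    exact fderiv_normal hx z i

lemma vecDeriv_nullIn_zero (z : R4) : vecDeriv N.nullIn x z 0 = 0 := by
  simp [vecDeriv]

lemma vecDeriv_nullIn_succ (hx : x ∈ N.region) (z : R4) (i : Fin 3) :
    vecDeriv N.nullIn x z i.succ = - fderiv ℝ (fun x => N.W x i) x z -
      fderiv ℝ N.V x z / 2 * normal x i -
      N.V x / 2 * ((z i.succ - rad x z * normal x i) / ‖spatial x‖) := by
  have hV := (contDiffAt_V hx).differentiableAt (by simp)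
  have hW := (contDiffAt_W hx i).differentiableAt (by simp)
  have hn := (contDiffAt_normal hx i).differentiableAt (by simp)
  have hV2 : DifferentiableAt ℝ (fun x => N.V x / 2) x := by
      simp only [div_eq_mul_inv]; exact hV.mul_const _
  simp only [vecDeriv, nullIn_succ]
  rw [fderiv_fun_sub hW.fun_neg (hV2.fun_mul hn), fderiv_fun_neg,
    fderiv_fun_mul hV2 hn]
  have : fderiv ℝ (fun x => N.V x / 2) x = (2 : ℝ)⁻¹ • fderiv ℝ N.V x := by
    simp only [div_eq_mul_inv]
    rw [fderiv_mul_const hV]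
  rw [this]
  simp [fderiv_normal hx]
  ring

lemma ipDeriv_metric (hx : x ∈ N.region) (z : R4) {v w : R4} (hv : v 0 = 0) (hw : w 0 = 0) :
    ipDeriv N.metric x z v w =
      ∑ i, ∑ j, fderiv ℝ (fun x => N.h x i j) x z * (v i.succ * w j.succ) := by
  have h1 := fderiv_ip (differentiableAt_metric hx) (A := fun _ => v) (B := fun _ => w)
    (fun _ => differentiableAt_const _) (fun _ => differentiableAt_const _) z
  have h2 : ∀ c : R4, vecDeriv (fun _ => c) x z = 0 := fun c => by ext l; simp [vecDeriv]
  simp only [h2, ip_zero_left, ip_zero_right, add_zero, ip_metric_of_zero_zero hv hw] at h1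
  rw [← h1]
  have hh := fun i j => (contDiffAt_h hx i j).differentiableAt (by simp)
  simp only [hform]
  rw [fderiv_fun_sum fun i _ => DifferentiableAt.fun_sum fun j _ => (hh i j).mul_const _]
  simp only [fderiv_fun_sum fun j _ => (hh _ j).mul_const _, fderiv_mul_const (hh _ _)]
  simp [mul_comm]

lemma ipDeriv_radialDir (hx : x ∈ N.region) (z : R4) {w : R4} (hw : w 0 = 0) :
    ipDeriv N.metric x z (radialDir x) w = - ip N.metric x (vecDeriv radialDir x z) w := by
  have h1 := fderiv_ip (differentiableAt_metric hx) (A := radialDir) (B := fun _ => w)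
    (differentiableAt_radialDir hx) (fun _ => differentiableAt_const _) z
  have h2 : vecDeriv (fun _ => w) x z = 0 := by ext l; simp [vecDeriv]
  have h3 : (fun x => ip N.metric x (radialDir x) w) =ᶠ[𝓝 x] fun _ => 0 := by
    filter_upwards [region_mem_nhds hx] with x' hx'
    rw [ip_radialDir hx', hw, mul_zero]
  rw [h3.fderiv_eq, h2] at h1
  simp at h1
  linarith

lemma ipDeriv_nullIn (hx : x ∈ N.region) (z : R4) {w : R4} (hw : w 0 = 0) (hr : rad x w = 0) :
    ipDeriv N.metric x z (N.nullIn x) w =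
      - N.U x * ∑ i, fderiv ℝ (fun x => normal x i) x z * w i.succ
      - ip N.metric x (vecDeriv N.nullIn x z) w := by
  have h1 := fderiv_ip (differentiableAt_metric hx) (A := N.nullIn) (B := fun _ => w)
    (differentiableAt_nullIn hx) (fun _ => differentiableAt_const _) z
  have h2 : vecDeriv (fun _ => w) x z = 0 := by ext l; simp [vecDeriv]
  have h3 : (fun x => ip N.metric x (N.nullIn x) w) =ᶠ[𝓝 x] fun x => - N.U x * rad x w := by
    filter_upwards [region_mem_nhds hx] with x' hx'
    rw [ip_nullIn hx', hw, mul_zero, sub_zero]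
  have hU := (contDiffAt_U hx).differentiableAt (by simp)
  have hn := fun i => (contDiffAt_normal hx i).differentiableAt (by simp)
  have h4 : fderiv ℝ (fun x => - N.U x * rad x w) x z =
      - N.U x * ∑ i, fderiv ℝ (fun x => normal x i) x z * w i.succ := by
    simp only [rad] at hr ⊢
    rw [fderiv_fun_mul hU.fun_neg (DifferentiableAt.fun_sum fun i _ => (hn i).mul_const _)]
    rw [fderiv_fun_sum fun i _ => (hn i).mul_const _]
    simp only [fderiv_mul_const (hn _)]
    simp [hr]
    exact Or.inl (Finset.sum_congr rfl fun i _ => mul_comm _ _)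
  rw [h3.fderiv_eq, h2, h4] at h1
  simp at h1
  linarith

end Exterior


namespace Exterior

variable {N : Exterior} {r : ℝ} {u : ℝ × ℝ}

/-! ### The surface `Σ_r` in the spacetime -/

lemma surface_mem_region (hr : N.R₀ < r) (u : ℝ × ℝ) : N.surface r u ∈ N.region := by
  apply pt_mem_region
  rwa [norm_smul_polar (N.R₀_pos.trans hr)]

lemma spatial_surface (r : ℝ) (u : ℝ × ℝ) : spatial (N.surface r u) = r • polar u := rfl

lemma normal_surface (hr : 0 < r) (u : ℝ × ℝ) (i : Fin 3) :
    normal (N.surface r u) i = polar u i := by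
  rw [normal, spatial_surface, nrm_smul_polar hr]

lemma contDiff_surface (r : ℝ) : ContDiff ℝ ∞ (N.surface r) :=
  (contDiff_pt N.c).comp (contDiff_polar.const_smul r)

lemma tangent_surface (r : ℝ) (a : Fin 2) (u : ℝ × ℝ) :
    tangent (N.surface r) a u = pt 0 (r • sphTan a u) := by
  have h : DifferentiableAt ℝ polar u := contDiff_polar.differentiable (by simp) u
  have h1 := (hasFDerivAt_pt N.c (r • polar u)).comp u (h.hasFDerivAt.const_smul r)
  rw [tangent, show N.surface r = pt N.c ∘ (r • polar) from rfl, h1.fderiv]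
  simp only [ContinuousLinearMap.comp_apply, _root_.smul_apply, hasFDerivAt_polar]
  rfl

@[simp] lemma tangent_surface_zero (a : Fin 2) : tangent (N.surface r) a u 0 = 0 := by
  rw [tangent_surface]; rfl

@[simp] lemma tangent_surface_succ (a : Fin 2) (i : Fin 3) :
    tangent (N.surface r) a u i.succ = r * sphTan a u i := by
  rw [tangent_surface]; rfl

lemma rad_tangent (hr : 0 < r) (a : Fin 2) :
    rad (N.surface r u) (tangent (N.surface r) a u) = 0 := by
  simp only [rad, tangent_surface_succ, normal_surface hr]
  calc _ = r * ∑ i, sphTan a u i * polar u i := by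
        rw [Finset.mul_sum]; exact Finset.sum_congr rfl fun i _ => by ring
    _ = 0 := by rw [sum_sphTan_polar]; simp

/-- The spatial components of the coordinate tangent vectors. -/
def tanVec (r : ℝ) (u : ℝ × ℝ) : Fin 2 → Fin 3 → ℝ := fun a i => r * sphTan a u i

lemma inducedMetric_eq_hform (a b : Fin 2) :
    inducedMetric N.metric (N.surface r) u a b =
      N.hform (N.surface r u) (tangent (N.surface r) a u) (tangent (N.surface r) b u) :=
  ip_metric_of_zero_zero (by simp) (by simp)

lemma inducedMetric_eq_gram :
    inducedMetric N.metric (N.surface r) u = gram (N.h (N.surface r u)) (tanVec r u) := by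
  ext a b
  rw [inducedMetric_eq_hform]
  simp only [hform, tangent_surface_succ, gram, tanVec, dotProduct, mulVec, Matrix.of_apply,
    Finset.mul_sum]
  exact Finset.sum_congr rfl fun _ _ => Finset.sum_congr rfl fun _ _ => by ring

lemma det_frameMatrix (hr : 0 < r) :
    (frameMatrix (tanVec r u) (normal (N.surface r u))).det ^ 2 = (r ^ 2 * Real.sin u.1) ^ 2 := by
  have h1 := Real.sin_sq_add_cos_sq u.1
  have h2 := Real.sin_sq_add_cos_sq u.2
  have e : (frameMatrix (tanVec r u) (normal (N.surface r u))).det = - (r ^ 2 * Real.sin u.1) := by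
    have n := fun i => normal_surface (N := N) hr u i
    rw [det_fin_three]
    simp only [frameMatrix, Matrix.of_apply, cons_val_zero, cons_val_one, cons_val_two, tanVec]
    simp [sphTan, unitTheta, unitPhi, n, polar]
    linear_combination (-r ^ 2 * Real.sin u.1 * (Real.sin u.2 ^ 2 + Real.cos u.2 ^ 2)) * h1 +
      (-r ^ 2 * Real.sin u.1) * h2
  rw [e]; ring

lemma tanVec_dot_normal (hr : 0 < r) (a : Fin 2) :
    tanVec r u a ⬝ᵥ normal (N.surface r u) = 0 := by
  have := rad_tangent (N := N) (u := u) hr a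
  simp only [rad, tangent_surface_succ] at this
  rw [← this, dotProduct]
  exact Finset.sum_congr rfl fun i _ => by rw [tanVec]; ring

lemma det_inducedMetric (hr : N.R₀ < r) :
    (inducedMetric N.metric (N.surface r) u).det = (r ^ 2 * Real.sin u.1) ^ 2 := by
  have hx := surface_mem_region hr u
  have hr0 := N.R₀_pos.trans hr
  rw [inducedMetric_eq_gram, det_gram (h_mulVec_normal hx) (normal_dot_self hx) (h_isSymm hx)
    (det_h_add hx) (tanVec_dot_normal hr0), det_frameMatrix hr0]

lemma sin_pos_of_mem (hu : u ∈ polarDomain) : 0 < Real.sin u.1 :=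
  Real.sin_pos_of_pos_of_lt_pi hu.1.1 hu.1.2

lemma det_inducedMetric_ne_zero (hr : N.R₀ < r) (hu : u ∈ polarDomain) :
    (inducedMetric N.metric (N.surface r) u).det ≠ 0 := by
  rw [det_inducedMetric hr]
  have := sin_pos_of_mem hu
  have := N.R₀_pos.trans hr
  positivity

lemma sqrt_det_inducedMetric (hr : N.R₀ < r) (hu : u ∈ polarDomain) :
    Real.sqrt (inducedMetric N.metric (N.surface r) u).det = r ^ 2 * Real.sin u.1 := by
  rw [det_inducedMetric hr, Real.sqrt_sq]
  have := sin_pos_of_mem hu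
  positivity

/-- The inverse induced metric in Cartesian components. -/
lemma sum_inv_inducedMetric (hr : N.R₀ < r) (hu : u ∈ polarDomain) (i j : Fin 3) :
    ∑ a, ∑ b, (inducedMetric N.metric (N.surface r) u)⁻¹ a b *
      ((r * sphTan a u i) * (r * sphTan b u j)) = N.Q (N.surface r u) i j := by
  have hx := surface_mem_region hr u
  have hr0 := N.R₀_pos.trans hr
  rw [inducedMetric_eq_gram]
  refine sum_gram_inv (h_mulVec_normal hx) (normal_dot_self hx) (h_isSymm hx)
    (det_h_add hx) (tanVec_dot_normal hr0) ?_ i j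
  intro h0
  have := det_frameMatrix (N := N) (u := u) hr0
  rw [h0] at this
  have h1 := sin_pos_of_mem hu
  have h2 : 0 < (r ^ 2 * Real.sin u.1) ^ 2 := by positivity
  linarith

/-- Traces with respect to the induced metric in Cartesian components. -/
lemma sum_inv_inducedMetric_mul (hr : N.R₀ < r) (hu : u ∈ polarDomain) (c : Fin 3 → Fin 3 → ℝ) :
    ∑ a, ∑ b, (inducedMetric N.metric (N.surface r) u)⁻¹ a b *
      ∑ i, ∑ j, c i j * ((r * sphTan a u i) * (r * sphTan b u j)) =
      ∑ i, ∑ j, N.Q (N.surface r u) i j * c i j := by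
  simp only [← sum_inv_inducedMetric hr hu, Fin.sum_univ_two, Fin.sum_univ_three]
  ring

/-- The second derivatives of the parametrization of the sphere. -/
lemma sum_ud_sphTan_polar (a b : Fin 2) (u : ℝ × ℝ) :
    ∑ i, ud a (fun z => sphTan b z i) u * polar u i = - ∑ i, sphTan a u i * sphTan b u i := by
  have d1 := fun i => differentiable_coord (contDiff_sphTan b) i u
  have d2 := fun i => differentiable_coord contDiff_polar i u
  have h : ud a (fun z => ∑ i, sphTan b z i * polar z i) u = 0 := by
    simp only [sum_sphTan_polar, ud_const]
  rw [ud_sum fun i _ => (d1 i).fun_mul (d2 i)] at h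
  simp only [ud_mul (d1 _) (d2 _), ud_polar, Finset.sum_add_distrib] at h
  simp only [mul_comm (sphTan a u _)]
  linarith

lemma ud_tangent_zero (a b : Fin 2) :
    ud a (fun z => tangent (N.surface r) b z 0) u = 0 := by
  simp only [tangent_surface_zero, ud_const]

lemma ud_tangent_succ (a b : Fin 2) (i : Fin 3) :
    ud a (fun z => tangent (N.surface r) b z i.succ) u = r * ud a (fun z => sphTan b z i) u := by
  simp only [tangent_surface_succ]
  exact ud_const_mul r (differentiable_coord (contDiff_sphTan b) i u) a

lemma rad_ud_tangent (hr : 0 < r) (a b : Fin 2) :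
    rad (N.surface r u) (fun l => ud a (fun z => tangent (N.surface r) b z l) u) =
      - r * ∑ i, sphTan a u i * sphTan b u i := by
  simp only [rad, normal_surface hr, ud_tangent_succ]
  rw [neg_mul, ← mul_neg, ← sum_ud_sphTan_polar, Finset.mul_sum]
  exact Finset.sum_congr rfl fun i _ => by ring

lemma norm_spatial_surface (hr : 0 < r) : ‖spatial (N.surface r u)‖ = r := norm_smul_polar hr u

lemma ip_radialDir_covDeriv (hr : N.R₀ < r) (a b : Fin 2) :
    ip N.metric (N.surface r u) (radialDir (N.surface r u))
      (covDeriv N.metric (N.surface r) (tangent (N.surface r) b) a u) =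
    - (1 / r) * inducedMetric N.metric (N.surface r) u a b -
      (1 / 2) * ∑ i, ∑ j, fderiv ℝ (fun x => N.h x i j) (N.surface r u)
        (radialDir (N.surface r u)) * ((r * sphTan a u i) * (r * sphTan b u j)) := by
  have hx := surface_mem_region hr u
  have hr0 := N.R₀_pos.trans hr
  set x := N.surface r u with hxd
  have hv : ∀ a, vecDeriv radialDir x (tangent (N.surface r) a u) =
      (1 / r) • tangent (N.surface r) a u := fun a => by
    rw [vecDeriv_radialDir hx]
    ext κ
    refine Fin.cases ?_ (fun i => ?_) κ
    · simp
    · simp only [pt_succ, rad_tangent hr0, hxd, norm_spatial_surface hr0, Pi.smul_apply,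
        smul_eq_mul]
      ring
  rw [ip_covDeriv (metric_det_ne_zero hx), ip_radialDir hx, ud_tangent_zero,
    ipDeriv_radialDir hx _ (tangent_surface_zero b), hv,
    ipDeriv_radialDir hx _ (tangent_surface_zero a), hv,
    ipDeriv_metric hx _ (tangent_surface_zero a) (tangent_surface_zero b), ip_smul_left,
    ip_smul_left, ip_comm (metric_isSymm hx) (tangent (N.surface r) b u)]
  simp only [tangent_surface_succ]
  have : ip N.metric x (tangent (N.surface r) a u) (tangent (N.surface r) b u) =
    inducedMetric N.metric (N.surface r) u a b := rfl
  rw [this]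
  ring

lemma sum_inv_mul_self (hr : N.R₀ < r) (hu : u ∈ polarDomain) :
    ∑ a, ∑ b, (inducedMetric N.metric (N.surface r) u)⁻¹ a b *
      inducedMetric N.metric (N.surface r) u a b = 2 := by
  have h1 := nonsing_inv_mul _ (isUnit_iff_ne_zero.2 (det_inducedMetric_ne_zero hr hu))
  have h2 : ∀ a, ∑ b, (inducedMetric N.metric (N.surface r) u)⁻¹ a b *
      inducedMetric N.metric (N.surface r) u a b = 1 := fun a => by
    have := congrFun (congrFun h1 a) a
    rw [Matrix.mul_apply, Matrix.one_apply_eq] at this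
    rw [← this]
    refine Finset.sum_congr rfl fun b _ => ?_
    rw [(inducedMetric_isSymm (F := N.surface r) (metric_isSymm (surface_mem_region hr u))).apply]
  simp [h2]

lemma ip_tangent_radialDir (hr : N.R₀ < r) (a : Fin 2) : ip N.metric (N.surface r u)
    (tangent (N.surface r) a u) (radialDir (N.surface r u)) = 0 := by
  have hx := surface_mem_region hr u
  rw [ip_comm (metric_isSymm hx), ip_radialDir hx]; simp

lemma ip_tangent_nullIn (hr : N.R₀ < r) (a : Fin 2) : ip N.metric (N.surface r u)
    (tangent (N.surface r) a u) (N.nullIn (N.surface r u)) = 0 := by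
  have hx := surface_mem_region hr u
  rw [ip_comm (metric_isSymm hx), ip_nullIn hx, rad_tangent (N.R₀_pos.trans hr)]; simp

lemma ip_meanCurv_radialDir (hr : N.R₀ < r) (hu : u ∈ polarDomain) :
    ip N.metric (N.surface r u) (meanCurv N.metric (N.surface r) u) (radialDir (N.surface r u)) =
      - 2 / r := by
  have hx := surface_mem_region hr u
  rw [ip_meanCurv_of_orthogonal (ip_tangent_radialDir hr)]
  simp only [ip_comm (metric_isSymm hx) _ (radialDir _), ip_radialDir_covDeriv hr]
  have h1 := sum_inv_mul_self hr hu
  have h2 := sum_inv_inducedMetric_mul hr hu fun i j =>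
    fderiv ℝ (fun x => N.h x i j) (N.surface r u) (radialDir (N.surface r u))
  rw [sum_Q_fderiv_h hx] at h2
  calc _ = - (1 / r) * ∑ a, ∑ b, (inducedMetric N.metric (N.surface r) u)⁻¹ a b *
      inducedMetric N.metric (N.surface r) u a b - (1 / 2) *
      ∑ a, ∑ b, (inducedMetric N.metric (N.surface r) u)⁻¹ a b *
      ∑ i, ∑ j, fderiv ℝ (fun x => N.h x i j) (N.surface r u) (radialDir (N.surface r u)) *
        ((r * sphTan a u i) * (r * sphTan b u j)) := by
        rw [Finset.mul_sum, Finset.mul_sum, ← Finset.sum_sub_distrib]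
        refine Finset.sum_congr rfl fun a _ => ?_
        rw [Finset.mul_sum, Finset.mul_sum, ← Finset.sum_sub_distrib]
        exact Finset.sum_congr rfl fun b _ => by ring
    _ = _ := by rw [h1, h2]; ring

variable (N) in
/-- The divergence of the shift vector. -/
def divW (x : R4) : ℝ := ∑ i, fderiv ℝ (fun x => N.W x i) x (Pi.single i.succ 1)

variable (N) in
/-- `-r` times the expansion of the spheres in the ingoing null direction. -/
def P (x : R4) : ℝ := N.V x + ‖spatial x‖ * N.divW x

lemma fderiv_tangent (f : R4 → ℝ) (a : Fin 2) : fderiv ℝ f (N.surface r u)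
    (tangent (N.surface r) a u) =
      ∑ k, (r * sphTan a u k) * fderiv ℝ f (N.surface r u) (Pi.single k.succ 1) := by
  rw [fderiv_eq_sum_single, Fin.sum_univ_succ]
  simp only [tangent_surface_zero, tangent_surface_succ, zero_mul, zero_add]

lemma ip_nullIn_covDeriv (hr : N.R₀ < r) (a b : Fin 2) :
    ip N.metric (N.surface r u) (N.nullIn (N.surface r u))
      (covDeriv N.metric (N.surface r) (tangent (N.surface r) b) a u) =
    (1 / 2) * (∑ i, ∑ j, (∑ k, fderiv ℝ (fun x => N.W x k) (N.surface r u) (Pi.single i.succ 1) *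
        N.h (N.surface r u) k j) * ((r * sphTan a u i) * (r * sphTan b u j)) +
      ∑ i, ∑ j, (∑ k, fderiv ℝ (fun x => N.W x k) (N.surface r u) (Pi.single j.succ 1) *
        N.h (N.surface r u) k i) * ((r * sphTan a u i) * (r * sphTan b u j))) +
    N.V (N.surface r u) / (2 * r) * inducedMetric N.metric (N.surface r) u a b -
      (1 / 2) * ∑ i, ∑ j, fderiv ℝ (fun x => N.h x i j) (N.surface r u)
        (N.nullIn (N.surface r u)) * ((r * sphTan a u i) * (r * sphTan b u j)) := by
  have hx := surface_mem_region hr u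
  have hr0 := N.R₀_pos.trans hr
  set x := N.surface r u with hxd
  have hv : ∀ a b, ip N.metric x (vecDeriv N.nullIn x (tangent (N.surface r) a u))
      (tangent (N.surface r) b u) =
      - ∑ i, ∑ j, (∑ k, fderiv ℝ (fun x => N.W x k) x (Pi.single i.succ 1) *
        N.h x k j) * ((r * sphTan a u i) * (r * sphTan b u j)) -
      N.V x / (2 * r) * inducedMetric N.metric (N.surface r) u a b := fun a b => by
    rw [ip_metric_of_zero_zero (vecDeriv_nullIn_zero _) (tangent_surface_zero b),
      inducedMetric_eq_hform]
    set A : R4 := Fin.cons 0 fun i => - fderiv ℝ (fun x => N.W x i) x (tangent (N.surface r) a u)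
      with hA
    set B : R4 := Fin.cons 0 fun i => - (fderiv ℝ N.V x (tangent (N.surface r) a u) / 2) *
      normal x i with hB
    have e : vecDeriv N.nullIn x (tangent (N.surface r) a u) =
        A + B + (- (N.V x / (2 * r))) • tangent (N.surface r) a u := by
      ext κ
      refine Fin.cases ?_ (fun i => ?_) κ
      · simp [vecDeriv_nullIn_zero, hA, hB]
      · rw [vecDeriv_nullIn_succ hx, hxd, rad_tangent hr0, norm_spatial_surface hr0, ← hxd]
        simp only [Pi.add_apply, Pi.smul_apply, smul_eq_mul, hA, hB, Fin.cons_succ]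
        field_simp
        ring
    have hB0 : N.hform x B (tangent (N.surface r) b u) = 0 :=
      hform_normal_left hx (fun i => rfl)
    have hA0 : N.hform x A (tangent (N.surface r) b u) =
        - ∑ i, ∑ j, (∑ k, fderiv ℝ (fun x => N.W x k) x (Pi.single i.succ 1) *
        N.h x k j) * ((r * sphTan a u i) * (r * sphTan b u j)) := by
      simp only [hform, hA, Fin.cons_succ, tangent_surface_succ, hxd, fderiv_tangent,
        Fin.sum_univ_three]
      ring
    rw [e, hform_add_left, hform_add_left, hform_smul_left, hA0, hB0]
    ring
  have hn : ∀ a b, ∑ i, fderiv ℝ (fun x => normal x i) x (tangent (N.surface r) a u) *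
      tangent (N.surface r) b u i.succ = r * ∑ i, sphTan a u i * sphTan b u i := fun a b => by
    rw [Finset.mul_sum]
    refine Finset.sum_congr rfl fun i _ => ?_
    rw [fderiv_normal hx, hxd, rad_tangent hr0, norm_spatial_surface hr0]
    simp only [tangent_surface_succ]
    field_simp
    ring
  rw [ip_covDeriv (metric_det_ne_zero hx), ip_nullIn hx, ud_tangent_zero, hxd,
    rad_ud_tangent hr0, ← hxd,
    ipDeriv_nullIn hx _ (tangent_surface_zero b) (rad_tangent hr0 b), hv, hn,
    ipDeriv_nullIn hx _ (tangent_surface_zero a) (rad_tangent hr0 a), hv, hn,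
    ipDeriv_metric hx _ (tangent_surface_zero a) (tangent_surface_zero b)]
  have hsym : inducedMetric N.metric (N.surface r) u b a =
      inducedMetric N.metric (N.surface r) u a b :=
    (inducedMetric_isSymm (F := N.surface r) (metric_isSymm hx)).apply a b
  rw [hsym]
  have hsw : ∑ i, ∑ j, (∑ k, fderiv ℝ (fun x => N.W x k) x (Pi.single i.succ 1) *
        N.h x k j) * ((r * sphTan b u i) * (r * sphTan a u j)) =
      ∑ i, ∑ j, (∑ k, fderiv ℝ (fun x => N.W x k) x (Pi.single j.succ 1) *
        N.h x k i) * ((r * sphTan a u i) * (r * sphTan b u j)) := by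
    rw [Finset.sum_comm]
    exact Finset.sum_congr rfl fun i _ => Finset.sum_congr rfl fun j _ => by ring
  have hsp : ∑ i, sphTan b u i * sphTan a u i = ∑ i, sphTan a u i * sphTan b u i :=
    Finset.sum_congr rfl fun i _ => mul_comm _ _
  rw [hsw, hsp]
  simp only [tangent_surface_succ]
  ring

lemma Q_comm {x : R4} (hx : x ∈ N.region) (i j : Fin 3) : N.Q x i j = N.Q x j i :=
  ((Q_isSymm hx).apply i j).symm

lemma sum_Q_h {x : R4} (hx : x ∈ N.region) (i k : Fin 3) :
    ∑ j, N.Q x i j * N.h x j k = (if i = k then 1 else 0) - normal x i * normal x k := by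
  have := congrFun (congrFun (Q_mul_h hx) i) k
  rwa [Matrix.mul_apply, Matrix.sub_apply, Matrix.one_apply, vecMulVec_apply] at this

lemma sum_Q_normal {x : R4} (hx : x ∈ N.region) (i : Fin 3) : ∑ j, N.Q x i j * normal x j = 0 :=
  congrFun (Q_mulVec_normal hx) i

/-- The derivative of the shift vector along its base ray is tangent to the spheres. -/
lemma sum_normal_fderiv_W {x : R4} (hx : x ∈ N.region) :
    ∑ i, ∑ k, normal x i * normal x k * fderiv ℝ (fun x => N.W x k) x (Pi.single i.succ 1) = 0 := by
  have hW := fun i => (contDiffAt_W hx i).differentiableAt (by simp)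
  have hn := fun i => (contDiffAt_normal hx i).differentiableAt (by simp)
  have h1 : (fun x => ∑ i, N.W x i * normal x i) =ᶠ[𝓝 x] fun _ => 0 := by
    filter_upwards [region_mem_nhds hx] with x' hx' using W_dot_normal hx'
  have h2 := congrArg (fun L : R4 →L[ℝ] ℝ => L (radialDir x)) h1.fderiv_eq
  rw [fderiv_fun_sum fun i _ => (hW i).fun_mul (hn i)] at h2
  simp only [fderiv_fun_mul (hW _) (hn _)] at h2
  have hrad : rad x (radialDir x) = 1 := by
    simpa only [rad, radialDir_succ, dotProduct] using normal_dot_self hx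
  have h3 : ∀ i, fderiv ℝ (fun x => normal x i) x (radialDir x) = 0 := fun i => by
    rw [fderiv_normal hx, hrad, radialDir_succ]; simp
  simp only [_root_.sum_apply, _root_.add_apply, _root_.smul_apply, h3, smul_eq_mul, mul_zero,
    zero_add] at h2
  refine Eq.trans ?_ (h2.trans (by simp))
  rw [Finset.sum_comm]
  refine Finset.sum_congr rfl fun k _ => ?_
  rw [fderiv_eq_sum_single, Fin.sum_univ_succ (n := 3), radialDir_zero, zero_mul, zero_add,
    Finset.mul_sum]
  exact Finset.sum_congr rfl fun i _ => by rw [radialDir_succ]; ring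

lemma ip_meanCurv_nullIn (hr : N.R₀ < r) (hu : u ∈ polarDomain) :
    ip N.metric (N.surface r u) (meanCurv N.metric (N.surface r) u) (N.nullIn (N.surface r u)) =
      N.P (N.surface r u) / r := by
  have hx := surface_mem_region hr u
  have hr0 := N.R₀_pos.trans hr
  rw [ip_meanCurv_of_orthogonal (ip_tangent_nullIn hr)]
  simp only [ip_comm (metric_isSymm hx) _ (N.nullIn _), ip_nullIn_covDeriv hr]
  have h1 := sum_inv_mul_self hr hu
  have h2 := sum_inv_inducedMetric_mul hr hu fun i j =>
    fderiv ℝ (fun x => N.h x i j) (N.surface r u) (N.nullIn (N.surface r u))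
  rw [sum_Q_fderiv_h hx] at h2
  have h3 := sum_inv_inducedMetric_mul hr hu fun i j =>
    ∑ k, fderiv ℝ (fun x => N.W x k) (N.surface r u) (Pi.single i.succ 1) *
        N.h (N.surface r u) k j
  have h4 := sum_inv_inducedMetric_mul hr hu fun i j =>
    ∑ k, fderiv ℝ (fun x => N.W x k) (N.surface r u) (Pi.single j.succ 1) *
        N.h (N.surface r u) k i
  set x := N.surface r u with hxd
  have key : ∑ i, ∑ j, N.Q x i j * ∑ k, fderiv ℝ (fun x => N.W x k) x (Pi.single i.succ 1) *
      N.h x k j = N.divW x := by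
    have : ∀ i, ∑ j, N.Q x i j * ∑ k, fderiv ℝ (fun x => N.W x k) x (Pi.single i.succ 1) *
        N.h x k j = ∑ k, fderiv ℝ (fun x => N.W x k) x (Pi.single i.succ 1) *
        ((if i = k then 1 else 0) - normal x i * normal x k) := fun i => by
      simp only [← sum_Q_h hx, Finset.mul_sum]
      rw [Finset.sum_comm]
      exact Finset.sum_congr rfl fun k _ => Finset.sum_congr rfl fun j _ => by
        rw [h_comm hx k j]; ring
    simp only [this]
    have hW := sum_normal_fderiv_W hx
    have e : ∀ i, ∑ k, fderiv ℝ (fun x => N.W x k) x (Pi.single i.succ 1) *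
        ((if i = k then 1 else 0) - normal x i * normal x k) =
        fderiv ℝ (fun x => N.W x i) x (Pi.single i.succ 1) -
        ∑ k, normal x i * normal x k * fderiv ℝ (fun x => N.W x k) x (Pi.single i.succ 1) :=
      fun i => by
        simp only [mul_sub, Finset.sum_sub_distrib]
        congr 1
        · simp
        · exact Finset.sum_congr rfl fun k _ => by ring
    simp only [e, Finset.sum_sub_distrib, hW, sub_zero]
    rfl
  have key' : ∑ i, ∑ j, N.Q x i j * ∑ k, fderiv ℝ (fun x => N.W x k) x (Pi.single j.succ 1) *
      N.h x k i = N.divW x := by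
    rw [← key, Finset.sum_comm]
    exact Finset.sum_congr rfl fun i _ => Finset.sum_congr rfl fun j _ => by rw [Q_comm hx]
  rw [key] at h3
  rw [key'] at h4
  simp only [Fin.sum_univ_two] at h1 h2 h3 h4 ⊢
  rw [P, hxd, norm_spatial_surface hr0, ← hxd]
  have : (N.V x + r * N.divW x) / r = N.V x / (2 * r) * 2 + N.divW x := by field_simp
  rw [this]
  linear_combination (N.V x / (2 * r)) * h1 - (1 / 2) * h2 + (1 / 2) * h3 + (1 / 2) * h4

end Exterior


namespace Exterior

variable {N : Exterior} {r : ℝ} {u : ℝ × ℝ}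

/-! ### The mean curvature gauge in the spacetime -/

lemma eq_zero_of_orthogonal (hr : N.R₀ < r) (hu : u ∈ polarDomain) {v : R4}
    (h1 : ip N.metric (N.surface r u) v (radialDir (N.surface r u)) = 0)
    (h2 : ip N.metric (N.surface r u) v (N.nullIn (N.surface r u)) = 0)
    (h3 : ∀ a, ip N.metric (N.surface r u) v (tangent (N.surface r) a u) = 0) : v = 0 := by
  have hx := surface_mem_region hr u
  set x := N.surface r u with hxd
  have hU := (N.U_pos x hx).ne'
  rw [ip_comm (metric_isSymm hx), ip_radialDir hx] at h1
  have h0 : v 0 = 0 := (mul_eq_zero.1 h1).resolve_left (neg_ne_zero.2 hU)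
  rw [ip_comm (metric_isSymm hx), ip_nullIn hx, h0, mul_zero, sub_zero] at h2
  have hrad : rad x v = 0 := (mul_eq_zero.1 h2).resolve_left (neg_ne_zero.2 hU)
  refine eq_zero_of_spatial h0 fun i => ?_
  have h4 : ∀ a, ∑ j, (r * sphTan a u j) * ∑ k, N.h x j k * v k.succ = 0 := fun a => by
    have := h3 a
    rw [ip_comm (metric_isSymm hx), ip_metric_of_zero_zero (tangent_surface_zero a) h0] at this
    rw [← this, hform]
    simp only [tangent_surface_succ, Finset.mul_sum]
    exact Finset.sum_congr rfl fun _ _ => Finset.sum_congr rfl fun _ _ => by ring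
  have h5 : ∑ j, N.Q x i j * ∑ k, N.h x j k * v k.succ = 0 := by
    simp only [hxd, ← sum_inv_inducedMetric hr hu]
    rw [← hxd]
    have : ∑ j, (∑ a, ∑ b, (inducedMetric N.metric (N.surface r) u)⁻¹ a b *
        (r * sphTan a u i * (r * sphTan b u j))) * ∑ k, N.h x j k * v k.succ =
        ∑ a, ∑ b, (inducedMetric N.metric (N.surface r) u)⁻¹ a b * (r * sphTan a u i) *
        ∑ j, (r * sphTan b u j) * ∑ k, N.h x j k * v k.succ := by
      simp only [Fin.sum_univ_two, Fin.sum_univ_three]; ring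
    rw [this]; simp [h4]
  have h6 : ∑ j, N.Q x i j * ∑ k, N.h x j k * v k.succ =
      ∑ k, ((if i = k then 1 else 0) - normal x i * normal x k) * v k.succ := by
    simp only [← sum_Q_h hx, Finset.mul_sum, Finset.sum_mul]
    rw [Finset.sum_comm]
    exact Finset.sum_congr rfl fun _ _ => Finset.sum_congr rfl fun _ _ => by ring
  rw [h6] at h5
  simp only [sub_mul, Finset.sum_sub_distrib, mul_assoc] at h5
  rw [← Finset.mul_sum, show ∑ k, normal x k * v k.succ = 0 from hrad] at h5
  simpa using h5

variable (N) in
/-- The normal vector field proportional to `H` (`s = -1`) or `J` (`s = 1`). -/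
def gaugeVec (s : ℝ) (x : R4) : R4 := (s * (N.P x / 2)) • radialDir x + N.nullIn x

lemma ip_gaugeVec {x : R4} (hx : x ∈ N.region) (s t : ℝ) :
    ip N.metric x (N.gaugeVec s x) (N.gaugeVec t x) = - (s + t) / 2 * (N.P x * N.U x) := by
  have hs := metric_isSymm hx
  simp only [gaugeVec, ip_add_left, ip_add_right, ip_smul_left, ip_smul_right]
  rw [ip_comm hs (N.nullIn x) (radialDir x), ip_radialDir hx, ip_radialDir hx, ip_nullIn hx,
    rad_nullIn hx]
  simp
  ring

lemma ip_gaugeVec_tangent (hr : N.R₀ < r) (s : ℝ) (a : Fin 2) :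
    ip N.metric (N.surface r u) (N.gaugeVec s (N.surface r u)) (tangent (N.surface r) a u) = 0 := by
  have hs := metric_isSymm (surface_mem_region hr u)
  rw [gaugeVec, ip_add_left, ip_smul_left, ip_comm hs, ip_tangent_radialDir hr, ip_comm hs,
    ip_tangent_nullIn hr]
  simp

lemma meanCurv_surface (hr : N.R₀ < r) (hu : u ∈ polarDomain) :
    meanCurv N.metric (N.surface r) u =
      (2 / (r * N.U (N.surface r u))) • N.gaugeVec (-1) (N.surface r u) := by
  have hx := surface_mem_region hr u
  have hr0 := N.R₀_pos.trans hr
  have hs := metric_isSymm hx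
  have hU := (N.U_pos _ hx).ne'
  rw [← sub_eq_zero]
  apply eq_zero_of_orthogonal hr hu
  · rw [ip_sub_left, ip_meanCurv_radialDir hr hu, ip_smul_left, gaugeVec, ip_add_left,
      ip_smul_left, ip_radialDir hx, ip_comm hs (N.nullIn _), ip_radialDir hx]
    simp; field_simp; ring
  · rw [ip_sub_left, ip_meanCurv_nullIn hr hu, ip_smul_left, gaugeVec, ip_add_left,
      ip_smul_left, ip_radialDir hx, ip_nullIn hx, rad_nullIn hx]
    simp; field_simp; ring
  · intro a
    rw [ip_sub_left, ip_meanCurv_tangent (det_inducedMetric_ne_zero hr hu), ip_smul_left,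
      ip_gaugeVec_tangent hr]
    simp

lemma ip_meanCurv_self (hr : N.R₀ < r) (hu : u ∈ polarDomain) :
    ip N.metric (N.surface r u) (meanCurv N.metric (N.surface r) u)
      (meanCurv N.metric (N.surface r) u) =
      (2 / r) ^ 2 * (N.P (N.surface r u) / N.U (N.surface r u)) := by
  have hx := surface_mem_region hr u
  have hU := (N.U_pos _ hx).ne'
  have hr0 := N.R₀_pos.trans hr
  rw [meanCurv_surface hr hu, ip_smul_left, ip_smul_right, ip_gaugeVec hx]
  field_simp
  ring

lemma normH_surface (hr : N.R₀ < r) (hu : u ∈ polarDomain) :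
    normH N.metric (N.surface r) u =
      2 / r * Real.sqrt (N.P (N.surface r u) / N.U (N.surface r u)) := by
  have hr0 := N.R₀_pos.trans hr
  rw [normH, ip_meanCurv_self hr hu, Real.sqrt_mul (by positivity), Real.sqrt_sq (by positivity)]

lemma dualJ_surface (hr : N.R₀ < r) (hu : u ∈ polarDomain) (hP : 0 < N.P (N.surface r u)) :
    dualJ N.metric radialDir (N.surface r) u =
      (2 / (r * N.U (N.surface r u))) • N.gaugeVec 1 (N.surface r u) := by
  have hx := surface_mem_region hr u
  have hU := N.U_pos _ hx
  have hr0 := N.R₀_pos.trans hr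
  have hs := metric_isSymm hx
  refine dualJ_eq hs (det_inducedMetric_ne_zero hr hu) ?_ ⟨?_, ?_, ?_, ?_⟩
  · rw [ip_meanCurv_self hr hu]; positivity
  · intro a
    rw [ip_smul_left, ip_gaugeVec_tangent hr, mul_zero]
  · rw [meanCurv_surface hr hu, ip_smul_left, ip_smul_right, ip_gaugeVec hx]; ring
  · rw [meanCurv_surface hr hu, ip_smul_left, ip_smul_right, ip_smul_left, ip_smul_right,
      ip_gaugeVec hx, ip_gaugeVec hx]; ring
  · rw [ip_smul_left, gaugeVec, ip_add_left, ip_smul_left, ip_radialDir hx,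
      ip_comm hs (N.nullIn _), ip_radialDir hx]
    simp only [radialDir_zero, nullIn_zero, mul_zero, mul_one, zero_add]
    rw [mul_neg]
    exact neg_neg_of_pos (by positivity)

lemma inv_normH_mul {p w : ℝ} (hr : 0 < r) (hp : 0 < p) (hw : 0 < w) :
    (2 / r * Real.sqrt (p / w))⁻¹ * (2 / (r * w)) = (Real.sqrt (p * w))⁻¹ := by
  rw [Real.sqrt_div hp.le, Real.sqrt_mul hp.le]
  have h1 := Real.sqrt_pos.2 hp
  have h2 := Real.sqrt_pos.2 hw
  have h3 := Real.mul_self_sqrt hw.le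
  field_simp
  nlinarith

lemma contDiffAt_P {x : R4} (hx : x ∈ N.region) : ContDiffAt ℝ ∞ N.P x := by
  have h1 : ContDiffAt ℝ ∞ (fun x => ‖spatial x‖) x :=
    (contDiffAt_norm ℝ (spatial_ne_zero hx)).comp x contDiff_spatial.contDiffAt
  have h2 : ContDiffAt ℝ ∞ N.divW x := ContDiffAt.sum fun i _ =>
    ((contDiffAt_W hx i).fderiv_right (m := ∞) (by simp)).clm_apply contDiffAt_const
  exact (contDiffAt_V hx).add (h1.mul h2)

lemma ipNabla_smul_add {g : R4 → Matrix (Fin 4) (Fin 4) ℝ} {x y v : R4} {A : R4 → ℝ}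
    {K L : R4 → R4} (hA : DifferentiableAt ℝ A x) (hK : ∀ κ, DifferentiableAt ℝ (fun x => K x κ) x)
    (hL : ∀ κ, DifferentiableAt ℝ (fun x => L x κ) x) :
    ipNabla g x y v (fun x => A x • K x + L x) =
      fderiv ℝ A x v * ip g x y (K x) + A x * ipNabla g x y v K + ipNabla g x y v L := by
  have e : vecDeriv (fun x => A x • K x + L x) x v =
      fderiv ℝ A x v • K x + A x • vecDeriv K x v + vecDeriv L x v := by
    ext l
    simp only [vecDeriv, Pi.add_apply, Pi.smul_apply, smul_eq_mul]
    rw [fderiv_fun_add (hA.fun_mul (hK l)) (hL l), fderiv_fun_mul hA (hK l)]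
    simp; ring
  simp only [ipNabla, e, ip_add_right, ip_smul_right]
  have e1 : ∀ z a : R4, ipDeriv g x z a (A x • K x + L x) =
      A x * ipDeriv g x z a (K x) + ipDeriv g x z a (L x) := fun z a => by
    simp only [ipDeriv, Pi.add_apply, Pi.smul_apply, smul_eq_mul, Finset.mul_sum,
      ← Finset.sum_add_distrib]
    exact Finset.sum_congr rfl fun _ _ => Finset.sum_congr rfl fun _ _ => by ring
  have e2 : ∀ a b : R4, ipDeriv g x (A x • K x + L x) a b =
      A x * ipDeriv g x (K x) a b + ipDeriv g x (L x) a b := fun a b => by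
    simp only [ipDeriv, map_add, map_smul, smul_eq_mul, Finset.mul_sum,
      ← Finset.sum_add_distrib]
    exact Finset.sum_congr rfl fun _ _ => Finset.sum_congr rfl fun _ _ => by ring
  rw [e1, e2, e1]
  ring

lemma ipNabla_add_smul_left {g : R4 → Matrix (Fin 4) (Fin 4) ℝ} {x y y' v : R4} {K : R4 → R4}
    (c : ℝ) : ipNabla g x (c • y + y') v K = c * ipNabla g x y v K + ipNabla g x y' v K := by
  have e1 : ∀ z a : R4, ipDeriv g x z (c • y + y') a =
      c * ipDeriv g x z y a + ipDeriv g x z y' a := fun z a => by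
    simp only [ipDeriv, Pi.add_apply, Pi.smul_apply, smul_eq_mul, Finset.mul_sum,
      ← Finset.sum_add_distrib]
    exact Finset.sum_congr rfl fun _ _ => Finset.sum_congr rfl fun _ _ => by ring
  have e2 : ∀ a b : R4, ipDeriv g x (c • y + y') a b =
      c * ipDeriv g x y a b + ipDeriv g x y' a b := fun a b => by
    simp only [ipDeriv, map_add, map_smul, smul_eq_mul, Finset.mul_sum,
      ← Finset.sum_add_distrib]
    exact Finset.sum_congr rfl fun _ _ => Finset.sum_congr rfl fun _ _ => by ring
  simp only [ipNabla, ip_add_left, ip_smul_left, e1, e2]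
  ring

variable (N) in
/-- The spatial vector `∂_r W - W / r`. -/
def shiftDeriv (x : R4) : R4 := Fin.cons 0 fun i =>
  fderiv ℝ (fun x => N.W x i) x (radialDir x) - N.W x i / ‖spatial x‖

lemma ipNabla_nullIn_radialDir (hr : N.R₀ < r) (a : Fin 2) :
    ipNabla N.metric (N.surface r u) (N.nullIn (N.surface r u)) (tangent (N.surface r) a u)
      radialDir = (1 / 2) * (- fderiv ℝ N.U (N.surface r u) (tangent (N.surface r) a u) +
        N.hform (N.surface r u) (N.shiftDeriv (N.surface r u)) (tangent (N.surface r) a u)) := by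
  have hx := surface_mem_region hr u
  have hr0 := N.R₀_pos.trans hr
  have hs := metric_isSymm hx
  have hev := metric_eventually_isSymm hx
  set x := N.surface r u with hxd
  set t := tangent (N.surface r) a u with ht
  have ht0 : t 0 = 0 := tangent_surface_zero a
  have htr : rad x t = 0 := rad_tangent hr0 a
  have hrl : rad x (radialDir x) = 1 := by
    simpa only [rad, radialDir_succ, dotProduct] using normal_dot_self hx
  have h4 : ip N.metric x (N.nullIn x) (vecDeriv radialDir x t) = 0 := by
    rw [ip_nullIn hx, vecDeriv_radialDir hx]
    simp only [rad, pt_succ, pt_zero]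
    rw [show ∑ i, normal x i * t i.succ = 0 from htr]
    have : ∑ i, normal x i * ((t i.succ - 0 * normal x i) / ‖spatial x‖) =
        rad x t / ‖spatial x‖ := by
      rw [rad, Finset.sum_div]; exact Finset.sum_congr rfl fun i _ => by ring
    rw [this, htr]; simp
  have h1 : ipDeriv N.metric x t (N.nullIn x) (radialDir x) = - fderiv ℝ N.U x t := by
    have e := fderiv_ip (differentiableAt_metric hx) (differentiableAt_nullIn hx)
      (differentiableAt_radialDir hx) t
    have e3 : (fun x => ip N.metric x (N.nullIn x) (radialDir x)) =ᶠ[𝓝 x] fun x => - N.U x := by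
      filter_upwards [region_mem_nhds hx] with x' hx'
      rw [ip_comm (metric_isSymm hx'), ip_radialDir hx']; simp
    have e4 : ip N.metric x (vecDeriv N.nullIn x t) (radialDir x) = 0 := by
      rw [ip_comm hs, ip_radialDir hx, vecDeriv_nullIn_zero, mul_zero]
    rw [e3.fderiv_eq, e4, h4, fderiv_fun_neg] at e
    simp at e
    linarith
  have h2 : ipDeriv N.metric x (radialDir x) (N.nullIn x) t =
      N.hform x (Fin.cons 0 fun i => fderiv ℝ (fun x => N.W x i) x (radialDir x)) t := by
    rw [ipDeriv_nullIn hx _ ht0 htr]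
    have e1 : ∀ i, fderiv ℝ (fun x => normal x i) x (radialDir x) = 0 := fun i => by
      rw [fderiv_normal hx, hrl, radialDir_succ]; simp
    have e2 : vecDeriv N.nullIn x (radialDir x) =
        (-1 : ℝ) • (Fin.cons 0 fun i => fderiv ℝ (fun x => N.W x i) x (radialDir x) : R4) +
        (Fin.cons 0 fun i => - (fderiv ℝ N.V x (radialDir x) / 2) * normal x i : R4) := by
      ext κ
      refine Fin.cases ?_ (fun i => ?_) κ
      · simp [vecDeriv_nullIn_zero]
      · rw [vecDeriv_nullIn_succ hx, hrl, radialDir_succ]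
        simp; ring
    have e3 : N.hform x (Fin.cons 0 fun i => - (fderiv ℝ N.V x (radialDir x) / 2) * normal x i)
        t = 0 := hform_normal_left hx (fun i => rfl)
    rw [ip_metric_of_zero_zero (vecDeriv_nullIn_zero _) ht0, e2, hform_add_left, hform_smul_left,
      e3]
    simp [e1]
  have h3 : ipDeriv N.metric x (N.nullIn x) t (radialDir x) =
      (1 / ‖spatial x‖) * N.hform x (Fin.cons 0 (N.W x)) t := by
    rw [ipDeriv_comm hev, ipDeriv_radialDir hx _ ht0]
    have e2 : vecDeriv radialDir x (N.nullIn x) =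
        (- (1 / ‖spatial x‖)) • (Fin.cons 0 (N.W x) : R4) := by
      rw [vecDeriv_radialDir hx, rad_nullIn hx]
      ext κ
      refine Fin.cases ?_ (fun i => ?_) κ
      · simp
      · simp; ring
    rw [e2, ip_smul_left, ip_metric_of_zero_zero rfl ht0]
    ring
  have h5 : N.shiftDeriv x =
      (Fin.cons 0 fun i => fderiv ℝ (fun x => N.W x i) x (radialDir x) : R4) +
      (- (1 / ‖spatial x‖)) • (Fin.cons 0 (N.W x) : R4) := by
    ext κ
    refine Fin.cases ?_ (fun i => ?_) κ
    · simp [shiftDeriv]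
    · simp [shiftDeriv]; ring
  rw [ipNabla, h1, h2, h3, h4, h5, hform_add_left, hform_smul_left]
  ring

lemma connForm_surface (hr : N.R₀ < r) (hu : u ∈ polarDomain)
    (hP : ∀ y : E3, ‖y‖ = r → 0 < N.P (pt N.c y)) (a : Fin 2) :
    connForm N.metric radialDir (N.surface r) a u =
      - fderiv ℝ N.P (N.surface r u) (tangent (N.surface r) a u) / (2 * N.P (N.surface r u)) +
      N.hform (N.surface r u) (N.shiftDeriv (N.surface r u)) (tangent (N.surface r) a u) /
        (2 * N.U (N.surface r u)) := by
  have hr0 := N.R₀_pos.trans hr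
  have hPu : ∀ u, 0 < N.P (N.surface r u) := fun u => hP _ (norm_smul_polar hr0 u)
  have hUu : ∀ u, 0 < N.U (N.surface r u) := fun u => N.U_pos _ (surface_mem_region hr u)
  set B : ℝ × ℝ → ℝ := fun u => (Real.sqrt (N.P (N.surface r u) * N.U (N.surface r u)))⁻¹ with hB
  have hloc : (fun z => (normH N.metric (N.surface r) z)⁻¹ •
      dualJ N.metric radialDir (N.surface r) z) =ᶠ[𝓝 u]
      fun z => B z • N.gaugeVec 1 (N.surface r z) := by
    filter_upwards [isOpen_polarDomain.mem_nhds hu] with z hz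
    rw [normH_surface hr hz, dualJ_surface hr hz (hPu z), smul_smul,
      inv_normH_mul hr0 (hPu z) (hUu z)]
  have hH : (normH N.metric (N.surface r) u)⁻¹ • meanCurv N.metric (N.surface r) u =
      B u • N.gaugeVec (-1) (N.surface r u) := by
    rw [normH_surface hr hu, meanCurv_surface hr hu, smul_smul, inv_normH_mul hr0 (hPu u) (hUu u)]
  have hx := surface_mem_region hr u
  have hs := metric_isSymm hx
  have hev := metric_eventually_isSymm hx
  have hFd : DifferentiableAt ℝ (N.surface r) u := (contDiff_surface r).differentiable (by simp) u
  have dP := (contDiffAt_P hx).differentiableAt (by simp)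
  have dU := (contDiffAt_U hx).differentiableAt (by simp)
  have dBx : DifferentiableAt ℝ B u := by
    have h1 : DifferentiableAt ℝ (fun x => N.P x * N.U x) (N.surface r u) := dP.fun_mul dU
    have h2 : DifferentiableAt ℝ (fun z => N.P (N.surface r z) * N.U (N.surface r z)) u :=
      h1.comp u hFd
    have hpos := mul_pos (hPu u) (hUu u)
    exact (h2.sqrt hpos.ne').inv (Real.sqrt_pos.2 hpos).ne'
  have dPh : DifferentiableAt ℝ (fun x => 1 * (N.P x / 2)) (N.surface r u) := by
    simp only [div_eq_mul_inv]; exact (dP.mul_const _).const_mul _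
  have dg : ∀ κ, DifferentiableAt ℝ (fun x => N.gaugeVec 1 x κ) (N.surface r u) := fun κ =>
    (dPh.fun_mul (differentiableAt_radialDir hx κ)).fun_add (differentiableAt_nullIn hx κ)
  have dgF : ∀ κ, DifferentiableAt ℝ (fun z => N.gaugeVec 1 (N.surface r z) κ) u := fun κ =>
    DifferentiableAt.comp u (g := fun x => N.gaugeVec 1 x κ) (dg κ) hFd
  rw [connForm, covDeriv_congr hloc, hH, covDeriv_smul dBx dgF, ip_add_left, ip_smul_left,
    ip_smul_left, ip_smul_right, ip_smul_right, ip_gaugeVec hx, ip_comm hs,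
    ip_covDeriv_comp (metric_det_ne_zero hx) dg hFd]
  set x := N.surface r u with hxd
  set t := tangent (N.surface r) a u with ht
  have hU0 := (hUu u).ne'
  have hP0 := (hPu u).ne'
  rw [← hxd] at hU0 hP0
  have n1 : ipNabla N.metric x (radialDir x) t radialDir = 0 := by
    have := fderiv_ip_eq_ipNabla hev (differentiableAt_metric hx)
      (differentiableAt_radialDir hx) (differentiableAt_radialDir hx) t
    have e : (fun x => ip N.metric x (radialDir x) (radialDir x)) =ᶠ[𝓝 x] fun _ => 0 := by
      filter_upwards [region_mem_nhds hx] with x' hx'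
      rw [ip_radialDir hx']; simp
    rw [e.fderiv_eq] at this
    simp at this
    linarith
  have n2 : ipNabla N.metric x (N.nullIn x) t N.nullIn = 0 := by
    have := fderiv_ip_eq_ipNabla hev (differentiableAt_metric hx)
      (differentiableAt_nullIn hx) (differentiableAt_nullIn hx) t
    have e : (fun x => ip N.metric x (N.nullIn x) (N.nullIn x)) =ᶠ[𝓝 x] fun _ => 0 := by
      filter_upwards [region_mem_nhds hx] with x' hx'
      rw [ip_nullIn hx', rad_nullIn hx']; simp; ring
    rw [e.fderiv_eq] at this
    simp at this
    linarith
  have n3 : ipNabla N.metric x (radialDir x) t N.nullIn +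
      ipNabla N.metric x (N.nullIn x) t radialDir = - fderiv ℝ N.U x t := by
    rw [← fderiv_ip_eq_ipNabla hev (differentiableAt_metric hx)
      (differentiableAt_radialDir hx) (differentiableAt_nullIn hx) t]
    have e : (fun x => ip N.metric x (radialDir x) (N.nullIn x)) =ᶠ[𝓝 x] fun x => - N.U x := by
      filter_upwards [region_mem_nhds hx] with x' hx'
      rw [ip_radialDir hx']; simp
    rw [e.fderiv_eq, fderiv_fun_neg]; rfl
  have n4 := ipNabla_nullIn_radialDir (u := u) hr a
  rw [← hxd, ← ht] at n4
  have e0 : N.gaugeVec 1 = fun x => (1 * (N.P x / 2)) • radialDir x + N.nullIn x := rfl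
  have e1 : fderiv ℝ (fun x => 1 * (N.P x / 2)) x t = fderiv ℝ N.P x t / 2 := by
    simp only [one_mul, div_eq_mul_inv]
    rw [fderiv_mul_const dP]
    simp; ring
  have e2 : N.gaugeVec (-1) x = (- 1 * (N.P x / 2)) • radialDir x + N.nullIn x := rfl
  have e3 : ip N.metric x (N.gaugeVec (-1) x) (radialDir x) = - N.U x := by
    rw [ip_comm hs, ip_radialDir hx, e2]; simp
  rw [e0, ipNabla_smul_add dPh (differentiableAt_radialDir hx) (differentiableAt_nullIn hx), e1, e3,
    e2, ipNabla_add_smul_left, ipNabla_add_smul_left, n1, n2]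
  have n3' : ipNabla N.metric x (radialDir x) t N.nullIn = - fderiv ℝ N.U x t -
      ipNabla N.metric x (N.nullIn x) t radialDir := by linarith
  rw [n3', n4]
  have hB2 : B u * B u = (N.P x * N.U x)⁻¹ := by
    rw [hB]
    simp only
    rw [← mul_inv, Real.mul_self_sqrt (mul_pos (hPu u) (hUu u)).le]
  have : ∀ X : ℝ, B u * (B u * X) = X / (N.P x * N.U x) := fun X => by
    rw [← mul_assoc, hB2]; field_simp
  rw [this]
  field_simp
  ring

end Exterior


/-! ### Surfaces in Minkowski space -/

/-- The diagonal entries of the Minkowski form. -/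
def sgn : Fin 4 → ℝ := ![-1, 1, 1, 1]

lemma mink_eq_sum (v w : R4) : mink v w = ∑ β, sgn β * (v β * w β) := by
  simp only [mink, eta, dotProduct, mulVec_diagonal, sgn]
  exact Finset.sum_congr rfl fun β _ => by ring

lemma mink_eq (v w : R4) : mink v w = - (v 0 * w 0) + ∑ i : Fin 3, v i.succ * w i.succ := by
  rw [mink_eq_sum, Fin.sum_univ_succ]
  simp [sgn, Fin.sum_univ_three]

lemma ip_minkowski (x v w : R4) : ip minkowski x v w = mink v w := rfl

lemma minkowski_isSymm (x : R4) : (minkowski x).IsSymm := by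
  simp [minkowski, eta, IsSymm]

lemma mink_comm (v w : R4) : mink v w = mink w v := ip_comm (minkowski_isSymm 0) v w

lemma christoffel_minkowski (x : R4) (l μ ν : Fin 4) : christoffel minkowski x l μ ν = 0 := by
  simp [christoffel, minkowski]

lemma covDeriv_minkowski (F Z : ℝ × ℝ → R4) (a : Fin 2) (u : ℝ × ℝ) :
    covDeriv minkowski F Z a u = fun l => ud a (fun z => Z z l) u := by
  ext l; simp [covDeriv, christoffel_minkowski, ud]

/-- A component of an embedding of the sphere, extended to be constant along rays. -/
def emb (Y : E3 → R4) (β : Fin 4) : E3 → ℝ := radialExt fun n => Y n β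

/-- The metric induced by an embedding of the sphere in Cartesian components. -/
def embMetric (Y : E3 → R4) (i j : Fin 3) (y : E3) : ℝ :=
  ∑ β, sgn β * (pd i (emb Y β) y * pd j (emb Y β) y)

/-- The derivative of an embedding in the direction `q`. -/
def pushforward (Y : E3 → R4) (y : E3) (q : Fin 3 → ℝ) : R4 :=
  fun β => ∑ j, q j * pd j (emb Y β) y

namespace Exterior

variable (N : Exterior)

/-- The inverse metric on the slice `w = c`. -/
def Qc (i j : Fin 3) (y : E3) : ℝ := N.Q (pt N.c y) i j

/-- The metric of the spheres on the slice `w = c`. -/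
def hc (i j : Fin 3) (y : E3) : ℝ := N.h (pt N.c y) i j

/-- The mean curvature vector of an isometric embedding as the Laplacian of the embedding. -/
def lapEmb (Y : E3 → R4) (y : E3) : R4 :=
  fun β => ∑ i, pd i (fun z => ∑ j, N.Qc i j z * pd j (emb Y β) z) y

variable {N} {r : ℝ} {u : ℝ × ℝ} {Y : E3 → R4}

lemma normal_pt (w : ℝ) (y : E3) (i : Fin 3) : normal (pt w y) i = nrm i y := rfl

lemma contDiffAt_Q {x : R4} (hx : x ∈ N.region) (i j : Fin 3) :
    ContDiffAt ℝ ∞ (fun x => N.Q x i j) x := by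
  have hA : ∀ i j, ContDiffAt ℝ ∞ (fun x => (N.h x + vecMulVec (normal x) (normal x)) i j) x :=
    fun i j => (contDiffAt_h hx i j).add ((contDiffAt_normal hx i).mul (contDiffAt_normal hx j))
  refine ContDiffAt.sub ?_ ((contDiffAt_normal hx i).mul (contDiffAt_normal hx j))
  simp only [adjugate_fin_three]
  fin_cases i <;> fin_cases j <;>
    simp only [Matrix.of_apply, Fin.zero_eta, Fin.mk_one, Fin.reduceFinMk, Matrix.cons_val,
      sub_eq_add_neg, ← neg_mul] <;>
    first
    | exact ((hA _ _).mul (hA _ _)).add ((hA _ _).neg.mul (hA _ _))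
    | exact ((hA _ _).neg.mul (hA _ _)).add ((hA _ _).mul (hA _ _))

lemma contDiffAt_Qc {y : E3} (hy : N.R₀ < ‖y‖) (i j : Fin 3) : ContDiffAt ℝ ∞ (N.Qc i j) y :=
  ContDiffAt.comp y (contDiffAt_Q (pt_mem_region hy) i j) (contDiff_pt N.c).contDiffAt

lemma contDiffAt_hc {y : E3} (hy : N.R₀ < ‖y‖) (i j : Fin 3) : ContDiffAt ℝ ∞ (N.hc i j) y :=
  ContDiffAt.comp y (contDiffAt_h (pt_mem_region hy) i j) (contDiff_pt N.c).contDiffAt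

lemma ne_zero_of_lt {y : E3} (hy : N.R₀ < ‖y‖) : y ≠ 0 :=
  norm_pos_iff.1 (N.R₀_pos.trans hy)

lemma eventually_lt_norm {y : E3} (hy : N.R₀ < ‖y‖) : ∀ᶠ z in 𝓝 y, N.R₀ < ‖z‖ :=
  (isOpen_lt continuous_const continuous_norm).mem_nhds hy

lemma Qc_comm {y : E3} (hy : N.R₀ < ‖y‖) (i j : Fin 3) : N.Qc i j y = N.Qc j i y :=
  Q_comm (pt_mem_region hy) i j

lemma sum_Qc_nrm {y : E3} (hy : N.R₀ < ‖y‖) (i : Fin 3) : ∑ j, N.Qc i j y * nrm j y = 0 :=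
  sum_Q_normal (pt_mem_region hy) i

lemma sum_Qc_hc {y : E3} (hy : N.R₀ < ‖y‖) (i k : Fin 3) :
    ∑ j, N.Qc i j y * N.hc j k y = tproj i k y :=
  sum_Q_h (pt_mem_region hy) i k

lemma sum_Qc_pd_hc {y : E3} (hy : N.R₀ < ‖y‖) (k : Fin 3) :
    ∑ i, ∑ j, N.Qc i j y * pd k (N.hc i j) y = 0 := by
  have hx := pt_mem_region hy
  rw [← sum_Q_fderiv_h hx (Pi.single k.succ 1)]
  refine Finset.sum_congr rfl fun i _ => Finset.sum_congr rfl fun j _ => ?_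
  rw [← pd_comp_pt ((contDiffAt_h hx i j).differentiableAt (by simp))]
  rfl

lemma sum_hc_nrm {y : E3} (hy : N.R₀ < ‖y‖) (i : Fin 3) : ∑ j, N.hc i j y * nrm j y = 0 :=
  sum_h_normal (pt_mem_region hy) i

end Exterior

open Exterior

section Embedding

variable {N : Exterior} {r : ℝ} {u : ℝ × ℝ} {Y : E3 → R4}

lemma IsIsometricEmbedding.contDiffAt_emb (hY : IsIsometricEmbedding N r Y) {y : E3} (hy : y ≠ 0)
    (β : Fin 4) : ContDiffAt ℝ ∞ (emb Y β) y := (hY.smooth β).contDiffAt_radialExt hy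

lemma emb_smul_polar (hr : 0 < r) (u : ℝ × ℝ) (β : Fin 4) :
    emb Y β (r • polar u) = Y (polar u) β :=
  radialExt_smul_of_norm_one _ hr (norm_polar u)

lemma comp_polar_eq (hr : 0 < r) (β : Fin 4) :
    (fun z => Y (polar z) β) = fun z => emb Y β (r • polar z) :=
  funext fun z => (emb_smul_polar hr z β).symm

lemma pushforward_nrm (hY : IsIsometricEmbedding N r Y) {y : E3} (hy : y ≠ 0) :
    pushforward Y y (fun i => nrm i y) = 0 := by
  ext β
  have := (homog_radialExt fun n => Y n β).sum_nrm_mul_pd hy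
    ((hY.contDiffAt_emb hy β).differentiableAt (by simp))
  exact this.trans (by simp)

lemma pushforward_add (y : E3) (q q' : Fin 3 → ℝ) :
    pushforward Y y (q + q') = pushforward Y y q + pushforward Y y q' := by
  ext β; simp [pushforward, add_mul, Finset.sum_add_distrib]

lemma pushforward_smul (y : E3) (c : ℝ) (q : Fin 3 → ℝ) :
    pushforward Y y (c • q) = c • pushforward Y y q := by
  ext β; simp [pushforward, Finset.mul_sum, mul_assoc]

lemma mink_pushforward (y : E3) (q q' : Fin 3 → ℝ) :
    mink (pushforward Y y q) (pushforward Y y q') = ∑ i, ∑ j, q i * q' j * embMetric Y i j y := by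
  simp only [mink_eq_sum, pushforward, embMetric, Fin.sum_univ_three, Fin.sum_univ_four]
  ring

lemma tangent_emb (hY : IsIsometricEmbedding N r Y) (hr : 0 < r) (a : Fin 2) (u : ℝ × ℝ) :
    tangent (fun z => Y (polar z)) a u =
      r • pushforward Y (r • polar u) (fun j => sphTan a u j) := by
  have hd : ∀ β, DifferentiableAt ℝ (fun z => Y (polar z) β) u := fun β => by
    rw [comp_polar_eq hr]
    exact (contDiffAt_comp_smul_polar (hY.contDiffAt_emb (smul_polar_ne_zero hr u) β)).differentiableAt
      (by simp)
  ext β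
  have h1 : tangent (fun z => Y (polar z)) a u β = ud a (fun z => Y (polar z) β) u := by
    have := hasFDerivAt_pi.2 fun β => (hd β).hasFDerivAt
    rw [tangent, ud]
    rw [show (fun z => Y (polar z)) = fun z β => Y (polar z) β from rfl, this.fderiv]
    rfl
  rw [h1, comp_polar_eq hr, ud_comp_smul_polar
    ((hY.contDiffAt_emb (smul_polar_ne_zero hr u) β).differentiableAt (by simp))]
  rfl

lemma frame_decomp (u : ℝ × ℝ) (c : Fin 3 → ℝ) (i : Fin 3) :
    c i = unitTheta u i * ∑ k, c k * unitTheta u k + unitPhi u i * ∑ k, c k * unitPhi u k +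
      polar u i * ∑ k, c k * polar u k := by
  have h : c i = ∑ k, c k * (if k = i then 1 else 0) := by simp
  have hc : ∀ k, (if k = i then (1 : ℝ) else 0) = unitTheta u k * unitTheta u i +
    unitPhi u k * unitPhi u i + polar u k * polar u i := fun k => by rw [frame_complete]; ring
  rw [h]
  simp only [hc, Fin.sum_univ_three]
  ring

lemma eq_zero_of_sphTan {c : Fin 3 → ℝ} (hu : u ∈ polarDomain)
    (hn : ∑ k, c k * polar u k = 0) (h : ∀ a, ∑ k, c k * sphTan a u k = 0) (i : Fin 3) :
    c i = 0 := by
  have h0 : ∑ k, c k * unitTheta u k = 0 := h 0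
  have h1 : Real.sin u.1 * ∑ k, c k * unitPhi u k = 0 := by
    rw [← h 1, Finset.mul_sum]
    refine Finset.sum_congr rfl fun k _ => ?_
    rw [show sphTan 1 u k = Real.sin u.1 * unitPhi u k from rfl]; ring
  rw [frame_decomp u c i, hn, h0, (mul_eq_zero.1 h1).resolve_left (sin_pos_of_mem hu).ne']
  simp

lemma eq_zero_of_frame {A : Fin 3 → Fin 3 → ℝ} (hs : ∀ i j, A i j = A j i)
    (hn : ∀ i, ∑ j, A i j * polar u j = 0) (hu : u ∈ polarDomain)
    (h : ∀ a b, ∑ i, ∑ j, sphTan a u i * sphTan b u j * A i j = 0) (i j : Fin 3) : A i j = 0 := by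
  refine eq_zero_of_sphTan hu (hn i) (fun b => ?_) j
  refine eq_zero_of_sphTan (c := fun i => ∑ j, A i j * sphTan b u j) hu ?_ (fun a => ?_) i
  · have : ∑ k, (∑ j, A k j * sphTan b u j) * polar u k =
        ∑ j, sphTan b u j * ∑ k, A j k * polar u k := by
      simp only [Finset.sum_mul, Finset.mul_sum]
      rw [Finset.sum_comm]
      exact Finset.sum_congr rfl fun j _ => Finset.sum_congr rfl fun k _ => by rw [hs k j]; ring
    rw [this]
    exact Finset.sum_eq_zero fun j _ => by rw [hn, mul_zero]
  · rw [← h a b]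
    simp only [Finset.sum_mul]
    exact Finset.sum_congr rfl fun j _ => Finset.sum_congr rfl fun k _ => by ring

lemma lt_norm_smul_polar (hr : N.R₀ < r) (u : ℝ × ℝ) : N.R₀ < ‖r • polar u‖ := by
  rwa [norm_smul_polar (N.R₀_pos.trans hr)]

/-- The isometry condition in Cartesian components. -/
lemma embMetric_eq (hY : IsIsometricEmbedding N r Y) (hr : N.R₀ < r) (hu : u ∈ polarDomain)
    (i j : Fin 3) : embMetric Y i j (r • polar u) = N.hc i j (r • polar u) := by
  have hr0 := N.R₀_pos.trans hr
  have hy := smul_polar_ne_zero hr0 u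
  rw [← sub_eq_zero]
  refine eq_zero_of_frame (A := fun i j => embMetric Y i j (r • polar u) - N.hc i j (r • polar u))
    ?_ ?_ hu ?_ i j
  · intro i j
    have h1 : embMetric Y i j (r • polar u) = embMetric Y j i (r • polar u) :=
      Finset.sum_congr rfl fun β _ => by ring
    have h2 : N.hc i j (r • polar u) = N.hc j i (r • polar u) :=
      h_comm (surface_mem_region hr u) i j
    simp only [h1, h2]
  · intro i
    have h1 := pushforward_nrm hY hy
    have h2 := sum_hc_nrm (lt_norm_smul_polar hr u) i
    simp only [nrm_smul_polar hr0] at h1 h2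
    simp only [sub_mul, Finset.sum_sub_distrib, h2, sub_zero, embMetric, Finset.sum_mul]
    rw [Finset.sum_comm]
    refine Finset.sum_eq_zero fun β _ => ?_
    have h3 := congrFun h1 β
    simp only [pushforward, Pi.zero_apply] at h3
    calc _ = sgn β * pd i (emb Y β) (r • polar u) *
          ∑ j, polar u j * pd j (emb Y β) (r • polar u) := by
          rw [Finset.mul_sum]; exact Finset.sum_congr rfl fun j _ => by ring
      _ = 0 := by rw [h3, mul_zero]
  · intro a b
    have h1 := congrFun (congrFun (hY.isometric u hu) a) b
    rw [inducedMetric_eq_hform] at h1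
    have h2 : inducedMetric minkowski (fun z => Y (polar z)) u a b =
        r ^ 2 * ∑ i, ∑ j, sphTan a u i * sphTan b u j * embMetric Y i j (r • polar u) := by
      change ip minkowski _ (tangent (fun z => Y (polar z)) a u)
        (tangent (fun z => Y (polar z)) b u) = _
      rw [tangent_emb hY hr0, tangent_emb hY hr0, ip_smul_left, ip_smul_right, ip_minkowski,
        mink_pushforward]
      ring
    have h3 : N.hform (N.surface r u) (tangent (N.surface r) a u) (tangent (N.surface r) b u) =
        r ^ 2 * ∑ i, ∑ j, sphTan a u i * sphTan b u j * N.hc i j (r • polar u) := by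
      simp only [hform, tangent_surface_succ, Finset.mul_sum]
      exact Finset.sum_congr rfl fun _ _ => Finset.sum_congr rfl fun _ _ => by
        rw [hc, surface]; ring
    rw [h2, h3] at h1
    have h4 := mul_left_cancel₀ (pow_ne_zero 2 hr0.ne') h1
    simp only [mul_sub, Finset.sum_sub_distrib, h4, sub_self]

lemma differentiableAt_pd_emb (hY : IsIsometricEmbedding N r Y) {y : E3} (hy : y ≠ 0) (j : Fin 3)
    (β : Fin 4) : DifferentiableAt ℝ (pd j (emb Y β)) y :=
  (contDiffAt_pd (hY.contDiffAt_emb hy β) j).differentiableAt (by simp)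

lemma contDiffAt_embMetric (hY : IsIsometricEmbedding N r Y) {y : E3} (hy : y ≠ 0) (i j : Fin 3) :
    ContDiffAt ℝ ∞ (embMetric Y i j) y :=
  ContDiffAt.sum fun β _ => contDiffAt_const.mul
    ((contDiffAt_pd (hY.contDiffAt_emb hy β) i).mul (contDiffAt_pd (hY.contDiffAt_emb hy β) j))

lemma pd_embMetric (hY : IsIsometricEmbedding N r Y) {y : E3} (hy : y ≠ 0) (i j k : Fin 3) :
    pd k (embMetric Y i j) y = ∑ β, sgn β * (pd k (pd i (emb Y β)) y * pd j (emb Y β) y +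
      pd i (emb Y β) y * pd k (pd j (emb Y β)) y) := by
  have d := fun j β => differentiableAt_pd_emb hY hy j β
  rw [show embMetric Y i j = fun y => ∑ β, sgn β * (pd i (emb Y β) y * pd j (emb Y β) y) from rfl,
    pd_sum fun β _ => ((d i β).fun_mul (d j β)).const_mul _]
  refine Finset.sum_congr rfl fun β _ => ?_
  rw [pd_const_mul _ ((d i β).fun_mul (d j β)), pd_mul (d i β) (d j β)]

/-- The tangential derivatives of the metrics agree. -/
lemma sum_sphTan_pd_embMetric (hY : IsIsometricEmbedding N r Y) (hr : N.R₀ < r)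
    (hu : u ∈ polarDomain) (a : Fin 2) (i j : Fin 3) :
    ∑ k, sphTan a u k * pd k (embMetric Y i j) (r • polar u) =
      ∑ k, sphTan a u k * pd k (N.hc i j) (r • polar u) := by
  have hr0 := N.R₀_pos.trans hr
  have hy := smul_polar_ne_zero hr0 u
  have h1 : (fun z => embMetric Y i j (r • polar z)) =ᶠ[𝓝 u] fun z => N.hc i j (r • polar z) := by
    filter_upwards [isOpen_polarDomain.mem_nhds hu] with z hz using embMetric_eq hY hr hz i j
  have h2 := ud_congr h1 a
  rw [ud_comp_smul_polar ((contDiffAt_embMetric hY hy i j).differentiableAt (by simp)),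
    ud_comp_smul_polar ((contDiffAt_hc (lt_norm_smul_polar hr u) i j).differentiableAt (by simp))]
    at h2
  exact mul_left_cancel₀ hr0.ne' h2

lemma sum_Qc_pd_embMetric (hY : IsIsometricEmbedding N r Y) (hr : N.R₀ < r)
    (hu : u ∈ polarDomain) (l i j : Fin 3) :
    ∑ k, N.Qc l k (r • polar u) * pd k (embMetric Y i j) (r • polar u) =
      ∑ k, N.Qc l k (r • polar u) * pd k (N.hc i j) (r • polar u) := by
  have h := fun a => sum_sphTan_pd_embMetric hY hr hu a i j
  have e : ∀ c : Fin 3 → ℝ, ∑ k, N.Qc l k (r • polar u) * c k =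
      ∑ a, ∑ b, (inducedMetric N.metric (N.surface r) u)⁻¹ a b *
        ((r * sphTan a u l) * (r * ∑ k, sphTan b u k * c k)) := fun c => by
    have : ∀ k, N.Qc l k (r • polar u) = N.Q (N.surface r u) l k := fun k => rfl
    simp only [this, ← sum_inv_inducedMetric hr hu, Fin.sum_univ_two, Fin.sum_univ_three]
    ring
  rw [e, e]
  simp only [h]

lemma lapEmb_eq (hY : IsIsometricEmbedding N r Y) {y : E3} (hy : N.R₀ < ‖y‖) (β : Fin 4) :
    N.lapEmb Y y β = ∑ i, ∑ j, (pd i (N.Qc i j) y * pd j (emb Y β) y +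
      N.Qc i j y * pd i (pd j (emb Y β)) y) := by
  have d := fun j => differentiableAt_pd_emb hY (ne_zero_of_lt hy) j β
  have dQ := fun i j => (contDiffAt_Qc hy i j).differentiableAt (by simp)
  refine Finset.sum_congr rfl fun i _ => ?_
  rw [pd_sum fun j _ => (dQ i j).fun_mul (d j)]
  exact Finset.sum_congr rfl fun j _ => pd_mul (dQ i j) (d j) i

lemma mink_lapEmb_pushforward (hY : IsIsometricEmbedding N r Y) (hr : N.R₀ < r)
    (hu : u ∈ polarDomain) (q : Fin 3 → ℝ) :
    mink (N.lapEmb Y (r • polar u)) (pushforward Y (r • polar u) q) = 0 := by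
  have hr0 := N.R₀_pos.trans hr
  have hyR := lt_norm_smul_polar hr u
  have hy := smul_polar_ne_zero hr0 u
  set y := r • polar u with hyd
  have hg := fun i j => embMetric_eq hY hr hu i j
  rw [← hyd] at hg
  have hdg := fun l i j => sum_Qc_pd_embMetric hY hr hu l i j
  rw [← hyd] at hdg
  -- the divergence of the inverse metric
  have hdiv : ∀ k, ∑ i, ∑ j, (pd i (N.Qc i j) y * N.hc j k y + N.Qc i j y * pd i (N.hc j k) y) =
      - 2 * nrm k y / ‖y‖ := fun k => by
    have h1 : ∀ i, pd i (fun z => ∑ j, N.Qc i j z * N.hc j k z) y = pd i (tproj i k) y := fun i => by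
      apply pd_congr
      filter_upwards [eventually_lt_norm hyR] with z hz using sum_Qc_hc hz i k
    have dQ := fun i j => (contDiffAt_Qc hyR i j).differentiableAt (by simp)
    have dh := fun i j => (contDiffAt_hc hyR i j).differentiableAt (by simp)
    have h2 : ∀ i, ∑ j, (pd i (N.Qc i j) y * N.hc j k y + N.Qc i j y * pd i (N.hc j k) y) =
        pd i (tproj i k) y := fun i => by
      rw [← h1, pd_sum fun j _ => (dQ i j).fun_mul (dh j k)]
      exact Finset.sum_congr rfl fun j _ => (pd_mul (dQ i j) (dh j k) i).symm
    simp only [h2, pd_tproj hy]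
    have h3 := sum_tproj_self hy
    have h4 := sum_tproj_nrm hy k
    rw [← Finset.sum_div, Finset.sum_neg_distrib, Finset.sum_add_distrib, ← Finset.sum_mul, h3]
    have h5 : ∑ i, nrm i y * tproj k i y = 0 := by
      rw [← h4]; exact Finset.sum_congr rfl fun i _ => mul_comm _ _
    rw [h5]; ring
  have hT : ∀ k, ∑ β, sgn β * (N.lapEmb Y y β * pd k (emb Y β) y) = - 2 * nrm k y / ‖y‖ -
      (1 / 2) * ∑ i, ∑ j, N.Qc i j y * pd k (embMetric Y i j) y := fun k => by
    have e1 : ∑ i, ∑ j, N.Qc i j y * pd i (N.hc j k) y =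
        ∑ i, ∑ j, N.Qc i j y * pd i (embMetric Y j k) y := by
      have : ∀ j, ∑ i, N.Qc i j y * pd i (N.hc j k) y =
          ∑ i, N.Qc i j y * pd i (embMetric Y j k) y := fun j => by
        have := hdg j j k
        simp only [Qc_comm hyR j] at this
        exact this.symm
      rw [Finset.sum_comm]
      simp only [this]
      rw [Finset.sum_comm]
    have e2 := hdiv k
    simp only [Finset.sum_add_distrib] at e2
    rw [e1] at e2
    have e3 : ∑ β, sgn β * (N.lapEmb Y y β * pd k (emb Y β) y) =
        ∑ i, ∑ j, (pd i (N.Qc i j) y * embMetric Y j k y) +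
        ∑ i, ∑ j, N.Qc i j y * ∑ β, sgn β * (pd i (pd j (emb Y β)) y * pd k (emb Y β) y) := by
      simp only [lapEmb_eq hY hyR, embMetric, Fin.sum_univ_three, Fin.sum_univ_four]
      ring
    have e4 : ∑ i, ∑ j, N.Qc i j y * ∑ β, sgn β * (pd i (pd j (emb Y β)) y * pd k (emb Y β) y) =
        ∑ i, ∑ j, N.Qc i j y * pd i (embMetric Y j k) y -
        ∑ i, ∑ j, N.Qc i j y * ∑ β, sgn β * (pd j (emb Y β) y * pd i (pd k (emb Y β)) y) := by
      simp only [pd_embMetric hY hy, mul_add, Finset.sum_add_distrib]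
      ring
    have e5 : ∑ i, ∑ j, N.Qc i j y * pd k (embMetric Y i j) y =
        2 * ∑ i, ∑ j, N.Qc i j y * ∑ β, sgn β * (pd j (emb Y β) y * pd i (pd k (emb Y β)) y) := by
      have f1 : ∀ i β, pd k (pd i (emb Y β)) y = pd i (pd k (emb Y β)) y := fun i β =>
        pd_comm (hY.contDiffAt_emb hy β) k i
      simp only [pd_embMetric hY hy, f1, mul_add, Finset.sum_add_distrib]
      have f2 : ∑ i, ∑ j, N.Qc i j y * ∑ β, sgn β * (pd i (emb Y β) y * pd j (pd k (emb Y β)) y) =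
          ∑ i, ∑ j, N.Qc i j y * ∑ β, sgn β * (pd j (emb Y β) y * pd i (pd k (emb Y β)) y) := by
        rw [Finset.sum_comm]
        exact Finset.sum_congr rfl fun i _ => Finset.sum_congr rfl fun j _ => by rw [Qc_comm hyR]
      have f3 : ∑ i, ∑ j, N.Qc i j y * ∑ β, sgn β * (pd i (pd k (emb Y β)) y * pd j (emb Y β) y) =
          ∑ i, ∑ j, N.Qc i j y * ∑ β, sgn β * (pd j (emb Y β) y * pd i (pd k (emb Y β)) y) :=
        Finset.sum_congr rfl fun i _ => Finset.sum_congr rfl fun j _ => by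
          congr 1; exact Finset.sum_congr rfl fun β _ => by ring
      rw [f2, f3]; ring
    simp only [← hg] at e2
    rw [e3, e4, e5]
    linarith
  -- tangential directions suffice
  have htan : ∀ a, mink (N.lapEmb Y y) (pushforward Y y fun j => sphTan a u j) = 0 := fun a => by
    have h1 : mink (N.lapEmb Y y) (pushforward Y y fun j => sphTan a u j) =
        ∑ k, sphTan a u k * ∑ β, sgn β * (N.lapEmb Y y β * pd k (emb Y β) y) := by
      simp only [mink_eq_sum, pushforward, Fin.sum_univ_three, Fin.sum_univ_four]
      ring
    have h2 : ∑ k, sphTan a u k * nrm k y = 0 := by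
      simp only [hyd, nrm_smul_polar hr0]; exact sum_sphTan_polar a u
    have h3 : ∑ k, sphTan a u k * ∑ i, ∑ j, N.Qc i j y * pd k (embMetric Y i j) y = 0 := by
      have g1 : ∑ k, sphTan a u k * ∑ i, ∑ j, N.Qc i j y * pd k (embMetric Y i j) y =
          ∑ i, ∑ j, N.Qc i j y * ∑ k, sphTan a u k * pd k (embMetric Y i j) y := by
        simp only [Fin.sum_univ_three]; ring
      have g2 : ∑ k, sphTan a u k * ∑ i, ∑ j, N.Qc i j y * pd k (N.hc i j) y =
          ∑ i, ∑ j, N.Qc i j y * ∑ k, sphTan a u k * pd k (N.hc i j) y := by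
        simp only [Fin.sum_univ_three]; ring
      have g3 := fun i j => sum_sphTan_pd_embMetric hY hr hu a i j
      rw [← hyd] at g3
      rw [g1]
      simp only [g3]
      rw [← g2]
      simp [sum_Qc_pd_hc hyR]
    rw [h1]
    simp only [hT, mul_sub, Finset.sum_sub_distrib]
    have h4 : ∑ k, sphTan a u k * (- 2 * nrm k y / ‖y‖) =
        (- 2 / ‖y‖) * ∑ k, sphTan a u k * nrm k y := by
      rw [Finset.mul_sum]; exact Finset.sum_congr rfl fun k _ => by ring
    have h5 : ∑ k, sphTan a u k * (1 / 2 * ∑ i, ∑ j, N.Qc i j y * pd k (embMetric Y i j) y) =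
        (1 / 2) * ∑ k, sphTan a u k * ∑ i, ∑ j, N.Qc i j y * pd k (embMetric Y i j) y := by
      rw [Finset.mul_sum]; exact Finset.sum_congr rfl fun k _ => by ring
    rw [h4, h5, h2, h3]; simp
  have hsin := (sin_pos_of_mem hu).ne'
  have hph : mink (N.lapEmb Y y) (pushforward Y y fun j => unitPhi u j) = 0 := by
    have h1 := htan 1
    have h2 : (fun j => sphTan 1 u j) = Real.sin u.1 • fun j => unitPhi u j := rfl
    rw [h2, pushforward_smul, ← ip_minkowski 0, ip_smul_right] at h1
    exact (mul_eq_zero.1 h1).resolve_left hsin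
  have hth : mink (N.lapEmb Y y) (pushforward Y y fun j => unitTheta u j) = 0 := htan 0
  have hdec : q = (∑ k, q k * unitTheta u k) • (fun j => unitTheta u j) +
      (∑ k, q k * unitPhi u k) • (fun j => unitPhi u j) +
      (∑ k, q k * polar u k) • (fun j => nrm j y) := by
    ext j
    simp only [Pi.add_apply, Pi.smul_apply, smul_eq_mul, hyd, nrm_smul_polar hr0]
    rw [frame_decomp u q j]
    ring
  rw [hdec, pushforward_add, pushforward_add, pushforward_smul, pushforward_smul, pushforward_smul,
    pushforward_nrm hY hy, ← ip_minkowski 0, ip_add_right, ip_add_right, ip_smul_right,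
    ip_smul_right, ip_smul_right, ip_minkowski, ip_minkowski, hth, hph]
  simp

end Embedding


open Exterior

section EnergyDensity

variable {N : Exterior} {r : ℝ} {u : ℝ × ℝ} {Y : E3 → R4}

/-! ### The mean curvature vector of an isometric embedding -/

lemma inducedMetric_emb_det_ne_zero (hY : IsIsometricEmbedding N r Y) (hr : N.R₀ < r)
    (hu : u ∈ polarDomain) : (inducedMetric minkowski (fun z => Y (polar z)) u).det ≠ 0 := by
  rw [hY.isometric u hu]; exact det_inducedMetric_ne_zero hr hu

lemma normalPart_pushforward (hY : IsIsometricEmbedding N r Y) (hr : N.R₀ < r)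
    (hu : u ∈ polarDomain) (q : Fin 3 → ℝ) :
    normalPart minkowski (fun z => Y (polar z)) u (pushforward Y (r • polar u) q) = 0 := by
  have hr0 := N.R₀_pos.trans hr
  have h : ∀ a, normalPart minkowski (fun z => Y (polar z)) u
      (pushforward Y (r • polar u) fun j => sphTan a u j) = 0 := fun a => by
    have h1 := normalPart_tangent (F := fun z => Y (polar z)) (minkowski_isSymm _)
      (inducedMetric_emb_det_ne_zero hY hr hu) a
    rw [tangent_emb hY hr0, normalPart_smul] at h1
    exact (smul_eq_zero.1 h1).resolve_left hr0.ne'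
  have h0 : normalPart minkowski (fun z => Y (polar z)) u
      (pushforward Y (r • polar u) fun j => unitTheta u j) = 0 := h 0
  have h1 : normalPart minkowski (fun z => Y (polar z)) u
      (pushforward Y (r • polar u) fun j => unitPhi u j) = 0 := by
    have h2 := h 1
    rw [show (fun j => sphTan 1 u j) = Real.sin u.1 • fun j => unitPhi u j from rfl,
      pushforward_smul, normalPart_smul] at h2
    exact (smul_eq_zero.1 h2).resolve_left (sin_pos_of_mem hu).ne'
  have hdec : q = (∑ k, q k * unitTheta u k) • (fun j => unitTheta u j) +
      (∑ k, q k * unitPhi u k) • (fun j => unitPhi u j) +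
      (∑ k, q k * polar u k) • (fun j => nrm j (r • polar u)) := by
    ext j
    simp only [Pi.add_apply, Pi.smul_apply, smul_eq_mul, nrm_smul_polar hr0]
    rw [frame_decomp u q j]
    ring
  rw [hdec, pushforward_add, pushforward_add, pushforward_smul, pushforward_smul, pushforward_smul,
    pushforward_nrm hY (smul_polar_ne_zero hr0 u), normalPart_add, normalPart_add, normalPart_smul,
    normalPart_smul, h0, h1]
  simp [normalPart_zero]

/-- The second partial derivatives of an embedding. -/
def hessEmb (Y : E3 → R4) (y : E3) (k j : Fin 3) : R4 := fun β => pd k (pd j (emb Y β)) y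

lemma covDeriv_tangent_emb (hY : IsIsometricEmbedding N r Y) (hr : 0 < r) (a b : Fin 2) :
    covDeriv minkowski (fun z => Y (polar z)) (tangent (fun z => Y (polar z)) b) a u =
      pushforward Y (r • polar u) (fun j => r * ud a (fun z => sphTan b z j) u) +
      ∑ k, ∑ j, ((r * sphTan a u k) * (r * sphTan b u j)) • hessEmb Y (r • polar u) k j := by
  have hy := smul_polar_ne_zero hr u
  ext β
  have e : (fun z => tangent (fun z => Y (polar z)) b z β) =
      fun z => r * ∑ j, sphTan b z j * pd j (emb Y β) (r • polar z) := by
    ext z; rw [tangent_emb hY hr]; rfl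
  have d1 := fun j => differentiable_coord (contDiff_sphTan b) j u
  have d2 : ∀ j, DifferentiableAt ℝ (fun z => pd j (emb Y β) (r • polar z)) u := fun j =>
    (contDiffAt_comp_smul_polar (contDiffAt_pd (hY.contDiffAt_emb hy β) j)).differentiableAt (by simp)
  rw [covDeriv_minkowski]
  simp only [e]
  rw [ud_const_mul _ (DifferentiableAt.fun_sum fun j _ => (d1 j).fun_mul (d2 j)),
    ud_sum fun j _ => (d1 j).fun_mul (d2 j)]
  have e2 : ∀ j, ud a (fun z => sphTan b z j * pd j (emb Y β) (r • polar z)) u =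
      ud a (fun z => sphTan b z j) u * pd j (emb Y β) (r • polar u) +
      sphTan b u j * (r * ∑ k, sphTan a u k * pd k (pd j (emb Y β)) (r • polar u)) := fun j => by
    rw [ud_mul (d1 j) (d2 j), ud_comp_smul_polar (differentiableAt_pd_emb hY hy j β)]
  simp only [e2, Pi.add_apply, pushforward, hessEmb, Pi.smul_apply, smul_eq_mul,
    Fin.sum_univ_three]
  ring

lemma lapEmb_eq_pushforward_add (hY : IsIsometricEmbedding N r Y) {y : E3} (hy : N.R₀ < ‖y‖) :
    N.lapEmb Y y = pushforward Y y (fun j => ∑ i, pd i (N.Qc i j) y) +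
      ∑ k, ∑ j, N.Qc k j y • hessEmb Y y k j := by
  ext β
  rw [lapEmb_eq hY hy]
  simp only [Pi.add_apply, pushforward, hessEmb, Pi.smul_apply, smul_eq_mul,
    Fin.sum_univ_three]
  ring

lemma meanCurv_emb (hY : IsIsometricEmbedding N r Y) (hr : N.R₀ < r) (hu : u ∈ polarDomain) :
    meanCurv minkowski (fun z => Y (polar z)) u = N.lapEmb Y (r • polar u) := by
  have hr0 := N.R₀_pos.trans hr
  have h1 : normalPart minkowski (fun z => Y (polar z)) u (N.lapEmb Y (r • polar u)) =
      N.lapEmb Y (r • polar u) := by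
    apply normalPart_of_orthogonal
    intro a
    rw [tangent_emb hY hr0, ip_smul_right, ip_minkowski, mink_lapEmb_pushforward hY hr hu, mul_zero]
  rw [← h1, lapEmb_eq_pushforward_add hY (lt_norm_smul_polar hr u), normalPart_add,
    normalPart_pushforward hY hr hu, zero_add, meanCurv]
  simp only [covDeriv_tangent_emb hY hr0, normalPart_add, normalPart_pushforward hY hr hu, zero_add,
    normalPart_sum, normalPart_smul, hY.isometric u hu]
  ext β
  have := sum_inv_inducedMetric_mul hr hu fun k j =>
    normalPart minkowski (fun z => Y (polar z)) u (hessEmb Y (r • polar u) k j) β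
  simp only [Finset.sum_apply, Pi.smul_apply, smul_eq_mul]
  simp only [Qc]
  refine Eq.trans ?_ this
  refine Finset.sum_congr rfl fun a _ => Finset.sum_congr rfl fun b _ => ?_
  congr 1
  exact Finset.sum_congr rfl fun k _ => Finset.sum_congr rfl fun j _ => by ring

/-! ### The dual normal of an isometric embedding -/

namespace Exterior

variable (N)

/-- The square of the mean curvature of an isometric embedding. -/
def lapSq (Y : E3 → R4) (y : E3) : ℝ := mink (N.lapEmb Y y) (N.lapEmb Y y)

/-- The projection of the time direction to the normal line orthogonal to the mean curvature. -/
def timeProj (Y : E3 → R4) (y : E3) : R4 := fun β =>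
  (if β = 0 then 1 else 0) +
    ∑ i, ∑ j, N.Qc i j y * (pd i (emb Y 0) y * pd j (emb Y β) y) +
    N.lapEmb Y y 0 / N.lapSq Y y * N.lapEmb Y y β

/-- The unit normal dual to the mean curvature vector of an isometric embedding. -/
def dualEmb (Y : E3 → R4) (y : E3) : R4 := (Real.sqrt (N.timeProj Y y 0))⁻¹ • N.timeProj Y y

/-- The connection form of the mean curvature gauge of an isometric embedding. -/
def embConn (Y : E3 → R4) (y : E3) (k : Fin 3) : ℝ :=
  - (∑ β, sgn β * (N.dualEmb Y y β * pd k (fun z => N.lapEmb Y z β) y)) / Real.sqrt (N.lapSq Y y)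

/-- The condition under which the mean curvature vector of the embedding is spacelike and its dual
is defined. -/
structure GoodAt (Y : E3 → R4) (y : E3) : Prop where
  lapSq_pos : 0 < N.lapSq Y y
  time_pos : 0 < N.timeProj Y y 0

end Exterior

lemma timeProj_eq (Y : E3 → R4) (y : E3) : N.timeProj Y y = Pi.single 0 1 +
    pushforward Y y (fun j => ∑ i, N.Qc i j y * pd i (emb Y 0) y) +
    (N.lapEmb Y y 0 / N.lapSq Y y) • N.lapEmb Y y := by
  ext β
  simp only [timeProj, Pi.add_apply, Pi.single_apply, Pi.smul_apply, smul_eq_mul, pushforward,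
    Fin.sum_univ_three]
  ring

lemma mink_time (v : R4) : mink v (Pi.single 0 1) = - v 0 := by
  rw [mink_eq]; simp

lemma mink_timeProj_pushforward (hY : IsIsometricEmbedding N r Y) (hr : N.R₀ < r)
    (hu : u ∈ polarDomain) (q : Fin 3 → ℝ) :
    mink (N.timeProj Y (r • polar u)) (pushforward Y (r • polar u) q) = 0 := by
  have hr0 := N.R₀_pos.trans hr
  have hy := smul_polar_ne_zero hr0 u
  have hyR := lt_norm_smul_polar hr u
  set y := r • polar u with hyd
  have hg := fun i j => embMetric_eq hY hr hu i j
  rw [← hyd] at hg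
  have h1 : mink (pushforward Y y fun j => ∑ i, N.Qc i j y * pd i (emb Y 0) y) (pushforward Y y q) =
      ∑ i, ∑ k, pd i (emb Y 0) y * q k * ∑ j, N.Qc i j y * N.hc j k y := by
    rw [mink_pushforward]
    simp only [hg, Fin.sum_univ_three]
    ring
  have h2 := congrFun (pushforward_nrm hY hy) 0
  simp only [sum_Qc_hc hyR, tproj] at h1
  have h3 : ∑ i, ∑ k, pd i (emb Y 0) y * q k * ((if i = k then 1 else 0) - nrm i y * nrm k y) =
      pushforward Y y q 0 - pushforward Y y (fun i => nrm i y) 0 * ∑ k, q k * nrm k y := by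
    simp [pushforward, Fin.sum_univ_three]
    ring
  rw [h3, h2] at h1
  rw [timeProj_eq, ← ip_minkowski 0, ip_add_left, ip_add_left, ip_smul_left, ip_minkowski,
    ip_minkowski, ip_minkowski, mink_lapEmb_pushforward hY hr hu, h1, mink_comm, mink_time]
  simp

lemma mink_timeProj_lapEmb (hY : IsIsometricEmbedding N r Y) (hr : N.R₀ < r)
    (hu : u ∈ polarDomain) (hH : 0 < N.lapSq Y (r • polar u)) :
    mink (N.timeProj Y (r • polar u)) (N.lapEmb Y (r • polar u)) = 0 := by
  rw [timeProj_eq, ← ip_minkowski 0, ip_add_left, ip_add_left, ip_smul_left, ip_minkowski,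
    ip_minkowski, ip_minkowski, mink_comm (pushforward _ _ _), mink_lapEmb_pushforward hY hr hu,
    mink_comm, mink_time]
  change _ + _ / _ * N.lapSq Y (r • polar u) = 0
  field_simp
  ring

lemma mink_timeProj_self (hY : IsIsometricEmbedding N r Y) (hr : N.R₀ < r)
    (hu : u ∈ polarDomain) (hH : 0 < N.lapSq Y (r • polar u)) :
    mink (N.timeProj Y (r • polar u)) (N.timeProj Y (r • polar u)) =
      - N.timeProj Y (r • polar u) 0 := by
  conv_lhs => arg 2; rw [timeProj_eq]
  rw [← ip_minkowski 0, ip_add_right, ip_add_right, ip_smul_right, ip_minkowski, ip_minkowski,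
    ip_minkowski, mink_timeProj_pushforward hY hr hu, mink_timeProj_lapEmb hY hr hu hH, mink_time]
  simp

lemma normH_emb (hY : IsIsometricEmbedding N r Y) (hr : N.R₀ < r) (hu : u ∈ polarDomain) :
    normH minkowski (fun z => Y (polar z)) u = Real.sqrt (N.lapSq Y (r • polar u)) := by
  rw [normH, meanCurv_emb hY hr hu]; rfl

lemma isFutureDual_emb (hY : IsIsometricEmbedding N r Y) (hr : N.R₀ < r) (hu : u ∈ polarDomain)
    (hg : N.GoodAt Y (r • polar u)) :
    IsFutureDual minkowski timeDir (fun z => Y (polar z)) u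
      (Real.sqrt (N.lapSq Y (r • polar u)) • N.dualEmb Y (r • polar u)) := by
  obtain ⟨h1, h2⟩ := hg
  have hr0 := N.R₀_pos.trans hr
  have hs := Real.sqrt_pos.2 h2
  have hs1 := Real.sqrt_pos.2 h1
  refine ⟨fun a => ?_, ?_, ?_, ?_⟩
  · rw [tangent_emb hY hr0, dualEmb, ip_smul_left, ip_smul_left, ip_smul_right, ip_minkowski,
      mink_timeProj_pushforward hY hr hu]; simp
  · rw [meanCurv_emb hY hr hu, dualEmb, ip_smul_left, ip_smul_left, ip_minkowski,
      mink_timeProj_lapEmb hY hr hu h1]; simp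
  · rw [meanCurv_emb hY hr hu, dualEmb, ip_smul_left, ip_smul_left, ip_smul_right, ip_smul_right,
      ip_minkowski, ip_minkowski, mink_timeProj_self hY hr hu h1]
    change _ = - N.lapSq Y (r • polar u)
    have e1 := Real.mul_self_sqrt h1.le
    have e2 := Real.mul_self_sqrt h2.le
    field_simp
    linear_combination (-1) * (Real.sqrt (N.timeProj Y (r • polar u) 0)) ^ 2 * e1 +
      N.lapSq Y (r • polar u) * 0 * e2 + (Real.sqrt (N.lapSq Y (r • polar u))) ^ 2 * e2
  · rw [dualEmb, ip_smul_left, ip_smul_left, ip_minkowski, timeDir, mink_time]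
    have : 0 < √(N.lapSq Y (r • polar u)) * ((√(N.timeProj Y (r • polar u) 0))⁻¹ *
      N.timeProj Y (r • polar u) 0) := by positivity
    linarith

lemma dualJ_emb (hY : IsIsometricEmbedding N r Y) (hr : N.R₀ < r) (hu : u ∈ polarDomain)
    (hg : N.GoodAt Y (r • polar u)) :
    dualJ minkowski timeDir (fun z => Y (polar z)) u =
      Real.sqrt (N.lapSq Y (r • polar u)) • N.dualEmb Y (r • polar u) :=
  dualJ_eq (minkowski_isSymm _) (inducedMetric_emb_det_ne_zero hY hr hu)
    (by rw [meanCurv_emb hY hr hu]; exact hg.1) (isFutureDual_emb hY hr hu hg)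

lemma contDiffAt_lapEmb (hY : IsIsometricEmbedding N r Y) {y : E3} (hy : N.R₀ < ‖y‖) (β : Fin 4) :
    ContDiffAt ℝ ∞ (fun z => N.lapEmb Y z β) y :=
  ContDiffAt.sum fun i _ => contDiffAt_pd (ContDiffAt.sum fun j _ =>
    (contDiffAt_Qc hy i j).mul (contDiffAt_pd (hY.contDiffAt_emb (ne_zero_of_lt hy) β) j)) i

lemma contDiffAt_lapSq (hY : IsIsometricEmbedding N r Y) {y : E3} (hy : N.R₀ < ‖y‖) :
    ContDiffAt ℝ ∞ (N.lapSq Y) y := by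
  have : N.lapSq Y = fun z => ∑ β, sgn β * (N.lapEmb Y z β * N.lapEmb Y z β) :=
    funext fun z => mink_eq_sum _ _
  rw [this]
  exact ContDiffAt.sum fun β _ => contDiffAt_const.mul
    ((contDiffAt_lapEmb hY hy β).mul (contDiffAt_lapEmb hY hy β))

lemma contDiffAt_timeProj (hY : IsIsometricEmbedding N r Y) {y : E3} (hy : N.R₀ < ‖y‖)
    (hH : 0 < N.lapSq Y y) (β : Fin 4) : ContDiffAt ℝ ∞ (fun z => N.timeProj Y z β) y := by
  have hy0 := ne_zero_of_lt hy
  refine (contDiffAt_const.add (ContDiffAt.sum fun i _ => ContDiffAt.sum fun j _ =>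
    (contDiffAt_Qc hy i j).mul ((contDiffAt_pd (hY.contDiffAt_emb hy0 0) i).mul
      (contDiffAt_pd (hY.contDiffAt_emb hy0 β) j)))).add ?_
  exact ((contDiffAt_lapEmb hY hy 0).div (contDiffAt_lapSq hY hy) hH.ne').mul
    (contDiffAt_lapEmb hY hy β)

lemma contDiffAt_dualEmb (hY : IsIsometricEmbedding N r Y) {y : E3} (hy : N.R₀ < ‖y‖)
    (hg : N.GoodAt Y y) (β : Fin 4) : ContDiffAt ℝ ∞ (fun z => N.dualEmb Y z β) y :=
  (((contDiffAt_timeProj hY hy hg.1 0).sqrt hg.2.ne').inv (Real.sqrt_pos.2 hg.2).ne').mul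
    (contDiffAt_timeProj hY hy hg.1 β)

lemma connForm_emb (hY : IsIsometricEmbedding N r Y) (hr : N.R₀ < r) (hu : u ∈ polarDomain)
    (hg : ∀ y : E3, ‖y‖ = r → N.GoodAt Y y) (a : Fin 2) :
    connForm minkowski timeDir (fun z => Y (polar z)) a u =
      ∑ k, (r * sphTan a u k) * N.embConn Y (r • polar u) k := by
  have hr0 := N.R₀_pos.trans hr
  have hgz : ∀ z, N.GoodAt Y (r • polar z) := fun z => hg _ (norm_smul_polar hr0 z)
  have hyR := lt_norm_smul_polar hr u
  have hloc : (fun z => (normH minkowski (fun z => Y (polar z)) z)⁻¹ •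
      dualJ minkowski timeDir (fun z => Y (polar z)) z) =ᶠ[𝓝 u]
      fun z => N.dualEmb Y (r • polar z) := by
    filter_upwards [isOpen_polarDomain.mem_nhds hu] with z hz
    rw [normH_emb hY hr hz, dualJ_emb hY hr hz (hgz z), smul_smul,
      inv_mul_cancel₀ (Real.sqrt_pos.2 (hgz z).1).ne', one_smul]
  have dv : ∀ β, DifferentiableAt ℝ (fun z => N.dualEmb Y (r • polar z) β) u := fun β =>
    (contDiffAt_comp_smul_polar (contDiffAt_dualEmb hY hyR (hgz u) β)).differentiableAt (by simp)
  have dH' : ∀ β, DifferentiableAt ℝ (fun z => N.lapEmb Y z β) (r • polar u) := fun β =>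
    (contDiffAt_lapEmb hY hyR β).differentiableAt (by simp)
  have dH : ∀ β, DifferentiableAt ℝ (fun z => N.lapEmb Y (r • polar z) β) u := fun β =>
    (contDiffAt_comp_smul_polar (contDiffAt_lapEmb hY hyR β)).differentiableAt (by simp)
  have horth : (fun z => ∑ β, sgn β * (N.dualEmb Y (r • polar z) β * N.lapEmb Y (r • polar z) β))
      =ᶠ[𝓝 u] fun _ => 0 := by
    filter_upwards [isOpen_polarDomain.mem_nhds hu] with z hz
    rw [← mink_eq_sum, dualEmb, ← ip_minkowski 0, ip_smul_left, ip_minkowski,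
      mink_timeProj_lapEmb hY hr hz (hgz z).1, mul_zero]
  have hd := ud_congr horth a
  rw [ud_const, ud_sum fun β _ => ((dv β).fun_mul (dH β)).const_mul _] at hd
  have e : ∀ β, ud a (fun z => sgn β * (N.dualEmb Y (r • polar z) β * N.lapEmb Y (r • polar z) β)) u
      = sgn β * (ud a (fun z => N.dualEmb Y (r • polar z) β) u * N.lapEmb Y (r • polar u) β +
        N.dualEmb Y (r • polar u) β *
          (r * ∑ k, sphTan a u k * pd k (fun z => N.lapEmb Y z β) (r • polar u))) := fun β => by
    rw [ud_const_mul _ ((dv β).fun_mul (dH β)), ud_mul (dv β) (dH β), ud_comp_smul_polar (dH' β)]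
  simp only [e] at hd
  rw [connForm, covDeriv_congr hloc, covDeriv_minkowski, ip_smul_right, meanCurv_emb hY hr hu,
    normH_emb hY hr hu, ip_minkowski, mink_eq_sum]
  have e2 : ∑ β, sgn β * (ud a (fun z => N.dualEmb Y (r • polar z) β) u * N.lapEmb Y (r • polar u) β) =
      - ∑ β, sgn β * (N.dualEmb Y (r • polar u) β *
          (r * ∑ k, sphTan a u k * pd k (fun z => N.lapEmb Y z β) (r • polar u))) := by
    simp only [mul_add, Finset.sum_add_distrib] at hd ⊢
    linarith
  rw [e2]
  simp only [embConn, Fin.sum_univ_three, Fin.sum_univ_four]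
  ring

/-! ### The energy density in Cartesian components -/

namespace Exterior

variable (N)

/-- The restriction of `P` to the slice `w = c`. -/
def Pc (y : E3) : ℝ := N.P (pt N.c y)

/-- The restriction of `U` to the slice `w = c`. -/
def Uc (y : E3) : ℝ := N.U (pt N.c y)

/-- The restriction of the shift vector to the slice `w = c`. -/
def Wc (i : Fin 3) (y : E3) : ℝ := N.W (pt N.c y) i

/-- The connection form of the mean curvature gauge of the spheres in spacetime. -/
def sphConn (y : E3) (k : Fin 3) : ℝ :=
  - pd k N.Pc y / (2 * N.Pc y) +
    (∑ i, N.hc i k y * (∑ j, nrm j y * pd j (N.Wc i) y - N.Wc i y / ‖y‖)) / (2 * N.Uc y)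

/-- The energy density with respect to the round measure of the sphere of radius `1`. -/
def density (Y : E3 → R4) (T : R4) (y : E3) : ℝ :=
  ‖y‖ ^ 2 * (- mink T (N.dualEmb Y y) *
      (Real.sqrt (N.lapSq Y y) - 2 / ‖y‖ * Real.sqrt (N.Pc y / N.Uc y)) +
    ∑ k, ∑ i, N.Qc k i y * (mink T (fun β => pd k (emb Y β) y) *
      (N.embConn Y y i - N.sphConn y i)))

end Exterior

lemma contDiffAt_Wc {y : E3} (hy : N.R₀ < ‖y‖) (i : Fin 3) : ContDiffAt ℝ ∞ (N.Wc i) y :=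
  ContDiffAt.comp y (contDiffAt_W (pt_mem_region hy) i) (contDiff_pt N.c).contDiffAt

lemma contDiffAt_Uc {y : E3} (hy : N.R₀ < ‖y‖) : ContDiffAt ℝ ∞ N.Uc y :=
  ContDiffAt.comp y (contDiffAt_U (pt_mem_region hy)) (contDiff_pt N.c).contDiffAt

lemma contDiffAt_Pc {y : E3} (hy : N.R₀ < ‖y‖) : ContDiffAt ℝ ∞ N.Pc y :=
  ContDiffAt.comp y (contDiffAt_P (pt_mem_region hy)) (contDiff_pt N.c).contDiffAt

lemma Pc_eq {y : E3} (hy : N.R₀ < ‖y‖) :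
    N.Pc y = N.V (pt N.c y) + ‖y‖ * ∑ i, pd i (N.Wc i) y := by
  rw [Pc, P, spatial_pt, divW]
  congr 2
  exact Finset.sum_congr rfl fun i _ =>
    (pd_comp_pt ((contDiffAt_W (pt_mem_region hy) i).differentiableAt (by simp)) i).symm

lemma Uc_pos {y : E3} (hy : N.R₀ < ‖y‖) : 0 < N.Uc y := N.U_pos _ (pt_mem_region hy)

lemma connForm_surface' (hr : N.R₀ < r) (hu : u ∈ polarDomain)
    (hP : ∀ y : E3, ‖y‖ = r → 0 < N.Pc y) (a : Fin 2) :
    connForm N.metric radialDir (N.surface r) a u =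
      ∑ k, (r * sphTan a u k) * N.sphConn (r • polar u) k := by
  have hyR := lt_norm_smul_polar hr u
  have hr0 := N.R₀_pos.trans hr
  rw [connForm_surface hr hu hP, fderiv_tangent]
  have e1 : ∀ k : Fin 3, fderiv ℝ N.P (N.surface r u) (Pi.single k.succ 1) =
      pd k N.Pc (r • polar u) := fun k =>
    (pd_comp_pt ((contDiffAt_P (pt_mem_region hyR)).differentiableAt (by simp)) k).symm
  have e2 : ∀ i : Fin 3, N.shiftDeriv (N.surface r u) i.succ =
      ∑ j, nrm j (r • polar u) * pd j (N.Wc i) (r • polar u) - N.Wc i (r • polar u) / ‖r • polar u‖ :=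
    fun i => by
      change fderiv ℝ (fun x => N.W x i) (pt N.c (r • polar u)) (pt 0 _) - _ = _
      rw [fderiv_pt_tangent ((contDiffAt_W (pt_mem_region hyR) i).differentiableAt (by simp))]
      congr 1
      refine Finset.sum_congr rfl fun j _ => ?_
      rw [norm_spatial_surface hr0, nrm_smul_polar hr0, spatial_surface, smul_smul,
        inv_mul_cancel₀ hr0.ne', one_smul]
      rfl
  simp only [e1, hform, e2, tangent_surface_succ, sphConn, Fin.sum_univ_three]
  change _ / (2 * N.Pc (r • polar u)) + _ / (2 * N.Uc (r • polar u)) = _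
  simp only [hc, surface]
  ring

lemma energyDensity_eq (hY : IsIsometricEmbedding N r Y) (hr : N.R₀ < r) (hu : u ∈ polarDomain)
    (hg : ∀ y : E3, ‖y‖ = r → N.GoodAt Y y) (hP : ∀ y : E3, ‖y‖ = r → 0 < N.Pc y) (T : R4) :
    energyDensity N r Y T u = Real.sin u.1 * N.density Y T (r • polar u) := by
  have hr0 := N.R₀_pos.trans hr
  have hy := smul_polar_ne_zero hr0 u
  have hgu := hg _ (norm_smul_polar hr0 u)
  have hτ : ∀ b, fderiv ℝ (fun z => - mink T (Y (polar z))) u (dir b) =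
      ∑ k, (r * sphTan b u k) * - mink T (fun β => pd k (emb Y β) (r • polar u)) := fun b => by
    have d : ∀ β, DifferentiableAt ℝ (fun z => Y (polar z) β) u := fun β => by
      rw [comp_polar_eq hr0]
      exact (contDiffAt_comp_smul_polar (hY.contDiffAt_emb hy β)).differentiableAt (by simp)
    have e : ∀ β, ud b (fun z => Y (polar z) β) u =
        r * ∑ k, sphTan b u k * pd k (emb Y β) (r • polar u) := fun β => by
      rw [comp_polar_eq hr0, ud_comp_smul_polar ((hY.contDiffAt_emb hy β).differentiableAt (by simp))]
    change ud b _ u = _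
    simp only [mink_eq_sum]
    rw [ud_neg, ud_sum fun β _ => ((d β).const_mul _).const_mul _]
    have e' : ∀ β, ud b (fun z => sgn β * (T β * Y (polar z) β)) u =
        sgn β * (T β * (r * ∑ k, sphTan b u k * pd k (emb Y β) (r • polar u))) := fun β => by
      rw [ud_const_mul _ ((d β).const_mul _), ud_const_mul _ (d β), e]
    simp only [e', Fin.sum_univ_three, Fin.sum_univ_four]
    ring
  have hsum : ∀ A : Fin 3 → ℝ, ∑ a, (∑ b, (inducedMetric N.metric (N.surface r) u)⁻¹ a b *
      fderiv ℝ (fun z => - mink T (Y (polar z))) u (dir b)) * (∑ k, (r * sphTan a u k) * A k) =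
      - ∑ k, ∑ i, N.Qc k i (r • polar u) * (mink T (fun β => pd k (emb Y β) (r • polar u)) * A i) :=
    fun A => by
      have := sum_inv_inducedMetric_mul hr hu fun k i =>
        (A k * - mink T (fun β => pd i (emb Y β) (r • polar u)))
      have e2 : ∑ k, ∑ i, N.Qc k i (r • polar u) *
          (mink T (fun β => pd k (emb Y β) (r • polar u)) * A i) =
          - ∑ k, ∑ i, N.Q (N.surface r u) k i *
            (A k * - mink T (fun β => pd i (emb Y β) (r • polar u))) := by
        rw [Finset.sum_comm]
        simp only [← Finset.sum_neg_distrib]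
        refine Finset.sum_congr rfl fun k _ => Finset.sum_congr rfl fun i _ => ?_
        rw [Qc_comm (lt_norm_smul_polar hr u)]
        simp only [Qc, surface]; ring
      rw [e2, ← this]
      simp only [hτ, Fin.sum_univ_two, Fin.sum_univ_three]
      ring
  simp only [energyDensity]
  rw [sqrt_det_inducedMetric hr hu]
  simp only [connForm_emb hY hr hu hg, connForm_surface' hr hu hP, hsum]
  rw [normH_emb hY hr hu, dualJ_emb hY hr hu hgu, normH_surface hr hu, smul_smul,
    inv_mul_cancel₀ (Real.sqrt_pos.2 hgu.1).ne', one_smul, density, norm_smul_polar hr0]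
  simp only [mul_sub, Finset.sum_sub_distrib]
  simp only [Pc, Uc, surface]
  ring

end EnergyDensity


/-! ### Symbols: families of functions with differentiable estimates

A family `f r` of functions is only considered near the sphere of radius `r`, for `r` large. -/

lemma eventually_cobounded_iff {p : E3 → Prop} :
    (∀ᶠ y in Bornology.cobounded E3, p y) ↔ ∀ᶠ r : ℝ in atTop, ∀ y : E3, ‖y‖ = r → p y := by
  rw [← comap_norm_atTop, eventually_comap]

lemma eventually_norm_cobounded {p : ℝ → Prop} (h : ∀ᶠ r in atTop, p r) :
    ∀ᶠ y in Bornology.cobounded E3, p ‖y‖ :=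
  tendsto_norm_cobounded_atTop.eventually h

lemma eventually_lt_norm_cobounded (R : ℝ) : ∀ᶠ y in Bornology.cobounded E3, R < ‖y‖ :=
  eventually_norm_cobounded (eventually_gt_atTop R)

/-- The families are smooth near the sphere of radius `r`. -/
def SmoothFamily (f : ℝ → E3 → ℝ) : Prop :=
  ∀ᶠ y in Bornology.cobounded E3, ∀ᶠ z in 𝓝 y, ContDiffAt ℝ ∞ (f ‖y‖) z

/-- Two families agree near the sphere of radius `r`. -/
def FamilyEq (f g : ℝ → E3 → ℝ) : Prop :=
  ∀ᶠ y in Bornology.cobounded E3, f ‖y‖ =ᶠ[𝓝 y] g ‖y‖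

/-- The estimates on the derivatives of order at most `k` of a symbol of order `q`. -/
def SymbBound : ℕ → ℤ → (ℝ → E3 → ℝ) → Prop
  | 0, q, f => (fun y => f ‖y‖ y) =O[Bornology.cobounded E3] fun y => ‖y‖ ^ q
  | k + 1, q, f => ((fun y => f ‖y‖ y) =O[Bornology.cobounded E3] fun y => ‖y‖ ^ q) ∧
      ∀ j, SymbBound k (q - 1) fun r => pd j (f r)

/-- A symbol of order `q`: a family which is `O(r ^ q)`, with an estimate which may be
differentiated. -/
structure Symb (q : ℤ) (f : ℝ → E3 → ℝ) : Prop where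
  smooth : SmoothFamily f
  bound : ∀ k, SymbBound k q f

lemma FamilyEq.pd {f g : ℝ → E3 → ℝ} (h : FamilyEq f g) (j : Fin 3) :
    FamilyEq (fun r => pd j (f r)) fun r => pd j (g r) :=
  h.mono fun _ hy => pd_eventuallyEq hy j

lemma SmoothFamily.pd {f : ℝ → E3 → ℝ} (h : SmoothFamily f) (j : Fin 3) :
    SmoothFamily fun r => pd j (f r) :=
  h.mono fun _ hy => hy.mono fun _ hz => contDiffAt_pd hz j

lemma SmoothFamily.mul {f g : ℝ → E3 → ℝ} (hf : SmoothFamily f) (hg : SmoothFamily g) :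
    SmoothFamily fun r y => f r y * g r y := by
  filter_upwards [hf, hg] with y h1 h2
  filter_upwards [h1, h2] with z h1 h2 using h1.mul h2

lemma SmoothFamily.add {f g : ℝ → E3 → ℝ} (hf : SmoothFamily f) (hg : SmoothFamily g) :
    SmoothFamily fun r y => f r y + g r y := by
  filter_upwards [hf, hg] with y h1 h2
  filter_upwards [h1, h2] with z h1 h2 using h1.add h2

lemma SmoothFamily.congr {f g : ℝ → E3 → ℝ} (hf : SmoothFamily f) (h : FamilyEq f g) :
    SmoothFamily g := by
  filter_upwards [hf, h] with y h1 h2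
  filter_upwards [h1, eventually_eventually_nhds.2 h2] with z h1 h2 using
    h1.congr_of_eventuallyEq (EventuallyEq.symm h2)

lemma FamilyEq.eventuallyEq {f g : ℝ → E3 → ℝ} (h : FamilyEq f g) :
    (fun y => f ‖y‖ y) =ᶠ[Bornology.cobounded E3] fun y => g ‖y‖ y :=
  h.mono fun _ hy => hy.self_of_nhds

lemma familyEq_pd_mul {f g : ℝ → E3 → ℝ} (hf : SmoothFamily f) (hg : SmoothFamily g) (j : Fin 3) :
    FamilyEq (fun r y => pd j (f r) y * g r y + f r y * pd j (g r) y)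
      fun r => pd j fun y => f r y * g r y := by
  filter_upwards [hf, hg] with y h1 h2
  filter_upwards [h1, h2] with z h1 h2 using
    (pd_mul (h1.differentiableAt (by simp)) (h2.differentiableAt (by simp)) j).symm

lemma familyEq_pd_add {f g : ℝ → E3 → ℝ} (hf : SmoothFamily f) (hg : SmoothFamily g) (j : Fin 3) :
    FamilyEq (fun r y => pd j (f r) y + pd j (g r) y) fun r => pd j fun y => f r y + g r y := by
  filter_upwards [hf, hg] with y h1 h2
  filter_upwards [h1, h2] with z h1 h2 using
    (pd_add (h1.differentiableAt (by simp)) (h2.differentiableAt (by simp)) j).symm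

lemma SymbBound.congr {k : ℕ} {q : ℤ} {f g : ℝ → E3 → ℝ} (hf : SymbBound k q f)
    (h : FamilyEq f g) : SymbBound k q g := by
  induction k generalizing q f g with
  | zero => exact IsBigO.congr' hf h.eventuallyEq EventuallyEq.rfl
  | succ k ih => exact ⟨hf.1.congr' h.eventuallyEq EventuallyEq.rfl, fun j => ih (hf.2 j) (h.pd j)⟩

lemma SymbBound.of_succ {k : ℕ} {q : ℤ} {f : ℝ → E3 → ℝ} (hf : SymbBound (k + 1) q f) :
    SymbBound k q f := by
  induction k generalizing q f with
  | zero => exact hf.1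
  | succ k ih => exact ⟨hf.1, fun j => ih (hf.2 j)⟩

lemma SymbBound.add {k : ℕ} {q : ℤ} {f g : ℝ → E3 → ℝ} (hf : SymbBound k q f)
    (hg : SymbBound k q g) (sf : SmoothFamily f) (sg : SmoothFamily g) :
    SymbBound k q fun r y => f r y + g r y := by
  induction k generalizing q f g with
  | zero => exact IsBigO.add hf hg
  | succ k ih =>
    exact ⟨hf.1.add hg.1, fun j =>
      (ih (hf.2 j) (hg.2 j) (sf.pd j) (sg.pd j)).congr (familyEq_pd_add sf sg j)⟩

lemma isBigO_norm_zpow_mul {p q : ℤ} {f g : E3 → ℝ}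
    (hf : f =O[Bornology.cobounded E3] fun y => ‖y‖ ^ q)
    (hg : g =O[Bornology.cobounded E3] fun y => ‖y‖ ^ p) :
    (fun y => f y * g y) =O[Bornology.cobounded E3] fun y => ‖y‖ ^ (q + p) := by
  refine (hf.mul hg).congr' EventuallyEq.rfl ?_
  filter_upwards [eventually_lt_norm_cobounded 0] with y hy
  rw [zpow_add₀ hy.ne']

lemma SymbBound.mul {k : ℕ} {p q : ℤ} {f g : ℝ → E3 → ℝ} (hf : SymbBound k q f)
    (hg : SymbBound k p g) (sf : SmoothFamily f) (sg : SmoothFamily g) :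
    SymbBound k (q + p) fun r y => f r y * g r y := by
  induction k generalizing p q f g with
  | zero => exact isBigO_norm_zpow_mul hf hg
  | succ k ih =>
    refine ⟨isBigO_norm_zpow_mul hf.1 hg.1, fun j => ?_⟩
    have h1 := ih (hf.2 j) hg.of_succ (sf.pd j) sg
    have h2 := ih hf.of_succ (hg.2 j) sf (sg.pd j)
    rw [show q - 1 + p = q + p - 1 by ring] at h1
    rw [show q + (p - 1) = q + p - 1 by ring] at h2
    exact (h1.add h2 ((sf.pd j).mul sg) (sf.mul (sg.pd j))).congr (familyEq_pd_mul sf sg j)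

lemma isBigO_norm_zpow_le {p q : ℤ} (h : q ≤ p) :
    (fun y : E3 => ‖y‖ ^ q) =O[Bornology.cobounded E3] fun y => ‖y‖ ^ p := by
  refine IsBigO.of_bound 1 ?_
  filter_upwards [eventually_lt_norm_cobounded 1] with y hy
  rw [one_mul, Real.norm_of_nonneg (by positivity), Real.norm_of_nonneg (by positivity)]
  exact zpow_le_zpow_right₀ hy.le h

lemma SymbBound.mono {k : ℕ} {p q : ℤ} {f : ℝ → E3 → ℝ} (hf : SymbBound k q f) (h : q ≤ p) :
    SymbBound k p f := by
  induction k generalizing p q f with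
  | zero => exact IsBigO.trans hf (isBigO_norm_zpow_le h)
  | succ k ih => exact ⟨hf.1.trans (isBigO_norm_zpow_le h), fun j => ih (hf.2 j) (by linarith)⟩

lemma symbBound_zero (k : ℕ) (q : ℤ) : SymbBound k q fun _ _ => 0 := by
  induction k generalizing q with
  | zero => exact isBigO_zero _ _
  | succ k ih =>
    refine ⟨isBigO_zero _ _, fun j => ?_⟩
    have : (fun (_ : ℝ) => pd j fun (_ : E3) => (0 : ℝ)) = fun _ _ => 0 := by
      ext r y; exact pd_const j 0 y
    rw [this]; exact ih _

namespace Symb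

variable {p q : ℤ} {f g : ℝ → E3 → ℝ}

lemma congr (hf : Symb q f) (h : FamilyEq f g) : Symb q g :=
  ⟨hf.smooth.congr h, fun k => (hf.bound k).congr h⟩

lemma isBigO (hf : Symb q f) : (fun y => f ‖y‖ y) =O[Bornology.cobounded E3] fun y => ‖y‖ ^ q :=
  hf.bound 0

lemma pd (hf : Symb q f) (j : Fin 3) : Symb (q - 1) fun r => BondiSachs.pd j (f r) :=
  ⟨hf.smooth.pd j, fun k => (hf.bound (k + 1)).2 j⟩

lemma add (hf : Symb q f) (hg : Symb q g) : Symb q fun r y => f r y + g r y :=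
  ⟨hf.smooth.add hg.smooth, fun k => (hf.bound k).add (hg.bound k) hf.smooth hg.smooth⟩

lemma mul (hf : Symb q f) (hg : Symb p g) : Symb (q + p) fun r y => f r y * g r y :=
  ⟨hf.smooth.mul hg.smooth, fun k => (hf.bound k).mul (hg.bound k) hf.smooth hg.smooth⟩

lemma mono (hf : Symb q f) (h : q ≤ p) : Symb p f :=
  ⟨hf.smooth, fun k => (hf.bound k).mono h⟩

lemma zero (q : ℤ) : Symb q fun _ _ => 0 :=
  ⟨Eventually.of_forall fun _ => Eventually.of_forall fun _ => contDiffAt_const,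
    fun k => symbBound_zero k q⟩

lemma of_isBigO {c : ℝ → ℝ} (h : c =O[atTop] fun r => r ^ q) : Symb q fun r _ => c r := by
  refine ⟨Eventually.of_forall fun _ => Eventually.of_forall fun _ => contDiffAt_const,
    fun k => ?_⟩
  have h0 := h.comp_tendsto (tendsto_norm_cobounded_atTop (E := E3))
  cases k with
  | zero => exact h0
  | succ k =>
    refine ⟨h0, fun j => ?_⟩
    have : (fun r => BondiSachs.pd j fun (_ : E3) => c r) = fun _ _ => 0 := by
      ext r y; exact pd_const j _ y
    rw [this]; exact symbBound_zero _ _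

lemma const (c : ℝ) : Symb 0 fun _ _ => c :=
  of_isBigO (by simpa using isBigO_const_const c (one_ne_zero (α := ℝ)) atTop)

lemma radius : Symb 1 fun r _ => r := of_isBigO (by simpa using isBigO_refl _ _)

lemma const_mul (c : ℝ) (hf : Symb q f) : Symb q fun r y => c * f r y := by
  simpa using (const c).mul hf

lemma neg (hf : Symb q f) : Symb q fun r y => - f r y := by
  simpa using hf.const_mul (-1)

lemma sub (hf : Symb q f) (hg : Symb q g) : Symb q fun r y => f r y - g r y := by
  simpa [sub_eq_add_neg] using hf.add hg.neg

lemma sum {ι : Type*} {s : Finset ι} {f : ι → ℝ → E3 → ℝ} (hf : ∀ i ∈ s, Symb q (f i)) :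
    Symb q fun r y => ∑ i ∈ s, f i r y := by
  classical
  induction s using Finset.induction_on with
  | empty => simpa using zero q
  | insert a s ha ih =>
    simp only [Finset.sum_insert ha]
    exact (hf a (by simp)).add (ih fun i hi => hf i (by simp [hi]))

end Symb

/-! ### Sources of symbols -/

lemma norm_iteratedFDeriv_pd_le {f : E3 → ℝ} {y : E3} (hf : ContDiffAt ℝ ∞ f y) (j : Fin 3)
    (k : ℕ) : ‖iteratedFDeriv ℝ k (pd j f) y‖ ≤ ‖iteratedFDeriv ℝ (k + 1) f y‖ := by
  have h := norm_iteratedFDeriv_clm_apply_const (c := EuclideanSpace.single j (1 : ℝ)) (n := k)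
    (hf.fderiv_right (m := ∞) (by simp)) (mod_cast le_top)
  rw [norm_iteratedFDeriv_fderiv] at h
  exact h.trans (by simp)

lemma smoothFamily_of_homog {f : E3 → ℝ} (hf : ∀ y, y ≠ 0 → ContDiffAt ℝ ∞ f y) :
    SmoothFamily fun _ => f := by
  filter_upwards [eventually_lt_norm_cobounded 0] with y hy
  filter_upwards [eventually_ne_zero (norm_pos_iff.1 hy)] with z hz using hf z hz

lemma Homog.eq_zpow_mul {d : ℤ} {f : E3 → ℝ} (hf : Homog d f) {y : E3} (hy : y ≠ 0) :
    f y = ‖y‖ ^ d * f (‖y‖⁻¹ • y) := by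
  have h0 := norm_pos_iff.2 hy
  rw [← hf _ h0 _ (smul_ne_zero (inv_ne_zero h0.ne') hy), smul_smul, mul_inv_cancel₀ h0.ne',
    one_smul]

lemma norm_inv_norm_smul {y : E3} (hy : y ≠ 0) : ‖‖y‖⁻¹ • y‖ = 1 := by
  rw [norm_smul, norm_inv, norm_norm, inv_mul_cancel₀ (norm_ne_zero_iff.2 hy)]

lemma symbBound_of_homog {d q : ℤ} {f : ℝ → E3 → ℝ}
    (hf : ∀ᶠ r in atTop, Homog d (f r) ∧ ∀ y, y ≠ 0 → ContDiffAt ℝ ∞ (f r) y)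
    (hb : ∀ k : ℕ, ∃ C : ℝ, ∀ᶠ r : ℝ in atTop, ∀ n : E3, ‖n‖ = 1 →
      ‖iteratedFDeriv ℝ k (f r) n‖ ≤ C * r ^ q) (k : ℕ) : SymbBound k (d + q) f := by
  have h0 : ∀ {d : ℤ} {f : ℝ → E3 → ℝ},
      (∀ᶠ r in atTop, Homog d (f r) ∧ ∀ y, y ≠ 0 → ContDiffAt ℝ ∞ (f r) y) →
      (∀ k : ℕ, ∃ C : ℝ, ∀ᶠ r : ℝ in atTop, ∀ n : E3, ‖n‖ = 1 →
        ‖iteratedFDeriv ℝ k (f r) n‖ ≤ C * r ^ q) →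
      (fun y => f ‖y‖ y) =O[Bornology.cobounded E3] fun y => ‖y‖ ^ (d + q) := by
    intro d f hf hb
    obtain ⟨C, hC⟩ := hb 0
    refine IsBigO.of_bound C ?_
    filter_upwards [eventually_norm_cobounded hC, eventually_norm_cobounded hf,
      eventually_lt_norm_cobounded 0] with y hy hf h0
    have hy0 := norm_pos_iff.1 h0
    have h1 := hy _ (norm_inv_norm_smul hy0)
    rw [norm_iteratedFDeriv_zero] at h1
    rw [hf.1.eq_zpow_mul hy0, norm_mul, zpow_add₀ h0.ne', norm_mul]
    rw [show ‖‖y‖ ^ q‖ = ‖y‖ ^ q from Real.norm_of_nonneg (by positivity)]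
    calc _ ≤ ‖‖y‖ ^ d‖ * (C * ‖y‖ ^ q) := by gcongr
      _ = _ := by ring
  induction k generalizing d f with
  | zero => exact h0 hf hb
  | succ k ih =>
    refine ⟨h0 hf hb, fun j => ?_⟩
    rw [show d + q - 1 = d - 1 + q by ring]
    refine ih (hf.mono fun r h => ⟨h.1.pd (fun y hy => (h.2 y hy).differentiableAt (by simp)) j,
      fun y hy => contDiffAt_pd (h.2 y hy) j⟩) fun k => ?_
    obtain ⟨C, hC⟩ := hb (k + 1)
    refine ⟨C, ?_⟩
    filter_upwards [hC, hf] with r h hf n hn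
    exact (norm_iteratedFDeriv_pd_le (hf.2 n (norm_ne_zero_iff.1 (by rw [hn]; simp))) j k).trans
      (h n hn)

lemma Homog.symb {d : ℤ} {f : E3 → ℝ} (hf : Homog d f)
    (hs : ∀ y, y ≠ 0 → ContDiffAt ℝ ∞ f y) : Symb d fun _ => f := by
  refine ⟨smoothFamily_of_homog hs, fun k => ?_⟩
  rw [← add_zero d]
  refine symbBound_of_homog (Eventually.of_forall fun _ => ⟨hf, hs⟩) (fun k => ?_) k
  have hc : ContinuousOn (iteratedFDeriv ℝ k f) (Metric.sphere 0 1) := fun n hn => by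
    have hn0 : n ≠ 0 := norm_ne_zero_iff.1 (by rw [mem_sphere_zero_iff_norm.1 hn]; simp)
    exact ((hs n hn0).iteratedFDeriv_right (m := 0) (by simpa using mod_cast le_top)
      ).continuousAt.continuousWithinAt
  obtain ⟨C, hC⟩ := (isCompact_sphere (0 : E3) 1).exists_bound_of_continuousOn hc
  exact ⟨C, Eventually.of_forall fun r n hn => by
    simpa using hC n (mem_sphere_zero_iff_norm.2 hn)⟩

lemma SphereBigO.symb {q : ℤ} {f : ℝ → E3 → ℝ} (hf : SphereBigO q f)
    (hs : ∀ᶠ r in atTop, SmoothOnSphere (f r)) : Symb q fun r => radialExt (f r) := by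
  refine ⟨?_, fun k => ?_⟩
  · filter_upwards [eventually_lt_norm_cobounded 0, eventually_norm_cobounded hs] with y hy hs
    filter_upwards [eventually_ne_zero (norm_pos_iff.1 hy)] with z hz using
      hs.contDiffAt_radialExt hz
  · rw [← zero_add q]
    exact symbBound_of_homog (hs.mono fun r h => ⟨homog_radialExt _, fun y hy =>
      h.contDiffAt_radialExt hy⟩) hf k

lemma DecayBigO.isBigO {q : ℤ} {f : E3 → ℝ} (hf : DecayBigO q f) :
    f =O[Bornology.cobounded E3] fun y => ‖y‖ ^ q := by
  have := (hf 0).norm_left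
  simp only [norm_iteratedFDeriv_zero] at this
  simpa using this.of_norm_left

lemma DecayBigO.pd {q : ℤ} {f : E3 → ℝ} (hf : DecayBigO q f)
    (hs : SmoothFamily fun _ => f) (j : Fin 3) : DecayBigO (q - 1) (pd j f) := fun k => by
  have := hf (k + 1)
  rw [show q - ((k + 1 : ℕ) : ℤ) = q - 1 - k by push_cast; ring] at this
  refine IsBigO.trans (IsBigO.of_bound 1 ?_) this
  filter_upwards [hs] with y hy
  rw [one_mul]; exact norm_iteratedFDeriv_pd_le hy.self_of_nhds j k

lemma DecayBigO.symb {q : ℤ} {f : E3 → ℝ} (hf : DecayBigO q f)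
    (hs : SmoothFamily fun _ => f) : Symb q fun _ => f := by
  refine ⟨hs, fun k => ?_⟩
  induction k generalizing q f with
  | zero => exact hf.isBigO
  | succ k ih => exact ⟨hf.isBigO, fun j => ih (hf.pd hs j) (hs.pd j)⟩

lemma DecayLittleO.isLittleO {q : ℤ} {f : E3 → ℝ} (hf : DecayLittleO q f) :
    f =o[Bornology.cobounded E3] fun y => ‖y‖ ^ q := by
  have := (hf 0).norm_left
  simp only [norm_iteratedFDeriv_zero] at this
  simpa using this.of_norm_left

lemma DecayLittleO.pd {q : ℤ} {f : E3 → ℝ} (hf : DecayLittleO q f)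
    (hs : SmoothFamily fun _ => f) (j : Fin 3) : DecayLittleO (q - 1) (pd j f) := fun k => by
  have := hf (k + 1)
  rw [show q - ((k + 1 : ℕ) : ℤ) = q - 1 - k by push_cast; ring] at this
  refine IsBigO.trans_isLittleO (IsBigO.of_bound 1 ?_) this
  filter_upwards [hs] with y hy
  rw [one_mul]; exact norm_iteratedFDeriv_pd_le hy.self_of_nhds j k

/-! ### Leading terms -/

/-- `f - φ → 0` at infinity, with `φ` bounded. -/
structure Near (f φ : E3 → ℝ) : Prop where
  tendsto : Tendsto (fun y => f y - φ y) (Bornology.cobounded E3) (𝓝 0)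
  bounded : φ =O[Bornology.cobounded E3] fun _ => (1 : ℝ)

namespace Near

variable {f g φ ψ : E3 → ℝ}

lemma isLittleO (hf : Near f φ) :
    (fun y => f y - φ y) =o[Bornology.cobounded E3] fun _ => (1 : ℝ) :=
  (isLittleO_one_iff ℝ).2 hf.tendsto

lemma bounded_left (hf : Near f φ) : f =O[Bornology.cobounded E3] fun _ => (1 : ℝ) := by
  simpa using hf.isLittleO.isBigO.add hf.bounded

lemma refl (hφ : φ =O[Bornology.cobounded E3] fun _ => (1 : ℝ)) : Near φ φ :=
  ⟨by simp, hφ⟩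

lemma const (c : ℝ) : Near (fun _ => c) fun _ => c := refl (isBigO_const_const _ one_ne_zero _)

lemma of_tendsto {c : ℝ} (h : Tendsto f (Bornology.cobounded E3) (𝓝 c)) : Near f fun _ => c :=
  ⟨by simpa using h.sub_const c, isBigO_const_const _ one_ne_zero _⟩

lemma tendsto_const {c : ℝ} (h : Near f fun _ => c) : Tendsto f (Bornology.cobounded E3) (𝓝 c) := by
  simpa using h.tendsto.add_const c

lemma congr (hf : Near f φ) (h : f =ᶠ[Bornology.cobounded E3] g) : Near g φ :=
  ⟨hf.tendsto.congr' (h.mono fun y hy => by simp only [hy]), hf.bounded⟩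

lemma congr_right (hf : Near f φ) (h : φ =ᶠ[Bornology.cobounded E3] ψ) : Near f ψ :=
  ⟨hf.tendsto.congr' (h.mono fun y hy => by simp only [hy]), hf.bounded.congr' h EventuallyEq.rfl⟩

lemma add (hf : Near f φ) (hg : Near g ψ) : Near (fun y => f y + g y) fun y => φ y + ψ y :=
  ⟨by
    have := hf.tendsto.add hg.tendsto
    rw [add_zero] at this
    exact this.congr fun y => by ring, hf.bounded.add hg.bounded⟩

lemma mul (hf : Near f φ) (hg : Near g ψ) : Near (fun y => f y * g y) fun y => φ y * ψ y := by
  refine ⟨?_, by simpa using hf.bounded.mul hg.bounded⟩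
  rw [← isLittleO_one_iff ℝ]
  have h1 := hf.isLittleO.mul_isBigO hg.bounded_left
  have h2 := hf.bounded.mul_isLittleO hg.isLittleO
  simp only [mul_one] at h1 h2
  exact (h1.add h2).congr_left fun y => by ring

lemma neg (hf : Near f φ) : Near (fun y => - f y) fun y => - φ y := by
  simpa using (const (-1)).mul hf

lemma sub (hf : Near f φ) (hg : Near g ψ) : Near (fun y => f y - g y) fun y => φ y - ψ y := by
  simpa [sub_eq_add_neg] using hf.add hg.neg

lemma sum {ι : Type*} {s : Finset ι} {f φ : ι → E3 → ℝ} (hf : ∀ i ∈ s, Near (f i) (φ i)) :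
    Near (fun y => ∑ i ∈ s, f i y) fun y => ∑ i ∈ s, φ i y := by
  classical
  induction s using Finset.induction_on with
  | empty => simpa using const 0
  | insert a s ha ih =>
    simp only [Finset.sum_insert ha]
    exact (hf a (by simp)).add (ih fun i hi => hf i (by simp [hi]))

lemma comp {c : ℝ} {F : ℝ → ℝ} (hf : Near f fun _ => c) (hF : ContinuousAt F c) :
    Near (fun y => F (f y)) fun _ => F c :=
  of_tendsto (hF.tendsto.comp hf.tendsto_const)

lemma div {c : ℝ} (hf : Near f φ) (hg : Near g fun _ => c) (hc : c ≠ 0) :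
    Near (fun y => f y / g y) fun y => φ y / c := by
  simpa only [div_eq_mul_inv] using hf.mul (hg.comp (continuousAt_inv₀ hc))

lemma of_isBigO {q : ℤ} (hf : f =O[Bornology.cobounded E3] fun y => ‖y‖ ^ q) (hq : q < 0) :
    Near f fun _ => 0 := by
  refine of_tendsto (hf.trans_tendsto ?_)
  have := (tendsto_zpow_atTop_zero hq (𝕜 := ℝ)).comp (tendsto_norm_cobounded_atTop (E := E3))
  exact this

lemma of_isLittleO (hf : f =o[Bornology.cobounded E3] fun y => ‖y‖ ^ (0 : ℤ)) :
    Near f fun _ => 0 := by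
  refine of_tendsto ?_
  rw [← isLittleO_one_iff ℝ]
  simpa using hf

end Near

lemma Symb.near {f : ℝ → E3 → ℝ} {q d : ℤ} (hf : Symb q f) (h : d + q < 0) :
    Near (fun y => ‖y‖ ^ d * f ‖y‖ y) fun _ => 0 :=
  Near.of_isBigO (isBigO_norm_zpow_mul (isBigO_refl _ _) hf.isBigO) h

lemma Homog.near {d : ℤ} {f : E3 → ℝ} (hf : Homog d f) (hs : ∀ y, y ≠ 0 → ContDiffAt ℝ ∞ f y) :
    Near (fun y => ‖y‖ ^ (-d) * f y) fun y => ‖y‖ ^ (-d) * f y := by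
  refine Near.refl ?_
  have := isBigO_norm_zpow_mul (isBigO_refl (fun y : E3 => ‖y‖ ^ (-d)) (Bornology.cobounded E3))
    (hf.symb hs).isBigO
  simpa using this


open Exterior

/-! ### Asymptotics of the metric of the spheres -/

section Asymptotics

variable {N : Exterior}

variable (N) in
/-- The difference of the metric of the spheres and the round metric. -/
def hdev (i j : Fin 3) (y : E3) : ℝ := N.hc i j y - tproj i j y

lemma smoothFamily_of_lt {f : E3 → ℝ} (hf : ∀ y, N.R₀ < ‖y‖ → ContDiffAt ℝ ∞ f y) :
    SmoothFamily fun _ => f := by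
  filter_upwards [eventually_lt_norm_cobounded N.R₀] with y hy
  filter_upwards [eventually_lt_norm hy] with z hz using hf z hz

lemma symb_hdev (i j : Fin 3) : Symb (-1) fun _ => hdev N i j := by
  refine DecayBigO.symb ?_ (smoothFamily_of_lt (N := N) fun y hy =>
    (contDiffAt_hc hy i j).sub (contDiffAt_tproj (ne_zero_of_lt hy) i j))
  convert N.asymp_h i j using 2 with y
  simp only [hdev, hc, tproj, nrm]
  ring

variable (N) in
/-- `hdev` as a matrix. -/
def hdevM (y : E3) : Matrix (Fin 3) (Fin 3) ℝ := Matrix.of fun i j => hdev N i j y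

lemma adjugate_one_add (K : Matrix (Fin 3) (Fin 3) ℝ) :
    (1 + K).adjugate = (1 + K.trace) • (1 : Matrix (Fin 3) (Fin 3) ℝ) - K + K.adjugate := by
  ext i j
  fin_cases i <;> fin_cases j <;>
    simp [adjugate_fin_three, Matrix.trace, Fin.sum_univ_three] <;> ring

lemma det_one_add (K : Matrix (Fin 3) (Fin 3) ℝ) :
    (1 + K).det = 1 + K.trace + K.adjugate.trace + K.det := by
  simp [adjugate_fin_three, Matrix.trace, Fin.sum_univ_three, det_fin_three]
  ring

lemma h_add_eq (y : E3) : N.h (pt N.c y) + vecMulVec (normal (pt N.c y)) (normal (pt N.c y)) =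
    1 + hdevM N y := by
  ext i j
  simp [hdevM, hdev, hc, tproj, vecMulVec_apply, normal_pt, one_apply]
  ring

lemma Qc_eq (i j : Fin 3) (y : E3) : N.Qc i j y = tproj i j y +
    ((hdevM N y).trace * (1 : Matrix (Fin 3) (Fin 3) ℝ) i j - hdev N i j y +
      (hdevM N y).adjugate i j) := by
  simp only [Qc, Q, pinv]
  rw [h_add_eq, adjugate_one_add]
  simp only [vecMulVec_apply, normal_pt, tproj, one_apply, hdevM, Matrix.add_apply, Matrix.sub_apply,
    Matrix.smul_apply, smul_eq_mul, Matrix.of_apply]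
  ring

lemma symb_adjugate (i j : Fin 3) : Symb (-2) fun _ y => (hdevM N y).adjugate i j := by
  have h := fun i j k l => (symb_hdev (N := N) i j).mul (symb_hdev (N := N) k l)
  simp only [adjugate_fin_three, hdevM]
  fin_cases i <;> fin_cases j <;>
    simp only [Matrix.of_apply, Fin.zero_eta, Fin.mk_one, Fin.reduceFinMk, Matrix.cons_val] <;>
    first
    | exact (h _ _ _ _).sub (h _ _ _ _)
    | exact (h _ _ _ _).neg.add (h _ _ _ _)

lemma symb_trace : Symb (-1) fun _ y => (hdevM N y).trace :=
  Symb.sum fun i _ => symb_hdev (N := N) i i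

lemma symb_Qc_sub (i j : Fin 3) : Symb (-1) fun _ y => N.Qc i j y - tproj i j y := by
  simp only [Qc_eq, add_sub_cancel_left]
  refine ((symb_trace.mul (Symb.const _)).sub (symb_hdev i j)).add ((symb_adjugate i j).mono ?_)
  norm_num

lemma homog_tproj (i j : Fin 3) : Homog 0 (tproj i j) := fun c hc y hy => by
  simp only [tproj, homog_nrm _ c hc y hy]; simp

lemma symb_tproj (i j : Fin 3) : Symb 0 fun _ => tproj i j :=
  (homog_tproj i j).symb fun _ hy => contDiffAt_tproj hy i j

lemma symb_Qc (i j : Fin 3) : Symb 0 fun _ => N.Qc i j := by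
  simpa using (symb_tproj i j).add ((symb_Qc_sub (N := N) i j).mono (by norm_num : (-1 : ℤ) ≤ 0))

lemma near_tproj (i j : Fin 3) : Near (tproj i j) (tproj i j) :=
  Near.refl (by simpa using (symb_tproj i j).isBigO)

lemma near_Qc (i j : Fin 3) : Near (N.Qc i j) (tproj i j) := by
  simpa using ((symb_Qc_sub (N := N) i j).near (d := 0) (by norm_num)).add (near_tproj i j)

lemma near_hc (i j : Fin 3) : Near (N.hc i j) (tproj i j) := by
  simpa [hdev] using ((symb_hdev (N := N) i j).near (d := 0) (by norm_num)).add (near_tproj i j)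

/-- The trace of the metric is close to that of the round metric to second order. -/
lemma isBigO_trace_Qc : (fun y => ∑ i, N.Qc i i y - 2) =O[Bornology.cobounded E3]
    fun y => ‖y‖ ^ (-2 : ℤ) := by
  have h1 : ∀ᶠ y in Bornology.cobounded E3, ∑ i, N.Qc i i y - 2 =
      - (∑ i, (hdevM N y).adjugate i i) + (-2) * ∑ i, hdev N i 0 y * (hdevM N y).adjugate 0 i := by
    filter_upwards [eventually_lt_norm_cobounded N.R₀] with y hy
    have hd := det_h_add (pt_mem_region (N := N) hy)
    rw [h_add_eq, det_one_add] at hd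
    have hs := sum_tproj_self (ne_zero_of_lt hy)
    have hdet : (hdevM N y).det = ∑ i, hdev N i 0 y * (hdevM N y).adjugate 0 i := by
      have := congrFun (congrFun (adjugate_mul (hdevM N y)) 0) 0
      rw [mul_apply, Matrix.smul_apply, one_apply_eq, smul_eq_mul, mul_one] at this
      rw [← this]
      exact Finset.sum_congr rfl fun i _ => mul_comm _ _
    simp only [Qc_eq, Finset.sum_add_distrib, Finset.sum_sub_distrib, one_apply_eq, mul_one, hs,
      ← hdet]
    have htr : ∑ i, hdev N i i y = (hdevM N y).trace := rfl
    have hta : ∑ i, (hdevM N y).adjugate i i = (hdevM N y).adjugate.trace := rfl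
    rw [htr, hta]
    simp only [Finset.sum_const, Finset.card_univ, Fintype.card_fin, nsmul_eq_mul]
    push_cast
    linarith
  have h2 : Symb (-2) fun _ y => - (∑ i, (hdevM N y).adjugate i i) +
      (-2) * ∑ i, hdev N i 0 y * (hdevM N y).adjugate 0 i :=
    (Symb.sum fun i _ => symb_adjugate i i).neg.add (Symb.const_mul _
      ((Symb.sum fun i _ => (symb_hdev i 0).mul (symb_adjugate 0 i)).mono (by norm_num)))
  exact h2.isBigO.congr' (h1.mono fun _ h => h.symm) EventuallyEq.rfl

/-! ### Asymptotics of the Laplacian -/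

/-- The flat Laplacian. -/
def flatLap (f : E3 → ℝ) (y : E3) : ℝ := ∑ i, pd i (pd i f) y

lemma symb_div_form {p q : ℤ} {K : Fin 3 → Fin 3 → E3 → ℝ} {f : ℝ → E3 → ℝ}
    (hK : ∀ i j, Symb p fun _ => K i j) (hf : Symb q f) :
    Symb (p + (q - 1) - 1) fun r y => ∑ i, pd i (fun z => ∑ j, K i j z * pd j (f r) z) y :=
  Symb.sum fun i _ => (Symb.sum fun j _ => (hK i j).mul (hf.pd j)).pd i

/-- The leading term of the Laplacian of a family with homogeneous leading term. -/
lemma symb_lap_sub {q : ℤ} {G t e : ℝ → E3 → ℝ} (hG : ∀ r y, G r y = t r y + e r y)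
    (ht : Symb q t) (he : Symb (q - 1) e) (ht0 : ∀ r, Homog 0 (t r)) :
    Symb (q - 3) fun r y => ∑ i, pd i (fun z => ∑ j, N.Qc i j z * pd j (G r) z) y -
      flatLap (t r) y := by
  have h1 := symb_div_form (fun i j => symb_Qc_sub (N := N) i j) ht
  have h2 := symb_div_form (fun i j => symb_Qc (N := N) i j) he
  rw [show (-1 : ℤ) + (q - 1) - 1 = q - 3 by ring] at h1
  rw [show (0 : ℤ) + (q - 1 - 1) - 1 = q - 3 by ring] at h2
  refine (h1.add h2).congr ?_
  have hQ : ∀ᶠ y in Bornology.cobounded E3, ∀ᶠ z in 𝓝 y, N.R₀ < ‖z‖ := by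
    filter_upwards [eventually_lt_norm_cobounded N.R₀] with y hy using eventually_lt_norm hy
  filter_upwards [ht.smooth, he.smooth, hQ] with y st se sQ
  filter_upwards [eventually_eventually_nhds.2 st, eventually_eventually_nhds.2 se,
    eventually_eventually_nhds.2 sQ] with z st se sQ
  have e1 : ∀ i, (fun z => ∑ j, N.Qc i j z * pd j (G ‖y‖) z) =ᶠ[𝓝 z] fun z =>
      pd i (t ‖y‖) z + (∑ j, (N.Qc i j z - tproj i j z) * pd j (t ‖y‖) z +
        ∑ j, N.Qc i j z * pd j (e ‖y‖) z) := fun i => by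
    filter_upwards [st, se, sQ] with x st se sQ
    have hx := ne_zero_of_lt sQ
    have dt := st.differentiableAt (by simp)
    have d : ∀ j, pd j (G ‖y‖) x = pd j (t ‖y‖) x + pd j (e ‖y‖) x := fun j => by
      rw [← pd_add dt (se.differentiableAt (by simp))]
      exact congrArg (fun f => pd j f x) (funext (hG ‖y‖))
    have h0 : ∑ j, nrm j x * pd j (t ‖y‖) x = 0 := by
      rw [(ht0 ‖y‖).sum_nrm_mul_pd hx dt]; simp
    have h3 : pd i (t ‖y‖) x = ∑ j, tproj i j x * pd j (t ‖y‖) x := by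
      simp only [tproj, sub_mul, Finset.sum_sub_distrib, mul_assoc, ← Finset.mul_sum, h0]
      simp
    simp only [d, mul_add, sub_mul, Finset.sum_add_distrib, Finset.sum_sub_distrib, ← h3]
    ring
  have sz := st.self_of_nhds
  have ez := se.self_of_nhds
  have Qz := sQ.self_of_nhds
  have dpt := fun j => (contDiffAt_pd sz j)
  have dpe := fun j => (contDiffAt_pd ez j)
  have dq := fun i j => contDiffAt_Qc Qz i j
  have dT := fun i j => contDiffAt_tproj (ne_zero_of_lt Qz) i j
  have c1 := fun i => (ContDiffAt.sum fun j (_ : j ∈ Finset.univ) =>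
    ((dq i j).sub (dT i j)).mul (dpt j)).differentiableAt (by simp)
  have c2 := fun i => (ContDiffAt.sum fun j (_ : j ∈ Finset.univ) =>
    (dq i j).mul (dpe j)).differentiableAt (by simp)
  have e2 : ∀ i, pd i (fun z => ∑ j, N.Qc i j z * pd j (G ‖y‖) z) z = pd i (pd i (t ‖y‖)) z +
      (pd i (fun z => ∑ j, (N.Qc i j z - tproj i j z) * pd j (t ‖y‖) z) z +
      pd i (fun z => ∑ j, N.Qc i j z * pd j (e ‖y‖) z) z) := fun i => by
    rw [pd_congr (e1 i), pd_add ((dpt i).differentiableAt (by simp)) ((c1 i).fun_add (c2 i)),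
      pd_add (c1 i) (c2 i)]
  simp only [e2, flatLap, Finset.sum_add_distrib]
  ring

lemma flatLap_nrm {y : E3} (hy : y ≠ 0) (i : Fin 3) :
    ‖y‖ ^ 2 * flatLap (nrm i) y = - 2 * nrm i y := by
  have h0 : ‖y‖ ≠ 0 := norm_ne_zero_iff.2 hy
  have dn : DifferentiableAt ℝ (fun z : E3 => ‖z‖) y := differentiableAt_norm' hy
  have dp := fun a => (contDiffAt_pd (contDiffAt_nrm hy i) a).differentiableAt (by simp)
  have e : ∀ a, ‖y‖ * pd a (pd a (nrm i)) y =
      pd a (tproj i a) y - nrm a y * pd a (nrm i) y := fun a => by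
    have h1 : (fun z => ‖z‖ * pd a (nrm i) z) =ᶠ[𝓝 y] tproj i a := by
      filter_upwards [eventually_ne_zero hy] with z hz
      rw [pd_nrm hz]
      field_simp [norm_ne_zero_iff.2 hz]
    rw [← pd_congr h1, pd_mul dn (dp a), pd_norm hy]
    ring
  have h1 : ‖y‖ * flatLap (nrm i) y = - 2 * nrm i y / ‖y‖ := by
    rw [flatLap, Finset.mul_sum]
    simp only [e, Finset.sum_sub_distrib, pd_nrm hy, pd_tproj hy]
    have s1 := sum_tproj_self hy
    have s2 := sum_tproj_nrm hy i
    simp only [Fin.sum_univ_three] at s1 s2 ⊢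
    field_simp
    linear_combination (-nrm i y) * s1 - 2 * s2
  rw [pow_two, mul_assoc, h1]
  field_simp

lemma pd_flatLap_nrm {y : E3} (hy : y ≠ 0) (i k : Fin 3) :
    ‖y‖ ^ 3 * pd k (flatLap (nrm i)) y = - 2 * tproj i k y + 4 * (nrm i y * nrm k y) := by
  have h0 : ‖y‖ ≠ 0 := norm_ne_zero_iff.2 hy
  have dn : DifferentiableAt ℝ (fun z : E3 => ‖z‖) y := differentiableAt_norm' hy
  have dL : DifferentiableAt ℝ (flatLap (nrm i)) y :=
    (ContDiffAt.sum fun a _ => contDiffAt_pd (contDiffAt_pd (contDiffAt_nrm hy i) a) a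
      ).differentiableAt (by simp)
  have h1 : (fun z => ‖z‖ * ‖z‖ * flatLap (nrm i) z) =ᶠ[𝓝 y] fun z => (-2) * nrm i z := by
    filter_upwards [eventually_ne_zero hy] with z hz
    rw [← flatLap_nrm hz]; ring
  have h2 := pd_congr h1 k
  rw [pd_mul (dn.fun_mul dn) dL, pd_mul dn dn, pd_norm hy,
    pd_const_mul _ (differentiableAt_nrm hy i), pd_nrm hy] at h2
  have h3 := flatLap_nrm hy i
  field_simp at h2
  linear_combination h2 - 2 * nrm k y * h3

end Asymptotics


open Exterior

/-! ### Asymptotics of the embeddings -/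

lemma Symb.near_pow {f : ℝ → E3 → ℝ} {q : ℤ} (hf : Symb q f) (d : ℕ) (h : (d : ℤ) + q < 0) :
    Near (fun y => ‖y‖ ^ d * f ‖y‖ y) fun _ => 0 := by
  simpa using hf.near h

lemma Symb.near_pow_of_sub {f g : ℝ → E3 → ℝ} {q : ℤ} {φ : E3 → ℝ}
    (hf : Symb q fun r y => f r y - g r y) (d : ℕ) (h : (d : ℤ) + q < 0)
    (hg : Near (fun y => ‖y‖ ^ d * g ‖y‖ y) φ) : Near (fun y => ‖y‖ ^ d * f ‖y‖ y) φ := by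
  have := (hf.near_pow d h).add hg
  simp only [zero_add] at this
  exact this.congr (Eventually.of_forall fun y => by ring)

lemma Homog.near_pow {d : ℕ} {f : E3 → ℝ} (hf : Homog (-(d : ℤ)) f)
    (hs : ∀ y, y ≠ 0 → ContDiffAt ℝ ∞ f y) :
    Near (fun y => ‖y‖ ^ d * f y) fun y => ‖y‖ ^ d * f y := by
  simpa using hf.near hs

lemma Near.eventually_pos {f : E3 → ℝ} {c : ℝ} (hf : Near f fun _ => c) (hc : 0 < c) :
    ∀ᶠ y in Bornology.cobounded E3, 0 < f y := hf.tendsto_const.eventually_const_lt hc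

lemma Near.zero_mul_near {f g φ : E3 → ℝ} (hf : Near f fun _ => 0) (hg : Near g φ) :
    Near (fun y => f y * g y) fun _ => 0 := by
  simpa using hf.mul hg

lemma near_inv_norm : Near (fun y => ‖y‖⁻¹) fun _ => 0 := by
  have := Near.of_isBigO (isBigO_refl (fun y : E3 => ‖y‖ ^ (-1 : ℤ)) (Bornology.cobounded E3))
    (by norm_num)
  simpa using this

lemma homog_flatLap {d : ℤ} {f : E3 → ℝ} (hf : Homog d f)
    (hs : ∀ y, y ≠ 0 → ContDiffAt ℝ ∞ f y) : Homog (d - 1 - 1) (flatLap f) :=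
  Homog.sum fun i _ => (hf.pd (fun y hy => (hs y hy).differentiableAt (by simp)) i).pd
    (fun y hy => (contDiffAt_pd (hs y hy) i).differentiableAt (by simp)) i

lemma contDiffAt_flatLap {f : E3 → ℝ} {y : E3} (hs : ContDiffAt ℝ ∞ f y) :
    ContDiffAt ℝ ∞ (flatLap f) y :=
  ContDiffAt.sum fun i _ => contDiffAt_pd (contDiffAt_pd hs i) i

/-- The asymptotics of a family of embeddings in terms of the homogeneous extension `t` of the
leading term of the time function. -/
structure EmbAsymp (N : Exterior) (X : ℝ → E3 → R4) (t : E3 → ℝ) : Prop where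
  embedding : ∀ᶠ r : ℝ in atTop, IsIsometricEmbedding N r (X r)
  smooth : ∀ y, y ≠ 0 → ContDiffAt ℝ ∞ t y
  homog : Homog 0 t
  time : Symb (-1) fun r y => emb (X r) 0 y - t y
  space : ∀ i : Fin 3, Symb 0 fun r y => emb (X r) i.succ y - r * nrm i y

lemma IsAsymptoticFamily.exists_embAsymp {N : Exterior} {X : ℝ → E3 → R4}
    (hX : IsAsymptoticFamily N X) : ∃ t, EmbAsymp N X t := by
  obtain ⟨τ, hτ, hτ'⟩ := hX.time
  refine ⟨radialExt τ, hX.embedding, fun y hy => hτ.contDiffAt_radialExt hy, homog_radialExt τ,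
    ?_, fun i => ?_⟩
  · exact hτ'.symb (hX.embedding.mono fun r h => (h.smooth 0).sub hτ)
  · have hi : SmoothOnSphere fun n => n i := fun y hy =>
      ((contDiffAt_nrm hy i).congr_of_eventuallyEq (Eventually.of_forall fun z => by
        simp [radialExt, nrm, div_eq_inv_mul])).contDiffWithinAt
    have := (hX.space i).symb (hX.embedding.mono fun r h =>
      (h.smooth i.succ).sub ((contDiffOn_const (c := r)).mul hi))
    convert this using 3 with r y
    simp [radialExt, emb, nrm, div_eq_inv_mul]

/-- The leading terms of the derivatives of the time function. -/
def timeLead₁ (t : E3 → ℝ) (k : Fin 3) (y : E3) : ℝ := ‖y‖ ^ 1 * pd k t y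

/-- The leading term of the Laplacian of the time function. -/
def timeLead₂ (t : E3 → ℝ) (y : E3) : ℝ := ‖y‖ ^ 2 * flatLap t y

/-- The leading term of the derivatives of the Laplacian of the time function. -/
def timeLead₃ (t : E3 → ℝ) (k : Fin 3) (y : E3) : ℝ := ‖y‖ ^ 3 * pd k (flatLap t) y

section EmbAsymp

variable {N : Exterior} {X : ℝ → E3 → R4} {t : E3 → ℝ}

lemma near_nrm (i : Fin 3) : Near (nrm i) (nrm i) := by
  have := Homog.near_pow (d := 0) (by simpa using homog_nrm i) (fun y hy => contDiffAt_nrm hy i)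
  simpa using this

lemma symb_nrm (i : Fin 3) : Symb 0 fun _ => nrm i :=
  (homog_nrm i).symb fun _ hy => contDiffAt_nrm hy i

lemma EmbAsymp.near_timeLead₁ (h : EmbAsymp N X t) (k : Fin 3) :
    Near (timeLead₁ t k) (timeLead₁ t k) :=
  Homog.near_pow (d := 1) (by
    simpa using h.homog.pd (fun y hy => (h.smooth y hy).differentiableAt (by simp)) k)
    (fun y hy => contDiffAt_pd (h.smooth y hy) k)

lemma EmbAsymp.near_timeLead₂ (h : EmbAsymp N X t) : Near (timeLead₂ t) (timeLead₂ t) :=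
  Homog.near_pow (d := 2) (by simpa using homog_flatLap h.homog h.smooth)
    (fun y hy => contDiffAt_flatLap (h.smooth y hy))

lemma EmbAsymp.near_timeLead₃ (h : EmbAsymp N X t) (k : Fin 3) :
    Near (timeLead₃ t k) (timeLead₃ t k) :=
  Homog.near_pow (d := 3) (by
    simpa using (homog_flatLap h.homog h.smooth).pd
      (fun y hy => (contDiffAt_flatLap (h.smooth y hy)).differentiableAt (by simp)) k)
    (fun y hy => contDiffAt_pd (contDiffAt_flatLap (h.smooth y hy)) k)

lemma EmbAsymp.symb_lead (h : EmbAsymp N X t) : Symb 0 fun _ => t := h.homog.symb h.smooth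

lemma EmbAsymp.symb_time (h : EmbAsymp N X t) : Symb 0 fun r => emb (X r) 0 := by
  simpa using (h.time.mono (by norm_num : (-1 : ℤ) ≤ 0)).add h.symb_lead

lemma EmbAsymp.symb_space (h : EmbAsymp N X t) (i : Fin 3) : Symb 1 fun r => emb (X r) i.succ := by
  simpa using ((h.space i).mono (by norm_num : (0 : ℤ) ≤ 1)).add (Symb.radius.mul (symb_nrm i))

lemma Symb.pd_sub {q : ℤ} {f g : ℝ → E3 → ℝ} (hf : SmoothFamily f) (hg : SmoothFamily g)
    (h : Symb q fun r y => f r y - g r y) (j : Fin 3) :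
    Symb (q - 1) fun r y => BondiSachs.pd j (f r) y - BondiSachs.pd j (g r) y := by
  refine (h.pd j).congr ?_
  filter_upwards [hf, hg] with y h1 h2
  filter_upwards [h1, h2] with z h1 h2 using
    BondiSachs.pd_sub (h1.differentiableAt (by simp)) (h2.differentiableAt (by simp)) j

lemma EmbAsymp.near_pd_time (h : EmbAsymp N X t) (k : Fin 3) :
    Near (fun y => ‖y‖ ^ 1 * pd k (emb (X ‖y‖) 0) y) (timeLead₁ t k) :=
  (Symb.pd_sub h.symb_time.smooth h.symb_lead.smooth h.time k).near_pow_of_sub 1 (by norm_num)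
    (h.near_timeLead₁ k)

lemma EmbAsymp.near_pd_time_zero (h : EmbAsymp N X t) (k : Fin 3) :
    Near (fun y => pd k (emb (X ‖y‖) 0) y) fun _ => 0 := by
  simpa using (h.symb_time.pd k).near_pow 0 (by norm_num)

lemma EmbAsymp.near_pd_space (h : EmbAsymp N X t) (i k : Fin 3) :
    Near (fun y => pd k (emb (X ‖y‖) i.succ) y) (tproj i k) := by
  have h1 := Symb.pd_sub (h.symb_space i).smooth (Symb.radius.mul (symb_nrm i)).smooth (h.space i) k
  have h2 : Near (fun y => ‖y‖ ^ 0 * pd k (fun z => ‖y‖ * nrm i z) y) (tproj i k) := by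
    refine (near_tproj i k).congr ?_
    filter_upwards [eventually_lt_norm_cobounded 0] with y hy
    have hy0 := norm_pos_iff.1 hy
    rw [pd_const_mul _ (differentiableAt_nrm hy0 i), pd_nrm hy0]
    field_simp
  simpa using h1.near_pow_of_sub 0 (by norm_num) h2

lemma EmbAsymp.smoothFamily_lapEmb (h : EmbAsymp N X t) (β : Fin 4) :
    SmoothFamily fun r y => N.lapEmb (X r) y β := by
  filter_upwards [eventually_lt_norm_cobounded N.R₀, eventually_norm_cobounded h.embedding]
    with y hy hX
  filter_upwards [eventually_lt_norm hy] with z hz using contDiffAt_lapEmb hX hz β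

lemma EmbAsymp.symb_lap_time (h : EmbAsymp N X t) :
    Symb (-3) fun r y => N.lapEmb (X r) y 0 - flatLap t y :=
  symb_lap_sub (G := fun r => emb (X r) 0) (t := fun _ => t) (q := 0) (fun r y => by ring)
    h.symb_lead h.time fun _ => h.homog

lemma flatLap_const_mul_nrm {y : E3} (hy : y ≠ 0) (r : ℝ) (i : Fin 3) :
    flatLap (fun z => r * nrm i z) y = r * flatLap (nrm i) y := by
  rw [flatLap, flatLap, Finset.mul_sum]
  refine Finset.sum_congr rfl fun a _ => ?_
  have h1 : pd a (fun z => r * nrm i z) =ᶠ[𝓝 y] fun z => r * pd a (nrm i) z := by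
    filter_upwards [eventually_ne_zero hy] with z hz
    exact pd_const_mul _ (differentiableAt_nrm hz i) a
  rw [pd_congr h1, pd_const_mul _
    ((contDiffAt_pd (contDiffAt_nrm hy i) a).differentiableAt (by simp))]

lemma EmbAsymp.symb_lap_space (h : EmbAsymp N X t) (i : Fin 3) :
    Symb (-2) fun r y => N.lapEmb (X r) y i.succ - r * flatLap (nrm i) y := by
  have h1 := symb_lap_sub (N := N) (G := fun r => emb (X r) i.succ) (t := fun r y => r * nrm i y)
    (q := 1) (fun r y => (add_sub_cancel _ _).symm) (Symb.radius.mul (symb_nrm i)) (h.space i)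
    fun r => by
      intro c hc y hy
      simp only [homog_nrm i c hc y hy]
      simp
  refine h1.congr ?_
  filter_upwards [eventually_lt_norm_cobounded 0] with y hy
  filter_upwards [eventually_ne_zero (norm_pos_iff.1 hy)] with z hz
  rw [flatLap_const_mul_nrm hz]
  rfl

lemma EmbAsymp.near_lap_time (h : EmbAsymp N X t) :
    Near (fun y => ‖y‖ ^ 2 * N.lapEmb (X ‖y‖) y 0) (timeLead₂ t) :=
  h.symb_lap_time.near_pow_of_sub (g := fun _ => flatLap t) 2 (by norm_num) h.near_timeLead₂

lemma EmbAsymp.near_lap_time_zero (h : EmbAsymp N X t) :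
    Near (fun y => ‖y‖ * N.lapEmb (X ‖y‖) y 0) fun _ => 0 := by
  refine (near_inv_norm.zero_mul_near h.near_lap_time).congr ?_
  filter_upwards [eventually_lt_norm_cobounded 0] with y hy
  field_simp

lemma symb_flatLap_lead (h : EmbAsymp N X t) : SmoothFamily fun _ => flatLap t :=
  smoothFamily_of_homog fun _ hy => contDiffAt_flatLap (h.smooth _ hy)

lemma EmbAsymp.near_pd_lap_time (h : EmbAsymp N X t) (k : Fin 3) :
    Near (fun y => ‖y‖ ^ 3 * pd k (fun z => N.lapEmb (X ‖y‖) z 0) y) (timeLead₃ t k) :=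
  (Symb.pd_sub (h.smoothFamily_lapEmb 0) (symb_flatLap_lead h) h.symb_lap_time k).near_pow_of_sub
    3 (by norm_num) (h.near_timeLead₃ k)

lemma EmbAsymp.near_lap_space (h : EmbAsymp N X t) (i : Fin 3) :
    Near (fun y => ‖y‖ * N.lapEmb (X ‖y‖) y i.succ) fun y => (-2) * nrm i y := by
  have h2 : Near (fun y => ‖y‖ ^ 1 * (‖y‖ * flatLap (nrm i) y)) fun y => (-2) * nrm i y := by
    refine ((Near.const (-2)).mul (near_nrm i)).congr ?_
    filter_upwards [eventually_lt_norm_cobounded 0] with y hy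
    rw [← flatLap_nrm (norm_pos_iff.1 hy)]; ring
  simpa using (h.symb_lap_space i).near_pow_of_sub (g := fun r y => r * flatLap (nrm i) y) 1
    (by norm_num) h2

lemma EmbAsymp.near_pd_lap_space (h : EmbAsymp N X t) (i k : Fin 3) :
    Near (fun y => ‖y‖ ^ 2 * pd k (fun z => N.lapEmb (X ‖y‖) z i.succ) y)
      fun y => (-2) * tproj i k y + 4 * (nrm i y * nrm k y) := by
  have hs : SmoothFamily fun r y => r * flatLap (nrm i) y := by
    filter_upwards [eventually_lt_norm_cobounded 0] with y hy
    filter_upwards [eventually_ne_zero (norm_pos_iff.1 hy)] with z hz using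
      contDiffAt_const.mul (contDiffAt_flatLap (contDiffAt_nrm hz i))
  have h2 : Near (fun y => ‖y‖ ^ 2 * pd k (fun z => ‖y‖ * flatLap (nrm i) z) y)
      fun y => (-2) * tproj i k y + 4 * (nrm i y * nrm k y) := by
    refine (((Near.const (-2)).mul (near_tproj i k)).add
      ((Near.const 4).mul ((near_nrm i).mul (near_nrm k)))).congr ?_
    filter_upwards [eventually_lt_norm_cobounded 0] with y hy
    have hy0 := norm_pos_iff.1 hy
    rw [pd_const_mul _ ((contDiffAt_flatLap (contDiffAt_nrm hy0 i)).differentiableAt (by simp)),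
      ← pd_flatLap_nrm hy0]
    ring
  exact (Symb.pd_sub (h.smoothFamily_lapEmb i.succ) hs (h.symb_lap_space i) k).near_pow_of_sub
    (g := fun r => pd k fun z => r * flatLap (nrm i) z) 2 (by norm_num) h2

lemma EmbAsymp.near_lapSq (h : EmbAsymp N X t) :
    Near (fun y => ‖y‖ ^ 2 * N.lapSq (X ‖y‖) y) fun _ => 4 := by
  have h1 := (h.near_lap_time_zero.mul h.near_lap_time_zero).neg.add
    (Near.sum (s := Finset.univ) fun i _ => (h.near_lap_space i).mul (h.near_lap_space i))
  refine (h1.congr (Eventually.of_forall fun y => ?_)).congr_right ?_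
  · simp only [lapSq, mink_eq, Fin.sum_univ_three]
    ring
  · filter_upwards [eventually_lt_norm_cobounded 0] with y hy
    have := sum_nrm_sq (norm_pos_iff.1 hy)
    simp only [Fin.sum_univ_three] at this ⊢
    linear_combination 4 * this

lemma EmbAsymp.near_lapSq_sqrt (h : EmbAsymp N X t) :
    Near (fun y => ‖y‖ * Real.sqrt (N.lapSq (X ‖y‖) y)) fun _ => 2 := by
  have h1 := h.near_lapSq.comp (F := Real.sqrt) (c := 4) Real.continuous_sqrt.continuousAt
  rw [show (4 : ℝ) = 2 ^ 2 by norm_num, Real.sqrt_sq (by norm_num)] at h1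
  refine h1.congr (Eventually.of_forall fun y => ?_)
  simp only
  rw [Real.sqrt_mul (by positivity), Real.sqrt_sq (norm_nonneg y)]

lemma lap_div_lapSq {a b c s : ℝ} (hs : 0 < s) (hc : s ^ 2 * c ≠ 0) :
    a / c * b = s * a * (s * b) / (s ^ 2 * c) := by
  have : c ≠ 0 := fun h => hc (by simp [h])
  field_simp

lemma EmbAsymp.near_timeProj_zero (h : EmbAsymp N X t) :
    Near (fun y => N.timeProj (X ‖y‖) y 0) fun _ => 1 := by
  have h1 := ((Near.const 1).add (Near.sum (s := Finset.univ) fun i _ =>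
    Near.sum (s := Finset.univ) fun j _ =>
      (near_Qc (N := N) i j).mul ((h.near_pd_time_zero i).mul (h.near_pd_time_zero j)))).add
    ((h.near_lap_time_zero.mul h.near_lap_time_zero).div h.near_lapSq (by norm_num))
  refine (h1.congr ?_).congr_right (Eventually.of_forall fun y => by simp)
  filter_upwards [h.near_lapSq.eventually_pos (by norm_num), eventually_lt_norm_cobounded 0]
    with y h1 h2
  simp only [timeProj]
  rw [lap_div_lapSq h2 h1.ne']
  simp

lemma EmbAsymp.eventually_goodAt (h : EmbAsymp N X t) :
    ∀ᶠ y in Bornology.cobounded E3, N.GoodAt (X ‖y‖) y := by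
  filter_upwards [h.near_lapSq.eventually_pos (by norm_num),
    h.near_timeProj_zero.eventually_pos (by norm_num), eventually_lt_norm_cobounded 0]
    with y h1 h2 h3
  exact ⟨pos_of_mul_pos_right h1 (by positivity), h2⟩

lemma EmbAsymp.sum_nrm_timeLead₁ (h : EmbAsymp N X t) {y : E3} (hy : y ≠ 0) :
    ∑ i, nrm i y * timeLead₁ t i y = 0 := by
  have := h.homog.sum_nrm_mul_pd hy ((h.smooth y hy).differentiableAt (by simp))
  simp only [timeLead₁, Fin.sum_univ_three] at this ⊢
  linear_combination ‖y‖ * this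

lemma EmbAsymp.sum_nrm_timeLead₃ (h : EmbAsymp N X t) {y : E3} (hy : y ≠ 0) :
    ∑ i, nrm i y * timeLead₃ t i y = - 2 * timeLead₂ t y := by
  have := (homog_flatLap h.homog h.smooth).sum_nrm_mul_pd hy
    ((contDiffAt_flatLap (h.smooth y hy)).differentiableAt (by simp))
  have h0 : ‖y‖ ≠ 0 := norm_ne_zero_iff.2 hy
  simp only [timeLead₃, timeLead₂, Fin.sum_univ_three] at this ⊢
  field_simp at this
  push_cast at this
  linear_combination ‖y‖ ^ 2 * this

lemma EmbAsymp.near_timeProj_succ (h : EmbAsymp N X t) (i : Fin 3) :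
    Near (fun y => ‖y‖ * N.timeProj (X ‖y‖) y i.succ)
      fun y => timeLead₁ t i y - 1 / 2 * (nrm i y * timeLead₂ t y) := by
  have h1 := (Near.sum (s := Finset.univ) fun j _ => Near.sum (s := Finset.univ) fun k _ =>
      (near_Qc (N := N) j k).mul ((h.near_pd_time j).mul (h.near_pd_space i k))).add
    ((h.near_lap_time.mul (h.near_lap_space i)).div h.near_lapSq (by norm_num))
  refine (h1.congr ?_).congr_right ?_
  · filter_upwards [h.near_lapSq.eventually_pos (by norm_num), eventually_lt_norm_cobounded 0]
      with y h1 h2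
    simp only [timeProj]
    rw [lap_div_lapSq h2 h1.ne', if_neg (Fin.succ_ne_zero i), zero_add, mul_add, Finset.mul_sum]
    congr 1
    · refine Finset.sum_congr rfl fun j _ => ?_
      rw [Finset.mul_sum]
      exact Finset.sum_congr rfl fun k _ => by ring
    · ring
  · filter_upwards [eventually_lt_norm_cobounded 0] with y hy
    have hy0 := norm_pos_iff.1 hy
    have e1 := h.sum_nrm_timeLead₁ hy0
    have e2 := sum_nrm_sq hy0
    have e3 : timeLead₁ t i y = ∑ j, (if i = j then (1 : ℝ) else 0) * timeLead₁ t j y := by simp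
    have e4 : ∑ j, ∑ k, tproj j k y * (timeLead₁ t j y * tproj i k y) = timeLead₁ t i y := by
      have f1 : ∀ j, ∑ k, tproj j k y * (timeLead₁ t j y * tproj i k y) =
          timeLead₁ t j y * tproj i j y := fun j => by
        have f2 := sum_tproj_nrm hy0 j
        have f3 : ∑ k, tproj j k y * (if i = k then (1 : ℝ) else 0) = tproj j i y := by simp
        have f4 := tproj_symm i j y
        rw [f4, ← f3]
        have : ∀ k, tproj i k y = (if i = k then (1 : ℝ) else 0) - nrm i y * nrm k y := fun k => rfl
        simp only [this, Fin.sum_univ_three] at f2 ⊢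
        linear_combination - timeLead₁ t j y * nrm i y * f2
      simp only [f1]
      simp only [tproj]
      conv_rhs => rw [e3]
      simp only [Fin.sum_univ_three] at e1 ⊢
      linear_combination - nrm i y * e1
    rw [e4]; ring

lemma EmbAsymp.near_inv_sqrt (h : EmbAsymp N X t) :
    Near (fun y => (Real.sqrt (N.timeProj (X ‖y‖) y 0))⁻¹) fun _ => 1 := by
  have := (h.near_timeProj_zero.comp (F := Real.sqrt) (c := 1)
    Real.continuous_sqrt.continuousAt).comp (F := fun x => x⁻¹) (continuousAt_inv₀ (by simp))
  simpa using this

lemma EmbAsymp.near_dualEmb_zero (h : EmbAsymp N X t) :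
    Near (fun y => N.dualEmb (X ‖y‖) y 0) fun _ => 1 := by
  simpa [dualEmb] using h.near_inv_sqrt.mul h.near_timeProj_zero

lemma EmbAsymp.near_dualEmb_succ (h : EmbAsymp N X t) (i : Fin 3) :
    Near (fun y => ‖y‖ * N.dualEmb (X ‖y‖) y i.succ)
      fun y => timeLead₁ t i y - 1 / 2 * (nrm i y * timeLead₂ t y) := by
  have := h.near_inv_sqrt.mul (h.near_timeProj_succ i)
  simp only [one_mul] at this
  refine this.congr (Eventually.of_forall fun y => ?_)
  simp only [dualEmb, Pi.smul_apply, smul_eq_mul]; ring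

lemma EmbAsymp.near_mink_dualEmb (h : EmbAsymp N X t) (T : R4) :
    Near (fun y => - mink T (N.dualEmb (X ‖y‖) y)) fun _ => T 0 := by
  have h1 := (((Near.const (T 0)).mul h.near_dualEmb_zero)).sub
    (Near.sum (s := Finset.univ) fun (i : Fin 3) _ => (Near.const (T i.succ)).mul
      (near_inv_norm.zero_mul_near (h.near_dualEmb_succ i)))
  refine (h1.congr ?_).congr_right (Eventually.of_forall fun y => by simp)
  filter_upwards [eventually_lt_norm_cobounded 0] with y hy
  rw [mink_eq]
  simp only [Fin.sum_univ_three]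
  field_simp
  ring

lemma EmbAsymp.near_embConn (h : EmbAsymp N X t) (k : Fin 3) :
    Near (fun y => ‖y‖ ^ 2 * N.embConn (X ‖y‖) y k)
      fun y => 1 / 2 * timeLead₃ t k y + timeLead₁ t k y + nrm k y * timeLead₂ t y := by
  have h1 := ((h.near_dualEmb_zero.mul (h.near_pd_lap_time k)).sub
    (Near.sum (s := Finset.univ) fun (i : Fin 3) _ =>
      (h.near_dualEmb_succ i).mul (h.near_pd_lap_space i k))).div h.near_lapSq_sqrt (by norm_num)
  refine (h1.congr ?_).congr_right ?_
  · filter_upwards [h.eventually_goodAt, eventually_lt_norm_cobounded 0] with y h1 h2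
    have h3 := (Real.sqrt_pos.2 h1.1).ne'
    have e : ∑ β, sgn β * (N.dualEmb (X ‖y‖) y β * pd k (fun z => N.lapEmb (X ‖y‖) z β) y) =
        - (N.dualEmb (X ‖y‖) y 0 * pd k (fun z => N.lapEmb (X ‖y‖) z 0) y) +
        ∑ i : Fin 3, N.dualEmb (X ‖y‖) y i.succ * pd k (fun z => N.lapEmb (X ‖y‖) z i.succ) y := by
      rw [← mink_eq_sum (N.dualEmb (X ‖y‖) y) fun β => pd k (fun z => N.lapEmb (X ‖y‖) z β) y,
        mink_eq]
    rw [embConn, e]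
    simp only [Fin.sum_univ_three]
    field_simp
    ring
  · filter_upwards [eventually_lt_norm_cobounded 0] with y hy
    have hy0 := norm_pos_iff.1 hy
    have e1 := h.sum_nrm_timeLead₁ hy0
    have e2 := sum_nrm_sq hy0
    have e3 : ∑ i, (timeLead₁ t i y - 1 / 2 * (nrm i y * timeLead₂ t y)) *
        ((-2) * tproj i k y + 4 * (nrm i y * nrm k y)) =
        -2 * timeLead₁ t k y - 2 * (nrm k y * timeLead₂ t y) := by
      have e4 : timeLead₁ t k y = ∑ i, (if i = k then (1 : ℝ) else 0) * timeLead₁ t i y := by simp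
      have e5 : nrm k y = ∑ i, (if i = k then (1 : ℝ) else 0) * nrm i y := by simp
      simp only [tproj]
      rw [e4]
      simp only [Fin.sum_univ_three] at e1 e2 e5 ⊢
      linear_combination 6 * nrm k y * e1 - 3 * nrm k y * timeLead₂ t y * e2 -
        timeLead₂ t y * e5
    rw [e3]; ring

end EmbAsymp


open Exterior

/-! ### Asymptotics of the spacetime metric -/

lemma DecayLittleO.near_pow {f : E3 → ℝ} {q : ℤ} (hf : DecayLittleO q f) (d : ℕ) (h : d + q = 0) :
    Near (fun y => ‖y‖ ^ d * f y) fun _ => 0 := by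
  refine Near.of_isLittleO ?_
  rw [← h]
  refine ((isBigO_refl (fun y : E3 => ‖y‖ ^ d) _).mul_isLittleO hf.isLittleO).congr'
    EventuallyEq.rfl ?_
  filter_upwards [eventually_lt_norm_cobounded 0] with y hy
  rw [zpow_add₀ hy.ne', zpow_natCast]

lemma Homog.eq_zero_of_tendsto {f : E3 → ℝ} (hf : Homog 0 f)
    (h : Tendsto f (Bornology.cobounded E3) (𝓝 0)) {y : E3} (hy : y ≠ 0) : f y = 0 := by
  have h1 : Tendsto (fun c : ℝ => c • y) atTop (Bornology.cobounded E3) := by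
    rw [← tendsto_norm_atTop_iff_cobounded]
    have : Tendsto (fun c : ℝ => c * ‖y‖) atTop atTop :=
      tendsto_id.atTop_mul_const (norm_pos_iff.2 hy)
    refine this.congr' ?_
    filter_upwards [eventually_ge_atTop 0] with c hc
    rw [norm_smul, Real.norm_of_nonneg hc]
  refine tendsto_nhds_unique (tendsto_const_nhds.congr' ?_) (h.comp h1)
  filter_upwards [eventually_gt_atTop 0] with c hc
  simp [hf c hc y hy]

namespace Exterior

variable (N : Exterior)

/-- The leading term of the shift vector. -/
def shiftLead (i : Fin 3) (y : E3) : ℝ := radialExt (N.W₀ i) y / ‖y‖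

/-- The leading term of `P - 1`. -/
def massLead (y : E3) : ℝ :=
  - (2 * radialExt N.m y / ‖y‖) + ‖y‖ * ∑ i, pd i (N.shiftLead i) y

variable {N}

lemma homog_inv_norm : Homog (-1) (fun y : E3 => ‖y‖⁻¹) := fun c hc y _ => by
  simp [norm_smul, Real.norm_of_nonneg hc.le, mul_comm]

lemma contDiffAt_norm_e3 {y : E3} (hy : y ≠ 0) : ContDiffAt ℝ ∞ (fun z : E3 => ‖z‖) y :=
  contDiffAt_norm ℝ hy

lemma homog_shiftLead (i : Fin 3) : Homog (-1) (N.shiftLead i) := by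
  have := (homog_radialExt (N.W₀ i)).mul homog_inv_norm
  simp only [zero_add, ← div_eq_mul_inv] at this
  exact this

lemma contDiffAt_shiftLead {y : E3} (hy : y ≠ 0) (i : Fin 3) :
    ContDiffAt ℝ ∞ (N.shiftLead i) y :=
  ((N.smooth_W₀ i).contDiffAt_radialExt hy).div (contDiffAt_norm_e3 hy) (norm_ne_zero_iff.2 hy)

lemma homog_massLead : Homog (-1) N.massLead := by
  have h1 : Homog (-1) fun y => - (2 * radialExt N.m y / ‖y‖) := fun c hc y hy => by
    have := ((homog_radialExt N.m).mul homog_inv_norm) c hc y hy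
    simp only [zero_add] at this
    simp only [div_eq_mul_inv, mul_assoc, this]
    ring
  have h2 : Homog (-1) fun y => ‖y‖ * ∑ i, pd i (N.shiftLead i) y := by
    have := homog_norm.mul (Homog.sum (s := Finset.univ) fun i _ => (homog_shiftLead (N := N) i).pd
      (fun y hy => (contDiffAt_shiftLead hy i).differentiableAt (by simp)) i)
    simpa using this
  exact h1.add h2

lemma contDiffAt_massLead {y : E3} (hy : y ≠ 0) : ContDiffAt ℝ ∞ N.massLead y :=
  ((contDiffAt_const.mul (N.smooth_m.contDiffAt_radialExt hy)).div (contDiffAt_norm_e3 hy)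
    (norm_ne_zero_iff.2 hy)).neg.add ((contDiffAt_norm_e3 hy).mul
      (ContDiffAt.sum fun i _ => contDiffAt_pd (contDiffAt_shiftLead hy i) i))

lemma near_radialExt {f : E3 → ℝ} (hf : SmoothOnSphere f) : Near (radialExt f) (radialExt f) := by
  have := Homog.near_pow (d := 0) (by simpa using homog_radialExt f)
    (fun y hy => hf.contDiffAt_radialExt hy)
  simpa using this

lemma near_massLead : Near (fun y => ‖y‖ * N.massLead y) fun y => ‖y‖ * N.massLead y := by
  have := Homog.near_pow (d := 1) (by simpa using homog_massLead (N := N))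
    (fun y hy => contDiffAt_massLead hy)
  simpa using this

lemma near_pd_massLead (k : Fin 3) :
    Near (fun y => ‖y‖ ^ 2 * pd k N.massLead y) fun y => ‖y‖ ^ 2 * pd k N.massLead y :=
  Homog.near_pow (d := 2) (by
    simpa using homog_massLead.pd (fun y hy => (contDiffAt_massLead hy).differentiableAt (by simp)) k)
    (fun y hy => contDiffAt_pd (contDiffAt_massLead hy) k)

lemma near_pd_shiftLead (i k : Fin 3) :
    Near (fun y => ‖y‖ ^ 2 * pd k (N.shiftLead i) y) fun y => ‖y‖ ^ 2 * pd k (N.shiftLead i) y :=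
  Homog.near_pow (d := 2) (by
    simpa using (homog_shiftLead (N := N) i).pd
      (fun y hy => (contDiffAt_shiftLead hy i).differentiableAt (by simp)) k)
    (fun y hy => contDiffAt_pd (contDiffAt_shiftLead hy i) k)

variable (N) in
/-- The remainder of the shift vector. -/
def shiftErr (i : Fin 3) (y : E3) : ℝ := N.Wc i y - N.shiftLead i y

variable (N) in
/-- The remainder of `V`. -/
def potErr (y : E3) : ℝ := N.V (pt N.c y) - (1 - 2 * radialExt N.m y / ‖y‖)

lemma contDiffAt_shiftErr {y : E3} (hy : N.R₀ < ‖y‖) (i : Fin 3) :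
    ContDiffAt ℝ ∞ (N.shiftErr i) y :=
  (contDiffAt_Wc hy i).sub (contDiffAt_shiftLead (ne_zero_of_lt hy) i)

lemma contDiffAt_potErr {y : E3} (hy : N.R₀ < ‖y‖) : ContDiffAt ℝ ∞ N.potErr y := by
  have hy0 := ne_zero_of_lt hy
  refine (ContDiffAt.comp y (contDiffAt_V (pt_mem_region hy)) (contDiff_pt N.c).contDiffAt).sub ?_
  exact contDiffAt_const.sub ((contDiffAt_const.mul (N.smooth_m.contDiffAt_radialExt hy0)).div
    (contDiffAt_norm_e3 hy0) (norm_ne_zero_iff.2 hy0))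

lemma decay_shiftErr (i : Fin 3) : DecayLittleO (-1) (N.shiftErr i) := N.asymp_W i

lemma decay_potErr : DecayLittleO (-1) N.potErr := N.asymp_V

lemma decay_pd_shiftErr (i j : Fin 3) : DecayLittleO (-2) (pd j (N.shiftErr i)) := by
  simpa using (decay_shiftErr (N := N) i).pd
    (smoothFamily_of_lt (N := N) fun y hy => contDiffAt_shiftErr hy i) j

lemma decay_pd_pd_shiftErr (i j k : Fin 3) : DecayLittleO (-3) (pd k (pd j (N.shiftErr i))) := by
  simpa using (decay_pd_shiftErr (N := N) i j).pd
    (smoothFamily_of_lt (N := N) fun y hy => contDiffAt_pd (contDiffAt_shiftErr hy i) j) k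

lemma near_Wc (i : Fin 3) : Near (fun y => ‖y‖ * N.Wc i y) (radialExt (N.W₀ i)) := by
  have h := ((decay_shiftErr (N := N) i).near_pow 1 (by norm_num)).add
    (near_radialExt (N.smooth_W₀ i))
  simp only [zero_add] at h
  refine h.congr ?_
  filter_upwards [eventually_lt_norm_cobounded 0] with y hy
  simp only [shiftErr, shiftLead]
  field_simp
  ring

lemma near_pd_Wc (i j : Fin 3) : Near (fun y => ‖y‖ ^ 2 * pd j (N.Wc i) y)
    fun y => ‖y‖ ^ 2 * pd j (N.shiftLead i) y := by
  have h := ((decay_pd_shiftErr (N := N) i j).near_pow 2 (by norm_num)).add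
    (near_pd_shiftLead (N := N) i j)
  simp only [zero_add] at h
  refine h.congr ?_
  filter_upwards [eventually_lt_norm_cobounded N.R₀] with y hy
  have : pd j (N.shiftErr i) y = pd j (N.Wc i) y - pd j (N.shiftLead i) y :=
    pd_sub ((contDiffAt_Wc hy i).differentiableAt (by simp))
      ((contDiffAt_shiftLead (ne_zero_of_lt hy) i).differentiableAt (by simp)) j
  rw [this]; ring

/-- The leading term of the shift vector is tangent to the spheres. -/
lemma sum_nrm_shift {y : E3} (hy : y ≠ 0) : ∑ i, nrm i y * radialExt (N.W₀ i) y = 0 := by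
  have h1 : Near (fun y => ∑ i, nrm i y * (‖y‖ * N.Wc i y))
      fun y => ∑ i, nrm i y * radialExt (N.W₀ i) y :=
    Near.sum fun i _ => (near_nrm i).mul (near_Wc i)
  have h2 : Homog 0 fun y => ∑ i, nrm i y * radialExt (N.W₀ i) y :=
    Homog.sum fun i _ => by simpa using (homog_nrm i).mul (homog_radialExt (N.W₀ i))
  refine h2.eq_zero_of_tendsto (f := fun y => ∑ i, nrm i y * radialExt (N.W₀ i) y) ?_ hy
  have h3 := h1.tendsto.neg
  rw [neg_zero] at h3
  refine h3.congr' ?_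
  filter_upwards [eventually_lt_norm_cobounded N.R₀] with y hy
  have h4 : ∑ i, N.Wc i y * nrm i y = 0 := W_dot_normal (pt_mem_region hy)
  have h5 : ∑ i, nrm i y * (‖y‖ * N.Wc i y) = ‖y‖ * ∑ i, N.Wc i y * nrm i y := by
    rw [Finset.mul_sum]; exact Finset.sum_congr rfl fun i _ => by ring
  rw [h5, h4]; ring

lemma sum_nrm_pd_shiftLead {y : E3} (hy : y ≠ 0) (i : Fin 3) :
    ∑ j, nrm j y * (‖y‖ ^ 2 * pd j (N.shiftLead i) y) = - radialExt (N.W₀ i) y := by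
  have h := (homog_shiftLead (N := N) i).sum_nrm_mul_pd hy
    ((contDiffAt_shiftLead hy i).differentiableAt (by simp))
  have h0 := norm_ne_zero_iff.2 hy
  simp only [Fin.sum_univ_three] at h ⊢
  have h1 : ‖y‖ ^ 2 * (((-1 : ℤ) : ℝ) * N.shiftLead i y / ‖y‖) = - radialExt (N.W₀ i) y := by
    simp only [shiftLead]; field_simp; push_cast; ring
  linear_combination ‖y‖ ^ 2 * h + h1

variable (N) in
/-- The remainder of `P`. -/
def expErr (y : E3) : ℝ := N.potErr y + ‖y‖ * ∑ i, pd i (N.shiftErr i) y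

lemma expErr_eq {y : E3} (hy : N.R₀ < ‖y‖) : N.expErr y = N.Pc y - 1 - N.massLead y := by
  have e : ∀ i, pd i (N.shiftErr i) y = pd i (N.Wc i) y - pd i (N.shiftLead i) y := fun i =>
    pd_sub ((contDiffAt_Wc hy i).differentiableAt (by simp))
      ((contDiffAt_shiftLead (ne_zero_of_lt hy) i).differentiableAt (by simp)) i
  rw [Pc_eq hy, expErr, massLead, potErr]
  simp only [e, Finset.sum_sub_distrib]
  ring

lemma near_expErr : Near (fun y => ‖y‖ * N.expErr y) fun _ => 0 := by
  have h := ((decay_potErr (N := N)).near_pow 1 (by norm_num)).add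
    (Near.sum (s := Finset.univ) fun i _ => (decay_pd_shiftErr (N := N) i i).near_pow 2
      (by norm_num))
  refine (h.congr (Eventually.of_forall fun y => ?_)).congr_right
    (Eventually.of_forall fun y => by simp)
  simp only [expErr, Fin.sum_univ_three]
  ring

lemma pd_expErr {y : E3} (hy : N.R₀ < ‖y‖) (k : Fin 3) : pd k N.expErr y = pd k N.potErr y +
    (nrm k y * ∑ i, pd i (N.shiftErr i) y + ‖y‖ * ∑ i, pd k (pd i (N.shiftErr i)) y) := by
  have hy0 := ne_zero_of_lt hy
  have d1 := (contDiffAt_potErr hy).differentiableAt (by simp)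
  have d2 := fun i => (contDiffAt_pd (contDiffAt_shiftErr hy i) i).differentiableAt (by simp)
  have d3 : DifferentiableAt ℝ (fun y => ∑ i, pd i (N.shiftErr i) y) y :=
    DifferentiableAt.fun_sum fun i _ => d2 i
  have d4 : DifferentiableAt ℝ (fun z : E3 => ‖z‖) y := differentiableAt_norm' hy0
  have e : N.expErr = fun y => N.potErr y + ‖y‖ * ∑ i, pd i (N.shiftErr i) y := rfl
  rw [e, pd_add d1 (d4.fun_mul d3), pd_mul d4 d3, pd_norm hy0, pd_sum fun i _ => d2 i]

lemma near_pd_expErr (k : Fin 3) : Near (fun y => ‖y‖ ^ 2 * pd k N.expErr y) fun _ => 0 := by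
  have hV : DecayLittleO (-2) (pd k N.potErr) := by
    simpa using (decay_potErr (N := N)).pd
      (smoothFamily_of_lt (N := N) fun y hy => contDiffAt_potErr hy) k
  have h := (hV.near_pow 2 (by norm_num)).add
    (((near_nrm k).mul (Near.sum (s := Finset.univ) fun i _ =>
      (decay_pd_shiftErr (N := N) i i).near_pow 2 (by norm_num))).add
    (Near.sum (s := Finset.univ) fun i _ =>
      (decay_pd_pd_shiftErr (N := N) i i k).near_pow 3 (by norm_num)))
  refine (h.congr ?_).congr_right (Eventually.of_forall fun y => by simp)
  filter_upwards [eventually_lt_norm_cobounded N.R₀] with y hy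
  rw [pd_expErr hy]
  simp only [Fin.sum_univ_three]
  ring

lemma near_Pc_sub : Near (fun y => ‖y‖ * (N.Pc y - 1)) fun y => ‖y‖ * N.massLead y := by
  have h := (near_expErr (N := N)).add (near_massLead (N := N))
  simp only [zero_add] at h
  refine h.congr ?_
  filter_upwards [eventually_lt_norm_cobounded N.R₀] with y hy
  rw [expErr_eq hy]; ring

lemma near_pd_Pc (k : Fin 3) : Near (fun y => ‖y‖ ^ 2 * pd k N.Pc y)
    fun y => ‖y‖ ^ 2 * pd k N.massLead y := by
  have h := (near_pd_expErr (N := N) k).add (near_pd_massLead (N := N) k)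
  simp only [zero_add] at h
  refine h.congr ?_
  filter_upwards [eventually_lt_norm_cobounded N.R₀] with y hy
  have h1 : N.expErr =ᶠ[𝓝 y] fun y => N.Pc y - 1 - N.massLead y := by
    filter_upwards [eventually_lt_norm hy] with z hz using expErr_eq hz
  have dP := (contDiffAt_Pc hy).differentiableAt (by simp)
  have e : pd k (fun y => N.Pc y - 1) y = pd k N.Pc y := by
    rw [pd_sub dP (differentiableAt_const _), pd_const, sub_zero]
  rw [pd_congr h1, pd_sub (dP.fun_sub (differentiableAt_const _))
    ((contDiffAt_massLead (ne_zero_of_lt hy)).differentiableAt (by simp)), e]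
  ring

lemma near_Pc : Near N.Pc fun _ => 1 := by
  have h := (near_inv_norm.zero_mul_near (near_Pc_sub (N := N))).add (Near.const 1)
  simp only [zero_add] at h
  refine h.congr ?_
  filter_upwards [eventually_lt_norm_cobounded 0] with y hy
  field_simp
  ring

lemma near_Uc_sub : Near (fun y => ‖y‖ * (N.Uc y - 1)) fun _ => 0 := by
  have h := Near.of_isBigO (isBigO_norm_zpow_mul
    (isBigO_refl (fun y : E3 => ‖y‖ ^ (1 : ℤ)) (Bornology.cobounded E3)) N.asymp_U.isBigO)
    (by norm_num)
  simp only [zpow_one] at h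
  exact h

lemma near_Uc : Near N.Uc fun _ => 1 := by
  have h := (near_inv_norm.zero_mul_near (near_Uc_sub (N := N))).add (Near.const 1)
  simp only [zero_add] at h
  refine h.congr ?_
  filter_upwards [eventually_lt_norm_cobounded 0] with y hy
  field_simp
  ring

lemma near_sqrt_ratio : Near (fun y => 2 * ‖y‖ * (Real.sqrt (N.Pc y / N.Uc y) - 1))
    fun y => ‖y‖ * N.massLead y := by
  have hr := (near_Pc (N := N)).div (near_Uc (N := N)) one_ne_zero
  simp only [div_one] at hr
  have h1 := hr.comp (F := Real.sqrt) Real.continuous_sqrt.continuousAt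
  have h2 := ((near_Pc_sub (N := N)).sub (near_Uc_sub (N := N))).div (near_Uc (N := N)) one_ne_zero
  have h3 := ((Near.const 2).mul h2).div (h1.add (Near.const 1)) (by simp)
  refine (h3.congr ?_).congr_right (Eventually.of_forall fun y => by simp; ring)
  filter_upwards [near_Pc.eventually_pos one_pos, near_Uc.eventually_pos one_pos] with y hP hU
  have h4 := Real.mul_self_sqrt (div_pos hP hU).le
  have h5 : Real.sqrt (N.Pc y / N.Uc y) + 1 ≠ 0 := by positivity
  rw [div_eq_iff h5]
  have h6 : (‖y‖ * (N.Pc y - 1) - ‖y‖ * (N.Uc y - 1)) / N.Uc y = ‖y‖ * (N.Pc y / N.Uc y - 1) := by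
    field_simp; ring
  rw [h6]
  linear_combination (-2 * ‖y‖) * h4

lemma near_sphConn (k : Fin 3) : Near (fun y => ‖y‖ ^ 2 * N.sphConn y k)
    fun y => - (1 / 2) * (‖y‖ ^ 2 * pd k N.massLead y) - radialExt (N.W₀ k) y := by
  have h1 := (near_pd_Pc (N := N) k).neg.div ((Near.const 2).mul (near_Pc (N := N))) (by norm_num)
  have h2 := (Near.sum (s := Finset.univ) fun i _ => (near_hc (N := N) i k).mul
    ((Near.sum (s := Finset.univ) fun j _ => (near_nrm j).mul (near_pd_Wc (N := N) i j)).sub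
      (near_Wc (N := N) i))).div ((Near.const 2).mul (near_Uc (N := N))) (by norm_num)
  refine ((h1.add h2).congr ?_).congr_right ?_
  · filter_upwards [eventually_lt_norm_cobounded 0] with y hy
    simp only [sphConn, Fin.sum_univ_three]
    field_simp
  · filter_upwards [eventually_lt_norm_cobounded 0] with y hy
    have hy0 := norm_pos_iff.1 hy
    simp only [sum_nrm_pd_shiftLead hy0]
    have h3 := sum_nrm_shift (N := N) hy0
    have h4 : ∑ i, (if i = k then (1 : ℝ) else 0) * radialExt (N.W₀ i) y = radialExt (N.W₀ k) y := by
      simp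
    rw [← h4]
    simp only [tproj]
    simp only [Fin.sum_univ_three] at h3 ⊢
    linear_combination nrm k y * h3

end Exterior

section EmbAsymp

variable {N : Exterior} {X : ℝ → E3 → R4} {t : E3 → ℝ}

/-! ### Asymptotics of the energy density -/

variable (N) in
/-- The deviation of the radial mean curvature of an embedding from that of the round sphere. -/
def radialDev (X : ℝ → E3 → R4) (y : E3) : ℝ :=
  ‖y‖ ^ 2 * ∑ i : Fin 3, nrm i y * N.lapEmb (X ‖y‖) y i.succ + 2 * ‖y‖

lemma EmbAsymp.near_lap_dev (h : EmbAsymp N X t) (i : Fin 3) :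
    Near (fun y => ‖y‖ * (‖y‖ * N.lapEmb (X ‖y‖) y i.succ + 2 * nrm i y))
      fun y => ‖y‖ * (‖y‖ * N.lapEmb (X ‖y‖) y i.succ + 2 * nrm i y) := by
  refine Near.refl ?_
  have h1 := isBigO_norm_zpow_mul
    (isBigO_refl (fun y : E3 => ‖y‖ ^ (2 : ℤ)) (Bornology.cobounded E3)) (h.symb_lap_space i).isBigO
  simp only [show (2 : ℤ) + -2 = 0 by norm_num, zpow_zero] at h1
  refine h1.congr' ?_ EventuallyEq.rfl
  filter_upwards [eventually_lt_norm_cobounded 0] with y hy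
  have h2 := flatLap_nrm (norm_pos_iff.1 hy) i
  have h3 : ‖y‖ ^ (2 : ℤ) = ‖y‖ ^ 2 := by norm_cast
  rw [h3]
  linear_combination (-‖y‖) * h2

lemma EmbAsymp.near_radialDev (h : EmbAsymp N X t) : Near (radialDev N X) (radialDev N X) := by
  have h1 := Near.sum (s := Finset.univ) fun i _ => (near_nrm i).mul (h.near_lap_dev i)
  have e : (fun y => ∑ i, nrm i y * (‖y‖ * (‖y‖ * N.lapEmb (X ‖y‖) y i.succ + 2 * nrm i y)))
      =ᶠ[Bornology.cobounded E3] radialDev N X := by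
    filter_upwards [eventually_lt_norm_cobounded 0] with y hy
    have h2 := sum_nrm_sq (norm_pos_iff.1 hy)
    simp only [radialDev, Fin.sum_univ_three] at h2 ⊢
    linear_combination 2 * ‖y‖ * h2
  exact (h1.congr e).congr_right e

/-- To second order the mean curvature of an embedding is its radial component. -/
lemma EmbAsymp.near_sqrt_lapSq (h : EmbAsymp N X t) :
    Near (fun y => ‖y‖ * (‖y‖ * Real.sqrt (N.lapSq (X ‖y‖) y) +
      ∑ i : Fin 3, nrm i y * (‖y‖ * N.lapEmb (X ‖y‖) y i.succ))) fun _ => 0 := by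
  have ha : ∀ i : Fin 3, Near (fun y => ‖y‖ * N.lapEmb (X ‖y‖) y i.succ + 2 * nrm i y)
      fun _ => 0 := fun i => by
    refine ((h.near_lap_space i).add ((Near.const 2).mul (near_nrm i))).congr_right
      (Eventually.of_forall fun y => by ring)
  have hn : Near (fun y => ∑ i : Fin 3, nrm i y * (‖y‖ * N.lapEmb (X ‖y‖) y i.succ + 2 * nrm i y))
      fun _ => 0 :=
    (Near.sum (s := Finset.univ) fun i _ => (near_nrm i).mul (ha i)).congr_right
      (Eventually.of_forall fun y => by simp)
  have hns := Near.sum (s := Finset.univ) fun i _ => (near_nrm i).mul (h.near_lap_dev i)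
  have h1 : Near (fun y => ∑ i : Fin 3, (‖y‖ * N.lapEmb (X ‖y‖) y i.succ + 2 * nrm i y) *
      (‖y‖ * (‖y‖ * N.lapEmb (X ‖y‖) y i.succ + 2 * nrm i y))) fun _ => 0 :=
    (Near.sum (s := Finset.univ) fun i _ => (ha i).zero_mul_near (h.near_lap_dev i)).congr_right
      (Eventually.of_forall fun y => by simp)
  have h2 := (h1.sub (hn.zero_mul_near hns)).sub
    (h.near_lap_time_zero.zero_mul_near h.near_lap_time)
  have h3 : Near (fun y => ‖y‖ * Real.sqrt (N.lapSq (X ‖y‖) y) -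
      ∑ i : Fin 3, nrm i y * (‖y‖ * N.lapEmb (X ‖y‖) y i.succ)) fun _ => 4 := by
    refine (h.near_lapSq_sqrt.sub (Near.sum (s := Finset.univ) fun i _ =>
      (near_nrm i).mul (h.near_lap_space i))).congr_right ?_
    filter_upwards [eventually_lt_norm_cobounded 0] with y hy
    have h4 := sum_nrm_sq (norm_pos_iff.1 hy)
    simp only [Fin.sum_univ_three] at h4 ⊢
    linear_combination 2 * h4
  refine ((h2.div h3 (by norm_num)).congr ?_).congr_right (Eventually.of_forall fun y => by simp)
  filter_upwards [h3.eventually_pos (by norm_num), h.eventually_goodAt,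
    eventually_lt_norm_cobounded 0] with y h4 h5 h6
  have h7 := Real.mul_self_sqrt h5.1.le
  have h8 := sum_nrm_sq (norm_pos_iff.1 h6)
  rw [div_eq_iff h4.ne']
  have h9 : N.lapSq (X ‖y‖) y = - (N.lapEmb (X ‖y‖) y 0 * N.lapEmb (X ‖y‖) y 0) +
    ∑ i : Fin 3, N.lapEmb (X ‖y‖) y i.succ * N.lapEmb (X ‖y‖) y i.succ := mink_eq _ _
  set A := Real.sqrt (N.lapSq (X ‖y‖) y) with hA
  rw [h9] at h7
  simp only [Fin.sum_univ_three] at h7 h8 ⊢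
  generalize N.lapEmb (X ‖y‖) y 0 = H0 at *
  generalize N.lapEmb (X ‖y‖) y (Fin.succ 0) = H1 at *
  generalize N.lapEmb (X ‖y‖) y (Fin.succ 1) = H2 at *
  generalize N.lapEmb (X ‖y‖) y (Fin.succ 2) = H3 at *
  generalize nrm 0 y = n0 at *
  generalize nrm 1 y = n1 at *
  generalize nrm 2 y = n2 at *
  generalize ‖y‖ = s at *
  linear_combination (-s ^ 3) * h7 + (-4 * s * (n0 ^ 2 + n1 ^ 2 + n2 ^ 2) -
    4 * s ^ 2 * (n0 * H1 + n1 * H2 + n2 * H3)) * h8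

variable (N) in
/-- The leading term of the energy density, apart from `radialDev`. -/
def densityLead (t : E3 → ℝ) (T : R4) (y : E3) : ℝ :=
  - (T 0 * (‖y‖ * N.massLead y)) + ∑ j : Fin 3, T j.succ *
    (1 / 2 * timeLead₃ t j y + nrm j y * timeLead₂ t y + timeLead₁ t j y +
      1 / 2 * (‖y‖ ^ 2 * pd j N.massLead y + nrm j y * (‖y‖ * N.massLead y)) +
      radialExt (N.W₀ j) y)

lemma sum_nrm_pd_massLead {y : E3} (hy : y ≠ 0) :
    ∑ j, nrm j y * (‖y‖ ^ 2 * pd j N.massLead y) = - (‖y‖ * N.massLead y) := by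
  have h := (homog_massLead (N := N)).sum_nrm_mul_pd hy
    ((contDiffAt_massLead hy).differentiableAt (by simp))
  have h0 := norm_ne_zero_iff.2 hy
  have h1 : ‖y‖ ^ 2 * (((-1 : ℤ) : ℝ) * N.massLead y / ‖y‖) = - (‖y‖ * N.massLead y) := by
    field_simp; push_cast; ring
  simp only [Fin.sum_univ_three] at h ⊢
  linear_combination ‖y‖ ^ 2 * h + h1

lemma EmbAsymp.near_density (h : EmbAsymp N X t) (T : R4) :
    Near (fun y => N.density (X ‖y‖) T y)
      fun y => - (T 0 * radialDev N X y) + densityLead N t T y := by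
  have h1 := (h.near_mink_dualEmb T).mul
    ((h.near_sqrt_lapSq.sub h.near_radialDev).sub (near_sqrt_ratio (N := N)))
  have hT : ∀ k, Near (fun y => mink T fun β => pd k (emb (X ‖y‖) β) y)
      fun y => ∑ j : Fin 3, T j.succ * tproj j k y := fun k => by
    have := (((Near.const (T 0)).mul (h.near_pd_time_zero k)).neg).add
      (Near.sum (s := Finset.univ) fun (j : Fin 3) _ =>
        (Near.const (T j.succ)).mul (h.near_pd_space j k))
    refine (this.congr (Eventually.of_forall fun y => ?_)).congr_right
      (Eventually.of_forall fun y => by simp)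
    rw [mink_eq]
  have h2 := Near.sum (s := Finset.univ) fun k _ => Near.sum (s := Finset.univ) fun i _ =>
    (near_Qc (N := N) k i).mul ((hT k).mul ((h.near_embConn i).sub (near_sphConn (N := N) i)))
  refine ((h1.add h2).congr ?_).congr_right ?_
  · filter_upwards [eventually_lt_norm_cobounded 0] with y hy
    simp only [density, radialDev, Fin.sum_univ_three]
    field_simp
    ring
  · filter_upwards [eventually_lt_norm_cobounded 0] with y hy
    have hy0 := norm_pos_iff.1 hy
    set C : Fin 3 → ℝ := fun i => 1 / 2 * timeLead₃ t i y + timeLead₁ t i y +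
      nrm i y * timeLead₂ t y -
      (- (1 / 2) * (‖y‖ ^ 2 * pd i N.massLead y) - radialExt (N.W₀ i) y) with hC
    have hnC : ∑ i, nrm i y * C i = - (1 / 2) * (‖y‖ * N.massLead y) := by
      have e1 := h.sum_nrm_timeLead₁ hy0
      have e3 := h.sum_nrm_timeLead₃ hy0
      have e2 := sum_nrm_sq hy0
      have e4 := sum_nrm_pd_massLead (N := N) hy0
      have e5 := sum_nrm_shift (N := N) hy0
      simp only [hC, Fin.sum_univ_three] at e1 e2 e3 e4 e5 ⊢
      linear_combination 1 / 2 * e3 + e1 + timeLead₂ t y * e2 + 1 / 2 * e4 + e5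
    have hpp : ∀ j i, ∑ k, tproj k i y * tproj j k y = tproj j i y := fun j i => by
      have f2 := sum_tproj_nrm hy0 i
      have f3 : ∑ k, tproj i k y * (if j = k then (1 : ℝ) else 0) = tproj i j y := by simp
      have f4 : ∀ k, tproj k i y = tproj i k y := fun k => tproj_symm _ _ _
      rw [f4, ← f3]
      simp only [f4]
      have : ∀ k, tproj j k y = (if j = k then (1 : ℝ) else 0) - nrm j y * nrm k y := fun k => rfl
      simp only [this, Fin.sum_univ_three] at f2 ⊢
      linear_combination - nrm j y * f2
    have hsum : ∑ k, ∑ i, tproj k i y * ((∑ j : Fin 3, T j.succ * tproj j k y) * C i) =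
        ∑ j : Fin 3, T j.succ * ∑ i, (∑ k, tproj k i y * tproj j k y) * C i := by
      simp only [Fin.sum_univ_three]; ring
    have hproj : ∀ j, ∑ i, tproj j i y * C i = C j - nrm j y * ∑ i, nrm i y * C i := fun j => by
      have : C j = ∑ i, (if j = i then (1 : ℝ) else 0) * C i := by simp
      conv_rhs => rw [this]
      simp only [tproj, Fin.sum_univ_three]
      ring
    change _ + ∑ k, ∑ i, tproj k i y * ((∑ j : Fin 3, T j.succ * tproj j k y) * C i) = _
    rw [hsum]
    simp only [hpp, hproj, hnC]
    simp only [densityLead, Fin.sum_univ_three, hC]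
    ring

end EmbAsymp


open Exterior

/-! ### Integrals over large spheres -/

lemma continuous_sin_mul_comp {f : E3 → ℝ} {r : ℝ} (hr : 0 < r)
    (hf : ∀ y : E3, ‖y‖ = r → ContinuousAt f y) :
    Continuous fun u : ℝ × ℝ => Real.sin u.1 * f (r • polar u) := by
  refine (Real.continuous_sin.comp continuous_fst).mul (continuous_iff_continuousAt.2 fun u => ?_)
  exact ContinuousAt.comp (f := fun u => r • polar u) (hf _ (norm_smul_polar hr u))
    (contDiff_polar.continuous.const_smul r).continuousAt

lemma integrableOn_sin_mul_comp {f : E3 → ℝ} {r : ℝ} (hr : 0 < r)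
    (hf : ∀ y : E3, ‖y‖ = r → ContinuousAt f y) :
    IntegrableOn (fun u : ℝ × ℝ => Real.sin u.1 * f (r • polar u)) polarDomain :=
  integrableOn_polarDomain (continuous_sin_mul_comp hr hf)

/-- Functions which differ by the divergence of a tangent vector field have the same integral. -/
lemma integral_eq_of_div {f g : E3 → ℝ} {Z : Fin 3 → E3 → ℝ} {r : ℝ} (hr : 0 < r)
    (hZ : ∀ i y, ‖y‖ = r → ContDiffAt ℝ ∞ (Z i) y)
    (ht : ∀ y : E3, ‖y‖ = r → ∀ᶠ z in 𝓝 y, ∑ i, nrm i z * Z i z = 0)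
    (hg : ∀ y : E3, ‖y‖ = r → ContinuousAt g y)
    (hf : ∀ y : E3, ‖y‖ = r → f y = g y + ∑ i, pd i (Z i) y) :
    ∫ u in polarDomain, Real.sin u.1 * f (r • polar u) =
      ∫ u in polarDomain, Real.sin u.1 * g (r • polar u) := by
  have h1 := integral_div_sphere hr hZ ht
  have h2 : ∀ u : ℝ × ℝ, Real.sin u.1 * f (r • polar u) = Real.sin u.1 * g (r • polar u) +
      Real.sin u.1 * ∑ i, pd i (Z i) (r • polar u) := fun u => by
    rw [hf _ (norm_smul_polar hr u)]; ring
  simp only [h2]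
  rw [integral_add (integrableOn_sin_mul_comp hr hg)
    (integrableOn_sin_mul_comp (f := fun y => ∑ i, pd i (Z i) y) hr fun y hy =>
      (ContDiffAt.sum fun i _ => contDiffAt_pd (hZ i y hy) i).continuousAt), h1, add_zero]

lemma tendsto_integral_of_near_zero {f : E3 → ℝ} (hf : Near f fun _ => 0) {F : ℝ → ℝ × ℝ → ℝ}
    (hF : ∀ᶠ r in atTop, ∀ u ∈ polarDomain, F r u = f (r • polar u)) :
    Tendsto (fun r : ℝ => ∫ u in polarDomain, Real.sin u.1 * F r u) atTop (𝓝 0) := by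
  have hvol : volume (polarDomain : Set (ℝ × ℝ)) < ⊤ := by
    rw [measure_congr polarDomain_ae_eq]; exact isCompact_Icc.measure_lt_top
  rw [Metric.tendsto_nhds]
  intro ε hε
  set V := volume.real (polarDomain : Set (ℝ × ℝ)) with hV
  have hV0 : 0 ≤ V := measureReal_nonneg
  have h1 : ∀ᶠ y in Bornology.cobounded E3, |f y| < ε / (V + 1) := by
    have := Metric.tendsto_nhds.1 hf.tendsto_const (ε / (V + 1)) (by positivity)
    simpa [Real.dist_eq] using this
  filter_upwards [eventually_cobounded_iff.1 h1, eventually_gt_atTop 0, hF] with r h1 hr hF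
  have h2 : ‖∫ u in polarDomain, Real.sin u.1 * F r u‖ ≤ ε / (V + 1) * V := by
    refine norm_setIntegral_le_of_norm_le_const hvol fun u hu => ?_
    rw [hF u hu, norm_mul]
    calc _ ≤ 1 * (ε / (V + 1)) := by
          gcongr
          · exact Real.abs_sin_le_one _
          · exact (h1 _ (norm_smul_polar hr u)).le
      _ = _ := one_mul _
  rw [dist_zero_right]
  refine h2.trans_lt ?_
  rw [div_mul_eq_mul_div, div_lt_iff₀ (by positivity)]
  nlinarith

section EmbAsymp

variable {N : Exterior} {X : ℝ → E3 → R4} {t : E3 → ℝ} {r : ℝ}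

/-! ### The integral of the leading term -/

lemma div_tproj_mul {f : E3 → ℝ} {y : E3} (hy : y ≠ 0) {d : ℤ} (hf : Homog d f)
    (hs : DifferentiableAt ℝ f y) (j : Fin 3) :
    ∑ i, pd i (fun z => tproj i j z * f z) y = pd j f y - (d + 2) / ‖y‖ * (nrm j y * f y) := by
  have hT := fun i => (contDiffAt_tproj hy i j).differentiableAt (by simp)
  have h1 : ∀ i, pd i (fun z => tproj i j z * f z) y =
      - (tproj i i y * nrm j y + nrm i y * tproj j i y) / ‖y‖ * f y + tproj i j y * pd i f y :=
    fun i => by rw [pd_mul (hT i) hs, pd_tproj hy]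
  have h2 := hf.sum_nrm_mul_pd hy hs
  have h3 := sum_tproj_self hy
  have h4 := sum_tproj_nrm hy j
  have h5 : pd j f y = ∑ i, (if i = j then (1 : ℝ) else 0) * pd i f y := by simp
  have h6 : ∑ i, tproj i j y * pd i f y = pd j f y - nrm j y * (d * f y / ‖y‖) := by
    rw [← h2]
    conv_rhs => rw [h5]
    simp only [tproj, Fin.sum_univ_three]
    ring
  simp only [h1, Finset.sum_add_distrib]
  rw [h6]
  have h0 := norm_ne_zero_iff.2 hy
  simp only [Fin.sum_univ_three] at h3 h4 ⊢
  field_simp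
  linear_combination (-nrm j y * f y) * h3 - f y * h4

lemma sum_nrm_tproj_mul {y : E3} (hy : y ≠ 0) (j : Fin 3) (c : ℝ) :
    ∑ i, nrm i y * (tproj i j y * c) = 0 := by
  have h := sum_tproj_nrm hy j
  have h' : ∀ i, tproj i j y = tproj j i y := fun i => tproj_symm _ _ _
  simp only [h', Fin.sum_univ_three] at h ⊢
  linear_combination c * h

lemma div_green {f : E3 → ℝ} {y : E3} (hy : y ≠ 0) (hs : ContDiffAt ℝ ∞ f y) (j : Fin 3) :
    ∑ i, pd i (fun z => nrm j z * pd i f z - f z * pd i (nrm j) z) y =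
      nrm j y * flatLap f y - f y * flatLap (nrm j) y := by
  have h1 := differentiableAt_nrm hy j
  have h2 := fun i => (contDiffAt_pd hs i).differentiableAt (by simp)
  have h3 := fun i => (contDiffAt_pd (contDiffAt_nrm hy j) i).differentiableAt (by simp)
  have h4 := hs.differentiableAt (by simp)
  have e : ∀ i, pd i (fun z => nrm j z * pd i f z - f z * pd i (nrm j) z) y =
      nrm j y * pd i (pd i f) y - f y * pd i (pd i (nrm j)) y := fun i => by
    rw [pd_sub (h1.fun_mul (h2 i)) (h4.fun_mul (h3 i)), pd_mul h1 (h2 i), pd_mul h4 (h3 i)]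
    ring
  simp only [e, flatLap, Finset.sum_sub_distrib, Finset.mul_sum]

lemma div_nrm_mul {y : E3} (hy : y ≠ 0) (j : Fin 3) :
    ∑ i, pd i (fun z => nrm j z * N.shiftLead i z) y =
      nrm j y * ∑ i, pd i (N.shiftLead i) y + N.shiftLead j y / ‖y‖ := by
  have h1 := differentiableAt_nrm hy j
  have h2 := fun i => (contDiffAt_shiftLead (N := N) hy i).differentiableAt (by simp)
  have e : ∀ i, pd i (fun z => nrm j z * N.shiftLead i z) y =
      tproj j i y / ‖y‖ * N.shiftLead i y + nrm j y * pd i (N.shiftLead i) y := fun i => by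
    rw [pd_mul h1 (h2 i), pd_nrm hy]
  have h3 := sum_nrm_shift (N := N) hy
  have h4 : N.shiftLead j y = ∑ i, (if j = i then (1 : ℝ) else 0) * N.shiftLead i y := by simp
  conv_rhs => rw [h4]
  simp only [e]
  simp only [tproj, shiftLead, Fin.sum_univ_three] at h3 ⊢
  linear_combination (-nrm j y / ‖y‖ / ‖y‖) * h3

variable (N) in
/-- The vector fields whose divergence is the irrelevant part of the leading term. -/
def leadField (t : E3 → ℝ) (r : ℝ) (j i : Fin 3) (z : E3) : ℝ :=
  r ^ 3 / 2 * (tproj i j z * flatLap t z) + (r ^ 2 * (nrm j z * pd i t z - t z * pd i (nrm j) z) +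
    (r * (tproj i j z * t z) + (r ^ 2 / 2 * (tproj i j z * N.massLead z) +
      r ^ 2 * (nrm j z * N.shiftLead i z))))

lemma EmbAsymp.contDiffAt_leadField (h : EmbAsymp N X t) {y : E3} (hy : y ≠ 0) (i j : Fin 3) :
    ContDiffAt ℝ ∞ (leadField N t r j i) y := by
  have hT := contDiffAt_tproj hy i j
  have hn := contDiffAt_nrm hy j
  have ht := h.smooth y hy
  exact (contDiffAt_const.mul (hT.mul (contDiffAt_flatLap ht))).add ((contDiffAt_const.mul
    ((hn.mul (contDiffAt_pd ht i)).sub (ht.mul (contDiffAt_pd hn i)))).add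
    ((contDiffAt_const.mul (hT.mul ht)).add ((contDiffAt_const.mul
      (hT.mul (contDiffAt_massLead hy))).add (contDiffAt_const.mul
        (hn.mul (contDiffAt_shiftLead hy i))))))

lemma EmbAsymp.sum_nrm_leadField (h : EmbAsymp N X t) {y : E3} (hy : y ≠ 0) (j : Fin 3) :
    ∑ i, nrm i y * leadField N t r j i y = 0 := by
  have h1 := sum_nrm_tproj_mul hy j (flatLap t y)
  have h2 := sum_nrm_tproj_mul hy j (t y)
  have h3 := sum_nrm_tproj_mul hy j (N.massLead y)
  have h4 := h.homog.sum_nrm_mul_pd hy ((h.smooth y hy).differentiableAt (by simp))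
  have h5 := (homog_nrm j).sum_nrm_mul_pd hy (differentiableAt_nrm hy j)
  have h6 := sum_nrm_shift (N := N) hy
  simp only [leadField, shiftLead, Fin.sum_univ_three, Int.cast_zero, zero_mul, zero_div]
    at h1 h2 h3 h4 h5 h6 ⊢
  linear_combination r ^ 3 / 2 * h1 + r * h2 + r ^ 2 / 2 * h3 + r ^ 2 * nrm j y * h4 -
    r ^ 2 * t y * h5 + r ^ 2 * nrm j y / ‖y‖ * h6

lemma EmbAsymp.div_leadField (h : EmbAsymp N X t) {y : E3} (hy : y ≠ 0) (j : Fin 3) :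
    ∑ i, pd i (leadField N t ‖y‖ j i) y =
      1 / 2 * timeLead₃ t j y + nrm j y * timeLead₂ t y + timeLead₁ t j y +
      1 / 2 * (‖y‖ ^ 2 * pd j N.massLead y + nrm j y * (‖y‖ * N.massLead y)) +
      radialExt (N.W₀ j) y + 2 * (radialExt N.m y * nrm j y) := by
  have ht := h.smooth y hy
  have hn := contDiffAt_nrm hy j
  have hT := fun i => contDiffAt_tproj hy i j
  have c1 : ∀ i, DifferentiableAt ℝ (fun z => tproj i j z * flatLap t z) y := fun i =>
    ((hT i).mul (contDiffAt_flatLap ht)).differentiableAt (by simp)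
  have c2 : ∀ i, DifferentiableAt ℝ (fun z => nrm j z * pd i t z - t z * pd i (nrm j) z) y :=
    fun i => ((hn.mul (contDiffAt_pd ht i)).sub (ht.mul (contDiffAt_pd hn i))).differentiableAt
      (by simp)
  have c3 : ∀ i, DifferentiableAt ℝ (fun z => tproj i j z * t z) y := fun i =>
    ((hT i).mul ht).differentiableAt (by simp)
  have c4 : ∀ i, DifferentiableAt ℝ (fun z => tproj i j z * N.massLead z) y := fun i =>
    ((hT i).mul (contDiffAt_massLead hy)).differentiableAt (by simp)
  have c5 : ∀ i, DifferentiableAt ℝ (fun z => nrm j z * N.shiftLead i z) y := fun i =>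
    (hn.mul (contDiffAt_shiftLead hy i)).differentiableAt (by simp)
  have e : ∀ r i, pd i (leadField N t r j i) y =
      r ^ 3 / 2 * pd i (fun z => tproj i j z * flatLap t z) y +
      (r ^ 2 * pd i (fun z => nrm j z * pd i t z - t z * pd i (nrm j) z) y +
      (r * pd i (fun z => tproj i j z * t z) y +
      (r ^ 2 / 2 * pd i (fun z => tproj i j z * N.massLead z) y +
      r ^ 2 * pd i (fun z => nrm j z * N.shiftLead i z) y))) := fun r i => by
    have d1 := (c1 i).const_mul (r ^ 3 / 2)
    have d2 := (c2 i).const_mul (r ^ 2)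
    have d3 := (c3 i).const_mul r
    have d4 := (c4 i).const_mul (r ^ 2 / 2)
    have d5 := (c5 i).const_mul (r ^ 2)
    have : leadField N t r j i = fun z => r ^ 3 / 2 * (tproj i j z * flatLap t z) +
      (r ^ 2 * (nrm j z * pd i t z - t z * pd i (nrm j) z) +
      (r * (tproj i j z * t z) + (r ^ 2 / 2 * (tproj i j z * N.massLead z) +
      r ^ 2 * (nrm j z * N.shiftLead i z)))) := rfl
    rw [this, pd_add d1 (d2.fun_add (d3.fun_add (d4.fun_add d5))),
      pd_add d2 (d3.fun_add (d4.fun_add d5)), pd_add d3 (d4.fun_add d5), pd_add d4 d5,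
      pd_const_mul _ (c1 i), pd_const_mul _ (c2 i), pd_const_mul _ (c3 i), pd_const_mul _ (c4 i),
      pd_const_mul _ (c5 i)]
  simp only [e, Finset.sum_add_distrib, ← Finset.mul_sum]
  rw [div_tproj_mul hy (homog_flatLap h.homog h.smooth)
      ((contDiffAt_flatLap ht).differentiableAt (by simp)), div_green hy ht,
    div_tproj_mul hy h.homog (ht.differentiableAt (by simp)),
    div_tproj_mul hy homog_massLead ((contDiffAt_massLead hy).differentiableAt (by simp)),
    div_nrm_mul hy]
  have h0 := norm_ne_zero_iff.2 hy
  have h1 := flatLap_nrm hy j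
  have h2 : ‖y‖ * N.massLead y = - 2 * radialExt N.m y + ‖y‖ ^ 2 * ∑ i, pd i (N.shiftLead i) y := by
    rw [massLead]; field_simp
  simp only [timeLead₁, timeLead₂, timeLead₃, shiftLead] at h2 ⊢
  push_cast
  field_simp
  linear_combination (-2) * t y * h1 - 2 * nrm j y * h2

variable (N) in
/-- The density of the limit of the energy. -/
def massDensity (T : R4) (y : E3) : ℝ :=
  2 * (T 0 * radialExt N.m y) - 2 * ∑ j : Fin 3, T j.succ * (radialExt N.m y * nrm j y)

lemma contDiffAt_massDensity (T : R4) {y : E3} (hy : y ≠ 0) :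
    ContDiffAt ℝ ∞ (massDensity N T) y := by
  have hm := N.smooth_m.contDiffAt_radialExt hy
  exact (contDiffAt_const.mul (contDiffAt_const.mul hm)).sub (contDiffAt_const.mul
    (ContDiffAt.sum fun j _ => contDiffAt_const.mul (hm.mul (contDiffAt_nrm hy j))))

lemma EmbAsymp.integral_densityLead (h : EmbAsymp N X t) (T : R4) (hr : 0 < r) :
    ∫ u in polarDomain, Real.sin u.1 * densityLead N t T (r • polar u) =
      ∫ u in polarDomain, Real.sin u.1 * massDensity N T (polar u) := by
  have h1 : ∀ u, massDensity N T (polar u) = massDensity N T (r • polar u) := fun u => by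
    have h2 : radialExt N.m (r • polar u) = radialExt N.m (polar u) := radialExt_smul _ hr _
    have h3 : ∀ j, nrm j (polar u) = polar u j := fun j => by simp [nrm, norm_polar]
    simp only [massDensity, h2, h3, nrm_smul_polar hr]
  simp only [h1]
  have hy0 : ∀ y : E3, ‖y‖ = r → y ≠ 0 := fun y hy => norm_pos_iff.1 (hy ▸ hr)
  refine integral_eq_of_div (Z := fun i z => (-T 0 * r ^ 2) * N.shiftLead i z +
    ∑ j : Fin 3, T j.succ * leadField N t r j i z) hr (fun i y hy => ?_) (fun y hy => ?_)
    (fun y hy => (contDiffAt_massDensity T (hy0 y hy)).continuousAt) (fun y hy => ?_)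
  · exact (contDiffAt_const.mul (contDiffAt_shiftLead (hy0 y hy) i)).add
      (ContDiffAt.sum fun j _ => contDiffAt_const.mul (h.contDiffAt_leadField (hy0 y hy) i j))
  · filter_upwards [eventually_ne_zero (hy0 y hy)] with z hz
    have e1 := fun j => h.sum_nrm_leadField (r := r) hz j
    have e2 := sum_nrm_shift (N := N) hz
    have e10 := e1 0
    have e11 := e1 1
    have e12 := e1 2
    simp only [shiftLead, Fin.sum_univ_three] at e10 e11 e12 e2 ⊢
    linear_combination T (Fin.succ 0) * e10 + T (Fin.succ 1) * e11 + T (Fin.succ 2) * e12 +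
      (-T 0 * r ^ 2) / ‖z‖ * e2
  · have hy' := hy0 y hy
    have dS := fun i => (contDiffAt_shiftLead (N := N) hy' i).differentiableAt (by simp)
    have dL := fun i j => (h.contDiffAt_leadField (r := r) hy' i j).differentiableAt (by simp)
    have e : ∀ i, pd i (fun z => (-T 0 * r ^ 2) * N.shiftLead i z +
        ∑ j : Fin 3, T j.succ * leadField N t r j i z) y = (-T 0 * r ^ 2) * pd i (N.shiftLead i) y +
        ∑ j : Fin 3, T j.succ * pd i (leadField N t r j i) y := fun i => by
      rw [pd_add ((dS i).const_mul _) (DifferentiableAt.fun_sum fun j _ => (dL i j).const_mul _),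
        pd_const_mul _ (dS i), pd_sum fun j _ => (dL i j).const_mul _]
      simp only [pd_const_mul _ (dL i _)]
    simp only [e, Finset.sum_add_distrib]
    rw [Finset.sum_comm]
    simp only [← Finset.mul_sum]
    have e3 := fun j => h.div_leadField hy' j
    simp only [hy] at e3
    simp only [e3, densityLead, massDensity, hy]
    have h0 := hr.ne'
    have h2 : r * N.massLead y = - 2 * radialExt N.m y + r ^ 2 * ∑ i, pd i (N.shiftLead i) y := by
      rw [massLead, hy]; field_simp
    simp only [Fin.sum_univ_three] at h2 ⊢
    linear_combination (-T 0) * h2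

/-! ### The integral of the radial deviation -/

variable (N) in
/-- The deviation of the divergence of the radial field along an embedding. -/
def divDev (Y : E3 → R4) (y : E3) : ℝ :=
  ‖y‖ * (2 - ∑ i : Fin 3, ∑ k, N.Qc i k y * pd k (emb Y i.succ) y)

lemma integral_radialDev (hY : IsIsometricEmbedding N r (X r)) (hr : N.R₀ < r) :
    ∫ u in polarDomain, Real.sin u.1 * radialDev N X (r • polar u) =
      ∫ u in polarDomain, Real.sin u.1 * divDev N (X r) (r • polar u) := by
  have hr0 := N.R₀_pos.trans hr
  have hR : ∀ y : E3, ‖y‖ = r → N.R₀ < ‖y‖ := fun y hy => by rw [hy]; exact hr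
  have cZ : ∀ (i : Fin 3) {y : E3}, N.R₀ < ‖y‖ → ∀ j,
      ContDiffAt ℝ ∞ (fun z => ∑ k, N.Qc j k z * pd k (emb (X r) i.succ) z) y := fun i y hy j =>
    ContDiffAt.sum fun k _ => (contDiffAt_Qc hy j k).mul
      (contDiffAt_pd (hY.contDiffAt_emb (ne_zero_of_lt hy) _) k)
  refine integral_eq_of_div (Z := fun j z => r ^ 2 * ∑ i : Fin 3, nrm i z *
    ∑ k, N.Qc j k z * pd k (emb (X r) i.succ) z) hr0 (fun j y hy => ?_) (fun y hy => ?_)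
    (fun y hy => ?_) (fun y hy => ?_)
  · exact contDiffAt_const.mul (ContDiffAt.sum fun i _ =>
      (contDiffAt_nrm (ne_zero_of_lt (hR y hy)) i).mul (cZ i (hR y hy) j))
  · filter_upwards [eventually_lt_norm (hR y hy)] with z hz
    have e : ∀ k, ∑ j, nrm j z * N.Qc j k z = 0 := fun k => by
      rw [← sum_Qc_nrm hz k]
      exact Finset.sum_congr rfl fun j _ => by rw [Qc_comm hz]; ring
    have e0 := e 0
    have e1 := e 1
    have e2 := e 2
    simp only [Fin.sum_univ_three] at e0 e1 e2 ⊢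
    generalize nrm 0 z = n0 at *
    generalize nrm 1 z = n1 at *
    generalize nrm 2 z = n2 at *
    linear_combination r ^ 2 * (
      (n0 * pd 0 (emb (X r) (Fin.succ 0)) z + n1 * pd 0 (emb (X r) (Fin.succ 1)) z +
        n2 * pd 0 (emb (X r) (Fin.succ 2)) z) * e0 +
      (n0 * pd 1 (emb (X r) (Fin.succ 0)) z + n1 * pd 1 (emb (X r) (Fin.succ 1)) z +
        n2 * pd 1 (emb (X r) (Fin.succ 2)) z) * e1 +
      (n0 * pd 2 (emb (X r) (Fin.succ 0)) z + n1 * pd 2 (emb (X r) (Fin.succ 1)) z +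
        n2 * pd 2 (emb (X r) (Fin.succ 2)) z) * e2)
  · have hy' := ne_zero_of_lt (hR y hy)
    exact ((contDiffAt_norm_e3 hy').mul (contDiffAt_const.sub
      (ContDiffAt.sum fun i _ => cZ i (hR y hy) i))).continuousAt
  · have hyR := hR y hy
    have hy' := ne_zero_of_lt hyR
    have dn := fun i => differentiableAt_nrm hy' i
    have dZ := fun i j => (cZ i hyR j).differentiableAt (by simp)
    have e : ∀ j, pd j (fun z => r ^ 2 * ∑ i : Fin 3, nrm i z *
        ∑ k, N.Qc j k z * pd k (emb (X r) i.succ) z) y = r ^ 2 * ∑ i : Fin 3,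
        (tproj i j y / ‖y‖ * ∑ k, N.Qc j k y * pd k (emb (X r) i.succ) y +
          nrm i y * pd j (fun z => ∑ k, N.Qc j k z * pd k (emb (X r) i.succ) z) y) := fun j => by
      rw [pd_const_mul _ (DifferentiableAt.fun_sum fun i _ => (dn i).fun_mul (dZ i j)),
        pd_sum fun i _ => (dn i).fun_mul (dZ i j)]
      congr 1
      refine Finset.sum_congr rfl fun i _ => ?_
      rw [pd_mul (dn i) (dZ i j), pd_nrm hy']
    have hpq : ∀ i k, ∑ j, tproj i j y * N.Qc j k y = N.Qc i k y := fun i k => by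
      have h1 : ∑ j, nrm j y * N.Qc j k y = 0 := by
        rw [← sum_Qc_nrm hyR k]
        exact Finset.sum_congr rfl fun j _ => by rw [Qc_comm hyR]; ring
      have h2 : N.Qc i k y = ∑ j, (if i = j then (1 : ℝ) else 0) * N.Qc j k y := by simp
      conv_rhs => rw [h2]
      simp only [tproj, Fin.sum_univ_three] at h1 ⊢
      linear_combination (-nrm i y) * h1
    have hS : ∑ j, ∑ i : Fin 3, tproj i j y / ‖y‖ * ∑ k, N.Qc j k y * pd k (emb (X r) i.succ) y =
        (∑ i : Fin 3, ∑ k, N.Qc i k y * pd k (emb (X r) i.succ) y) / ‖y‖ := by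
      have : ∑ j, ∑ i : Fin 3, tproj i j y / ‖y‖ *
          ∑ k, N.Qc j k y * pd k (emb (X r) i.succ) y = (∑ i : Fin 3, ∑ k,
          (∑ j, tproj i j y * N.Qc j k y) * pd k (emb (X r) i.succ) y) / ‖y‖ := by
        simp only [Fin.sum_univ_three]
        ring
      rw [this]
      simp only [hpq]
    simp only [e, ← Finset.mul_sum, Finset.sum_add_distrib, hS]
    simp only [radialDev, divDev, lapEmb, hy]
    have h0 := hr0.ne'
    simp only [Fin.sum_univ_three]
    field_simp
    ring

end EmbAsymp


open Exterior

section EmbAsymp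

variable {N : Exterior} {X : ℝ → E3 → R4} {t : E3 → ℝ} {r : ℝ}

/-! ### The limit of the energy -/

/-- The deviation of the derivatives of the spatial components from those of the round sphere. -/
def spaceDev (Y : E3 → R4) (r : ℝ) (i k : Fin 3) (y : E3) : ℝ :=
  pd k (emb Y i.succ) y - pd k (fun z => r * nrm i z) y

lemma EmbAsymp.symb_spaceDev (h : EmbAsymp N X t) (i k : Fin 3) :
    Symb (-1) fun r => spaceDev (X r) r i k := by
  have h1 := Symb.pd_sub (h.symb_space i).smooth (Symb.radius.mul (symb_nrm i)).smooth (h.space i) k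
  rw [zero_sub] at h1
  exact h1

variable (N) in
/-- The second order expression for the deviation of the divergence of the radial field. -/
def divDevQuad (Y : E3 → R4) (r : ℝ) (y : E3) : ℝ :=
  r * (1 / 2 * (-(∑ i, N.Qc i i y - 2) -
    ∑ j, ∑ k, N.Qc j k y * (pd j (emb Y 0) y * pd k (emb Y 0) y) +
    ∑ j, ∑ k, N.Qc j k y * ∑ i, spaceDev Y r i j y * spaceDev Y r i k y))

lemma divDev_eq {Y : E3 → R4} (hY : IsIsometricEmbedding N r Y) (hr : N.R₀ < r) {u : ℝ × ℝ}
    (hu : u ∈ polarDomain) : divDev N Y (r • polar u) = divDevQuad N Y r (r • polar u) := by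
  have hr0 := N.R₀_pos.trans hr
  have hyR := lt_norm_smul_polar hr u
  have hnorm := norm_smul_polar hr0 u
  have hy := smul_polar_ne_zero hr0 u
  have hg := fun i j => embMetric_eq hY hr hu i j
  generalize r • polar u = y at *
  have hp : ∀ i k, pd k (emb Y i.succ) y = tproj i k y + spaceDev Y r i k y := fun i k => by
    have : pd k (fun z => r * nrm i z) y = tproj i k y := by
      rw [pd_const_mul _ (differentiableAt_nrm hy i), pd_nrm hy, hnorm]
      field_simp
    rw [spaceDev, this]; ring
  have hQh : ∑ j, ∑ k, N.Qc j k y * embMetric Y j k y = 2 := by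
    simp only [hg]
    rw [← sum_tproj_self hy]
    refine Finset.sum_congr rfl fun j _ => ?_
    rw [← sum_Qc_hc hyR]
    refine Finset.sum_congr rfl fun k _ => ?_
    rw [show N.hc j k y = N.hc k j y from h_comm (pt_mem_region hyR) j k]
  have hQt : ∀ j i, ∑ k, N.Qc j k y * tproj i k y = N.Qc j i y := fun j i => by
    have h1 := sum_Qc_nrm hyR j
    have h2 : N.Qc j i y = ∑ k, N.Qc j k y * (if i = k then (1 : ℝ) else 0) := by simp
    conv_rhs => rw [h2]
    simp only [tproj, Fin.sum_univ_three] at h1 ⊢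
    linear_combination (-nrm i y) * h1
  have hm : ∀ j k, embMetric Y j k y = - (pd j (emb Y 0) y * pd k (emb Y 0) y) +
      ∑ i : Fin 3, (tproj i j y + spaceDev Y r i j y) * (tproj i k y + spaceDev Y r i k y) :=
    fun j k => by
      simp only [embMetric, ← hp]
      exact (mink_eq_sum _ _).symm.trans
        (mink_eq (fun β => pd j (emb Y β) y) fun β => pd k (emb Y β) y)
  have hexp : ∑ j, ∑ k, N.Qc j k y * embMetric Y j k y =
      - ∑ j, ∑ k, N.Qc j k y * (pd j (emb Y 0) y * pd k (emb Y 0) y) +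
      (∑ i, ∑ j, (∑ k, N.Qc j k y * tproj i k y) * tproj i j y +
      2 * ∑ i, ∑ j, (∑ k, N.Qc j k y * tproj i k y) * spaceDev Y r i j y +
      ∑ j, ∑ k, N.Qc j k y * ∑ i, spaceDev Y r i j y * spaceDev Y r i k y) := by
    have hs : ∀ i, ∑ j, ∑ k, N.Qc j k y * (tproj i j y * spaceDev Y r i k y) =
        ∑ j, (∑ k, N.Qc j k y * tproj i k y) * spaceDev Y r i j y := fun i => by
      rw [Finset.sum_comm]
      refine Finset.sum_congr rfl fun j _ => ?_
      rw [Finset.sum_mul]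
      exact Finset.sum_congr rfl fun k _ => by rw [Qc_comm hyR]; ring
    have hs0 := hs 0
    have hs1 := hs 1
    have hs2 := hs 2
    simp only [hm]
    simp only [Fin.sum_univ_three] at hs0 hs1 hs2 ⊢
    linear_combination hs0 + hs1 + hs2
  have hcomm : ∀ i, ∑ j, N.Qc j i y * tproj i j y = N.Qc i i y := fun i => by
    rw [← hQt]
    exact Finset.sum_congr rfl fun j _ => by rw [Qc_comm hyR]
  have hdiv : ∑ i : Fin 3, ∑ k, N.Qc i k y * pd k (emb Y i.succ) y = ∑ i, N.Qc i i y +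
      ∑ i, ∑ j, N.Qc j i y * spaceDev Y r i j y := by
    rw [← Finset.sum_add_distrib]
    refine Finset.sum_congr rfl fun i _ => ?_
    rw [← hcomm i, ← Finset.sum_add_distrib]
    exact Finset.sum_congr rfl fun j _ => by rw [hp, Qc_comm hyR]; ring
  simp only [hQt, hcomm] at hexp
  rw [hQh] at hexp
  rw [divDev, divDevQuad, hdiv, hnorm]
  linear_combination (r / 2) * hexp

lemma EmbAsymp.near_divDevQuad (h : EmbAsymp N X t) :
    Near (fun y => divDevQuad N (X ‖y‖) ‖y‖ y) fun _ => 0 := by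
  have h1 : Near (fun y => ‖y‖ ^ (1 : ℤ) * (∑ i, N.Qc i i y - 2)) fun _ => 0 :=
    Near.of_isBigO (isBigO_norm_zpow_mul (isBigO_refl _ _) isBigO_trace_Qc) (by norm_num)
  have h2 := Near.sum (s := Finset.univ) fun j _ => Near.sum (s := Finset.univ) fun k _ =>
    (near_Qc (N := N) j k).mul ((h.near_pd_time_zero k).zero_mul_near (h.near_pd_time j))
  have hE : ∀ i j k, Symb (-2) fun r y => spaceDev (X r) r i j y * spaceDev (X r) r i k y :=
    fun i j k => by
      have := (h.symb_spaceDev i j).mul (h.symb_spaceDev i k)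
      norm_num at this
      exact this
  have hQE : ∀ j k, Symb (-2) fun r y => N.Qc j k y *
      ∑ i, spaceDev (X r) r i j y * spaceDev (X r) r i k y := fun j k => by
    have := (symb_Qc (N := N) j k).mul (Symb.sum (s := Finset.univ) fun i _ => hE i j k)
    norm_num at this
    exact this
  have h3 : Symb (-1) fun r y => r * ∑ j, ∑ k, N.Qc j k y *
      ∑ i, spaceDev (X r) r i j y * spaceDev (X r) r i k y := by
    have := Symb.radius.mul (Symb.sum (s := Finset.univ) fun j _ =>
      Symb.sum (s := Finset.univ) fun k _ => hQE j k)
    norm_num at this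
    exact this
  have h4 := (Near.const (1 / 2)).mul ((h1.neg.sub h2).add (h3.near_pow 0 (by norm_num)))
  refine (h4.congr (Eventually.of_forall fun y => ?_)).congr_right
    (Eventually.of_forall fun y => by simp)
  simp only [divDevQuad, Fin.sum_univ_three]
  simp
  ring

lemma EmbAsymp.tendsto_integral_radialDev (h : EmbAsymp N X t) :
    Tendsto (fun r : ℝ => ∫ u in polarDomain, Real.sin u.1 * radialDev N X (r • polar u)) atTop
      (𝓝 0) := by
  have h1 := tendsto_integral_of_near_zero h.near_divDevQuad
    (F := fun r u => divDev N (X r) (r • polar u)) (by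
      filter_upwards [h.embedding, eventually_gt_atTop N.R₀] with r hY hr u hu
      rw [divDev_eq hY hr hu, norm_smul_polar (N.R₀_pos.trans hr)])
  refine h1.congr' ?_
  filter_upwards [h.embedding, eventually_gt_atTop N.R₀] with r hY hr
  exact (integral_radialDev hY hr).symm

lemma continuousAt_density {Y : E3 → R4} (hY : IsIsometricEmbedding N r Y) (T : R4) {y : E3}
    (hy : N.R₀ < ‖y‖) (hg : N.GoodAt Y y) (hP : 0 < N.Pc y) :
    ContinuousAt (N.density Y T) y := by
  have hy0 := ne_zero_of_lt hy
  have hU := Uc_pos hy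
  have cn : ContinuousAt (fun z : E3 => ‖z‖) y := continuous_norm.continuousAt
  have hn0 := norm_ne_zero_iff.2 hy0
  have cS := (contDiffAt_lapSq hY hy).continuousAt.sqrt
  have cP := (contDiffAt_Pc hy).continuousAt
  have cU := (contDiffAt_Uc hy).continuousAt
  have cv := fun β => (contDiffAt_dualEmb hY hy hg β).continuousAt
  have cQ := fun i j => (contDiffAt_Qc hy i j).continuousAt
  have ce := fun k β => (contDiffAt_pd (hY.contDiffAt_emb hy0 β) k).continuousAt
  have cH := fun k β => (contDiffAt_pd (contDiffAt_lapEmb hY hy β) k).continuousAt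
  have ca : ∀ k, ContinuousAt (fun z => N.embConn Y z k) y := fun k =>
    (tendsto_finsetSum _ fun β _ => ((cv β).mul (cH k β)).const_mul (sgn β)).neg.div cS
      (Real.sqrt_pos.2 hg.1).ne'
  have cb : ∀ k, ContinuousAt (fun z => N.sphConn z k) y := fun k =>
    (((contDiffAt_pd (contDiffAt_Pc hy) k).continuousAt.neg.div (cP.const_mul 2)
      (by positivity)).add ((tendsto_finsetSum _ fun i _ => (contDiffAt_hc hy i k).continuousAt.mul
        ((tendsto_finsetSum _ fun j _ => (contDiffAt_nrm hy0 j).continuousAt.mul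
          (contDiffAt_pd (contDiffAt_Wc hy i) j).continuousAt).sub
          ((contDiffAt_Wc hy i).continuousAt.div cn hn0))).div (cU.const_mul 2) (by positivity)))
  have cm : ∀ {f : E3 → R4}, (∀ β, ContinuousAt (fun z => f z β) y) →
      ContinuousAt (fun z => mink T (f z)) y := fun {f} hf => by
    have : (fun z => mink T (f z)) = fun z => ∑ β, sgn β * (T β * f z β) :=
      funext fun z => mink_eq_sum _ _
    rw [this]
    exact tendsto_finsetSum _ fun β _ => ((hf β).const_mul (T β)).const_mul (sgn β)
  exact (cn.pow 2).mul (((cm cv).neg.mul (cS.sub ((continuousAt_const.div cn hn0).mul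
    (cP.div cU hU.ne').sqrt))).add (tendsto_finsetSum _ fun k _ => tendsto_finsetSum _ fun i _ =>
      (cQ k i).mul ((cm (ce k)).mul ((ca i).sub (cb i)))))

lemma measurableSet_polarDomain : MeasurableSet (polarDomain : Set (ℝ × ℝ)) :=
  isOpen_polarDomain.measurableSet

/-- For `r` large the energy density is given by `density`. -/
lemma EmbAsymp.eventually_energyDensity_eq (h : EmbAsymp N X t) :
    ∀ᶠ r : ℝ in atTop, N.R₀ < r ∧ IsIsometricEmbedding N r (X r) ∧
      (∀ y : E3, ‖y‖ = r → N.GoodAt (X r) y) ∧ ∀ y : E3, ‖y‖ = r → 0 < N.Pc y := by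
  filter_upwards [eventually_gt_atTop N.R₀, h.embedding,
    eventually_cobounded_iff.1 h.eventually_goodAt,
    eventually_cobounded_iff.1 ((near_Pc (N := N)).eventually_pos one_pos)] with r h1 h2 h3 h4
  exact ⟨h1, h2, fun y hy => by simpa [hy] using h3 y hy, h4⟩

lemma EmbAsymp.eventually_integrableOn (h : EmbAsymp N X t) : ∀ᶠ r : ℝ in atTop, ∀ T : R4,
    IntegrableOn (energyDensity N r (X r) T) polarDomain := by
  filter_upwards [h.eventually_energyDensity_eq] with r ⟨hr, hY, hg, hP⟩ T
  refine (integrableOn_sin_mul_comp (f := N.density (X r) T) (N.R₀_pos.trans hr) fun y hy =>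
    continuousAt_density hY T (by rwa [hy]) (hg y hy) (hP y hy)).congr_fun (fun u hu => ?_)
    measurableSet_polarDomain
  exact (energyDensity_eq hY hr hu hg hP T).symm

lemma EmbAsymp.tendsto_integral_energyDensity (h : EmbAsymp N X t) (T : R4) :
    Tendsto (fun r : ℝ => ∫ u in polarDomain, energyDensity N r (X r) T u) atTop
      (𝓝 (∫ u in polarDomain, Real.sin u.1 * massDensity N T (polar u))) := by
  have hnear : Near (fun y => N.density (X ‖y‖) T y + T 0 * radialDev N X y - densityLead N t T y)
      fun _ => 0 := by
    refine Near.of_tendsto ((h.near_density T).tendsto.congr fun y => ?_)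
    ring
  have h1 := tendsto_integral_of_near_zero hnear
    (F := fun r u => N.density (X r) T (r • polar u) + T 0 * radialDev N X (r • polar u) -
      densityLead N t T (r • polar u)) (by
      filter_upwards [eventually_gt_atTop 0] with r hr u _
      simp only [norm_smul_polar hr])
  have h2 := (h1.sub (h.tendsto_integral_radialDev.const_mul (T 0))).add_const
    (∫ u in polarDomain, Real.sin u.1 * massDensity N T (polar u))
  simp only [mul_zero, sub_zero, zero_add] at h2
  refine h2.congr' ?_
  filter_upwards [h.eventually_energyDensity_eq] with r ⟨hr, hY, hg, hP⟩
  have hr0 := N.R₀_pos.trans hr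
  have hR : ∀ y : E3, ‖y‖ = r → N.R₀ < ‖y‖ := fun y hy => by rw [hy]; exact hr
  have i1 := integrableOn_sin_mul_comp (f := N.density (X r) T) hr0 fun y hy =>
    continuousAt_density hY T (hR y hy) (hg y hy) (hP y hy)
  have i2 := integrableOn_sin_mul_comp (f := fun y => ‖y‖ ^ 2 * ∑ i : Fin 3,
    nrm i y * N.lapEmb (X r) y i.succ + 2 * ‖y‖) hr0 fun y hy =>
    (((contDiffAt_norm_e3 (ne_zero_of_lt (hR y hy))).pow 2).mul (ContDiffAt.sum fun i _ =>
      (contDiffAt_nrm (ne_zero_of_lt (hR y hy)) i).mul (contDiffAt_lapEmb hY (hR y hy) i.succ))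
      ).continuousAt.add (continuous_norm.continuousAt.const_mul 2)
  have i3 := integrableOn_sin_mul_comp (f := densityLead N t T) hr0 fun y hy => by
    have hy0 := ne_zero_of_lt (hR y hy)
    have cn := contDiffAt_norm_e3 hy0
    have cM := contDiffAt_massLead (N := N) hy0
    have ct := h.smooth y hy0
    refine ContDiffAt.continuousAt (n := ∞) (𝕜 := ℝ) ?_
    refine (contDiffAt_const.mul (cn.mul cM)).neg.add (ContDiffAt.sum fun j _ =>
      contDiffAt_const.mul (((((contDiffAt_const.mul ((cn.pow 3).mul
        (contDiffAt_pd (contDiffAt_flatLap ct) j))).add ((contDiffAt_nrm hy0 j).mul ((cn.pow 2).mul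
        (contDiffAt_flatLap ct)))).add ((cn.pow 1).mul (contDiffAt_pd ct j))).add
        (contDiffAt_const.mul (((cn.pow 2).mul (contDiffAt_pd cM j)).add
          ((contDiffAt_nrm hy0 j).mul (cn.mul cM))))).add
        ((N.smooth_W₀ j).contDiffAt_radialExt hy0)))
  have i2' : IntegrableOn (fun u : ℝ × ℝ => Real.sin u.1 * radialDev N X (r • polar u))
      polarDomain := by
    refine i2.congr_fun (fun u _ => ?_) measurableSet_polarDomain
    simp only [radialDev, norm_smul_polar hr0]
  have e1 : ∫ u in polarDomain, energyDensity N r (X r) T u =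
      ∫ u in polarDomain, Real.sin u.1 * N.density (X r) T (r • polar u) :=
    setIntegral_congr_fun measurableSet_polarDomain fun u hu => energyDensity_eq hY hr hu hg hP T
  have e2 : ∀ u : ℝ × ℝ, Real.sin u.1 * (N.density (X r) T (r • polar u) +
      T 0 * radialDev N X (r • polar u) - densityLead N t T (r • polar u)) =
      Real.sin u.1 * N.density (X r) T (r • polar u) +
      T 0 * (Real.sin u.1 * radialDev N X (r • polar u)) -
      Real.sin u.1 * densityLead N t T (r • polar u) := fun u => by ring
  simp only [e2]
  have i12 : IntegrableOn (fun u : ℝ × ℝ => Real.sin u.1 * N.density (X r) T (r • polar u) +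
      T 0 * (Real.sin u.1 * radialDev N X (r • polar u))) polarDomain :=
    i1.add (i2'.const_mul (T 0))
  rw [integral_sub i12 i3, integral_add i1 (i2'.const_mul (T 0)),
    integral_const_mul, h.integral_densityLead T hr0, e1]
  ring

variable (N) in
/-- The energy-momentum vector. -/
def momentum : R4 := Fin.cons
  (1 / (4 * Real.pi) * ∫ u in polarDomain, Real.sin u.1 * radialExt N.m (polar u))
  fun j => 1 / (4 * Real.pi) *
    ∫ u in polarDomain, Real.sin u.1 * (radialExt N.m (polar u) * nrm j (polar u))

lemma integral_massDensity (T : R4) : 1 / (8 * Real.pi) *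
    ∫ u in polarDomain, Real.sin u.1 * massDensity N T (polar u) = - mink T (momentum N) := by
  have hy0 : ∀ y : E3, ‖y‖ = 1 → y ≠ 0 := fun y hy => norm_ne_zero_iff.1 (by rw [hy]; simp)
  have i1 := integrableOn_sin_mul_comp (f := radialExt N.m) one_pos fun y hy =>
    (N.smooth_m.contDiffAt_radialExt (hy0 y hy)).continuousAt
  have i2 := fun j => integrableOn_sin_mul_comp (f := fun y => radialExt N.m y * nrm j y) one_pos
    fun y hy => ((N.smooth_m.contDiffAt_radialExt (hy0 y hy)).mul
      (contDiffAt_nrm (hy0 y hy) j)).continuousAt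
  simp only [one_smul] at i1 i2
  have e : ∀ u : ℝ × ℝ, Real.sin u.1 * massDensity N T (polar u) =
      2 * T 0 * (Real.sin u.1 * radialExt N.m (polar u)) -
      ∑ j : Fin 3, 2 * T j.succ * (Real.sin u.1 * (radialExt N.m (polar u) * nrm j (polar u))) :=
    fun u => by simp only [massDensity, Fin.sum_univ_three]; ring
  simp only [e]
  rw [integral_sub (i1.const_mul _) (integrable_finsetSum _ fun j _ => (i2 j).const_mul _),
    integral_finsetSum _ fun j _ => (i2 j).const_mul _, integral_const_mul]
  simp only [integral_const_mul]
  rw [mink_eq]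
  have hpi := Real.pi_ne_zero
  simp only [momentum, Fin.cons_zero, Fin.cons_succ, Fin.sum_univ_three]
  field_simp
  ring

lemma EmbAsymp.isEnergyMomentum (h : EmbAsymp N X t) : IsEnergyMomentum N X (momentum N) :=
  fun T _ => ⟨h.eventually_integrableOn.mono fun _ h => h T, by
    rw [← integral_massDensity]
    exact (h.tendsto_integral_energyDensity T).const_mul _⟩

end EmbAsymp


open Exterior

section Lorentz

/-! ### Covariance under Lorentz transformations -/

variable {L : Matrix (Fin 4) (Fin 4) ℝ} {b : R4} {F Z : ℝ × ℝ → R4} {u : ℝ × ℝ}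

lemma eta_mul_eta : eta * eta = 1 := by
  rw [eta, diagonal_mul_diagonal, ← diagonal_one]
  congr 1
  ext i; fin_cases i <;> simp

lemma mulVec_dotProduct (A : Matrix (Fin 4) (Fin 4) ℝ) (v w : R4) :
    (A *ᵥ v) ⬝ᵥ w = v ⬝ᵥ (Aᵀ *ᵥ w) := by
  rw [dotProduct_mulVec, vecMul_transpose]

lemma IsLorentz.mink_mulVec (hL : IsLorentz L) (v w : R4) : mink (L *ᵥ v) (L *ᵥ w) = mink v w := by
  rw [mink, mulVec_dotProduct, mulVec_mulVec, mulVec_mulVec, hL.1, mink]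

lemma mink_mulVec_right (L : Matrix (Fin 4) (Fin 4) ℝ) (T v : R4) :
    mink T (L *ᵥ v) = mink ((eta * Lᵀ * eta) *ᵥ T) v := by
  have he : etaᵀ = eta := minkowski_isSymm 0
  rw [mink, mink, mulVec_dotProduct, mulVec_mulVec, mulVec_mulVec]
  congr 2
  simp only [transpose_mul, transpose_transpose, he, Matrix.mul_assoc, eta_mul_eta, Matrix.mul_one]

/-- Orthochronous Lorentz transformations preserve the future. -/
lemma IsLorentz.mulVec_zero_pos (hL : IsLorentz L) {v : R4} (hv : mink v v < 0) (h0 : 0 < v 0) :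
    0 < (L *ᵥ v) 0 := by
  have h3 : L * (eta * Lᵀ * eta) = 1 := by
    apply mul_eq_one_comm.1
    calc eta * Lᵀ * eta * L = eta * (Lᵀ * eta * L) := by simp only [Matrix.mul_assoc]
      _ = 1 := by rw [hL.1, eta_mul_eta]
  have h4 := congrFun (congrFun h3 0) 0
  have hp := hL.2.2
  simp [Matrix.mul_apply, eta, Fin.sum_univ_four, diagonal_apply] at h4
  rw [mink_eq] at hv
  simp only [mulVec, dotProduct, Fin.sum_univ_four]
  simp only [Fin.sum_univ_three] at hv
  change -(v 0 * v 0) + (v 1 * v 1 + v 2 * v 2 + v 3 * v 3) < 0 at hv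
  by_contra hneg
  push Not at hneg
  have hcs : (L 0 1 * v 1 + L 0 2 * v 2 + L 0 3 * v 3) ^ 2 ≤
      (L 0 1 ^ 2 + L 0 2 ^ 2 + L 0 3 ^ 2) * (v 1 ^ 2 + v 2 ^ 2 + v 3 ^ 2) := by
    nlinarith [sq_nonneg (L 0 1 * v 2 - L 0 2 * v 1), sq_nonneg (L 0 1 * v 3 - L 0 3 * v 1),
      sq_nonneg (L 0 2 * v 3 - L 0 3 * v 2)]
  have h5 : (L 0 0 * v 0) ^ 2 ≤ (L 0 1 * v 1 + L 0 2 * v 2 + L 0 3 * v 3) ^ 2 := by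
    rw [← neg_sq (L 0 1 * v 1 + L 0 2 * v 2 + L 0 3 * v 3)]
    exact pow_le_pow_left₀ (mul_pos hp h0).le (by linarith) 2
  have h6 : (L 0 1 ^ 2 + L 0 2 ^ 2 + L 0 3 ^ 2) * (v 1 ^ 2 + v 2 ^ 2 + v 3 ^ 2) ≤
      (L 0 0 ^ 2 - 1) * v 0 ^ 2 := by
    rw [show L 0 0 ^ 2 - 1 = L 0 1 ^ 2 + L 0 2 ^ 2 + L 0 3 ^ 2 by linear_combination h4]
    exact mul_le_mul_of_nonneg_left (by linarith) (by positivity)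
  nlinarith [pow_pos h0 2]

lemma differentiableAt_mulVec (L : Matrix (Fin 4) (Fin 4) ℝ) (b : R4)
    (hF : DifferentiableAt ℝ F u) : HasFDerivAt (fun z => L *ᵥ F z + b)
      ((toLin' L).toContinuousLinearMap.comp (fderiv ℝ F u)) u :=
  ((toLin' L).toContinuousLinearMap.hasFDerivAt.comp u hF.hasFDerivAt).add_const b

lemma tangent_mulVec (L : Matrix (Fin 4) (Fin 4) ℝ) (b : R4) (hF : DifferentiableAt ℝ F u)
    (a : Fin 2) : tangent (fun z => L *ᵥ F z + b) a u = L *ᵥ tangent F a u := by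
  rw [tangent, (differentiableAt_mulVec L b hF).fderiv]; rfl

lemma covDeriv_minkowski_of_differentiableAt (hZ : DifferentiableAt ℝ Z u) (a : Fin 2) :
    covDeriv minkowski F Z a u = fderiv ℝ Z u (dir a) := by
  rw [covDeriv_minkowski]
  ext l
  have := (hasFDerivAt_pi'.1 hZ.hasFDerivAt l).fderiv
  rw [ud, this]; rfl

lemma covDeriv_mulVec (L : Matrix (Fin 4) (Fin 4) ℝ) {F' : ℝ × ℝ → R4}
    (hZ : DifferentiableAt ℝ Z u) (a : Fin 2) :
    covDeriv minkowski F' (fun z => L *ᵥ Z z) a u = L *ᵥ covDeriv minkowski F Z a u := by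
  have h := differentiableAt_mulVec L 0 hZ
  simp only [add_zero] at h
  rw [covDeriv_minkowski_of_differentiableAt h.differentiableAt,
    covDeriv_minkowski_of_differentiableAt hZ, h.fderiv]
  rfl

lemma IsLorentz.inducedMetric_mulVec (hL : IsLorentz L) (hF : DifferentiableAt ℝ F u) :
    inducedMetric minkowski (fun z => L *ᵥ F z + b) u = inducedMetric minkowski F u := by
  ext a c
  simp only [inducedMetric, of_apply, tangent_mulVec L b hF, ip_minkowski, hL.mink_mulVec]

lemma IsLorentz.normalPart_mulVec (hL : IsLorentz L) (hF : DifferentiableAt ℝ F u) (v : R4) :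
    normalPart minkowski (fun z => L *ᵥ F z + b) u (L *ᵥ v) =
      L *ᵥ normalPart minkowski F u v := by
  simp only [normalPart, hL.inducedMetric_mulVec hF, tangent_mulVec L b hF, ip_minkowski,
    hL.mink_mulVec, mulVec_sub, mulVec_sum, mulVec_smul]

lemma IsLorentz.meanCurv_mulVec (hL : IsLorentz L) (hF : Differentiable ℝ F)
    (hT : ∀ a, DifferentiableAt ℝ (tangent F a) u) :
    meanCurv minkowski (fun z => L *ᵥ F z + b) u = L *ᵥ meanCurv minkowski F u := by
  have e : ∀ a, tangent (fun z => L *ᵥ F z + b) a = fun z => L *ᵥ tangent F a z := fun a =>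
    funext fun z => tangent_mulVec L b (hF z) a
  simp only [meanCurv, e, covDeriv_mulVec (F := F) L (hT _), hL.inducedMetric_mulVec (hF u),
    hL.normalPart_mulVec (hF u), mulVec_sum, mulVec_smul]

lemma IsLorentz.normH_mulVec (hL : IsLorentz L) (hF : Differentiable ℝ F)
    (hT : ∀ a, DifferentiableAt ℝ (tangent F a) u) :
    normH minkowski (fun z => L *ᵥ F z + b) u = normH minkowski F u := by
  simp only [normH, hL.meanCurv_mulVec hF hT, ip_minkowski, hL.mink_mulVec]

lemma IsLorentz.isFutureDual_mulVec (hL : IsLorentz L) (hF : Differentiable ℝ F)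
    (hT : ∀ a, DifferentiableAt ℝ (tangent F a) u)
    (hH : 0 < mink (meanCurv minkowski F u) (meanCurv minkowski F u)) {J : R4}
    (hJ : IsFutureDual minkowski timeDir F u J) :
    IsFutureDual minkowski timeDir (fun z => L *ᵥ F z + b) u (L *ᵥ J) := by
  obtain ⟨h1, h2, h3, h4⟩ := hJ
  simp only [ip_minkowski] at h1 h2 h3 h4
  rw [timeDir, mink_time] at h4
  refine ⟨fun a => ?_, ?_, ?_, ?_⟩
  · rw [tangent_mulVec L b (hF u), ip_minkowski, hL.mink_mulVec, h1]
  · rw [hL.meanCurv_mulVec hF hT, ip_minkowski, hL.mink_mulVec, h2]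
  · rw [hL.meanCurv_mulVec hF hT, ip_minkowski, ip_minkowski, hL.mink_mulVec, hL.mink_mulVec, h3]
  · rw [ip_minkowski, timeDir, mink_time]
    have := hL.mulVec_zero_pos (v := J) (by rw [h3]; linarith) (by linarith)
    linarith

lemma IsLorentz.dualJ_mulVec (hL : IsLorentz L) (hF : Differentiable ℝ F)
    (hT : ∀ a, DifferentiableAt ℝ (tangent F a) u) (hσ : (inducedMetric minkowski F u).det ≠ 0)
    (hH : 0 < mink (meanCurv minkowski F u) (meanCurv minkowski F u))
    (hJ : IsFutureDual minkowski timeDir F u (dualJ minkowski timeDir F u)) :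
    dualJ minkowski timeDir (fun z => L *ᵥ F z + b) u = L *ᵥ dualJ minkowski timeDir F u := by
  apply dualJ_eq (minkowski_isSymm _) (by rwa [hL.inducedMetric_mulVec (hF u)]) ?_
    (hL.isFutureDual_mulVec hF hT hH hJ)
  rwa [hL.meanCurv_mulVec hF hT, ip_minkowski, hL.mink_mulVec]

end Lorentz

section LorentzEnergy

variable {N : Exterior} {r : ℝ} {u : ℝ × ℝ} {Y Y' : E3 → R4} {L : Matrix (Fin 4) (Fin 4) ℝ} {b : R4}

lemma IsIsometricEmbedding.contDiff_comp_polar (hY : IsIsometricEmbedding N r Y) :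
    ContDiff ℝ ∞ fun z => Y (polar z) := by
  refine contDiff_pi.2 fun β => contDiff_iff_contDiffAt.2 fun u => ?_
  rw [comp_polar_eq one_pos]
  exact contDiffAt_comp_smul_polar (hY.contDiffAt_emb (smul_polar_ne_zero one_pos u) β)

lemma IsIsometricEmbedding.differentiable_tangent (hY : IsIsometricEmbedding N r Y) (a : Fin 2) :
    Differentiable ℝ (tangent (fun z => Y (polar z)) a) :=
  ((hY.contDiff_comp_polar.fderiv_right (m := ∞) (by simp)).differentiable (by simp)).clm_apply
    (differentiable_const _)

/-- The energy density is covariant under Poincaré transformations of the embedding. -/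
lemma energyDensity_mulVec (hL : IsLorentz L) (hY : IsIsometricEmbedding N r Y)
    (hY' : ∀ n : E3, ‖n‖ = 1 → Y' n = L *ᵥ Y n + b) (hr : N.R₀ < r) (hu : u ∈ polarDomain)
    (hg : ∀ y : E3, ‖y‖ = r → N.GoodAt Y y) (T : R4) :
    energyDensity N r Y' T u = energyDensity N r Y ((eta * Lᵀ * eta) *ᵥ T) u := by
  have hr0 := N.R₀_pos.trans hr
  set F : ℝ × ℝ → R4 := fun z => Y (polar z) with hFd
  have hF' : (fun z => Y' (polar z)) = fun z => L *ᵥ F z + b :=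
    funext fun z => hY' _ (norm_polar z)
  have hF : Differentiable ℝ F := hY.contDiff_comp_polar.differentiable (by simp)
  have hT : ∀ a z, DifferentiableAt ℝ (tangent F a) z := fun a z => hY.differentiable_tangent a z
  have hH : ∀ z ∈ polarDomain, 0 < mink (meanCurv minkowski F z) (meanCurv minkowski F z) :=
    fun z hz => by
      rw [meanCurv_emb hY hr hz]; exact (hg _ (norm_smul_polar hr0 z)).1
  have hn : ∀ z, normH minkowski (fun z => L *ᵥ F z + b) z = normH minkowski F z := fun z =>
    hL.normH_mulVec hF fun a => hT a z
  have hJ : ∀ z ∈ polarDomain, dualJ minkowski timeDir (fun z => L *ᵥ F z + b) z =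
      L *ᵥ dualJ minkowski timeDir F z := fun z hz =>
    hL.dualJ_mulVec hF (fun a => hT a z) (inducedMetric_emb_det_ne_zero hY hr hz) (hH z hz) (by
      rw [hFd, dualJ_emb hY hr hz (hg _ (norm_smul_polar hr0 z))]
      exact isFutureDual_emb hY hr hz (hg _ (norm_smul_polar hr0 z)))
  have hc : ∀ a, connForm minkowski timeDir (fun z => L *ᵥ F z + b) a u =
      connForm minkowski timeDir F a u := fun a => by
    have hloc : (fun z => (normH minkowski F z)⁻¹ • dualJ minkowski timeDir F z) =ᶠ[𝓝 u]
        fun z => N.dualEmb Y (r • polar z) := by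
      filter_upwards [isOpen_polarDomain.mem_nhds hu] with z hz
      have hgz := hg _ (norm_smul_polar hr0 z)
      rw [normH_emb hY hr hz, dualJ_emb hY hr hz hgz, smul_smul,
        inv_mul_cancel₀ (Real.sqrt_pos.2 hgz.1).ne', one_smul]
    have hloc' : (fun z => (normH minkowski (fun z => L *ᵥ F z + b) z)⁻¹ •
        dualJ minkowski timeDir (fun z => L *ᵥ F z + b) z) =ᶠ[𝓝 u]
        fun z => L *ᵥ ((normH minkowski F z)⁻¹ • dualJ minkowski timeDir F z) := by
      filter_upwards [isOpen_polarDomain.mem_nhds hu] with z hz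
      rw [hn, hJ z hz, mulVec_smul]
    have hd : DifferentiableAt ℝ (fun z => (normH minkowski F z)⁻¹ • dualJ minkowski timeDir F z) u :=
      (differentiableAt_pi.2 fun β => (contDiffAt_comp_smul_polar (contDiffAt_dualEmb hY
        (lt_norm_smul_polar hr u) (hg _ (norm_smul_polar hr0 u)) β)).differentiableAt
          (by simp)).congr_of_eventuallyEq hloc
    rw [connForm, covDeriv_congr hloc', covDeriv_mulVec (F := F) L hd, hn,
      hL.meanCurv_mulVec hF fun a => hT a u, ← mulVec_smul, ip_minkowski, hL.mink_mulVec]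
    rfl
  have hτ : ∀ v, fderiv ℝ (fun z => - mink T (L *ᵥ F z + b)) u v =
      fderiv ℝ (fun z => - mink ((eta * Lᵀ * eta) *ᵥ T) (F z)) u v := fun v => by
    have e : (fun z => - mink T (L *ᵥ F z + b)) =
        fun z => - mink ((eta * Lᵀ * eta) *ᵥ T) (F z) + - mink T b := funext fun z => by
      rw [← mink_mulVec_right, ← ip_minkowski 0, ip_add_right, ip_minkowski, ip_minkowski]; ring
    rw [e, fderiv_add_const]
  have e : ∀ z, Y' (polar z) = L *ᵥ F z + b := fun z => hY' _ (norm_polar z)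
  simp only [energyDensity, e]
  simp only [hτ, hc, hn, hJ u hu, ← mulVec_smul, mink_mulVec_right]
  rfl

lemma density_eq_sum (T : R4) (y : E3) : N.density Y T y =
    ∑ α, T α * N.density Y (Pi.single α 1) y := by
  have h : ∀ v, mink T v = ∑ α, T α * mink (Pi.single α 1) v := fun v => by
    simp only [mink_eq_sum, Pi.single_apply, Fin.sum_univ_four]
    simp
    ring
  simp only [density, h]
  simp only [Fin.sum_univ_four, Fin.sum_univ_three]
  ring

lemma EmbAsymp.tendsto_integral_energyDensity_var {X : ℝ → E3 → R4} {t : E3 → ℝ}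
    (h : EmbAsymp N X t) {T : ℝ → R4} {T' : R4} (hT : Tendsto T atTop (𝓝 T')) :
    Tendsto (fun r : ℝ => ∫ u in polarDomain, energyDensity N r (X r) (T r) u) atTop
      (𝓝 (∫ u in polarDomain, Real.sin u.1 * massDensity N T' (polar u))) := by
  have key : ∀ S : ℝ → R4, (fun r : ℝ => ∫ u in polarDomain, energyDensity N r (X r) (S r) u)
      =ᶠ[atTop] fun r : ℝ => ∑ α, S r α * ∫ u in polarDomain,
        energyDensity N r (X r) (Pi.single α 1) u := fun S => by
    filter_upwards [h.eventually_energyDensity_eq, h.eventually_integrableOn]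
      with r ⟨hr, hY, hg, hP⟩ hi
    simp only [← integral_const_mul]
    rw [← integral_finsetSum _ fun α _ => (hi (Pi.single α 1)).const_mul (S r α)]
    refine setIntegral_congr_fun measurableSet_polarDomain fun u hu => ?_
    simp only [energyDensity_eq hY hr hu hg hP]
    rw [density_eq_sum, Finset.mul_sum]
    exact Finset.sum_congr rfl fun α _ => by ring
  have hsum : ∀ S : ℝ → R4, Tendsto S atTop (𝓝 T') → Tendsto (fun r : ℝ => ∑ α, S r α *
      ∫ u in polarDomain, energyDensity N r (X r) (Pi.single α 1) u) atTop
      (𝓝 (∑ α, T' α * ∫ u in polarDomain, Real.sin u.1 * massDensity N (Pi.single α 1) (polar u))) :=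
    fun S hS => tendsto_finsetSum _ fun α _ => (tendsto_pi_nhds.1 hS α).mul
      (h.tendsto_integral_energyDensity _)
  rw [tendsto_nhds_unique (h.tendsto_integral_energyDensity T')
    ((hsum _ tendsto_const_nhds).congr' (key fun _ => T').symm)]
  exact (hsum T hT).congr' (key T).symm

lemma EmbAsymp.isEnergyMomentum_mulVec {X X' : ℝ → E3 → R4} {t : E3 → ℝ} (h : EmbAsymp N X t)
    {L : ℝ → Matrix (Fin 4) (Fin 4) ℝ} {b : ℝ → R4} {L_inf : Matrix (Fin 4) (Fin 4) ℝ}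
    (hL : ∀ᶠ r : ℝ in atTop, IsLorentz (L r))
    (hX' : ∀ᶠ r : ℝ in atTop, ∀ n : E3, ‖n‖ = 1 → X' r n = L r *ᵥ X r n + b r)
    (hlim : Tendsto L atTop (𝓝 L_inf)) :
    IsEnergyMomentum N X' (L_inf *ᵥ momentum N) := fun T _ => by
  have heq : ∀ᶠ r : ℝ in atTop, Set.EqOn (energyDensity N r (X' r) T)
      (energyDensity N r (X r) ((eta * (L r)ᵀ * eta) *ᵥ T)) polarDomain := by
    filter_upwards [hL, hX', h.eventually_energyDensity_eq] with r hLr hXr ⟨hr, hY, hg, _⟩ u hu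
    exact energyDensity_mulVec hLr hY hXr hr hu hg T
  refine ⟨?_, ?_⟩
  · filter_upwards [heq, h.eventually_integrableOn] with r hr hi
    exact (hi _).congr_fun hr.symm measurableSet_polarDomain
  · have hT : Tendsto (fun r => (eta * (L r)ᵀ * eta) *ᵥ T) atTop
        (𝓝 ((eta * L_infᵀ * eta) *ᵥ T)) := by
      have hc : Continuous fun A : Matrix (Fin 4) (Fin 4) ℝ => (eta * Aᵀ * eta) *ᵥ T := by
        fun_prop
      exact (hc.tendsto _).comp hlim
    rw [mink_mulVec_right, ← integral_massDensity]
    refine ((h.tendsto_integral_energyDensity_var hT).const_mul _).congr' ?_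
    filter_upwards [heq] with r hr
    rw [energy, setIntegral_congr_fun measurableSet_polarDomain hr]

end LorentzEnergy

end BondiSachs
end

open BondiSachs

theorem corollary3p5 (N : Exterior)
    (X X' : ℝ → E3 → R4) (hX : IsAsymptoticFamily N X)
    (L : ℝ → Matrix (Fin 4) (Fin 4) ℝ) (b : ℝ → R4) (L_inf : Matrix (Fin 4) (Fin 4) ℝ)
    (hL : ∀ᶠ r : ℝ in atTop, IsLorentz (L r))
    (hX' : ∀ᶠ r : ℝ in atTop, ∀ n : E3, ‖n‖ = 1 → X' r n = L r *ᵥ X r n + b r)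
    (hlim : Tendsto L atTop (𝓝 L_inf)) :
    ∃ p : R4, IsEnergyMomentum N X p ∧ IsEnergyMomentum N X' (L_inf *ᵥ p) := by
  obtain ⟨t, h⟩ := hX.exists_embAsymp
  exact ⟨momentum N, h.isEnergyMomentum, h.isEnergyMomentum_mulVec hL hX' hlim⟩
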